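/- Let $n,N\in\mathbb N$, let $J\subset\mathbb R$ be an open interval and $\Omega\subset\mathbb R^n$ a domain. Let $0<c_0\le c_1$ and let $\varphi:[0,\infty)\to[0,\infty)$ be convex, $\varphi\in C^2((0,\infty))\cap C^1([0,\infty))$, $\varphi(0)=\varphi'(0)=0$, $\lim_{t\to\infty}\varphi(t)=\infty$ and $$c_0\,\varphi'(t)\le t\,\varphi''(t)\le c_1\,\varphi'(t)\qquad(t>0).$$ For $a,t\ge 0$ put $\varphi_a(t)=\int_0^t\frac{\varphi'(a+s)}{a+s}\,s\,ds$, and for $P\in\mathbb R^{n\times N}$ (with the Frobenius norm) put $V(P)=\sqrt{\varphi'(|P|)|P|}\,\frac{P}{|P|}$, $V(0)=0$. A local weak solution of $\partial_t u-\operatorname{div}\big(\frac{\varphi'(|\nabla u|)}{|\nabla u|}\nabla u\big)=0$ on $J\times\Omega$ is a function $u:J\times\Omega\to\mathbb R^N$ with a weak spatial gradient $\nabla u\in L^1_{\rm loc}(J\times\Omega)$ such that $u\in L^\infty_{\rm loc}(J;L^2_{\rm loc}(\Omega))$, $\varphi(|\nabla u|)\in L^1_{\rm loc}(J\times\Omega)$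 and $$\int_{J\times\Omega}\frac{\varphi'(|\nabla u|)}{|\nabla u|}\nabla u\cdot\nabla\zeta\,dz=\int_{J\times\Omega}u\cdot\partial_t\zeta\,dz\qquad\text{for all }\zeta\in C_0^\infty(J\times\Omega;\mathbb R^N).$$ For $t_0\in\mathbb R$, $x_0\in\mathbb R^n$, $\alpha,r>0$ let $B_r=B_r(x_0)$ and $Q_r=(t_0-\alpha r^2,t_0)\times B_r$, and let $C^\infty_{0,\rm par}(Q_r)=C^\infty_0(Q_r\cup(\{t_0\}\times B_r))$ be the functions that are smooth on $(t_0-\alpha r^2,t_0]\times B_r$ and have compact support in that set. **Theorem.** (i) There are $q>1$ and $C>0$, depending only on $c_0,c_1$, such that $$\varphi_a(\theta^{q-1}t)\le C\,\theta^q\,\varphi_a(t)\qquad\text{for all }a,t\ge0,\ \theta\in[0,1].\tag{1}$$ (ii) Let $q>1$ and $C$ be such that (1) holds. There is a constant $c>0$ depending only on $n,c_0,c_1,q,C$ with the following property. Let $u$ be a local weak solution on $J\times\Omega$ with $\nabla u\in L^2_{\rm loc}(J\times\Omega)$. Then $V(\nabla u)$ has weak spatial derivatives in $L^2_{\rm loc}(J\times\Omega)$.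 Moreover, let $f:[0,\infty)\to[0,\infty)$ be bounded and non-decreasing, and let $H:[0,\infty)\to[0,\infty)$ satisfy $H'(t)=t f(t)$, in the sense that $H(t)=H(0)+\int_0^t s f(s)\,ds$ for $t\ge0$. Then for every cylinder with $Q_R\Subset J\times\Omega$ and $Q_{2R}\subset J\times\Omega$, and every $\eta\in C^\infty_{0,\rm par}(Q_{2R})$ with $0\le\eta\le1$ (in particular, every such $\eta\in C^\infty_{0,\rm par}(Q_R)$, extended by zero), $$\operatorname*{ess\,sup}_{s\in(t_0-\alpha R^2,t_0)}\frac1\alpha\,\frac{1}{|B_R|}\int_{B_R}H(|\nabla u(s,x)|)\,\eta(s,x)^q\,dx+\frac{R^2}{|Q_R|}\int_{Q_R}|\nabla V(\nabla u)|^2\,\eta^q f(|\nabla u|)\,dz$$ $$\le c\,\Big(\frac{R^2}{|Q_{2R}|}\int_{Q_{2R}}|V(\nabla u)|^2\,\|\nabla\eta\|_\infty^2\,f(|\nabla u|)\,dz+\frac{R^2}{|Q_{2R}|}\int_{Q_{2R}}H(|\nabla u|)\,\eta^{q-1}|\partial_t\eta|\,dz\Big),$$ where $\|\nabla\eta\|_\infty=\sup_{Q_{2R}}|\nabla\eta|$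 and the right-hand side may be $+\infty$. -/

import Mathlib

open MeasureTheory Set
open scoped ContDiff ENNReal

noncomputable section

namespace PhiCaloric

/-- The space `ℝⁿ`. -/
abbrev Space (n : ℕ) := EuclideanSpace ℝ (Fin n)

/-- Space-time `ℝ × ℝⁿ`; points are `(t, x)`, the measure is Lebesgue measure. -/
abbrev SpaceTime (n : ℕ) := ℝ × Space n

/-- The matrices `ℝ^{n × N}` with the Frobenius inner product and norm. -/
abbrev Mat (n N : ℕ) := EuclideanSpace ℝ (Fin n × Fin N)

/-! ### The Orlicz function -/

/-- `φ : [0,∞) → [0,∞)` is convex, `C²` on `(0,∞)` and `C¹` on `[0,∞)`, `φ(0) = φ'(0) = 0`,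
`φ(t) → ∞`, and `c₀ φ'(t) ≤ t φ''(t) ≤ c₁ φ'(t)` for `t > 0`; the numbers `c₀, c₁` are the
characteristics of `φ`. Values of `φ` on `(-∞,0)` are irrelevant. -/
structure IsOrlicz (φ : ℝ → ℝ) (c₀ c₁ : ℝ) : Prop where
  nonneg : ∀ t, 0 ≤ t → 0 ≤ φ t
  convex : ConvexOn ℝ (Ici 0) φ
  contDiffOn_two : ContDiffOn ℝ 2 φ (Ioi 0)
  contDiffOn_one : ContDiffOn ℝ 1 φ (Ici 0)
  map_zero : φ 0 = 0
  deriv_zero : derivWithin φ (Ici 0) 0 = 0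
  tendsto : Filter.Tendsto φ Filter.atTop Filter.atTop
  lower : ∀ t, 0 < t → c₀ * deriv φ t ≤ deriv (deriv φ) t * t
  upper : ∀ t, 0 < t → deriv (deriv φ) t * t ≤ c₁ * deriv φ t

/-- The shifted function `φ_a`, given by `φ_a(0) = 0` and `φ_a'(t) = φ'(a + t) / (a + t) * t`. -/
def shifted (φ : ℝ → ℝ) (a t : ℝ) : ℝ :=
  ∫ s in (0 : ℝ)..t, deriv φ (a + s) / (a + s) * s

/-- `φ_a(θ^{q-1} t) ≤ C θ^q φ_a(t)` for all `θ ∈ [0,1]`, uniformly in `a, t ≥ 0`. -/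
def IsCutoffExponent (φ : ℝ → ℝ) (q C : ℝ) : Prop :=
  ∀ a t θ : ℝ, 0 ≤ a → 0 ≤ t → 0 ≤ θ → θ ≤ 1 →
    shifted φ a (θ ^ (q - 1) * t) ≤ C * θ ^ q * shifted φ a t

/-- `A(P) = φ'(|P|) P / |P|`, with `A(0) = 0`. -/
def fluxA {n N : ℕ} (φ : ℝ → ℝ) (P : Mat n N) : Mat n N :=
  (deriv φ ‖P‖ / ‖P‖) • P

/-- `V(P) = √(φ'(|P|) |P|) P / |P|`, with `V(0) = 0`. -/
def fieldV {n N : ℕ} (φ : ℝ → ℝ) (P : Mat n N) : Mat n N :=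
  (√(deriv φ ‖P‖ * ‖P‖) / ‖P‖) • P

/-! ### Classical and weak derivatives in space-time -/

section Derivatives

variable {n : ℕ} {F : Type*} [NormedAddCommGroup F] [NormedSpace ℝ F]

/-- The classical time derivative `∂_t ζ`. -/
def timeDeriv (ζ : SpaceTime n → F) (z : SpaceTime n) : F :=
  fderiv ℝ ζ z (1, 0)

/-- The classical spatial partial derivative `∂_j ζ`. -/
def spaceDeriv (j : Fin n) (ζ : SpaceTime n → F) (z : SpaceTime n) : F :=
  fderiv ℝ ζ z (0, EuclideanSpace.single j 1)

/-- `C_0^∞(D; F)`. -/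
def IsTestFunction (D : Set (SpaceTime n)) (ζ : SpaceTime n → F) : Prop :=
  ContDiff ℝ ∞ ζ ∧ HasCompactSupport ζ ∧ tsupport ζ ⊆ D

/-- `w ∈ L¹_loc(D)` is the weak partial derivative `∂_j g` of `g ∈ L¹_loc(D)`, where `D` is an
open subset of space-time. -/
def HasWeakSpaceDeriv (D : Set (SpaceTime n)) (j : Fin n) (g w : SpaceTime n → F) : Prop :=
  LocallyIntegrableOn g D ∧ LocallyIntegrableOn w D ∧
    ∀ ζ : SpaceTime n → ℝ, IsTestFunction D ζ →
      ∫ z in D, spaceDeriv j ζ z • g z = - ∫ z in D, ζ z • w z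

end Derivatives

/-- The classical spatial gradient of a vector field, as the matrix with entries `∂_j ζ_k`. -/
def spaceGrad {n N : ℕ} (ζ : SpaceTime n → EuclideanSpace ℝ (Fin N)) (z : SpaceTime n) :
    Mat n N :=
  WithLp.toLp 2 fun p => spaceDeriv p.1 ζ z p.2

/-- The Euclidean norm `|∇η(z)|` of the classical spatial gradient of a scalar function. -/
def normSpaceGrad {n : ℕ} (η : SpaceTime n → ℝ) (z : SpaceTime n) : ℝ :=
  √(∑ j, spaceDeriv j η z ^ 2)

/-- `G` is the weak spatial gradient `∇u` of `u` on `D`, with entries `G_{jk} = ∂_j u_k`. -/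
def HasWeakSpaceGrad {n N : ℕ} (D : Set (SpaceTime n))
    (u : SpaceTime n → EuclideanSpace ℝ (Fin N)) (G : SpaceTime n → Mat n N) : Prop :=
  LocallyIntegrableOn u D ∧ LocallyIntegrableOn G D ∧
    ∀ j, HasWeakSpaceDeriv D j u fun z => WithLp.toLp 2 fun k => G z (j, k)

/-- `u`, with weak spatial gradient `G = ∇u`, is a local weak solution of
`∂_t u - div (φ'(|∇u|) / |∇u| ∇u) = 0` on `J × Ω`: it has the regularity
`u ∈ L^∞_loc(J; L²_loc(Ω))`, `φ(|∇u|) ∈ L¹_loc(J × Ω)`, and satisfies the equation weakly. -/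
structure IsLocalWeakSolution {n N : ℕ} (φ : ℝ → ℝ) (J : Set ℝ) (Ω : Set (Space n))
    (u : SpaceTime n → EuclideanSpace ℝ (Fin N)) (G : SpaceTime n → Mat n N) : Prop where
  weakGrad : HasWeakSpaceGrad (J ×ˢ Ω) u G
  bounded_L2 : ∀ I : Set ℝ, ∀ K : Set (Space n), IsCompact I → IsCompact K → I ⊆ J → K ⊆ Ω →
    essSup (fun t => ∫⁻ x in K, ‖u (t, x)‖ₑ ^ 2) (volume.restrict I) < ⊤
  energy : LocallyIntegrableOn (fun z => φ ‖G z‖) (J ×ˢ Ω)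
  weakEq : ∀ ζ : SpaceTime n → EuclideanSpace ℝ (Fin N), IsTestFunction (J ×ˢ Ω) ζ →
    ∫ z in J ×ˢ Ω, inner ℝ (fluxA φ (G z)) (spaceGrad ζ z) =
      ∫ z in J ×ˢ Ω, inner ℝ (u z) (timeDeriv ζ z)

/-! ### Cylinders, cutoff functions and the pair `f`, `H` -/

/-- The cylinder `Q_r = (t₀ - α r², t₀) × B_r(x₀)`. -/
def paraCyl {n : ℕ} (t₀ : ℝ) (x₀ : Space n) (α r : ℝ) : Set (SpaceTime n) :=
  Ioo (t₀ - α * r ^ 2) t₀ ×ˢ Metric.ball x₀ r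

/-- The set `Q_r ∪ ({t₀} × B_r(x₀)) = (t₀ - α r², t₀] × B_r(x₀)`. -/
def paraCylTop {n : ℕ} (t₀ : ℝ) (x₀ : Space n) (α r : ℝ) : Set (SpaceTime n) :=
  Ioc (t₀ - α * r ^ 2) t₀ ×ˢ Metric.ball x₀ r

/-- `η ∈ C_{0,par}^∞(Q_r) = C_0^∞(Q_r ∪ ({t₀} × B_r(x₀)))` with `0 ≤ η ≤ 1`: smooth up to the
top of the cylinder, with compact support in the cylinder together with its top. Values of `η`
elsewhere are irrelevant. -/
structure IsParCutoff {n : ℕ} (t₀ : ℝ) (x₀ : Space n) (α r : ℝ) (η : SpaceTime n → ℝ) :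
    Prop where
  smooth : ContDiffOn ℝ ∞ η (paraCylTop t₀ x₀ α r)
  support : ∃ K : Set (SpaceTime n), IsCompact K ∧ K ⊆ paraCylTop t₀ x₀ α r ∧
    ∀ z ∈ paraCylTop t₀ x₀ α r, z ∉ K → η z = 0
  nonneg : ∀ z ∈ paraCylTop t₀ x₀ α r, 0 ≤ η z
  le_one : ∀ z ∈ paraCylTop t₀ x₀ α r, η z ≤ 1

/-- `f : [0,∞) → [0,∞)` is bounded and non-decreasing, and `H : [0,∞) → [0,∞)` satisfies
`H'(t) = t f(t)`. As `f` may jump, the latter is stated in integrated form (`H` is absolutely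
continuous and the identity holds for almost every `t`). -/
structure IsWeightPair (f H : ℝ → ℝ) : Prop where
  nonneg : ∀ t, 0 ≤ t → 0 ≤ f t
  mono : MonotoneOn f (Ici 0)
  bdd : BddAbove (f '' Ici 0)
  nonneg_H : ∀ t, 0 ≤ t → 0 ≤ H t
  primitive : ∀ t, 0 ≤ t → H t = H 0 + ∫ s in (0 : ℝ)..t, s * f s

end PhiCaloric

end

open PhiCaloric

namespace PhiCaloric

open Filter Topology

set_option linter.unusedSectionVars false

/-! ### Growth of φ' and the admissible cutoff exponents. -/

section
namespace IsOrlicz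

variable {φ : ℝ → ℝ} {c₀ c₁ : ℝ}

/-! Part (i). The bound `c₀ φ' ≤ t φ''` makes `φ'(t) t^(-m)` nondecreasing for `m = min c₀ 1`. After
the substitution `s ↦ θ s` in the integral this gives `φ_a(θ t) ≤ θ^(1+m) φ_a(t)` uniformly in `a`,
and `q = 1 + 1/m` solves `(q-1)(1+m) = q`, so (1) holds with `C = 1`. Conversely `φ_1` is at least
quadratic near 0, so (1) forces `2 ≤ q` (`IsCutoffExponent.two_le`). This is all that part (ii)
takes from (1).

Part (ii), formally: differentiate the system in `x_j`, test with `η^q χ f(|∇u|) ∂_j u` for a time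
cutoff `χ`, and sum over `j`. The time term produces `H` because `H' = t f`. The elliptic term is
bounded below by `|∇V(∇u)|² f`. The term containing `f'` has a sign. The term with `∇η` is absorbed
by Young's inequality since `(η^(q-1))² ≤ η^q` for `q ≥ 2`.

None of this is directly legitimate: `∂_t u` and `∇²u` need not be functions and `f` may jump. The
formal argument is replaced as follows.

All space difference quotients of `u` with step `h` are collected in one matrix field `w`. By the
fundamental theorem of calculus its rows are averages of `∇u` over segments, and `w` solves the
differenced system. Testing with `ζ g(|w|²) w` is justified by mollification in space-time. The
products that arise are not products of functions in dual Lebesgue spaces, but the two-point Young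
inequality `|A(P)||Q| ≤ |V(P)|² + |V(Q)|²` dominates products of mollifications by mollifications of
a single integrable function, and these converge in `L¹` (`integral_renormIntegrand`,
`integral_renormIntegrand_gradAvg`).

With `g = 1` this yields `L²` bounds for the difference quotients of `V(∇u)`. The flux increment is
paired with averages of `∇u`, so the errors contain differences of `V(∇u)` with steps smaller than
`h`; they are absorbed by taking the supremum over all smaller steps (`exists_integral_sq_diff_le`).
Weak compactness then provides the derivatives of `V(∇u)`.

For increasing `g` one lets `h` tend to 0 along a sequence with almost everywhere and `L¹`
convergence. The delicate term contains `g'` times `∑ᵢ ⟨w, ∂ᵢw⟩⟨∂ᵢA, w⟩`. Where `∇u = 0` it tends to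
0. Where `∇u ≠ 0` the map `V` is differentiable with invertible derivative, so `∇²u` exists as a
pointwise limit, and the term is nonnegative once `∇²u` is known to be symmetric
(`sum_inner_fluxA_deriv_nonneg`). Symmetry is proved by cutting off to annuli in the space of
matrices, on which functions of `∇u` are Lipschitz functions of `V(∇u)`
(`IsLimitSetup.ae_row_hess_comm`). The outcome is `IsLimitSetup.renormalized_inequality`.

The inequality is linear in `g`, so it extends from smooth steps to every bounded monotone weight,
in particular to `g(y) = f(√y)`, for which `½ ∫₀^(t²) g = H(t) - H(0)`. Finally `ζ = η^q χ`:
concentrating `-χ'` at a time `s` gives the supremum over times, and letting `χ` increase to 1 gives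
the space-time integral. -/

theorem deriv_zero_eq (h : IsOrlicz φ c₀ c₁) : deriv φ 0 = 0 := by
  -- The values of `φ` on the negative axis are arbitrary, so the two-sided derivative at 0 may fail
  -- to exist; then `deriv` takes the default value 0.
  by_cases hd : DifferentiableAt ℝ φ 0
  · exact (hd.derivWithin (uniqueDiffOn_Ici 0 0 self_mem_Ici)).symm.trans h.deriv_zero
  · exact deriv_zero_of_not_differentiableAt hd

theorem hasDerivAt (h : IsOrlicz φ c₀ c₁) {t : ℝ} (ht : 0 < t) : HasDerivAt φ (deriv φ t) t :=
  ((h.contDiffOn_two.differentiableOn (by norm_num)).differentiableAt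
    (Ioi_mem_nhds ht)).hasDerivAt

theorem contDiffOn_deriv (h : IsOrlicz φ c₀ c₁) : ContDiffOn ℝ 1 (deriv φ) (Ioi 0) :=
  ((contDiffOn_succ_iff_deriv_of_isOpen (n := 1) isOpen_Ioi).1 h.contDiffOn_two).2.2

theorem hasDerivAt_deriv (h : IsOrlicz φ c₀ c₁) {t : ℝ} (ht : 0 < t) :
    HasDerivAt (deriv φ) (deriv (deriv φ) t) t :=
  ((h.contDiffOn_deriv.differentiableOn (by norm_num)).differentiableAt
    (Ioi_mem_nhds ht)).hasDerivAt

theorem deriv_nonneg (h : IsOrlicz φ c₀ c₁) {t : ℝ} (ht : 0 ≤ t) : 0 ≤ deriv φ t := by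
  rcases ht.eq_or_lt with rfl | ht
  · exact h.deriv_zero_eq.ge
  have h1 := h.convex.slope_le_deriv (x := 0) (y := t) self_mem_Ici ht.le ht
    (h.hasDerivAt ht).differentiableAt
  refine le_trans ?_ h1
  rw [slope_def_field, h.map_zero]
  have := h.nonneg t ht.le
  positivity

/-- The derivative of `t ↦ φ'(t) t^{-c}`. -/
theorem hasDerivAt_deriv_mul_rpow (h : IsOrlicz φ c₀ c₁) (c : ℝ) {t : ℝ} (ht : 0 < t) :
    HasDerivAt (fun t => deriv φ t * t ^ (-c))
      ((deriv (deriv φ) t * t - c * deriv φ t) * t ^ (-c - 1)) t := by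
  refine ((h.hasDerivAt_deriv ht).mul
    (Real.hasDerivAt_rpow_const (p := -c) (Or.inl ht.ne'))).congr_deriv ?_
  have : t ^ (-c) = t ^ (-c - 1) * t := by
    rw [← Real.rpow_add_one ht.ne']; ring_nf
  rw [this]; ring

/-- The derivative of `φ'(t) t^(-c)` has the sign of `t φ'' - c φ'`, which is nonnegative for every
`c ≤ c₀`. Exponents below `c₀` are needed since the cutoff exponent uses `min c₀ 1`. -/
theorem deriv_mul_rpow_le_of_le_lower (h : IsOrlicz φ c₀ c₁) {c : ℝ} (hc : c ≤ c₀) {s t : ℝ}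
    (hs : 0 < s) (hst : s ≤ t) : deriv φ s * s ^ (-c) ≤ deriv φ t * t ^ (-c) := by
  have hm : MonotoneOn (fun t => deriv φ t * t ^ (-c)) (Ioi 0) := by
    refine monotoneOn_of_deriv_nonneg (convex_Ioi 0)
      (fun x hx => (h.hasDerivAt_deriv_mul_rpow c hx).continuousAt.continuousWithinAt)
      (fun x hx => ?_) (fun x hx => ?_)
    · rw [interior_Ioi] at hx
      exact (h.hasDerivAt_deriv_mul_rpow c hx).differentiableAt.differentiableWithinAt
    · rw [interior_Ioi] at hx
      rw [(h.hasDerivAt_deriv_mul_rpow c hx).deriv]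
      have := h.lower x hx
      have h2 := h.deriv_nonneg (le_of_lt hx)
      have : 0 ≤ x ^ (-c - 1) := Real.rpow_nonneg (le_of_lt hx) _
      refine mul_nonneg ?_ this
      nlinarith
  exact hm hs (hs.trans_le hst) hst

theorem deriv_mul_rpow_upper (h : IsOrlicz φ c₀ c₁) {s t : ℝ}
    (hs : 0 < s) (hst : s ≤ t) : deriv φ t * t ^ (-c₁) ≤ deriv φ s * s ^ (-c₁) := by
  have hm : AntitoneOn (fun t => deriv φ t * t ^ (-c₁)) (Ioi 0) := by
    refine antitoneOn_of_deriv_nonpos (convex_Ioi 0)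
      (fun x hx => (h.hasDerivAt_deriv_mul_rpow c₁ hx).continuousAt.continuousWithinAt)
      (fun x hx => ?_) (fun x hx => ?_)
    · rw [interior_Ioi] at hx
      exact (h.hasDerivAt_deriv_mul_rpow c₁ hx).differentiableAt.differentiableWithinAt
    · rw [interior_Ioi] at hx
      rw [(h.hasDerivAt_deriv_mul_rpow c₁ hx).deriv]
      have := h.upper x hx
      have : 0 ≤ x ^ (-c₁ - 1) := Real.rpow_nonneg (le_of_lt hx) _
      refine mul_nonpos_of_nonpos_of_nonneg ?_ this
      linarith
  exact hm hs (hs.trans_le hst) hst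

theorem deriv_le_rpow_mul (h : IsOrlicz φ c₀ c₁) {c : ℝ} (hc : c ≤ c₀) {s t : ℝ}
    (hs : 0 < s) (hst : s ≤ t) : deriv φ s ≤ (s / t) ^ c * deriv φ t := by
  have ht := hs.trans_le hst
  have := h.deriv_mul_rpow_le_of_le_lower hc hs hst
  rw [Real.rpow_neg hs.le, Real.rpow_neg ht.le] at this
  rw [Real.div_rpow hs.le ht.le]
  have p1 := Real.rpow_pos_of_pos hs c
  have p2 := Real.rpow_pos_of_pos ht c
  field_simp at this ⊢
  linarith

theorem deriv_upper (h : IsOrlicz φ c₀ c₁) {s t : ℝ}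
    (hs : 0 < s) (hst : s ≤ t) : deriv φ t ≤ (t / s) ^ c₁ * deriv φ s := by
  have ht := hs.trans_le hst
  have := h.deriv_mul_rpow_upper hs hst
  rw [Real.rpow_neg hs.le, Real.rpow_neg ht.le] at this
  rw [Real.div_rpow ht.le hs.le]
  have p1 := Real.rpow_pos_of_pos hs c₁
  have p2 := Real.rpow_pos_of_pos ht c₁
  field_simp at this ⊢
  linarith

theorem monotoneOn_deriv (h : IsOrlicz φ c₀ c₁) (hc₀ : 0 < c₀) :
    MonotoneOn (deriv φ) (Ici 0) := by
  intro s hs t ht hst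
  rcases (mem_Ici.1 hs).eq_or_lt with rfl | hs
  · rw [h.deriv_zero_eq]; exact h.deriv_nonneg ht
  · simpa using h.deriv_le_rpow_mul hc₀.le hs hst

/-- A zero of `φ'` at one point spreads to the left by monotonicity and to the right by the upper
power bound. Then `φ` is constant, which contradicts `φ(t) → ∞`. -/
theorem deriv_pos (h : IsOrlicz φ c₀ c₁) (hc₀ : 0 < c₀) {t : ℝ} (ht : 0 < t) :
    0 < deriv φ t := by
  refine lt_of_le_of_ne (h.deriv_nonneg ht.le) fun h0 => ?_
  have hz : ∀ s, 0 < s → deriv φ s = 0 := by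
    intro s hs
    rcases le_total s t with hst | hst
    · exact le_antisymm ((h.monotoneOn_deriv hc₀ hs.le ht.le hst).trans h0.ge)
        (h.deriv_nonneg hs.le)
    · have := h.deriv_upper ht hst
      rw [← h0, mul_zero] at this
      exact le_antisymm this (h.deriv_nonneg hs.le)
  have hconst : ∀ s ∈ Ioi (0 : ℝ), φ s = φ 1 := by
    intro s hs
    refine (convex_Ioi (0 : ℝ)).is_const_of_fderivWithin_eq_zero (𝕜 := ℝ)
      (h.contDiffOn_two.differentiableOn (by norm_num)) (fun x hx => ?_) hs
      (mem_Ioi.2 one_pos)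
    rw [fderivWithin_of_isOpen isOpen_Ioi hx]
    ext
    have := (h.hasDerivAt hx).hasFDerivAt.fderiv
    rw [this, hz x hx]; simp
  obtain ⟨s, hs, hs'⟩ := ((h.tendsto.eventually_gt_atTop (φ 1)).and (eventually_gt_atTop 0)).exists
  exact hs.ne' (hconst s hs')

theorem c_le (h : IsOrlicz φ c₀ c₁) (hc₀ : 0 < c₀) : c₀ ≤ c₁ := by
  have h1 := h.lower 1 one_pos
  have h2 := h.upper 1 one_pos
  exact le_of_mul_le_mul_right (h1.trans h2) (h.deriv_pos hc₀ one_pos)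

theorem deriv_two_mul_le (h : IsOrlicz φ c₀ c₁) {t : ℝ} (ht : 0 ≤ t) :
    deriv φ (2 * t) ≤ 2 ^ c₁ * deriv φ t := by
  rcases ht.eq_or_lt with rfl | ht
  · simp [h.deriv_zero_eq]
  · have := h.deriv_upper ht (t := 2 * t) (by linarith)
    rwa [mul_div_assoc, div_self ht.ne', mul_one] at this

/-- If `s ≤ t ≤ 2 s` then `φ'(t) ≤ 2^{c₁} φ'(s)`. -/
theorem deriv_le_of_le_two_mul (h : IsOrlicz φ c₀ c₁) (hc₀ : 0 < c₀) {s t : ℝ} (hs : 0 ≤ s)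
    (ht : 0 ≤ t) (hst : t ≤ 2 * s) : deriv φ t ≤ 2 ^ c₁ * deriv φ s :=
  (h.monotoneOn_deriv hc₀ ht (mem_Ici.2 (by linarith)) hst).trans (h.deriv_two_mul_le hs)

/-- Convexity gives `φ'(t/2) · t/2 ≤ φ(t)`, and doubling replaces `φ'(t/2)` by `φ'(t)`. This is how
local integrability of `φ(|∇u|)` becomes local square integrability of `V(∇u)`. -/
theorem deriv_mul_le (h : IsOrlicz φ c₀ c₁) {t : ℝ} (ht : 0 ≤ t) :
    deriv φ t * t ≤ 2 * 2 ^ c₁ * φ t := by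
  rcases ht.eq_or_lt with rfl | ht
  · simp [h.map_zero]
  have h2 : 0 < t / 2 := by linarith
  have h1 := h.convex.deriv_le_slope (x := t / 2) (y := t) (mem_Ici.2 h2.le) (mem_Ici.2 ht.le)
    (by linarith) (h.hasDerivAt h2).differentiableAt
  rw [slope_def_field, le_div_iff₀ (by linarith)] at h1
  have h3 := h.deriv_two_mul_le h2.le
  rw [mul_div_cancel₀ t (two_ne_zero)] at h3
  have h4 := h.nonneg _ h2.le
  have p : (0 : ℝ) < 2 ^ c₁ := by positivity
  have h5 : deriv φ (t / 2) * (t / 2) ≤ φ t := by nlinarith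
  calc deriv φ t * t ≤ 2 ^ c₁ * deriv φ (t / 2) * t := by gcongr
    _ = 2 * 2 ^ c₁ * (deriv φ (t / 2) * (t / 2)) := by ring
    _ ≤ _ := by gcongr

/-- Young's inequality in its simplest form. -/
theorem deriv_mul_le_add (h : IsOrlicz φ c₀ c₁) (hc₀ : 0 < c₀) {s t : ℝ} (hs : 0 ≤ s)
    (ht : 0 ≤ t) : deriv φ s * t ≤ deriv φ s * s + deriv φ t * t := by
  rcases le_total t s with hst | hst
  · have := mul_le_mul_of_nonneg_left hst (h.deriv_nonneg hs)
    have := mul_nonneg (h.deriv_nonneg ht) ht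
    linarith
  · have := mul_le_mul_of_nonneg_right (h.monotoneOn_deriv hc₀ hs ht hst) ht
    have := mul_nonneg (h.deriv_nonneg hs) hs
    linarith

theorem monotoneOn_shift (h : IsOrlicz φ c₀ c₁) (hc₀ : 0 < c₀) {a : ℝ} (ha : 0 ≤ a) :
    MonotoneOn (fun s => deriv φ (a + s) / (a + s) * s) (Ici 0) := by
  intro s hs t ht hst
  rcases (mem_Ici.1 hs).eq_or_lt with rfl | hs
  · simp only [add_zero, mul_zero]
    have := h.deriv_nonneg (add_nonneg ha ht)
    have := add_nonneg ha ht
    have : (0 : ℝ) ≤ t := ht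
    positivity
  · have h1 : deriv φ (a + s) ≤ deriv φ (a + t) :=
      h.monotoneOn_deriv hc₀ (mem_Ici.2 (by linarith)) (mem_Ici.2 (by linarith)) (by linarith)
    have h2 : s / (a + s) ≤ t / (a + t) := by
      rw [div_le_div_iff₀ (by linarith) (by linarith)]; nlinarith
    have h3 := h.deriv_nonneg (t := a + s) (by linarith)
    have h4 : 0 ≤ t / (a + t) := by
      have : 0 < t := by linarith
      positivity
    calc deriv φ (a + s) / (a + s) * s = deriv φ (a + s) * (s / (a + s)) := by ring
      _ ≤ deriv φ (a + t) * (t / (a + t)) := by gcongr; exact h3.trans h1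
      _ = _ := by ring

theorem intervalIntegrable_shift (h : IsOrlicz φ c₀ c₁) (hc₀ : 0 < c₀) {a : ℝ} (ha : 0 ≤ a)
    {x y : ℝ} (hx : 0 ≤ x) (hy : 0 ≤ y) :
    IntervalIntegrable (fun s => deriv φ (a + s) / (a + s) * s) volume x y :=
  ((h.monotoneOn_shift hc₀ ha).mono fun _ hs =>
    mem_Ici.2 ((le_min hx hy).trans hs.1)).intervalIntegrable

/-- Compare the integrands after `s ↦ θ s`. With `ρ = (a + θ s)/(a + s)` and `m = min c₀ 1`, the
growth of `φ'` gives `φ'(a + θ s) ≤ ρ^m φ'(a + s)`. Since `ρ ≥ θ` and `m - 1 ≤ 0`, one has `ρ^(m-1)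
≤ θ^(m-1)`; this is why the exponent is capped at 1. -/
theorem shifted_mul_le (h : IsOrlicz φ c₀ c₁) (hc₀ : 0 < c₀) {a t θ : ℝ} (ha : 0 ≤ a)
    (ht : 0 ≤ t) (hθ : 0 < θ) (hθ1 : θ ≤ 1) :
    shifted φ a (θ * t) ≤ θ ^ (1 + min c₀ 1) * shifted φ a t := by
  unfold shifted
  have e1 : ∫ s in (0 : ℝ)..(θ * t), deriv φ (a + s) / (a + s) * s
      = ∫ s in (0 : ℝ)..t, θ * (deriv φ (a + θ * s) / (a + θ * s) * (θ * s)) := by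
    rw [intervalIntegral.integral_const_mul,
      intervalIntegral.mul_integral_comp_mul_left (f := fun s => deriv φ (a + s) / (a + s) * s)]
    simp
  rw [e1, ← intervalIntegral.integral_const_mul]
  refine intervalIntegral.integral_mono_on ht ?_ ((h.intervalIntegrable_shift hc₀ ha le_rfl ht).const_mul _) ?_
  · refine IntervalIntegrable.const_mul ?_ _
    refine MonotoneOn.intervalIntegrable ?_
    intro x hx y hy hxy
    rw [uIcc_of_le ht] at hx hy
    exact h.monotoneOn_shift hc₀ ha (mem_Ici.2 (mul_nonneg hθ.le hx.1))
      (mem_Ici.2 (mul_nonneg hθ.le hy.1)) (by gcongr)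
  · rintro s ⟨hs0, -⟩
    rcases hs0.eq_or_lt with rfl | hs
    · simp
    have hθs : 0 < θ * s := by positivity
    have hle : θ * s ≤ s := by nlinarith
    have p1 : 0 < a + θ * s := by linarith
    have p2 : 0 < a + s := by linarith
    have h1 := h.deriv_le_rpow_mul (min_le_left c₀ 1) p1 (t := a + s) (by linarith)
    have h0 := h.deriv_nonneg p2.le
    have hr : θ ≤ (a + θ * s) / (a + s) := by
      rw [le_div_iff₀ p2]; nlinarith
    have h2 : ((a + θ * s) / (a + s)) ^ (min c₀ 1 - 1) ≤ θ ^ (min c₀ 1 - 1) :=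
      Real.rpow_le_rpow_of_nonpos hθ hr (by linarith [min_le_right c₀ 1])
    have h3 : ((a + θ * s) / (a + s)) ^ (min c₀ 1)
        = ((a + θ * s) / (a + s)) ^ (min c₀ 1 - 1) * ((a + θ * s) / (a + s)) := by
      rw [← Real.rpow_add_one (by positivity)]; ring_nf
    have h4 : θ ^ (1 + min c₀ 1) = θ ^ (min c₀ 1 - 1) * θ ^ 2 := by
      rw [← Real.rpow_add_natCast hθ.ne']; congr 1; push_cast; ring
    rw [h3] at h1
    calc θ * (deriv φ (a + θ * s) / (a + θ * s) * (θ * s))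
        ≤ θ * ((((a + θ * s) / (a + s)) ^ (min c₀ 1 - 1) * ((a + θ * s) / (a + s))
            * deriv φ (a + s)) / (a + θ * s) * (θ * s)) := by gcongr
      _ = ((a + θ * s) / (a + s)) ^ (min c₀ 1 - 1) * (θ ^ 2 * (deriv φ (a + s) / (a + s) * s)) := by
          field_simp
      _ ≤ θ ^ (min c₀ 1 - 1) * (θ ^ 2 * (deriv φ (a + s) / (a + s) * s)) := by gcongr
      _ = _ := by rw [h4]; ring

end IsOrlicz

theorem exists_isCutoffExponent (c₀ c₁ : ℝ) (hc₀ : 0 < c₀) :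
    ∃ q C : ℝ, 1 < q ∧ ∀ φ : ℝ → ℝ, IsOrlicz φ c₀ c₁ → IsCutoffExponent φ q C := by
  have hm : 0 < min c₀ 1 := lt_min hc₀ one_pos
  -- This `q` is the solution of `(q - 1)(1 + m) = q` with `m = min c₀ 1`, so the scaling bound with
  -- `θ^(q-1)` in place of `θ` produces exactly `θ^q`.
  refine ⟨1 + 1 / min c₀ 1, 1, by simp [hm], fun φ h a t θ ha ht hθ hθ1 => ?_⟩
  rcases hθ.eq_or_lt with rfl | hθ
  · rw [Real.zero_rpow (by simp [hm.ne']), Real.zero_rpow (by positivity)]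
    simp [shifted]
  · have h1 := h.shifted_mul_le hc₀ ha ht (Real.rpow_pos_of_pos hθ (1 + 1 / min c₀ 1 - 1))
      (Real.rpow_le_one hθ.le hθ1 (by simp [hm.le]))
    rw [← Real.rpow_mul hθ.le] at h1
    rw [one_mul]
    convert h1 using 3
    field_simp
    ring

/-- With `a = t = 1` the left side of (1) is at least a multiple of `θ^(2(q-1))`, because
`φ'(1+x)/(1+x) ≥ φ'(1)/2` for `0 ≤ x ≤ 1`. If `q < 2`, dividing by `θ^q` leaves `θ^(q-2)`, which is
unbounded as `θ → 0`. -/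
theorem IsCutoffExponent.two_le {φ : ℝ → ℝ} {c₀ c₁ q C : ℝ} (hq : IsCutoffExponent φ q C)
    (h : IsOrlicz φ c₀ c₁) (hc₀ : 0 < c₀) (hq1 : 1 < q) : 2 ≤ q := by
  by_contra! hlt
  set m := deriv φ 1 / 2 with hm
  have hmpos : 0 < m := by have := h.deriv_pos hc₀ one_pos; positivity
  have hlow : ∀ s, 0 ≤ s → s ≤ 1 → m * (s ^ 2 / 2) ≤ shifted φ 1 s := by
    intro s hs hs1
    have : m * (s ^ 2 / 2) = ∫ x in (0 : ℝ)..s, m * x := by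
      rw [intervalIntegral.integral_const_mul, integral_id]; ring
    rw [this]
    refine intervalIntegral.integral_mono_on hs
      ((continuous_const.mul continuous_id).intervalIntegrable _ _)
      (h.intervalIntegrable_shift hc₀ zero_le_one le_rfl hs) ?_
    rintro x ⟨hx0, hxs⟩
    refine mul_le_mul_of_nonneg_right ?_ hx0
    have h1 : deriv φ 1 ≤ deriv φ (1 + x) :=
      h.monotoneOn_deriv hc₀ (mem_Ici.2 zero_le_one) (mem_Ici.2 (by linarith)) (by linarith)
    have := h.deriv_pos hc₀ one_pos
    rw [hm]
    gcongr
    all_goals linarith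
  set A := C * shifted φ 1 1 with hA
  have key : ∀ θ : ℝ, 0 < θ → θ ≤ 1 → m / 2 * θ ^ (q - 2) ≤ A := by
    intro θ hθ hθ1
    have e1 := hq 1 1 θ zero_le_one zero_le_one hθ.le hθ1
    have e2 := hlow (θ ^ (q - 1)) (by positivity) (Real.rpow_le_one hθ.le hθ1 (by linarith))
    rw [mul_one] at e1
    have e3 : (θ ^ (q - 1)) ^ 2 = θ ^ (q - 2) * θ ^ q := by
      rw [← Real.rpow_natCast, ← Real.rpow_mul hθ.le, ← Real.rpow_add hθ]
      congr 1; push_cast; ring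
    rw [e3] at e2
    have p := Real.rpow_pos_of_pos hθ q
    have := e2.trans e1
    rw [hA]
    refine le_of_mul_le_mul_right ?_ p
    linarith
  have ht : Tendsto (fun θ : ℝ => m / 2 * θ ^ (q - 2)) (𝓝[>] 0) atTop :=
    (tendsto_rpow_neg_nhdsGT_zero (by linarith)).const_mul_atTop (by positivity)
  obtain ⟨θ, h1, h2, h3⟩ := ((ht.eventually_gt_atTop A).and
    (Ioc_mem_nhdsGT (zero_lt_one (α := ℝ)))).exists
  exact absurd (key θ h2 h3) (not_le.2 h1)

end

section
/-! ### Radial vector fields -/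

section Radial

variable {E : Type*} [NormedAddCommGroup E] [InnerProductSpace ℝ E]

theorem norm_radial {f : ℝ → ℝ} (hf : f 0 = 0) (hf' : ∀ t, 0 ≤ t → 0 ≤ f t) (P : E) :
    ‖(f ‖P‖ / ‖P‖) • P‖ = f ‖P‖ := by
  rcases eq_or_ne P 0 with rfl | hP
  · simp [hf]
  · have := norm_pos_iff.2 hP
    rw [norm_smul, Real.norm_of_nonneg (div_nonneg (hf' _ this.le) this.le)]
    field_simp

/-- The product splits into a radial part, depending on the norms only, and an angular part
proportional to `|P||Q| - P·Q ≥ 0`. With various choices of `f` and `g` it reduces every comparison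
between `A`, `V` and the identity to scalar inequalities for the two parts. -/
theorem inner_radial_sub {f g : ℝ → ℝ} (hf : f 0 = 0) (hg : g 0 = 0) (P Q : E) :
    inner ℝ ((f ‖P‖ / ‖P‖) • P - (f ‖Q‖ / ‖Q‖) • Q) ((g ‖P‖ / ‖P‖) • P - (g ‖Q‖ / ‖Q‖) • Q)
      = (f ‖P‖ - f ‖Q‖) * (g ‖P‖ - g ‖Q‖)
        + (‖P‖ * ‖Q‖ - inner ℝ P Q) *
          (f ‖P‖ / ‖P‖ * (g ‖Q‖ / ‖Q‖) + f ‖Q‖ / ‖Q‖ * (g ‖P‖ / ‖P‖)) := by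
  simp only [inner_sub_left, inner_sub_right, real_inner_smul_left, real_inner_smul_right,
    real_inner_self_eq_norm_sq, real_inner_comm P Q]
  rcases eq_or_ne P 0 with rfl | hP <;> rcases eq_or_ne Q 0 with rfl | hQ
  · simp [hf, hg]
  · have := norm_ne_zero_iff.2 hQ
    simp only [norm_zero, hf, hg, inner_zero_left]
    field_simp; ring
  · have := norm_ne_zero_iff.2 hP
    simp only [norm_zero, hf, hg, inner_zero_right]
    field_simp; ring
  · have := norm_ne_zero_iff.2 hQ
    have := norm_ne_zero_iff.2 hP
    field_simp; ring

end Radial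

/-! ### Scalar inequalities for the radial profiles of `A` and `V`. -/

namespace IsOrlicz

variable {φ : ℝ → ℝ} {c₀ c₁ : ℝ}

/-- The radial profile `√(φ'(r) r)` of `V`. -/
noncomputable abbrev profileV (φ : ℝ → ℝ) (r : ℝ) : ℝ := √(deriv φ r * r)

theorem profileV_zero : profileV φ 0 = 0 := by simp [profileV]

theorem profileV_sq (h : IsOrlicz φ c₀ c₁) {r : ℝ} (hr : 0 ≤ r) :
    profileV φ r ^ 2 = deriv φ r * r :=
  Real.sq_sqrt (mul_nonneg (h.deriv_nonneg hr) hr)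

theorem profileV_mono (h : IsOrlicz φ c₀ c₁) (hc₀ : 0 < c₀) {s r : ℝ} (hs : 0 ≤ s) (hr : s ≤ r) :
    profileV φ s ≤ profileV φ r :=
  Real.sqrt_le_sqrt (mul_le_mul (h.monotoneOn_deriv hc₀ hs (hs.trans hr) hr) hr hs
    (h.deriv_nonneg (hs.trans hr)))

theorem profileV_strictMono (h : IsOrlicz φ c₀ c₁) (hc₀ : 0 < c₀) {s r : ℝ} (hs : 0 ≤ s)
    (hr : s < r) : profileV φ s < profileV φ r :=
  Real.sqrt_lt_sqrt (mul_nonneg (h.deriv_nonneg hs) hs)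
    (mul_lt_mul' (h.monotoneOn_deriv hc₀ hs (hs.trans hr.le) hr.le) hr hs
      (h.deriv_pos hc₀ (hs.trans_lt hr)))

/-- After expansion this is the inequality between geometric and arithmetic mean for `φ'(r) s` and
`φ'(s) r`, whose product is the square of `√(φ'(r) r) √(φ'(s) s)`. -/
theorem deriv_sub_mul_le (h : IsOrlicz φ c₀ c₁) {s r : ℝ} (hs : 0 ≤ s)
    (hr : s ≤ r) :
    (deriv φ r - deriv φ s) * (r - s) ≤ (profileV φ r - profileV φ s) ^ 2 := by
  have h1 := h.profileV_sq hs
  have h2 := h.profileV_sq (hs.trans hr)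
  have e1 := h.deriv_nonneg hs
  have e2 := h.deriv_nonneg (hs.trans hr)
  have h3 : profileV φ r * profileV φ s ≤ (deriv φ r * s + deriv φ s * r) / 2 := by
    refine (abs_le_of_sq_le_sq' (a := profileV φ r * profileV φ s) ?_ (by nlinarith)).2
    rw [mul_pow, h1, h2]
    nlinarith [sq_nonneg (deriv φ r * s - deriv φ s * r)]
  nlinarith

/-- If `2s ≤ r`, the squares of the profile differ by a factor 2 at least, hence the profile at `s`
is at most 3/4 of the one at `r`; the remaining quarter gives 16. -/
theorem sq_profileV_le (h : IsOrlicz φ c₀ c₁) (hc₀ : 0 < c₀) {s r : ℝ} (hs : 0 ≤ s)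
    (hr : 2 * s ≤ r) :
    deriv φ r * r ≤ 16 * (profileV φ r - profileV φ s) ^ 2 := by
  have h1 := h.profileV_sq hs
  have h2 := h.profileV_sq (r := r) (by linarith)
  have e1 := h.deriv_nonneg hs
  have e2 := h.monotoneOn_deriv hc₀ hs (mem_Ici.2 (by linarith : 0 ≤ r)) (by linarith)
  rw [← h2]
  have p1 : 0 ≤ profileV φ r := Real.sqrt_nonneg _
  have p2 : 0 ≤ profileV φ s := Real.sqrt_nonneg _
  have h3 : 2 * profileV φ s ^ 2 ≤ profileV φ r ^ 2 := by rw [h1, h2]; nlinarith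
  have h4 : 4 * profileV φ s ≤ 3 * profileV φ r := by
    refine (abs_le_of_sq_le_sq' (a := 4 * profileV φ s) ?_ (by positivity)).2
    nlinarith
  nlinarith

/-- By the mean value theorem the increment of `φ'` is `φ''(ξ)(r - s)`. Here `ξ` and `r` agree up to
a factor 2, so `φ''(ξ)` is comparable to `φ'(r)/r`. -/
theorem deriv_sub_bounds (h : IsOrlicz φ c₀ c₁) (hc₀ : 0 < c₀) {s r : ℝ} (hs : 0 < s)
    (hsr : s ≤ r) (hr : r ≤ 2 * s) :
    c₀ * (deriv φ r / r * (r - s)) ≤ 2 ^ c₁ * (deriv φ r - deriv φ s) ∧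
      deriv φ r - deriv φ s ≤ 2 * c₁ * (deriv φ r / r * (r - s)) := by
  rcases hsr.eq_or_lt with rfl | hlt
  · simp
  have hr0 : 0 < r := hs.trans hlt
  obtain ⟨ξ, ⟨h1, h2⟩, h3⟩ := exists_hasDerivAt_eq_slope (deriv φ) (deriv (deriv φ)) hlt
    (fun x hx => (h.hasDerivAt_deriv (hs.trans_le hx.1)).continuousAt.continuousWithinAt)
    (fun x hx => h.hasDerivAt_deriv (hs.trans hx.1))
  have hξ : 0 < ξ := hs.trans h1
  have hd : deriv φ r - deriv φ s = deriv (deriv φ) ξ * (r - s) := by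
    rw [h3]; field_simp [sub_ne_zero.2 hlt.ne']
  have hl := h.lower ξ hξ
  have hu := h.upper ξ hξ
  have hp := h.deriv_pos hc₀ hξ
  have hpr := h.deriv_pos hc₀ hr0
  have hc1 : 0 < c₁ := hc₀.trans_le (h.c_le hc₀)
  have k0 := h.deriv_le_of_le_two_mul hc₀ hξ.le hr0.le (by linarith)
  have k1 := h.monotoneOn_deriv hc₀ hξ.le hr0.le h2.le
  have p2 : (0 : ℝ) < 2 ^ c₁ := by positivity
  have d0 : 0 < deriv (deriv φ) ξ := by
    by_contra! hcon
    nlinarith [mul_pos hc₀ hp]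
  constructor
  · rw [hd]
    have : c₀ * (deriv φ r / r) ≤ 2 ^ c₁ * deriv (deriv φ) ξ := by
      rw [← mul_div_assoc, div_le_iff₀ hr0]
      calc c₀ * deriv φ r ≤ 2 ^ c₁ * (c₀ * deriv φ ξ) := by nlinarith
        _ ≤ 2 ^ c₁ * (deriv (deriv φ) ξ * ξ) := by gcongr
        _ ≤ 2 ^ c₁ * (deriv (deriv φ) ξ * r) := by gcongr
        _ = _ := by ring
    nlinarith [sub_pos.2 hlt]
  · rw [hd, ← mul_assoc]
    refine mul_le_mul_of_nonneg_right ?_ (sub_pos.2 hlt).le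
    rw [← mul_div_assoc, le_div_iff₀ hr0]
    calc deriv (deriv φ) ξ * r ≤ deriv (deriv φ) ξ * (2 * ξ) := by gcongr; linarith
      _ ≤ 2 * (c₁ * deriv φ ξ) := by linarith
      _ ≤ 2 * (c₁ * deriv φ r) := by gcongr
      _ = _ := by ring

/-- `(√(φ'(r) r) - √(φ'(s) s))²` is controlled by `(φ'(r) - φ'(s)) (r - s)`. -/
theorem exists_sq_profileV_sub_le (c₀ c₁ : ℝ) (hc₀ : 0 < c₀) :
    ∃ C : ℝ, 1 ≤ C ∧ ∀ φ, IsOrlicz φ c₀ c₁ → ∀ s r : ℝ, 0 ≤ s → s ≤ r →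
      (profileV φ r - profileV φ s) ^ 2 ≤ C * ((deriv φ r - deriv φ s) * (r - s)) := by
  have q1 : (1 / 2 : ℝ) ^ c₀ < 1 := Real.rpow_lt_one (by norm_num) (by norm_num) hc₀
  have q2 : 0 < 1 - (1 / 2 : ℝ) ^ c₀ := by linarith
  have p2 : (0 : ℝ) < 2 ^ c₁ := by positivity
  refine ⟨1 + 2 / (1 - (1 / 2 : ℝ) ^ c₀) + 4 * |c₁| + 2 * (2 ^ c₁ / c₀),
    by have : 0 ≤ |c₁| := abs_nonneg _
       have : 0 ≤ 2 / (1 - (1 / 2 : ℝ) ^ c₀) := by positivity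
       have : 0 ≤ 2 ^ c₁ / c₀ := by positivity
       linarith, fun φ h s r hs hsr => ?_⟩
  have hc1 : 0 < c₁ := hc₀.trans_le (h.c_le hc₀)
  rw [abs_of_pos hc1]
  have hr : 0 ≤ r := hs.trans hsr
  have h1 := h.profileV_sq hs
  have h2 := h.profileV_sq hr
  have p3 : 0 ≤ profileV φ r := Real.sqrt_nonneg _
  have p4 : 0 ≤ profileV φ s := Real.sqrt_nonneg _
  have hm := h.monotoneOn_deriv hc₀ hs hr hsr
  have hX : 0 ≤ (deriv φ r - deriv φ s) * (r - s) :=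
    mul_nonneg (sub_nonneg.2 hm) (sub_nonneg.2 hsr)
  rcases hr.eq_or_lt with rfl | hr0
  · obtain rfl : s = 0 := le_antisymm hsr hs
    simp
  -- For separated radii `φ'(s) ≤ 2^(-c₀) φ'(r)`, so both increments on the right are fixed
  -- fractions of `φ'(r)` and `r`. For comparable radii the difference of the profiles, multiplied
  -- by their sum, is `φ'(r) r - φ'(s) s`, which is linear in the two increments.
  rcases le_total (2 * s) r with hcase | hcase
  · have h3 : (profileV φ r - profileV φ s) ^ 2 ≤ deriv φ r * r := by
      rw [← h2]
      have := h.profileV_mono hc₀ hs hsr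
      nlinarith
    have h4 : deriv φ s ≤ (1 / 2 : ℝ) ^ c₀ * deriv φ r := by
      have k1 := h.deriv_le_rpow_mul le_rfl (s := r / 2) (t := r) (by linarith) (by linarith)
      rw [show r / 2 / r = 1 / 2 by field_simp] at k1
      exact (h.monotoneOn_deriv hc₀ hs (mem_Ici.2 (by linarith)) (by linarith)).trans k1
    have h5 : (1 - (1 / 2 : ℝ) ^ c₀) * (deriv φ r * r)
        ≤ 2 * ((deriv φ r - deriv φ s) * (r - s)) := by
      have : (1 - (1 / 2 : ℝ) ^ c₀) * deriv φ r ≤ deriv φ r - deriv φ s := by linarith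
      have h6 : r ≤ 2 * (r - s) := by linarith
      calc (1 - (1 / 2 : ℝ) ^ c₀) * (deriv φ r * r) = ((1 - (1 / 2 : ℝ) ^ c₀) * deriv φ r) * r := by
            ring
        _ ≤ (deriv φ r - deriv φ s) * (2 * (r - s)) :=
          mul_le_mul this h6 hr (sub_nonneg.2 hm)
        _ = _ := by ring
    have h7 : deriv φ r * r ≤ 2 / (1 - (1 / 2 : ℝ) ^ c₀) * ((deriv φ r - deriv φ s) * (r - s)) := by
      rw [div_mul_eq_mul_div, le_div_iff₀ q2]; linarith
    have : 0 ≤ (4 * c₁ + 2 * (2 ^ c₁ / c₀)) * ((deriv φ r - deriv φ s) * (r - s)) := by positivity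
    linarith
  · have hs0 : 0 < s := by linarith
    obtain ⟨b1, b2⟩ := h.deriv_sub_bounds hc₀ hs0 hsr hcase
    have hpr := h.deriv_pos hc₀ hr0
    set A := deriv φ r - deriv φ s with hA
    set R := r - s with hR
    set a := deriv φ r / r with ha
    have ha0 : 0 < a := by positivity
    have har : deriv φ r = a * r := by rw [ha]; field_simp
    have hA0 : 0 ≤ A := sub_nonneg.2 hm
    have hR0 : 0 ≤ R := sub_nonneg.2 hsr
    clear_value a
    set D := profileV φ r - profileV φ s with hD
    have hD0 : 0 ≤ D := sub_nonneg.2 (h.profileV_mono hc₀ hs hsr)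
    have e1 : D * profileV φ r ≤ r * (A + a * R) := by
      have : D * (profileV φ r + profileV φ s) = deriv φ r * r - deriv φ s * s := by
        rw [← h1, ← h2, hD]; ring
      have e2 : deriv φ r * r - deriv φ s * s ≤ r * (A + a * R) := by
        have e3 : deriv φ r * r - deriv φ s * s = r * A + deriv φ s * R := by rw [hA, hR]; ring
        rw [e3]
        nlinarith
      nlinarith
    have e2 : D ^ 2 * (a * r ^ 2) ≤ (2 * A ^ 2 + 2 * a ^ 2 * R ^ 2) * r ^ 2 := by
      have : D ^ 2 * (a * r ^ 2) = (D * profileV φ r) ^ 2 := by rw [mul_pow, h2, har]; ring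
      rw [this]
      calc (D * profileV φ r) ^ 2 ≤ (r * (A + a * R)) ^ 2 := by gcongr
        _ ≤ _ := by nlinarith [mul_nonneg (sq_nonneg r) (sq_nonneg (A - a * R))]
    have e3 : D ^ 2 * a ≤ 2 * A ^ 2 + 2 * a ^ 2 * R ^ 2 := by
      refine le_of_mul_le_mul_right ?_ (pow_pos hr0 2)
      linarith
    have e4 : A ^ 2 ≤ 2 * c₁ * a * (A * R) := by nlinarith
    have e5 : a * R ^ 2 ≤ 2 ^ c₁ / c₀ * (A * R) := by
      rw [div_mul_eq_mul_div, le_div_iff₀ hc₀]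
      have := mul_le_mul_of_nonneg_right b1 hR0
      linarith
    have e6 : D ^ 2 ≤ 4 * c₁ * (A * R) + 2 * (2 ^ c₁ / c₀ * (A * R)) := by
      refine le_of_mul_le_mul_right ?_ ha0
      have := mul_le_mul_of_nonneg_left e5 ha0.le
      linarith
    have : 0 ≤ (1 + 2 / (1 - (1 / 2 : ℝ) ^ c₀)) * (A * R) := by positivity
    linarith

end IsOrlicz

/-! ### Comparison of `A`, `V` and increments of matrices. -/

section Fields

variable {φ : ℝ → ℝ} {c₀ c₁ : ℝ} {n N : ℕ}

open IsOrlicz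

theorem norm_fieldV (P : Mat n N) : ‖fieldV φ P‖ = profileV φ ‖P‖ :=
  norm_radial (f := profileV φ) profileV_zero (fun _ _ => Real.sqrt_nonneg _) P

theorem norm_fluxA (h : IsOrlicz φ c₀ c₁) (P : Mat n N) : ‖fluxA φ P‖ = deriv φ ‖P‖ :=
  norm_radial h.deriv_zero_eq (fun _ => h.deriv_nonneg) P

theorem sq_norm_fieldV (h : IsOrlicz φ c₀ c₁) (P : Mat n N) :
    ‖fieldV φ P‖ ^ 2 = deriv φ ‖P‖ * ‖P‖ := by
  rw [norm_fieldV, h.profileV_sq (norm_nonneg _)]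

@[simp] theorem fieldV_zero : fieldV φ (0 : Mat n N) = 0 := by simp [fieldV]

@[simp] theorem fluxA_zero : fluxA φ (0 : Mat n N) = 0 := by simp [fluxA]

theorem sq_norm_fieldV_sub (P Q : Mat n N) :
    ‖fieldV φ P - fieldV φ Q‖ ^ 2 = (profileV φ ‖P‖ - profileV φ ‖Q‖) ^ 2
      + 2 * (‖P‖ * ‖Q‖ - inner ℝ P Q) * (profileV φ ‖P‖ / ‖P‖ * (profileV φ ‖Q‖ / ‖Q‖)) := by
  rw [← real_inner_self_eq_norm_sq]
  refine (inner_radial_sub (f := profileV φ) (g := profileV φ) profileV_zero profileV_zero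
    P Q).trans ?_
  ring

theorem sq_norm_fluxA_sub (h : IsOrlicz φ c₀ c₁) (P Q : Mat n N) :
    ‖fluxA φ P - fluxA φ Q‖ ^ 2 = (deriv φ ‖P‖ - deriv φ ‖Q‖) ^ 2
      + 2 * (‖P‖ * ‖Q‖ - inner ℝ P Q) * (deriv φ ‖P‖ / ‖P‖ * (deriv φ ‖Q‖ / ‖Q‖)) := by
  rw [← real_inner_self_eq_norm_sq]
  refine (inner_radial_sub h.deriv_zero_eq h.deriv_zero_eq P Q).trans ?_
  ring

theorem radial_id (P : Mat n N) : ((fun t : ℝ => t) ‖P‖ / ‖P‖) • P = P := by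
  rcases eq_or_ne P 0 with rfl | hP
  · simp
  · rw [div_self (norm_ne_zero_iff.2 hP), one_smul]

theorem inner_fluxA_sub (h : IsOrlicz φ c₀ c₁) (P Q : Mat n N) :
    inner ℝ (fluxA φ P - fluxA φ Q) (P - Q) = (deriv φ ‖P‖ - deriv φ ‖Q‖) * (‖P‖ - ‖Q‖)
      + (‖P‖ * ‖Q‖ - inner ℝ P Q) * (deriv φ ‖P‖ / ‖P‖ + deriv φ ‖Q‖ / ‖Q‖) := by
  have := inner_radial_sub (f := deriv φ) (g := fun t => t) h.deriv_zero_eq rfl P Q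
  rw [radial_id, radial_id] at this
  refine this.trans ?_
  rcases eq_or_ne P 0 with rfl | hP <;> rcases eq_or_ne Q 0 with rfl | hQ
  · simp
  · simp
  · simp
  · rw [div_self (norm_ne_zero_iff.2 hP), div_self (norm_ne_zero_iff.2 hQ)]
    ring

theorem sq_norm_sub_eq (P Q : Mat n N) :
    ‖P - Q‖ ^ 2 = (‖P‖ - ‖Q‖) ^ 2 + 2 * (‖P‖ * ‖Q‖ - inner ℝ P Q) := by
  rw [norm_sub_sq_real]; ring

theorem profileV_div_sq (h : IsOrlicz φ c₀ c₁) {r : ℝ} (hr : 0 ≤ r) :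
    (profileV φ r / r) ^ 2 = deriv φ r / r := by
  rw [div_pow, h.profileV_sq hr]
  rcases hr.eq_or_lt with rfl | hr
  · simp
  · field_simp

/-- Monotonicity of `A` in terms of `V`. -/
theorem exists_sq_fieldV_sub_le_inner (c₀ c₁ : ℝ) (hc₀ : 0 < c₀) :
    ∃ C : ℝ, 1 ≤ C ∧ ∀ φ, IsOrlicz φ c₀ c₁ → ∀ (n N : ℕ) (P Q : Mat n N),
      ‖fieldV φ P - fieldV φ Q‖ ^ 2 ≤ C * inner ℝ (fluxA φ P - fluxA φ Q) (P - Q) := by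
  obtain ⟨C, hC, H⟩ := exists_sq_profileV_sub_le c₀ c₁ hc₀
  refine ⟨C, hC, fun φ h n N P Q => ?_⟩
  rw [sq_norm_fieldV_sub, inner_fluxA_sub h]
  have hK : 0 ≤ ‖P‖ * ‖Q‖ - inner ℝ P Q := sub_nonneg.2 (real_inner_le_norm P Q)
  have h1 : (profileV φ ‖P‖ - profileV φ ‖Q‖) ^ 2
      ≤ C * ((deriv φ ‖P‖ - deriv φ ‖Q‖) * (‖P‖ - ‖Q‖)) := by
    rcases le_total ‖Q‖ ‖P‖ with hle | hle
    · exact H φ h _ _ (norm_nonneg _) hle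
    · have := H φ h _ _ (norm_nonneg _) hle
      linarith
  have x1 := profileV_div_sq h (norm_nonneg P)
  have x2 := profileV_div_sq h (norm_nonneg Q)
  set x := profileV φ ‖P‖ / ‖P‖
  set y := profileV φ ‖Q‖ / ‖Q‖
  rw [← x1, ← x2]
  have h2 : 2 * (x * y) ≤ C * (x ^ 2 + y ^ 2) := by
    nlinarith [sq_nonneg (x - y), sq_nonneg x, sq_nonneg y]
  nlinarith [mul_le_mul_of_nonneg_left h2 hK]

/-- If `2|Q| ≤ |P|`, all increments are dominated by their value at `P`, and `|V(P) - V(Q)|²` is at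
least a multiple of `φ'(|P|)|P|`. Otherwise the weights at `P` and `Q` are comparable, and the
radial and angular parts are compared separately. -/
theorem exists_norm_sub_le_aux (c₀ c₁ : ℝ) (hc₀ : 0 < c₀) :
    ∃ C : ℝ, 1 ≤ C ∧ ∀ φ, IsOrlicz φ c₀ c₁ → ∀ (n N : ℕ) (P Q : Mat n N), ‖Q‖ ≤ ‖P‖ →
      deriv φ ‖P‖ / ‖P‖ * ‖P - Q‖ ^ 2 ≤ C * ‖fieldV φ P - fieldV φ Q‖ ^ 2 ∧
      ‖fluxA φ P - fluxA φ Q‖ ^ 2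
        ≤ C * (deriv φ ‖P‖ / ‖P‖) * ‖fieldV φ P - fieldV φ Q‖ ^ 2 := by
  have p2 : (0 : ℝ) < 2 ^ c₁ := by positivity
  have hq : 0 ≤ 2 ^ c₁ / c₀ := by positivity
  refine ⟨64 + 2 ^ c₁ / c₀ + 2 ^ c₁ + 2 * |c₁| , by have := abs_nonneg c₁; linarith,
    fun φ h n N P Q hPQ => ?_⟩
  have hc1 : 0 < c₁ := hc₀.trans_le (h.c_le hc₀)
  rw [abs_of_pos hc1]
  rcases (norm_nonneg P).eq_or_lt with hP | hr0
  · have hP' : P = 0 := norm_eq_zero.1 hP.symm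
    have hQ' : Q = 0 := norm_eq_zero.1 (le_antisymm (hPQ.trans hP.ge) (norm_nonneg _))
    subst hP' hQ'
    simp
  have hpr := h.deriv_pos hc₀ hr0
  have hK : 0 ≤ ‖P‖ * ‖Q‖ - inner ℝ P Q := sub_nonneg.2 (real_inner_le_norm P Q)
  have x1 := profileV_div_sq h (norm_nonneg P)
  have x2 := profileV_div_sq h (norm_nonneg Q)
  have x0 : 0 ≤ profileV φ ‖P‖ / ‖P‖ := div_nonneg (Real.sqrt_nonneg _) (norm_nonneg _)
  have y0 : 0 ≤ profileV φ ‖Q‖ / ‖Q‖ := div_nonneg (Real.sqrt_nonneg _) (norm_nonneg _)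
  have hV := sq_norm_fieldV_sub (φ := φ) P Q
  have hA := sq_norm_fluxA_sub h P Q
  have hS := sq_norm_sub_eq P Q
  have hdv := h.deriv_sub_mul_le (norm_nonneg Q) hPQ
  have hm := h.monotoneOn_deriv hc₀ (norm_nonneg Q) (norm_nonneg P) hPQ
  set a := deriv φ ‖P‖ / ‖P‖ with ha
  have ha0 : 0 < a := by positivity
  have har : deriv φ ‖P‖ = a * ‖P‖ := by rw [ha]; field_simp
  clear_value a
  set x := profileV φ ‖P‖ / ‖P‖
  set y := profileV φ ‖Q‖ / ‖Q‖
  clear_value x y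
  set K := ‖P‖ * ‖Q‖ - inner ℝ P Q
  set Δv := profileV φ ‖P‖ - profileV φ ‖Q‖
  have hxy : 0 ≤ x * y := mul_nonneg x0 y0
  have hVge : Δv ^ 2 ≤ ‖fieldV φ P - fieldV φ Q‖ ^ 2 := by
    rw [hV]; nlinarith [mul_nonneg hK hxy]
  rcases le_total (2 * ‖Q‖) ‖P‖ with hcase | hcase
  · have hbig := (h.sq_profileV_le hc₀ (norm_nonneg Q) hcase).trans
      (mul_le_mul_of_nonneg_left hVge (by norm_num))
    set X := ‖fieldV φ P - fieldV φ Q‖ ^ 2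
    have hX : 0 ≤ X := sq_nonneg _
    have hCX : 64 * X ≤ (64 + 2 ^ c₁ / c₀ + 2 ^ c₁ + 2 * c₁) * X := by
      gcongr; linarith
    constructor
    · have t1 : ‖P - Q‖ ≤ 2 * ‖P‖ := (norm_sub_le P Q).trans (by linarith)
      have t2 : ‖P - Q‖ ^ 2 ≤ (2 * ‖P‖) ^ 2 := by gcongr
      calc a * ‖P - Q‖ ^ 2 ≤ a * (2 * ‖P‖) ^ 2 := by gcongr
        _ = 4 * (deriv φ ‖P‖ * ‖P‖) := by rw [har]; ring
        _ ≤ _ := by linarith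
    · have t1 : ‖fluxA φ P - fluxA φ Q‖ ≤ 2 * deriv φ ‖P‖ :=
        (norm_sub_le _ _).trans (by rw [norm_fluxA h, norm_fluxA h]; linarith)
      calc ‖fluxA φ P - fluxA φ Q‖ ^ 2 ≤ (2 * deriv φ ‖P‖) ^ 2 := by gcongr
        _ = a * (4 * (deriv φ ‖P‖ * ‖P‖)) := by rw [har]; ring
        _ ≤ a * ((64 + 2 ^ c₁ / c₀ + 2 ^ c₁ + 2 * c₁) * X) := by
            refine mul_le_mul_of_nonneg_left ?_ ha0.le; linarith
        _ = _ := by ring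
  · have hs0 : 0 < ‖Q‖ := by linarith
    obtain ⟨b1, b2⟩ := h.deriv_sub_bounds hc₀ hs0 hPQ hcase
    rw [← ha] at b1 b2
    have hyx : x ^ 2 ≤ 2 ^ c₁ * y ^ 2 := by
      rw [x1, x2, ha, ← mul_div_assoc]
      exact div_le_div₀ (mul_nonneg p2.le (h.deriv_nonneg hs0.le))
        (h.deriv_le_of_le_two_mul hc₀ hs0.le hr0.le hcase) hs0 hPQ
    have hyx' : y ^ 2 ≤ 2 * x ^ 2 := by
      rw [x1, x2, ha, ← mul_div_assoc, div_le_div_iff₀ hs0 hr0]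
      nlinarith
    have one_le : (1 : ℝ) ≤ 2 ^ c₁ := Real.one_le_rpow (by norm_num) hc1.le
    have k1 : x ^ 2 ≤ 2 ^ c₁ * (x * y) := by
      have : x ≤ 2 ^ c₁ * y := by
        refine (abs_le_of_sq_le_sq' (a := x) ?_ (by positivity)).2
        have := mul_le_mul_of_nonneg_right one_le (mul_nonneg p2.le (sq_nonneg y))
        linarith
      have := mul_le_mul_of_nonneg_left this x0
      linarith
    have k2 : y ^ 2 ≤ 2 * (x * y) := by
      have : y ≤ 2 * x := by
        refine (abs_le_of_sq_le_sq' (a := y) ?_ (by positivity)).2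
        linarith [sq_nonneg x]
      have := mul_le_mul_of_nonneg_left this y0
      linarith
    have hL : a * (‖P‖ - ‖Q‖) ^ 2 ≤ 2 ^ c₁ / c₀ * Δv ^ 2 := by
      rw [div_mul_eq_mul_div, le_div_iff₀ hc₀]
      have := mul_le_mul_of_nonneg_right b1 (sub_nonneg.2 hPQ)
      have := mul_le_mul_of_nonneg_left hdv p2.le
      linarith
    have hU : (deriv φ ‖P‖ - deriv φ ‖Q‖) ^ 2 ≤ 2 * c₁ * a * Δv ^ 2 := by
      have : (deriv φ ‖P‖ - deriv φ ‖Q‖) ^ 2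
          ≤ 2 * c₁ * a * ((deriv φ ‖P‖ - deriv φ ‖Q‖) * (‖P‖ - ‖Q‖)) := by
        have := mul_le_mul_of_nonneg_right b2 (sub_nonneg.2 hm)
        linarith
      exact this.trans (mul_le_mul_of_nonneg_left hdv (by positivity))
    have s1 : 0 ≤ Δv ^ 2 := sq_nonneg _
    have s2 : 0 ≤ K * (x * y) := mul_nonneg hK hxy
    generalize (2 : ℝ) ^ c₁ / c₀ = q at *
    generalize (2 : ℝ) ^ c₁ = p at *
    have gen : ∀ u w : ℝ, 0 ≤ u → 0 ≤ w → q * u + p * w ≤ (64 + q + p + 2 * c₁) * (u + w) ∧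
        2 * c₁ * u + 2 * w ≤ (64 + q + p + 2 * c₁) * (u + w) := by
      intro u w hu hw
      have g1 : 0 ≤ (64 + p + 2 * c₁) * u + (64 + q + 2 * c₁) * w := by positivity
      have g2 : 0 ≤ (64 + q + p) * u + (62 + q + p + 2 * c₁) * w := by positivity
      constructor <;> linarith
    obtain ⟨g1, g2⟩ := gen (Δv ^ 2) (2 * K * (x * y)) s1 (by linarith)
    constructor
    · rw [hS, hV, mul_add]
      have := mul_le_mul_of_nonneg_left k1 (mul_nonneg two_pos.le hK)
      rw [x1] at this
      linarith
    · rw [hA, hV, ← x2]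
      have k3 := mul_le_mul_of_nonneg_left k2 (mul_nonneg (mul_nonneg two_pos.le hK) ha0.le)
      have k4 := mul_le_mul_of_nonneg_left g2 ha0.le
      linarith

/-- With `a = φ'(s) / s` and `s = max |P| |Q|`, the quantities `√a |P - Q|` and
`|A(P) - A(Q)| / √a` are controlled by `|V(P) - V(Q)|`. -/
theorem exists_norm_sub_le (c₀ c₁ : ℝ) (hc₀ : 0 < c₀) :
    ∃ C : ℝ, 1 ≤ C ∧ ∀ φ, IsOrlicz φ c₀ c₁ → ∀ (n N : ℕ) (P Q : Mat n N),
      deriv φ (max ‖P‖ ‖Q‖) / max ‖P‖ ‖Q‖ * ‖P - Q‖ ^ 2 ≤ C * ‖fieldV φ P - fieldV φ Q‖ ^ 2 ∧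
      ‖fluxA φ P - fluxA φ Q‖ ^ 2
        ≤ C * (deriv φ (max ‖P‖ ‖Q‖) / max ‖P‖ ‖Q‖) * ‖fieldV φ P - fieldV φ Q‖ ^ 2 := by
  obtain ⟨C, hC, H⟩ := exists_norm_sub_le_aux c₀ c₁ hc₀
  refine ⟨C, hC, fun φ h n N P Q => ?_⟩
  rcases le_total ‖Q‖ ‖P‖ with hle | hle
  · rw [max_eq_left hle]; exact H φ h n N P Q hle
  · rw [max_eq_right hle, norm_sub_rev P Q, norm_sub_rev (fluxA φ P), norm_sub_rev (fieldV φ P)]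
    exact H φ h n N Q P hle

/-- Multiplying the two bounds of `exists_norm_sub_le` cancels the weight `a`. For the second
estimate, with `s = max |P| |Q|`, the product `a s²` is `φ'(s) s`, the square of the larger of
`|V(P)|` and `|V(Q)|`. -/
theorem exists_fluxA_sub_mul_le (c₀ c₁ : ℝ) (hc₀ : 0 < c₀) :
    ∃ C : ℝ, 1 ≤ C ∧ ∀ φ, IsOrlicz φ c₀ c₁ → ∀ (n N : ℕ) (P Q : Mat n N),
      ‖fluxA φ P - fluxA φ Q‖ * ‖P - Q‖ ≤ C * ‖fieldV φ P - fieldV φ Q‖ ^ 2 ∧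
      ‖fluxA φ P - fluxA φ Q‖ * ‖Q‖
        ≤ C * (‖fieldV φ P - fieldV φ Q‖ * (‖fieldV φ P - fieldV φ Q‖ + ‖fieldV φ Q‖)) := by
  obtain ⟨C, hC, H⟩ := exists_norm_sub_le c₀ c₁ hc₀
  refine ⟨C, hC, fun φ h n N P Q => ?_⟩
  obtain ⟨h1, h2⟩ := H φ h n N P Q
  have hs : 0 ≤ max ‖P‖ ‖Q‖ := le_max_of_le_left (norm_nonneg _)
  set a := deriv φ (max ‖P‖ ‖Q‖) / max ‖P‖ ‖Q‖ with ha
  have ha0 : 0 ≤ a := div_nonneg (h.deriv_nonneg hs) hs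
  set X := ‖fieldV φ P - fieldV φ Q‖ with hX
  have hX0 : 0 ≤ X := norm_nonneg _
  constructor
  · refine (abs_le_of_sq_le_sq' (a := ‖fluxA φ P - fluxA φ Q‖ * ‖P - Q‖) ?_ (by positivity)).2
    calc (‖fluxA φ P - fluxA φ Q‖ * ‖P - Q‖) ^ 2
        = ‖fluxA φ P - fluxA φ Q‖ ^ 2 * ‖P - Q‖ ^ 2 := by ring
      _ ≤ (C * a * X ^ 2) * ‖P - Q‖ ^ 2 := by gcongr
      _ = C * X ^ 2 * (a * ‖P - Q‖ ^ 2) := by ring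
      _ ≤ C * X ^ 2 * (C * X ^ 2) := by gcongr
      _ = _ := by ring
  · have hv : profileV φ (max ‖P‖ ‖Q‖) ≤ X + ‖fieldV φ Q‖ := by
      rcases le_total ‖Q‖ ‖P‖ with hle | hle
      · rw [max_eq_left hle, ← norm_fieldV]
        have := norm_add_le (fieldV φ P - fieldV φ Q) (fieldV φ Q)
        rwa [sub_add_cancel] at this
      · rw [max_eq_right hle, ← norm_fieldV]; linarith
    have hva : a * max ‖P‖ ‖Q‖ ^ 2 = profileV φ (max ‖P‖ ‖Q‖) ^ 2 := by
      rw [h.profileV_sq hs, ha]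
      rcases hs.eq_or_lt with h0 | h0
      · rw [← h0]; simp
      · field_simp
    refine (abs_le_of_sq_le_sq' (a := ‖fluxA φ P - fluxA φ Q‖ * ‖Q‖) ?_ (by positivity)).2
    have p0 : 0 ≤ profileV φ (max ‖P‖ ‖Q‖) := Real.sqrt_nonneg _
    calc (‖fluxA φ P - fluxA φ Q‖ * ‖Q‖) ^ 2
        = ‖fluxA φ P - fluxA φ Q‖ ^ 2 * ‖Q‖ ^ 2 := by ring
      _ ≤ (C * a * X ^ 2) * max ‖P‖ ‖Q‖ ^ 2 := by gcongr; exact le_max_right _ _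
      _ = C * X ^ 2 * (a * max ‖P‖ ‖Q‖ ^ 2) := by ring
      _ ≤ C * X ^ 2 * (X + ‖fieldV φ Q‖) ^ 2 := by rw [hva]; gcongr
      _ ≤ C ^ 2 * X ^ 2 * (X + ‖fieldV φ Q‖) ^ 2 := by
          gcongr; nlinarith
      _ = _ := by ring

/-- By monotonicity of `φ'`. The arguments `P` and `Q` are unrelated, so the inequality may be used
with gradients at two different points; this makes mollification compatible with the nonlinear
structure. -/
theorem norm_fluxA_mul_le (h : IsOrlicz φ c₀ c₁) (hc₀ : 0 < c₀) (P Q : Mat n N) :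
    ‖fluxA φ P‖ * ‖Q‖ ≤ ‖fieldV φ P‖ ^ 2 + ‖fieldV φ Q‖ ^ 2 := by
  rw [norm_fluxA h, sq_norm_fieldV h, sq_norm_fieldV h]
  exact h.deriv_mul_le_add hc₀ (norm_nonneg _) (norm_nonneg _)

end Fields

end

section
/-! ### A dominated convergence theorem with varying bounds -/

/-- The bounds converge in `L¹` by Scheffé's argument. Then `|f_k - f₀|` is at most `min |f_k - f₀|
(2 g₀)`, to which the usual dominated convergence theorem applies, plus `|g_k - g₀|`. -/
theorem tendsto_integral_of_tendsto_bound {X F : Type*} [MeasurableSpace X] {μ : Measure X}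
    [NormedAddCommGroup F] [NormedSpace ℝ F] {f : ℕ → X → F} {f₀ : X → F} {g : ℕ → X → ℝ}
    {g₀ : X → ℝ} (hf : ∀ k, AEStronglyMeasurable (f k) μ) (hg : ∀ k, Integrable (g k) μ)
    (hg₀ : Integrable g₀ μ) (hle : ∀ k, ∀ᵐ z ∂μ, ‖f k z‖ ≤ g k z)
    (hflim : ∀ᵐ z ∂μ, Tendsto (fun k => f k z) atTop (𝓝 (f₀ z)))
    (hglim : ∀ᵐ z ∂μ, Tendsto (fun k => g k z) atTop (𝓝 (g₀ z)))
    (hint : Tendsto (fun k => ∫ z, g k z ∂μ) atTop (𝓝 (∫ z, g₀ z ∂μ))) :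
    Integrable f₀ μ ∧ Tendsto (fun k => ∫ z, f k z ∂μ) atTop (𝓝 (∫ z, f₀ z ∂μ)) := by
  have hf₀ : AEStronglyMeasurable f₀ μ := aestronglyMeasurable_of_tendsto_ae atTop hf hflim
  have hall : ∀ᵐ z ∂μ, ∀ k, ‖f k z‖ ≤ g k z := ae_all_iff.2 hle
  have hf₀le : ∀ᵐ z ∂μ, ‖f₀ z‖ ≤ g₀ z := by
    filter_upwards [hall, hflim, hglim] with z h1 h2 h3
    exact le_of_tendsto_of_tendsto' h2.norm h3 h1
  have hif : ∀ k, Integrable (f k) μ := fun k => (hg k).mono' (hf k) (hle k)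
  have hif₀ : Integrable f₀ μ := hg₀.mono' hf₀ hf₀le
  refine ⟨hif₀, ?_⟩
  -- Scheffé for the bounds
  have hmin : Tendsto (fun k => ∫ z, min (g k z) (g₀ z) ∂μ) atTop (𝓝 (∫ z, g₀ z ∂μ)) := by
    refine tendsto_integral_of_dominated_convergence g₀
      (fun k => ((hg k).inf hg₀).aestronglyMeasurable) hg₀ (fun k => ?_) ?_
    · filter_upwards [hall, hf₀le] with z h1 h2
      have := (norm_nonneg _).trans (h1 k)
      have := (norm_nonneg _).trans h2
      rw [Real.norm_of_nonneg (by positivity)]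
      exact min_le_right _ _
    · filter_upwards [hglim] with z h
      simpa using h.min (tendsto_const_nhds (x := g₀ z))
  have hsch : Tendsto (fun k => ∫ z, |g k z - g₀ z| ∂μ) atTop (𝓝 0) := by
    have e : ∀ k, ∫ z, |g k z - g₀ z| ∂μ
        = ∫ z, g k z ∂μ + ∫ z, g₀ z ∂μ - 2 * ∫ z, min (g k z) (g₀ z) ∂μ := by
      intro k
      rw [← integral_const_mul, ← integral_add (hg k) hg₀,
        ← integral_sub (f := fun z => g k z + g₀ z) (g := fun z => 2 * min (g k z) (g₀ z))
          ((hg k).add hg₀) (((hg k).inf hg₀).const_mul 2)]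
      refine integral_congr_ae (Eventually.of_forall fun z => ?_)
      rcases le_total (g k z) (g₀ z) with h | h
      · simp only [min_eq_left h, abs_of_nonpos (sub_nonpos.2 h)]; ring
      · simp only [min_eq_right h, abs_of_nonneg (sub_nonneg.2 h)]; ring
    simp_rw [e]
    have := (hint.add_const (∫ z, g₀ z ∂μ)).sub (hmin.const_mul 2)
    convert this using 2
    ring
  have hmin2 : Tendsto (fun k => ∫ z, min ‖f k z - f₀ z‖ (2 * g₀ z) ∂μ) atTop (𝓝 0) := by
    have : Tendsto (fun k => ∫ z, min ‖f k z - f₀ z‖ (2 * g₀ z) ∂μ) atTop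
        (𝓝 (∫ z, (0 : ℝ) ∂μ)) := by
      refine tendsto_integral_of_dominated_convergence (fun z => 2 * g₀ z)
        (fun k => (((hif k).sub hif₀).norm.inf (hg₀.const_mul 2)).aestronglyMeasurable)
        (hg₀.const_mul 2) (fun k => ?_) ?_
      · filter_upwards [hf₀le] with z h2
        have := (norm_nonneg _).trans h2
        rw [Real.norm_of_nonneg (by positivity)]
        exact min_le_right _ _
      · filter_upwards [hflim, hf₀le] with z h h2
        have h0 := (norm_nonneg _).trans h2
        have := (tendsto_iff_norm_sub_tendsto_zero.1 h).min (tendsto_const_nhds (x := 2 * g₀ z))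
        rwa [min_eq_left (by positivity)] at this
    simpa using this
  rw [tendsto_iff_norm_sub_tendsto_zero]
  refine squeeze_zero (fun _ => norm_nonneg _) (fun k => ?_)
    (by simpa using hmin2.add hsch)
  rw [← integral_sub (hif k) hif₀]
  refine (norm_integral_le_integral_norm _).trans ?_
  have i1 : Integrable (fun z => min ‖f k z - f₀ z‖ (2 * g₀ z)) μ :=
    ((hif k).sub hif₀).norm.inf (hg₀.const_mul 2)
  have i2 : Integrable (fun z => |g k z - g₀ z|) μ := ((hg k).sub hg₀).abs
  rw [← integral_add i1 i2]
  refine integral_mono_ae ((hif k).sub hif₀).norm (i1.add i2) ?_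
  filter_upwards [hall, hf₀le] with z h1 h2
  have h3 : ‖f k z - f₀ z‖ ≤ g k z + g₀ z := (norm_sub_le _ _).trans (add_le_add (h1 k) h2)
  show ‖f k z - f₀ z‖ ≤ min ‖f k z - f₀ z‖ (2 * g₀ z) + |g k z - g₀ z|
  rcases le_total ‖f k z - f₀ z‖ (2 * g₀ z) with h | h
  · rw [min_eq_left h]; have := abs_nonneg (g k z - g₀ z); linarith
  · rw [min_eq_right h]; have := le_abs_self (g k z - g₀ z); linarith

/-! ### Averages along segments -/

section Segment

variable {E F : Type*} [NormedAddCommGroup E] [NormedSpace ℝ E] [FiniteDimensional ℝ E]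
  [MeasurableSpace E] [BorelSpace E] {μ : Measure E} [μ.IsAddHaarMeasure]
  [NormedAddCommGroup F] [NormedSpace ℝ F]

/-- The average of `X` over the segment from `z` to `z + v`. -/
noncomputable def segAvg (X : E → F) (v z : E) : F := ∫ r in (0 : ℝ)..1, X (z + r • v)

theorem segAvg_eq (X : E → F) (v z : E) :
    segAvg X v z = ∫ r in Ioc (0 : ℝ) 1, X (z + r • v) :=
  intervalIntegral.integral_of_le zero_le_one

instance : IsProbabilityMeasure (volume.restrict (Ioc (0 : ℝ) 1)) := ⟨by simp⟩

theorem sq_lintegral_le {X : Type*} [MeasurableSpace X] {ν : Measure X} [IsProbabilityMeasure ν]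
    {f : X → ℝ≥0∞} (hf : AEMeasurable f ν) : (∫⁻ r, f r ∂ν) ^ 2 ≤ ∫⁻ r, f r ^ 2 ∂ν := by
  have h := ENNReal.lintegral_mul_le_Lp_mul_Lq ν Real.HolderConjugate.two_two hf
    (g := fun _ => 1) aemeasurable_const
  simp only [Pi.mul_apply, mul_one, lintegral_const, measure_univ,
    ENNReal.rpow_ofNat, one_pow, ENNReal.one_rpow] at h
  calc (∫⁻ r, f r ∂ν) ^ 2 ≤ ((∫⁻ r, f r ^ 2 ∂ν) ^ (1 / 2 : ℝ)) ^ 2 := by gcongr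
    _ = _ := by
      rw [← ENNReal.rpow_natCast, ← ENNReal.rpow_mul]; norm_num

theorem measurable_shear (v : E) : Measurable fun p : ℝ × E => p.2 + p.1 • v := by fun_prop

theorem stronglyMeasurable_segAvg {X : E → F} (hX : StronglyMeasurable X) (v : E) :
    StronglyMeasurable (segAvg X v) := by
  have : StronglyMeasurable fun p : E × ℝ => X (p.1 + p.2 • v) :=
    hX.comp_measurable (by fun_prop)
  have h2 := this.integral_prod_right' (ν := volume.restrict (Ioc (0 : ℝ) 1))
  convert h2 using 1
  ext z
  exact segAvg_eq X v z

theorem lintegral_segment {f : E → ℝ≥0∞} (hf : Measurable f) (v : E) :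
    ∫⁻ z, (∫⁻ r in Ioc (0 : ℝ) 1, f (z + r • v)) ∂μ = ∫⁻ z, f z ∂μ := by
  rw [lintegral_lintegral_swap]
  · simp_rw [lintegral_add_right_eq_self (μ := μ) f]
    simp
  · exact (hf.comp (by fun_prop : Measurable fun p : E × ℝ => p.1 + p.2 • v)).aemeasurable

theorem sq_enorm_segAvg_le {X : E → F} (hX : StronglyMeasurable X) (v z : E) :
    ‖segAvg X v z‖ₑ ^ 2 ≤ ∫⁻ r in Ioc (0 : ℝ) 1, ‖X (z + r • v)‖ₑ ^ 2 := by
  rw [segAvg_eq]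
  calc _ ≤ (∫⁻ r in Ioc (0 : ℝ) 1, ‖X (z + r • v)‖ₑ) ^ 2 := by
        gcongr; exact enorm_integral_le_lintegral_enorm _
    _ ≤ _ := sq_lintegral_le
        ((hX.comp_measurable (by fun_prop : Measurable fun r : ℝ => z + r • v)).enorm.aemeasurable)

theorem lintegral_sq_segAvg_le {X : E → F} (hX : StronglyMeasurable X) (v : E) :
    ∫⁻ z, ‖segAvg X v z‖ₑ ^ 2 ∂μ ≤ ∫⁻ z, ‖X z‖ₑ ^ 2 ∂μ :=
  (lintegral_mono fun z => sq_enorm_segAvg_le hX v z).trans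
    (lintegral_segment (f := fun z => ‖X z‖ₑ ^ 2) (hX.enorm.pow_const 2) v).le

theorem ae_integrable_segment {X : E → F} (hX : StronglyMeasurable X)
    (h2 : ∫⁻ z, ‖X z‖ₑ ^ 2 ∂μ < ⊤) (v : E) :
    ∀ᵐ z ∂μ, IntegrableOn (fun r : ℝ => X (z + r • v)) (Ioc 0 1) := by
  have hm : Measurable fun z => ‖X z‖ₑ ^ 2 := hX.enorm.pow_const 2
  have hfin : ∀ᵐ z ∂μ, ∫⁻ r in Ioc (0 : ℝ) 1, ‖X (z + r • v)‖ₑ ^ 2 < ⊤ := by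
    refine ae_lt_top ?_ ((lintegral_segment hm v).trans_lt h2).ne
    exact Measurable.lintegral_prod_right'
      (f := fun p : E × ℝ => ‖X (p.1 + p.2 • v)‖ₑ ^ 2) (hm.comp (by fun_prop))
  filter_upwards [hfin] with z hz
  have hmr : StronglyMeasurable fun r : ℝ => X (z + r • v) :=
    hX.comp_measurable (by fun_prop)
  refine ⟨hmr.aestronglyMeasurable, ?_⟩
  have := sq_lintegral_le (ν := volume.restrict (Ioc (0 : ℝ) 1)) (f := fun r => ‖X (z + r • v)‖ₑ)
    hmr.enorm.aemeasurable
  by_contra hcon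
  rw [hasFiniteIntegral_iff_enorm, not_lt, top_le_iff] at hcon
  rw [hcon] at this
  simp only [ne_eq, OfNat.ofNat_ne_zero, not_false_eq_true, ENNReal.top_pow, top_le_iff] at this
  exact hz.ne this

theorem memLp_two_of_lintegral {X : E → F} (hX : AEStronglyMeasurable X μ)
    (h2 : ∫⁻ z, ‖X z‖ₑ ^ 2 ∂μ < ⊤) : MemLp X 2 μ := by
  refine ⟨hX, ?_⟩
  rw [eLpNorm_lt_top_iff_lintegral_rpow_enorm_lt_top (by norm_num) (by norm_num)]
  simpa using h2

/-- Translations are continuous in `L²`. -/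
theorem tendsto_lintegral_translate {X : E → F} (hX : StronglyMeasurable X)
    (h2 : ∫⁻ z, ‖X z‖ₑ ^ 2 ∂μ < ⊤) :
    Tendsto (fun v => ∫⁻ z, ‖X (z + v) - X z‖ₑ ^ 2 ∂μ) (𝓝 0) (𝓝 0) := by
  have : Fact ((1 : ℝ≥0∞) ≤ 2) := ⟨by norm_num⟩
  have hL := memLp_two_of_lintegral hX.aestronglyMeasurable h2
  let T : C(E, C(E, E)) := ContinuousMap.curry ⟨fun p : E × E => p.2 + p.1, by fun_prop⟩
  have hT : ∀ v, MeasurePreserving (T v) μ μ := fun v => measurePreserving_add_right μ v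
  have hlim : Tendsto (fun v => Lp.compMeasurePreserving (T v) (hT v) (hL.toLp X)) (𝓝 0)
      (𝓝 (Lp.compMeasurePreserving (T 0) (hT 0) (hL.toLp X))) :=
    Filter.Tendsto.compMeasurePreservingLp (p := 2) tendsto_const_nhds (T.continuous.tendsto 0)
      hT (hT 0) (by norm_num)
  rw [tendsto_iff_edist_tendsto_0] at hlim
  have hpow := (ENNReal.continuous_pow 2).tendsto 0 |>.comp hlim
  simp only [ne_eq, OfNat.ofNat_ne_zero, not_false_eq_true, zero_pow] at hpow
  have e : ∀ v, Lp.compMeasurePreserving (T v) (hT v) (hL.toLp X) =ᵐ[μ] fun z => X (z + v) := by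
    intro v
    refine (Lp.coeFn_compMeasurePreserving _ (hT v)).trans ?_
    exact (hT v).quasiMeasurePreserving.ae_eq_comp hL.coeFn_toLp
  refine hpow.congr fun v => ?_
  have e2 : ⇑(Lp.compMeasurePreserving (T v) (hT v) (hL.toLp X)) -
      ⇑(Lp.compMeasurePreserving (T 0) (hT 0) (hL.toLp X)) =ᵐ[μ] fun z => X (z + v) - X z := by
    filter_upwards [e v, e 0] with z h3 h4
    rw [Pi.sub_apply, h3, h4, add_zero]
  simp only [Function.comp_apply]
  rw [Lp.edist_def, eLpNorm_congr_ae e2, eLpNorm_eq_lintegral_rpow_enorm_toReal (by norm_num) (by norm_num)]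
  simp only [ENNReal.toReal_ofNat, ENNReal.rpow_ofNat]
  rw [← ENNReal.rpow_natCast, ← ENNReal.rpow_mul]
  norm_num

/-- Jensen's inequality and Tonelli bound the left side by the average over `r ∈ (0,1]` of the `L²`
distance between `X` and its translate by `r v`. Each of these translations is no longer than `v`.
-/
theorem tendsto_lintegral_segAvg_sub {X : E → F} [CompleteSpace F] (hX : StronglyMeasurable X)
    (h2 : ∫⁻ z, ‖X z‖ₑ ^ 2 ∂μ < ⊤) :
    Tendsto (fun v => ∫⁻ z, ‖segAvg X v z - X z‖ₑ ^ 2 ∂μ) (𝓝 0) (𝓝 0) := by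
  have ht := tendsto_lintegral_translate hX h2
  rw [ENNReal.tendsto_nhds_zero] at ht ⊢
  intro ε hε
  obtain ⟨δ, hδ, hball⟩ := Metric.eventually_nhds_iff_ball.1 (ht ε hε)
  filter_upwards [Metric.ball_mem_nhds (0 : E) hδ] with v hv
  have hm : Measurable fun p : E × ℝ => ‖X (p.1 + p.2 • v) - X p.1‖ₑ ^ 2 := by
    refine StronglyMeasurable.measurable ?_ |>.pow_const 2
    exact (((hX.comp_measurable (by fun_prop : Measurable fun p : E × ℝ => p.1 + p.2 • v)).sub
      (hX.comp_measurable measurable_fst)).enorm).stronglyMeasurable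
  calc ∫⁻ z, ‖segAvg X v z - X z‖ₑ ^ 2 ∂μ
      ≤ ∫⁻ z, (∫⁻ r in Ioc (0 : ℝ) 1, ‖X (z + r • v) - X z‖ₑ ^ 2) ∂μ := by
        refine lintegral_mono_ae ?_
        filter_upwards [ae_integrable_segment hX h2 v] with z hz
        have e1 : segAvg X v z - X z = ∫ r in Ioc (0 : ℝ) 1, (X (z + r • v) - X z) := by
          rw [integral_sub hz (integrable_const _), segAvg_eq]
          simp
        rw [e1]
        calc _ ≤ (∫⁻ r in Ioc (0 : ℝ) 1, ‖X (z + r • v) - X z‖ₑ) ^ 2 := by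
              gcongr; exact enorm_integral_le_lintegral_enorm _
          _ ≤ _ := sq_lintegral_le (hz.sub (integrable_const _)).aestronglyMeasurable.enorm
    _ = ∫⁻ r in Ioc (0 : ℝ) 1, (∫⁻ z, ‖X (z + r • v) - X z‖ₑ ^ 2 ∂μ) :=
        lintegral_lintegral_swap hm.aemeasurable
    _ ≤ ∫⁻ _ in Ioc (0 : ℝ) 1, ε := by
        refine setLIntegral_mono' measurableSet_Ioc fun r hr => hball _ ?_
        rw [mem_ball_zero_iff] at hv ⊢
        rw [norm_smul, Real.norm_of_nonneg hr.1.le]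
        nlinarith [hr.1, hr.2, norm_nonneg v]
    _ = ε := by simp

theorem integrable_segment {X : E → F} (hX : StronglyMeasurable X) (hi : Integrable X μ) (v : E) :
    Integrable (fun p : ℝ × E => X (p.2 + p.1 • v))
      ((volume.restrict (Ioc (0 : ℝ) 1)).prod μ) := by
  have hm : StronglyMeasurable fun p : ℝ × E => X (p.2 + p.1 • v) :=
    hX.comp_measurable (measurable_shear v)
  rw [integrable_prod_iff hm.aestronglyMeasurable]
  refine ⟨Eventually.of_forall fun r => hi.comp_add_right (r • v), ?_⟩
  have : ∀ r : ℝ, ∫ z, ‖X (z + r • v)‖ ∂μ = ∫ z, ‖X z‖ ∂μ := fun r =>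
    integral_add_right_eq_self (μ := μ) (fun z => ‖X z‖) (r • v)
  simp only [this]
  exact integrable_const _

theorem integrable_segAvg {X : E → F} (hX : StronglyMeasurable X) (hi : Integrable X μ) (v : E) :
    Integrable (segAvg X v) μ := by
  have := (integrable_segment hX hi v).integral_prod_right
  exact this.congr (Eventually.of_forall fun z => (segAvg_eq X v z).symm)

end Segment

end

/-! ### Weak directional derivatives and the fundamental theorem of calculus. -/

section
section WeakSegment

variable {E F : Type*} [NormedAddCommGroup E] [NormedSpace ℝ E] [FiniteDimensional ℝ E]
  [MeasurableSpace E] [BorelSpace E] {μ : Measure E} [μ.IsAddHaarMeasure]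
  [NormedAddCommGroup F] [NormedSpace ℝ F] [CompleteSpace F]

/-- Compactly supported smooth functions on `D`, in an arbitrary finite-dimensional space. -/
def IsTestFn (D : Set E) (θ : E → ℝ) : Prop :=
  ContDiff ℝ ∞ θ ∧ HasCompactSupport θ ∧ tsupport θ ⊆ D

/-- `w` is the weak derivative of `g` on `D` in the direction `v`. -/
def HasWeakDirDeriv (μ : Measure E) (D : Set E) (v : E) (g w : E → F) : Prop :=
  ∀ θ : E → ℝ, IsTestFn D θ → ∫ z, (fderiv ℝ θ z v) • g z ∂μ = - ∫ z, θ z • w z ∂μ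

theorem IsTestFn.mono {D D' : Set E} {θ : E → ℝ} (h : IsTestFn D θ) (hD : D ⊆ D') :
    IsTestFn D' θ := ⟨h.1, h.2.1, h.2.2.trans hD⟩

theorem tsupport_comp_sub {G : Type*} [Zero G] (θ : E → G) (a : E) :
    tsupport (fun z => θ (z - a)) = (fun z => z - a) ⁻¹' tsupport θ :=
  tsupport_comp_eq_preimage θ (Homeomorph.subRight a)

theorem hasCompactSupport_comp_sub {G : Type*} [Zero G] {θ : E → G} (h : HasCompactSupport θ)
    (a : E) : HasCompactSupport fun z => θ (z - a) :=
  h.comp_homeomorph (Homeomorph.subRight a)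

theorem IsTestFn.comp_sub {D D' : Set E} {θ : E → ℝ} (h : IsTestFn D θ) {a : E}
    (hD : ∀ z ∈ D, z + a ∈ D') : IsTestFn D' fun z => θ (z - a) := by
  refine ⟨h.1.comp (contDiff_id.sub contDiff_const), hasCompactSupport_comp_sub h.2.1 a, ?_⟩
  rw [tsupport_comp_sub]
  intro z hz
  simpa using hD _ (h.2.2 hz)

theorem fderiv_comp_sub {G : Type*} [NormedAddCommGroup G] [NormedSpace ℝ G] (θ : E → G)
    (a z : E) : fderiv ℝ (fun z => θ (z - a)) z = fderiv ℝ θ (z - a) := by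
  simpa only [sub_eq_add_neg] using fderiv_comp_add_right (𝕜 := ℝ) (f := θ) (x := z) (-a)

theorem fderiv_eq_zero_of_notMem_tsupport {G : Type*} [NormedAddCommGroup G] [NormedSpace ℝ G]
    {θ : E → G} {z : E} (hz : z ∉ tsupport θ) : fderiv ℝ θ z = 0 := by
  have := support_fderiv_subset ℝ (f := θ)
  by_contra h
  exact hz (this h)

theorem HasWeakDirDeriv.smul {D : Set E} {v : E} {g w : E → F} (h : HasWeakDirDeriv μ D v g w)
    (c : ℝ) : HasWeakDirDeriv μ D (c • v) g (fun z => c • w z) := by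
  intro θ hθ
  have := h θ hθ
  simp only [map_smul, smul_eq_mul, mul_smul, smul_comm _ c, integral_smul]
  rw [this, smul_neg]

/-- Exchange of the weak derivative with translations, in the form needed for segments. -/
theorem integral_sub_translate_eq {U : Set E} {v : E} {g w : E → F}
    (hwm : StronglyMeasurable w)
    (hg : Integrable g μ) (hw : Integrable w μ)
    (hweak : ∀ θ, IsTestFn U θ → ∀ r ∈ Icc (0 : ℝ) 1,
      ∫ z, (fderiv ℝ θ (z - r • v) v) • g z ∂μ = - ∫ z, θ (z - r • v) • w z ∂μ)
    {θ : E → ℝ} (hθ : IsTestFn U θ) :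
    ∫ z, θ z • (g (z + v) - g z) ∂μ = ∫ z, θ z • segAvg w v z ∂μ := by
  have hc : Continuous θ := hθ.1.continuous
  have hd : Continuous (fderiv ℝ θ) := hθ.1.continuous_fderiv (by norm_num)
  obtain ⟨M, hM⟩ := hθ.2.1.exists_bound_of_continuous hc
  obtain ⟨M', hM'⟩ := (hθ.2.1.fderiv ℝ).exists_bound_of_continuous hd
  have hdv : Continuous fun p : ℝ × E => fderiv ℝ θ (p.2 - p.1 • v) v :=
    (hd.comp (by fun_prop)).clm_apply continuous_const
  have i1 : Integrable (fun z => θ z • g (z + v)) μ :=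
    (hg.comp_add_right v).bdd_smul M hc.aestronglyMeasurable (Eventually.of_forall hM)
  have i2 : Integrable (fun z => θ z • g z) μ :=
    hg.bdd_smul M hc.aestronglyMeasurable (Eventually.of_forall hM)
  have i3 : Integrable (fun z => θ (z - v) • g z) μ :=
    hg.bdd_smul M (hc.comp (by fun_prop)).aestronglyMeasurable
      (Eventually.of_forall fun z => hM _)
  have e1 : ∫ z, θ z • (g (z + v) - g z) ∂μ = ∫ z, (θ (z - v) - θ z) • g z ∂μ := by
    have : ∫ z, θ z • g (z + v) ∂μ = ∫ z, θ (z - v) • g z ∂μ := by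
      rw [← integral_add_right_eq_self (μ := μ) (fun z => θ (z - v) • g z) v]
      simp
    simp only [smul_sub, sub_smul]
    rw [integral_sub i1 i2, this, integral_sub i3 i2]
  -- The difference falls on the test function, where the classical fundamental theorem applies. For
  -- each `r` the translate of `θ` by `r v` is again a test function, so the derivative can be moved
  -- back to `w`.
  have e2 : ∀ z, θ (z - v) - θ z = ∫ r in (0 : ℝ)..1, - fderiv ℝ θ (z - r • v) v := by
    intro z
    have hder : ∀ r ∈ uIcc (0 : ℝ) 1,
        HasDerivAt (fun r : ℝ => θ (z - r • v)) (- fderiv ℝ θ (z - r • v) v) r := by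
      intro r _
      have h1 : HasDerivAt (fun r : ℝ => z - r • v) (-v) r := by
        simpa using ((hasDerivAt_id r).smul_const v).const_sub z
      have h2 : HasFDerivAt θ (fderiv ℝ θ (z - r • v)) (z - r • v) :=
        (hθ.1.differentiable (by norm_num) _).hasFDerivAt
      have h3 := h2.comp_hasDerivAt r h1
      rw [map_neg] at h3
      exact h3
    rw [intervalIntegral.integral_eq_sub_of_hasDerivAt hder]
    · simp
    · exact ((hdv.comp (by fun_prop : Continuous fun r : ℝ => (r, z))).neg).intervalIntegrable _ _
  have i4 : Integrable (fun p : ℝ × E => (fderiv ℝ θ (p.2 - p.1 • v) v) • g p.2)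
      ((volume.restrict (Ioc (0 : ℝ) 1)).prod μ) := by
    refine (hg.comp_snd _).bdd_smul (M' * ‖v‖) hdv.aestronglyMeasurable
      (Eventually.of_forall fun p => ?_)
    exact (ContinuousLinearMap.le_opNorm _ _).trans (by gcongr; exact hM' _)
  have i5 : Integrable (fun p : ℝ × E => θ p.2 • w (p.2 + p.1 • v))
      ((volume.restrict (Ioc (0 : ℝ) 1)).prod μ) := by
    refine (integrable_segment hwm hw v).bdd_smul M (hc.comp continuous_snd).aestronglyMeasurable
      (Eventually.of_forall fun p => hM _)
  calc ∫ z, θ z • (g (z + v) - g z) ∂μ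
      = ∫ z, (∫ r in Ioc (0 : ℝ) 1, - ((fderiv ℝ θ (z - r • v) v) • g z)) ∂μ := by
        rw [e1]
        refine integral_congr_ae (Eventually.of_forall fun z => ?_)
        simp only [e2 z, intervalIntegral.integral_of_le zero_le_one]
        rw [← integral_smul_const]
        simp
    _ = ∫ r in Ioc (0 : ℝ) 1, (∫ z, - ((fderiv ℝ θ (z - r • v) v) • g z) ∂μ) :=
        (integral_integral_swap (f := fun r z => - ((fderiv ℝ θ (z - r • v) v) • g z)) i4.neg).symm
    _ = ∫ r in Ioc (0 : ℝ) 1, (∫ z, θ z • w (z + r • v) ∂μ) := by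
        refine setIntegral_congr_fun measurableSet_Ioc fun r hr => ?_
        rw [integral_neg, hweak θ hθ r ⟨hr.1.le, hr.2⟩, neg_neg,
          ← integral_add_right_eq_self (μ := μ) (fun z => θ (z - r • v) • w z) (r • v)]
        simp
    _ = ∫ z, (∫ r in Ioc (0 : ℝ) 1, θ z • w (z + r • v)) ∂μ :=
        integral_integral_swap (f := fun r z => θ z • w (z + r • v)) i5
    _ = ∫ z, θ z • segAvg w v z ∂μ := by
        refine integral_congr_ae (Eventually.of_forall fun z => ?_)
        simp only
        rw [segAvg_eq, integral_smul]

/-- The fundamental theorem of calculus for weak derivatives. -/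
theorem HasWeakDirDeriv.ae_sub_eq_segAvg {D K U : Set E} {v : E} {g w : E → F}
    (h : HasWeakDirDeriv μ D v g w) (hwm : StronglyMeasurable w)
    (hg : LocallyIntegrableOn g D μ) (hw : LocallyIntegrableOn w D μ)
    (hK : IsCompact K) (hKD : K ⊆ D) (hU : IsOpen U)
    (hseg : ∀ z ∈ U, ∀ r ∈ Icc (0 : ℝ) 1, z + r • v ∈ K) :
    ∀ᵐ z ∂μ, z ∈ U → g (z + v) - g z = segAvg (K.indicator w) v z := by
  have hKm : MeasurableSet K := hK.measurableSet
  have hg' : Integrable (K.indicator g) μ :=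
    (integrable_indicator_iff hKm).2 (hg.integrableOn_compact_subset hKD hK)
  have hw' : Integrable (K.indicator w) μ :=
    (integrable_indicator_iff hKm).2 (hw.integrableOn_compact_subset hKD hK)
  have hwm' := hwm.indicator hKm
  have hweak : ∀ θ, IsTestFn U θ → ∀ r ∈ Icc (0 : ℝ) 1,
      ∫ z, (fderiv ℝ θ (z - r • v) v) • K.indicator g z ∂μ
        = - ∫ z, θ (z - r • v) • K.indicator w z ∂μ := by
    intro θ hθ r hr
    have hθr := hθ.comp_sub (a := r • v) (fun z hz => hseg z hz r hr)
    have := h _ (hθr.mono hKD)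
    simp only [fderiv_comp_sub] at this
    have hz' : ∀ z, z ∉ K → z ∉ tsupport (fun z => θ (z - r • v)) := fun z hz h =>
      hz (hθr.2.2 h)
    have e1 : ∀ z, (fderiv ℝ θ (z - r • v) v) • K.indicator g z
        = (fderiv ℝ θ (z - r • v) v) • g z := by
      intro z
      by_cases hz : z ∈ K
      · rw [indicator_of_mem hz]
      · have h0 : fderiv ℝ (fun z => θ (z - r • v)) z = 0 :=
          fderiv_eq_zero_of_notMem_tsupport (hz' z hz)
        rw [fderiv_comp_sub] at h0
        rw [h0]; simp
    have e2 : ∀ z, θ (z - r • v) • K.indicator w z = θ (z - r • v) • w z := by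
      intro z
      by_cases hz : z ∈ K
      · rw [indicator_of_mem hz]
      · have h0 : θ (z - r • v) = 0 :=
          image_eq_zero_of_notMem_tsupport (f := fun z => θ (z - r • v)) (hz' z hz)
        rw [h0]; simp
    simp only [e1, e2]
    exact this
  have hi : Integrable (fun z => K.indicator g (z + v) - K.indicator g z
      - segAvg (K.indicator w) v z) μ :=
    ((hg'.comp_add_right v).sub hg').sub (integrable_segAvg hwm' hw' v)
  -- Both sides have equal integrals against every test function on `U`, so the fundamental lemma of
  -- the calculus of variations gives equality almost everywhere. Cutting off by `K` makes all
  -- functions globally integrable without changing anything on the segments.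
  have := hU.ae_eq_zero_of_integral_contDiff_smul_eq_zero
    (hi.locallyIntegrable.locallyIntegrableOn U) (fun θ h1 h2 h3 => by
      have hθ : IsTestFn U θ := ⟨h1, h2, h3⟩
      obtain ⟨M, hM⟩ := h2.exists_bound_of_continuous h1.continuous
      simp only [smul_sub]
      simp only [← smul_sub (θ _) (K.indicator g _)]
      rw [integral_sub, integral_sub_translate_eq hwm' hg' hw' hweak hθ, sub_self]
      · exact ((hg'.comp_add_right v).sub hg').bdd_smul M h1.continuous.aestronglyMeasurable
          (Eventually.of_forall hM)
      · exact (integrable_segAvg hwm' hw' v).bdd_smul M h1.continuous.aestronglyMeasurable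
          (Eventually.of_forall hM))
  filter_upwards [this] with z hz hzU
  have hz0 := hseg z hzU 0 (by simp)
  have hz1 := hseg z hzU 1 (by simp)
  rw [zero_smul, add_zero] at hz0
  rw [one_smul] at hz1
  have := hz hzU
  rw [indicator_of_mem hz0, indicator_of_mem hz1] at this
  exact sub_eq_zero.1 this

end WeakSegment

end

/-! ### The renormalized energy identity for smooth fields; mollification. -/

section
section Renormalized

variable {E F : Type*} [NormedAddCommGroup E] [NormedSpace ℝ E] [FiniteDimensional ℝ E]
  [MeasurableSpace E] [BorelSpace E] {μ : Measure E} [μ.IsAddHaarMeasure]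
  [NormedAddCommGroup F] [InnerProductSpace ℝ F] [CompleteSpace F]

theorem integral_fderiv_apply_eq_zero {P : E → ℝ} (hP : ContDiff ℝ 1 P) (hc : HasCompactSupport P)
    (v : E) : ∫ z, fderiv ℝ P z v ∂μ = 0 := by
  have hd : Continuous fun z => fderiv ℝ P z v :=
    (hP.continuous_fderiv (by norm_num)).clm_apply continuous_const
  have hdc : HasCompactSupport fun z => fderiv ℝ P z v := hc.fderiv_apply ℝ v
  have := integral_bilinear_hasLineDerivAt_right_eq_neg_left_of_integrable (μ := μ)
    (f := fun _ : E => (1 : ℝ)) (f' := fun _ => 0) (g := P) (g' := fun z => fderiv ℝ P z v)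
    (v := v) (B := ContinuousLinearMap.mul ℝ ℝ)
    (by simp) (by simpa using hd.integrable_of_hasCompactSupport hdc)
    (by simpa using hP.continuous.integrable_of_hasCompactSupport hc)
    (fun x _ => by simpa using (hasFDerivAt_const (1 : ℝ) x).hasLineDerivAt v)
    (fun x _ => ((hP.differentiable (by norm_num) x).hasFDerivAt).hasLineDerivAt v)
  simpa using this

/-- The integrand in the renormalized energy identity. -/
noncomputable def renormIntegrand {ι : Type*} [Fintype ι] (Γ g : ℝ → ℝ) (ζ : E → ℝ) (τ : E)
    (e : ι → E) (w : E → F) (d b : ι → E → F) (z : E) : ℝ :=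
  1 / 2 * Γ (‖w z‖ ^ 2) * fderiv ℝ ζ z τ
    - ∑ i, inner ℝ (b i z) ((ζ z * g (‖w z‖ ^ 2)) • d i z
        + (ζ z * (2 * deriv g (‖w z‖ ^ 2) * inner ℝ (w z) (d i z))) • w z
        + (fderiv ℝ ζ z (e i) * g (‖w z‖ ^ 2)) • w z)

/-- The integrand is a total divergence, namely `∂_τ (½ Γ(|w|²) ζ) - ∑ᵢ ∂_{eᵢ} ⟨bᵢ, ζ g(|w|²) w⟩`:
the terms in which derivatives fall on `w` in direction `τ` and on `bᵢ` cancel by the equation. The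
equations are needed only on the support of `ζ`. -/
theorem integral_renormIntegrand_smooth {ι : Type*} [Fintype ι] {Γ g : ℝ → ℝ}
    (hΓ : ∀ x, HasDerivAt Γ (g x) x) (hg : ContDiff ℝ 1 g) {ζ : E → ℝ} (hζ : ContDiff ℝ 1 ζ)
    (hζc : HasCompactSupport ζ) {τ : E} {e : ι → E} {w : E → F} {d b : ι → E → F}
    (hw : ContDiff ℝ 1 w) (hb : ∀ i, ContDiff ℝ 1 (b i))
    (hwd : ∀ z ∈ tsupport ζ, ∀ i, fderiv ℝ w z (e i) = d i z)
    (hwτ : ∀ z ∈ tsupport ζ, fderiv ℝ w z τ = ∑ i, fderiv ℝ (b i) z (e i)) :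
    ∫ z, renormIntegrand Γ g ζ τ e w d b z ∂μ = 0 := by
  have hΓ1 : ContDiff ℝ 1 Γ := by
    have hd : deriv Γ = g := funext fun x => (hΓ x).deriv
    exact contDiff_one_iff_deriv.2 ⟨fun x => (hΓ x).differentiableAt, hd ▸ hg.continuous⟩
  have hN : ContDiff ℝ 1 fun z => ‖w z‖ ^ 2 := hw.norm_sq ℝ
  set P : E → ℝ := fun z => 1 / 2 * Γ (‖w z‖ ^ 2) * ζ z with hPdef
  set R : ι → E → ℝ := fun i z => inner ℝ (b i z) ((ζ z * g (‖w z‖ ^ 2)) • w z) with hRdef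
  have hP : ContDiff ℝ 1 P := (contDiff_const.mul (hΓ1.comp hN)).mul hζ
  have hR : ∀ i, ContDiff ℝ 1 (R i) := fun i =>
    (hb i).inner ℝ ((hζ.mul (hg.comp hN)).smul hw)
  have hPs : ∀ z, ζ z = 0 → P z = 0 := fun z hz => by simp [hPdef, hz]
  have hRs : ∀ i z, ζ z = 0 → R i z = 0 := fun i z hz => by simp [hRdef, hz]
  have hPc : HasCompactSupport P := hζc.mono fun z hz h => hz (hPs z h)
  have hRc : ∀ i, HasCompactSupport (R i) := fun i => hζc.mono fun z hz h => hz (hRs i z h)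
  have key : ∀ z, renormIntegrand Γ g ζ τ e w d b z
      = fderiv ℝ P z τ - ∑ i, fderiv ℝ (R i) z (e i) := by
    intro z
    by_cases hz : z ∈ tsupport ζ
    · have dw : HasFDerivAt w (fderiv ℝ w z) z := (hw.differentiable (by norm_num) z).hasFDerivAt
      have dζ : HasFDerivAt ζ (fderiv ℝ ζ z) z := (hζ.differentiable (by norm_num) z).hasFDerivAt
      have dg := (hg.differentiable (by norm_num) (‖w z‖ ^ 2)).hasDerivAt
      have dN := dw.norm_sq
      have dP := ((((hΓ (‖w z‖ ^ 2)).comp_hasFDerivAt z dN).const_mul (1 / 2)).mul dζ).fderiv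
      have dR : ∀ i, HasFDerivAt (R i) _ z := fun i =>
        (((hb i).differentiable (by norm_num) z).hasFDerivAt).inner ℝ
          ((dζ.mul (dg.comp_hasFDerivAt z dN)).smul dw)
      have eP : fderiv ℝ P z = _ := dP
      rw [eP]
      simp only [fun i => (dR i).fderiv, renormIntegrand]
      simp [fderivInnerCLM_apply, innerSL_apply_apply, hwd z hz, hwτ z hz]
      have hi : ∀ x, inner ℝ (fderiv ℝ (b x) z (e x)) ((ζ z * g (‖w z‖ ^ 2)) • w z)
          = ζ z * g (‖w z‖ ^ 2) * inner ℝ (w z) (fderiv ℝ (b x) z (e x)) := fun x => by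
        rw [real_inner_smul_right, real_inner_comm]
      rw [Finset.sum_add_distrib]
      simp only [hi]
      rw [← Finset.mul_sum]
      have hs : ∀ x, inner ℝ (b x z) ((ζ z * g (‖w z‖ ^ 2)) • d x z
            + (ζ z * (2 * deriv g (‖w z‖ ^ 2) * inner ℝ (w z) (d x z))) • w z +
            ((fderiv ℝ ζ z) (e x) * g (‖w z‖ ^ 2)) • w z)
          = inner ℝ (b x z) ((ζ z * g (‖w z‖ ^ 2)) • d x z +
              (ζ z * (deriv g (‖w z‖ ^ 2) * (2 * inner ℝ (w z) (d x z)))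
                + g (‖w z‖ ^ 2) * (fderiv ℝ ζ z) (e x)) • w z) := fun x => by
        simp only [inner_add_right, real_inner_smul_right]; ring
      rw [Finset.sum_congr rfl fun x _ => hs x]
      ring
    · have h1 : z ∉ tsupport P := fun h => hz (closure_mono
        (show Function.support P ⊆ Function.support ζ from fun y hy h' => hy (hPs y h')) h)
      have h2 : ∀ i, z ∉ tsupport (R i) := fun i h =>
        hz (closure_mono (show Function.support (R i) ⊆ Function.support ζ from
          fun y hy h' => hy (hRs i y h')) h)
      simp [renormIntegrand, fderiv_eq_zero_of_notMem_tsupport h1,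
        fun i => fderiv_eq_zero_of_notMem_tsupport (h2 i),
        fderiv_eq_zero_of_notMem_tsupport hz, image_eq_zero_of_notMem_tsupport hz]
  have iP : Integrable (fun z => fderiv ℝ P z τ) μ :=
    ((hP.continuous_fderiv (by norm_num)).clm_apply
      continuous_const).integrable_of_hasCompactSupport (hPc.fderiv_apply ℝ τ)
  have iR : ∀ i, Integrable (fun z => fderiv ℝ (R i) z (e i)) μ := fun i =>
    (((hR i).continuous_fderiv (by norm_num)).clm_apply
      continuous_const).integrable_of_hasCompactSupport ((hRc i).fderiv_apply ℝ (e i))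
  simp only [key]
  rw [integral_sub iP (integrable_finsetSum _ fun i _ => iR i),
    integral_finsetSum _ fun i _ => iR i, integral_fderiv_apply_eq_zero hP hPc]
  simp [fun i => integral_fderiv_apply_eq_zero (μ := μ) (hR i) (hRc i) (e i)]

/-- Mollification. -/
noncomputable def mollify {X : Type*} [NormedAddCommGroup X] [NormedSpace ℝ X]
    (μ : Measure E) (ρ : ContDiffBump (0 : E)) (f : E → X) : E → X :=
  convolution (ρ.normed μ) f (ContinuousLinearMap.lsmul ℝ ℝ) μ

section Mollify

variable {X : Type*} [NormedAddCommGroup X] [NormedSpace ℝ X] {ρ : ContDiffBump (0 : E)}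

theorem mollify_apply (f : E → X) (z : E) :
    mollify μ ρ f z = ∫ y, ρ.normed μ (z - y) • f y ∂μ := by
  rw [mollify, convolution_eq_swap]; rfl

theorem contDiff_mollify {f : E → X} (hf : LocallyIntegrable f μ) [CompleteSpace X] :
    ContDiff ℝ 1 (mollify μ ρ f) :=
  ρ.hasCompactSupport_normed.contDiff_convolution_left (n := 1) _ (ρ.contDiff_normed (n := 1)) hf

theorem integrable_normed_smul {f : E → X} (hf : Integrable f μ) (z : E) :
    Integrable (fun y => ρ.normed μ (z - y) • f y) μ := by
  obtain ⟨M, hM⟩ := ρ.hasCompactSupport_normed.exists_bound_of_continuous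
    (ρ.continuous_normed (μ := μ))
  exact hf.bdd_smul M (ρ.continuous_normed.comp (by fun_prop)).aestronglyMeasurable
    (Eventually.of_forall fun y => hM _)

theorem isTestFn_normed {U : Set E} {z : E} (hz : Metric.closedBall z ρ.rOut ⊆ U) :
    IsTestFn U fun y => ρ.normed μ (z - y) := by
  have e : (fun y => ρ.normed μ (z - y)) = fun y => ρ.normed μ (y - z) := by
    ext y; rw [← ρ.normed_neg, neg_sub]
  rw [e]
  refine ⟨ρ.contDiff_normed.comp (contDiff_id.sub contDiff_const),
    hasCompactSupport_comp_sub ρ.hasCompactSupport_normed z, ?_⟩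
  rw [tsupport_comp_sub, ρ.tsupport_normed_eq]
  intro y hy
  apply hz
  simpa [dist_eq_norm] using hy

theorem fderiv_normed_sub (z y v : E) :
    fderiv ℝ (fun y => ρ.normed μ (z - y)) y v = - fderiv ℝ (ρ.normed μ) (z - y) v := by
  have h1 : HasFDerivAt (ρ.normed μ) (fderiv ℝ (ρ.normed μ) (z - y)) (z - y) :=
    ((ρ.contDiff_normed (n := 1) (μ := μ)).differentiable (by norm_num) _).hasFDerivAt
  have h2 : HasFDerivAt (fun y => z - y) (-(ContinuousLinearMap.id ℝ E)) y :=
    (hasFDerivAt_id y).const_sub z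
  have h3 : HasFDerivAt (fun y => ρ.normed μ (z - y)) _ y := h1.comp y h2
  rw [h3.fderiv]; simp

theorem fderiv_mollify {f : E → X} (hf : LocallyIntegrable f μ) (z v : E) [CompleteSpace X] :
    fderiv ℝ (mollify μ ρ f) z v
      = - ∫ y, (fderiv ℝ (fun y => ρ.normed μ (z - y)) y v) • f y ∂μ := by
  have h := (ρ.hasCompactSupport_normed (μ := μ)).hasFDerivAt_convolution_left
    (ContinuousLinearMap.lsmul ℝ ℝ) (ρ.contDiff_normed (n := 1)) hf z (μ := μ)
  have h' : HasFDerivAt (mollify μ ρ f) _ z := h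
  rw [h'.fderiv, convolution_eq_swap, ← integral_neg]
  have hd : Continuous (fderiv ℝ (ρ.normed μ)) :=
    (ρ.contDiff_normed (n := 1) (μ := μ)).continuous_fderiv (by norm_num)
  have hdc : HasCompactSupport (fderiv ℝ (ρ.normed μ)) := ρ.hasCompactSupport_normed.fderiv ℝ
  have hi := hdc.convolutionExists_left
    ((ContinuousLinearMap.lsmul ℝ ℝ : ℝ →L[ℝ] X →L[ℝ] X).precompL E) hd hf z
  have hi' := hi.integrable_swap
  rw [ContinuousLinearMap.integral_apply hi']
  refine integral_congr_ae (Eventually.of_forall fun y => ?_)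
  simp only [fderiv_normed_sub]
  simp [ContinuousLinearMap.precompL_apply]

/-- The translated kernel is an admissible test function as soon as its ball lies in `U`, so the
weak derivative can be moved from the kernel to `f`. -/
theorem fderiv_mollify_eq_mollify {U : Set E} {v : E} {f g : E → X} [CompleteSpace X]
    (h : HasWeakDirDeriv μ U v f g) (hf : LocallyIntegrable f μ) {z : E}
    (hz : Metric.closedBall z ρ.rOut ⊆ U) :
    fderiv ℝ (mollify μ ρ f) z v = mollify μ ρ g z := by
  rw [fderiv_mollify hf, h _ (isTestFn_normed hz), neg_neg, mollify_apply]

theorem integrable_mollify {f : E → X} (hf : Integrable f μ) : Integrable (mollify μ ρ f) μ :=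
  ρ.integrable_normed.integrable_convolution _ hf

theorem integral_mollify {f : E → X} [CompleteSpace X] (hf : Integrable f μ) :
    ∫ z, mollify μ ρ f z ∂μ = ∫ z, f z ∂μ := by
  have := integral_convolution (ContinuousLinearMap.lsmul ℝ ℝ : ℝ →L[ℝ] X →L[ℝ] X)
    (ρ.integrable_normed (μ := μ)) hf
  refine this.trans ?_
  simp [ρ.integral_normed]

theorem norm_mollify_le (f : E → X) (z : E) :
    ‖mollify μ ρ f z‖ ≤ mollify μ ρ (fun y => ‖f y‖) z := by
  rw [mollify_apply, mollify_apply]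
  refine (norm_integral_le_integral_norm _).trans_eq ?_
  refine integral_congr_ae (Eventually.of_forall fun y => ?_)
  simp only [norm_smul, Real.norm_of_nonneg (ρ.nonneg_normed _), smul_eq_mul]

theorem integral_normed_sub (z : E) : ∫ y, ρ.normed μ (z - y) ∂μ = 1 := by
  rw [integral_sub_left_eq_self (fun y => ρ.normed μ y) μ z, ρ.integral_normed]

theorem mollify_le_of_ae_le {f : E → ℝ} {C : ℝ} {g : E → ℝ} (hf : Integrable f μ)
    (hg : Integrable g μ) (h : ∀ᵐ y ∂μ, f y ≤ g y + C) (z : E) :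
    mollify μ ρ f z ≤ mollify μ ρ g z + C := by
  have i3 : Integrable (fun y => ρ.normed μ (z - y)) μ :=
    (ρ.integrable_normed (μ := μ)).comp_sub_left z
  have e : mollify μ ρ g z + C = ∫ y, ρ.normed μ (z - y) • (g y) + ρ.normed μ (z - y) * C ∂μ := by
    rw [integral_add (integrable_normed_smul hg z) (i3.mul_const C), integral_mul_const,
      integral_normed_sub, mollify_apply, one_mul]
  rw [e, mollify_apply]
  refine integral_mono_ae (integrable_normed_smul hf z)
    ((integrable_normed_smul hg z).add (i3.mul_const C)) ?_
  filter_upwards [h] with y hy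
  have := mul_le_mul_of_nonneg_left hy (ρ.nonneg_normed (μ := μ) (z - y))
  simp only [smul_eq_mul]
  linarith

/-- The two-point bound is averaged in `z` and in `z'` separately. It replaces Hölder's inequality:
no integrability of `a` and `c` in dual spaces is required, and the right side converges in `L¹` as
the radius tends to 0. -/
theorem mollify_mul_mollify_le {Y : Type*} [NormedAddCommGroup Y] [NormedSpace ℝ Y] {a : E → X}
    {c : E → Y} {ε : E → ℝ} (ha : Integrable a μ) (hc : Integrable c μ) (hε : Integrable ε μ)
    (h : ∀ᵐ z ∂μ, ∀ᵐ z' ∂μ, ‖a z‖ * ‖c z'‖ ≤ ε z + ε z') (z : E) :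
    ‖mollify μ ρ a z‖ * ‖mollify μ ρ c z‖ ≤ 2 * mollify μ ρ ε z := by
  have lin : ∀ (f : E → ℝ) (r : ℝ), mollify μ ρ (fun y => r * f y) z = r * mollify μ ρ f z := by
    intro f r
    rw [mollify_apply, mollify_apply, ← integral_const_mul]
    refine integral_congr_ae (Eventually.of_forall fun y => ?_)
    simp only [smul_eq_mul]; ring
  have s1 : ∀ᵐ y ∂μ, mollify μ ρ (fun y => ‖c y‖) z * ‖a y‖ ≤ ε y + mollify μ ρ ε z := by
    filter_upwards [h] with y hy
    have := mollify_le_of_ae_le (ρ := ρ) (hc.norm.const_mul ‖a y‖) hε (C := ε y)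
      (hy.mono fun y' hy' => by linarith) z
    rw [lin] at this
    linarith
  have s2 := mollify_le_of_ae_le (ρ := ρ) (ha.norm.const_mul _) hε s1 z
  rw [lin] at s2
  have n1 := norm_mollify_le (μ := μ) (ρ := ρ) a z
  have n2 := norm_mollify_le (μ := μ) (ρ := ρ) c z
  calc _ ≤ mollify μ ρ (fun y => ‖a y‖) z * mollify μ ρ (fun y => ‖c y‖) z :=
        mul_le_mul n1 n2 (norm_nonneg _) ((norm_nonneg _).trans n1)
    _ ≤ _ := by linarith

end Mollify

end Renormalized

end

/-! ### The renormalized energy identity for weak solutions. -/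

section
section Renormalized

variable {E F : Type*} [NormedAddCommGroup E] [NormedSpace ℝ E] [FiniteDimensional ℝ E]
  [MeasurableSpace E] [BorelSpace E] {μ : Measure E} [μ.IsAddHaarMeasure]
  [NormedAddCommGroup F] [InnerProductSpace ℝ F] [CompleteSpace F]

/-- A sequence of bump functions shrinking to the origin. -/
noncomputable def bumpSeq (E : Type*) [NormedAddCommGroup E] (k : ℕ) :
    ContDiffBump (0 : E) where
  rIn := 1 / (2 * ((k : ℝ) + 1))
  rOut := 1 / ((k : ℝ) + 1)
  rIn_pos := by positivity
  rIn_lt_rOut := by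
    apply one_div_lt_one_div_of_lt <;> linarith [(Nat.cast_nonneg k : (0 : ℝ) ≤ k)]

theorem tendsto_bumpSeq_rOut : Tendsto (fun k => (bumpSeq E k).rOut) atTop (𝓝 0) :=
  tendsto_one_div_add_atTop_nhds_zero_nat

theorem ae_tendsto_mollify {X : Type*} [NormedAddCommGroup X] [NormedSpace ℝ X] [CompleteSpace X]
    {f : E → X} (hf : LocallyIntegrable f μ) :
    ∀ᵐ z ∂μ, Tendsto (fun k => mollify μ (bumpSeq E k) f z) atTop (𝓝 (f z)) := by
  refine ContDiffBump.ae_convolution_tendsto_right_of_locallyIntegrable (K := 2)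
    tendsto_bumpSeq_rOut (Eventually.of_forall fun k => le_of_eq ?_) hf
  simp only [bumpSeq]
  field_simp

/-- Boundedness of `g` and of `x g'(x)` suffices to bound the integrand by the products `|w||w|`,
`|b||d|` and `|b||w|`: in the term with `g'` two factors `|w|` are available to pair with
`g'(|w|²)`. -/
theorem abs_renormIntegrand_le {ι : Type*} [Fintype ι] {Γ g : ℝ → ℝ} {ζ : E → ℝ} {τ : E}
    {e : ι → E} {w : E → F} {d b : ι → E → F} {M B : ℝ} {z : E}
    (hΓM : ∀ x, 0 ≤ x → |Γ x| ≤ M * x)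
    (hM : ∀ x, 0 ≤ x → |g x| ≤ M) (hM' : ∀ x, 0 ≤ x → |deriv g x * x| ≤ M)
    (hB : |ζ z| ≤ B) (hBτ : |fderiv ℝ ζ z τ| ≤ B) (hBe : ∀ i, |fderiv ℝ ζ z (e i)| ≤ B) :
    |renormIntegrand Γ g ζ τ e w d b z|
      ≤ B * M * (‖w z‖ * ‖w z‖ + ∑ i, (3 * (‖b i z‖ * ‖d i z‖) + ‖b i z‖ * ‖w z‖)) := by
  have hB0 : 0 ≤ B := (abs_nonneg _).trans hB
  have hx : 0 ≤ ‖w z‖ ^ 2 := sq_nonneg _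
  have hM0 : 0 ≤ M := (abs_nonneg _).trans (hM _ hx)
  have hi : ∀ i, |(inner ℝ (b i z) ((ζ z * g (‖w z‖ ^ 2)) • d i z
        + (ζ z * (2 * deriv g (‖w z‖ ^ 2) * inner ℝ (w z) (d i z))) • w z
        + (fderiv ℝ ζ z (e i) * g (‖w z‖ ^ 2)) • w z) : ℝ)|
      ≤ B * M * (3 * (‖b i z‖ * ‖d i z‖) + ‖b i z‖ * ‖w z‖) := by
    intro i
    refine (abs_real_inner_le_norm _ _).trans ?_
    have h1 : ‖(ζ z * g (‖w z‖ ^ 2)) • d i z‖ ≤ B * M * ‖d i z‖ := by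
      rw [norm_smul, norm_mul]
      gcongr
      · exact hB
      · exact hM _ hx
    have h2 : ‖(ζ z * (2 * deriv g (‖w z‖ ^ 2) * inner ℝ (w z) (d i z))) • w z‖
        ≤ 2 * (B * M * ‖d i z‖) := by
      have h3 := hM' _ hx
      have h4 := abs_real_inner_le_norm (w z) (d i z)
      rw [abs_mul, abs_of_nonneg hx] at h3
      simp only [norm_smul, norm_mul, Real.norm_eq_abs, abs_two]
      calc |ζ z| * (2 * |deriv g (‖w z‖ ^ 2)| * |inner ℝ (w z) (d i z)|) * ‖w z‖
          ≤ B * (2 * |deriv g (‖w z‖ ^ 2)| * (‖w z‖ * ‖d i z‖)) * ‖w z‖ := by gcongr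
        _ = 2 * (B * (|deriv g (‖w z‖ ^ 2)| * ‖w z‖ ^ 2) * ‖d i z‖) := by ring
        _ ≤ _ := by gcongr
    have h3 : ‖(fderiv ℝ ζ z (e i) * g (‖w z‖ ^ 2)) • w z‖ ≤ B * M * ‖w z‖ := by
      rw [norm_smul, norm_mul]
      gcongr
      · exact hBe i
      · exact hM _ hx
    calc _ ≤ ‖b i z‖ * (B * M * ‖d i z‖ + 2 * (B * M * ‖d i z‖) + B * M * ‖w z‖) := by
          gcongr
          exact (norm_add₃_le).trans (add_le_add_three h1 h2 h3)
      _ = _ := by ring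
  have hP : |1 / 2 * Γ (‖w z‖ ^ 2) * fderiv ℝ ζ z τ| ≤ B * M * (‖w z‖ * ‖w z‖) := by
    rw [abs_mul, abs_mul]
    have := hΓM _ hx
    calc |(1 / 2 : ℝ)| * |Γ (‖w z‖ ^ 2)| * |fderiv ℝ ζ z τ|
        ≤ 1 * (M * ‖w z‖ ^ 2) * B := by
          gcongr
          rw [abs_of_pos (by norm_num)]; norm_num
      _ = _ := by ring
  rw [renormIntegrand]
  refine (abs_sub _ _).trans ?_
  rw [mul_add, Finset.mul_sum]
  exact add_le_add hP ((Finset.abs_sum_le_sum_abs _ _).trans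
    (Finset.sum_le_sum fun i _ => hi i))

theorem abs_le_mul_of_hasDerivAt {Γ g : ℝ → ℝ} (hΓ : ∀ x, HasDerivAt Γ (g x) x) (hΓ0 : Γ 0 = 0)
    {M : ℝ} (hM : ∀ x, 0 ≤ x → |g x| ≤ M) {x : ℝ} (hx : 0 ≤ x) : |Γ x| ≤ M * x := by
  have := (convex_Ici (0 : ℝ)).norm_image_sub_le_of_norm_hasDerivWithin_le
    (fun y _ => (hΓ y).hasDerivWithinAt) (C := M) (fun y hy => hM y hy) (self_mem_Ici) hx
  simpa [hΓ0, abs_of_nonneg hx] using this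

theorem tendsto_renormIntegrand {ι α : Type*} [Fintype ι] {l : Filter α} {Γ g : ℝ → ℝ}
    (hΓ : Continuous Γ) (hg : ContDiff ℝ 1 g)
    {ζ : E → ℝ} {τ : E} {e : ι → E} {w : α → E → F} {d b : α → ι → E → F} {w₀ : E → F}
    {d₀ b₀ : ι → E → F} {z : E} (hw : Tendsto (fun k => w k z) l (𝓝 (w₀ z)))
    (hd : ∀ i, Tendsto (fun k => d k i z) l (𝓝 (d₀ i z)))
    (hb : ∀ i, Tendsto (fun k => b k i z) l (𝓝 (b₀ i z))) :
    Tendsto (fun k => renormIntegrand Γ g ζ τ e (w k) (d k) (b k) z) l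
      (𝓝 (renormIntegrand Γ g ζ τ e w₀ d₀ b₀ z)) := by
  have hN : Tendsto (fun k => ‖w k z‖ ^ 2) l (𝓝 (‖w₀ z‖ ^ 2)) := hw.norm.pow 2
  have h1 := (hΓ.tendsto _).comp hN
  have h2 := (hg.continuous.tendsto _).comp hN
  have h3 := ((hg.continuous_deriv le_rfl).tendsto _).comp hN
  unfold renormIntegrand
  refine ((h1.const_mul _).mul_const _).sub (tendsto_finsetSum _ fun i _ => (hb i).inner ?_)
  exact (((h2.const_mul _).smul (hd i)).add
    ((((h3.const_mul 2).mul (hw.inner (hd i))).const_mul _).smul hw)).add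
    ((h2.const_mul _).smul hw)

theorem aestronglyMeasurable_renormIntegrand {ι : Type*} [Fintype ι] {Γ g : ℝ → ℝ}
    (hΓ : Continuous Γ) (hg : ContDiff ℝ 1 g)
    {ζ : E → ℝ} (hζ : ContDiff ℝ 1 ζ) {τ : E} {e : ι → E} {w : E → F} {d b : ι → E → F}
    (hw : AEStronglyMeasurable w μ) (hd : ∀ i, AEStronglyMeasurable (d i) μ)
    (hb : ∀ i, AEStronglyMeasurable (b i) μ) :
    AEStronglyMeasurable (renormIntegrand Γ g ζ τ e w d b) μ := by
  have hN : AEStronglyMeasurable (fun z => ‖w z‖ ^ 2) μ := hw.norm.pow 2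
  have h1 := hΓ.comp_aestronglyMeasurable hN
  have h2 := hg.continuous.comp_aestronglyMeasurable hN
  have h3 := (hg.continuous_deriv le_rfl).comp_aestronglyMeasurable hN
  have hζm : AEStronglyMeasurable ζ μ := hζ.continuous.aestronglyMeasurable
  have hζd : ∀ v, AEStronglyMeasurable (fun z => fderiv ℝ ζ z v) μ := fun v =>
    ((hζ.continuous_fderiv (by norm_num)).clm_apply continuous_const).aestronglyMeasurable
  refine ((h1.const_mul _).mul (hζd τ)).sub
    (Finset.aestronglyMeasurable_fun_sum _ fun i _ => (hb i).inner ?_)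
  exact (((hζm.mul h2).smul (hd i)).add
    ((hζm.mul ((h3.const_mul 2).mul (hw.inner (hd i)))).smul hw)).add
    (((hζd (e i)).mul h2).smul hw)

theorem exists_bound_test {ι : Type*} [Fintype ι] {ζ : E → ℝ} (hζ : ContDiff ℝ 1 ζ)
    (hζc : HasCompactSupport ζ) (τ : E) (e : ι → E) :
    ∃ B : ℝ, ∀ z, |ζ z| ≤ B ∧ |fderiv ℝ ζ z τ| ≤ B ∧ ∀ i, |fderiv ℝ ζ z (e i)| ≤ B := by
  obtain ⟨B1, h1⟩ := hζc.exists_bound_of_continuous hζ.continuous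
  obtain ⟨B2, h2⟩ := (hζc.fderiv ℝ).exists_bound_of_continuous
    (hζ.continuous_fderiv (by norm_num))
  have p1 : 0 ≤ B1 := (norm_nonneg _).trans (h1 0)
  have p2 : 0 ≤ B2 := (norm_nonneg _).trans (h2 0)
  have hs : ∀ i, ‖e i‖ ≤ ∑ i, ‖e i‖ := fun i =>
    Finset.single_le_sum (f := fun i => ‖e i‖) (fun j _ => norm_nonneg _) (Finset.mem_univ i)
  have p3 : 0 ≤ ∑ i, ‖e i‖ := Finset.sum_nonneg fun i _ => norm_nonneg _
  refine ⟨B1 + B2 * (‖τ‖ + ∑ i, ‖e i‖), fun z => ⟨?_, ?_, fun i => ?_⟩⟩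
  · refine (h1 z).trans (le_add_of_nonneg_right (by positivity))
  · refine ((fderiv ℝ ζ z).le_opNorm τ).trans ?_
    calc _ ≤ B2 * ‖τ‖ := by gcongr; exact h2 z
      _ ≤ B2 * (‖τ‖ + ∑ i, ‖e i‖) := by gcongr; linarith
      _ ≤ _ := by linarith
  · refine ((fderiv ℝ ζ z).le_opNorm (e i)).trans ?_
    calc _ ≤ B2 * ‖e i‖ := by gcongr; exact h2 z
      _ ≤ B2 * (‖τ‖ + ∑ i, ‖e i‖) := by gcongr; linarith [hs i, norm_nonneg τ]
      _ ≤ _ := by linarith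

/-- Mollified fields satisfy the equations classically near the support of `ζ`, so the smooth
identity applies to them. The two-point bounds dominate the integrands by multiples of the
mollifications of `ε`, whose integrals are constant, and dominated convergence with varying bounds
passes to the limit. -/
theorem integral_renormIntegrand {ι : Type*} [Fintype ι] {U : Set E} (hU : IsOpen U)
    {τ : E} {e : ι → E} {w : E → F} {d b : ι → E → F} {ε : E → ℝ} (hw : Integrable w μ)
    (hd : ∀ i, Integrable (d i) μ) (hb : ∀ i, Integrable (b i) μ) (hε : Integrable ε μ)
    (hwd : ∀ i, HasWeakDirDeriv μ U (e i) w (d i))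
    (heq : ∀ θ, IsTestFn U θ →
      ∫ z, (fderiv ℝ θ z τ) • w z ∂μ = ∑ i, ∫ z, (fderiv ℝ θ z (e i)) • b i z ∂μ)
    (hww : ∀ᵐ z ∂μ, ∀ᵐ z' ∂μ, ‖w z‖ * ‖w z'‖ ≤ ε z + ε z')
    (hbw : ∀ i, ∀ᵐ z ∂μ, ∀ᵐ z' ∂μ, ‖b i z‖ * ‖w z'‖ ≤ ε z + ε z')
    (hbd : ∀ i, ∀ᵐ z ∂μ, ∀ᵐ z' ∂μ, ‖b i z‖ * ‖d i z'‖ ≤ ε z + ε z')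
    {Γ g : ℝ → ℝ} (hΓ : ∀ x, HasDerivAt Γ (g x) x) (hΓ0 : Γ 0 = 0) (hg : ContDiff ℝ 1 g)
    {M : ℝ} (hM : ∀ x, 0 ≤ x → |g x| ≤ M) (hM' : ∀ x, 0 ≤ x → |deriv g x * x| ≤ M)
    {ζ : E → ℝ} (hζ : ContDiff ℝ 1 ζ) (hζc : HasCompactSupport ζ) (hζU : tsupport ζ ⊆ U) :
    Integrable (renormIntegrand Γ g ζ τ e w d b) μ ∧
      ∫ z, renormIntegrand Γ g ζ τ e w d b z ∂μ = 0 := by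
  have hΓc : Continuous Γ := continuous_iff_continuousAt.2 fun x => (hΓ x).continuousAt
  have hΓM : ∀ x, 0 ≤ x → |Γ x| ≤ M * x := fun x hx => abs_le_mul_of_hasDerivAt hΓ hΓ0 hM hx
  have hM0 : 0 ≤ M := (abs_nonneg _).trans (hM 0 le_rfl)
  obtain ⟨B, hB⟩ := exists_bound_test hζ hζc τ e
  have hB0 : 0 ≤ B := (abs_nonneg _).trans (hB 0).1
  set S : ℕ → E → ℝ := fun k => renormIntegrand Γ g ζ τ e (mollify μ (bumpSeq E k) w)
    (fun i => mollify μ (bumpSeq E k) (d i)) (fun i => mollify μ (bumpSeq E k) (b i)) with hS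
  -- Each product of mollifications costs `2 ε`: one product `|w||w|` gives 2, and for each `i` the
  -- combination `3 |b||d| + |b||w|` gives 8.
  set L : ℝ := B * M * (2 + ∑ _i : ι, 8) with hL
  have hint : ∀ᶠ k in atTop, ∫ z, S k z ∂μ = 0 := by
    obtain ⟨δ, hδ, hδU⟩ := hζc.isCompact.exists_cthickening_subset_open hU hζU
    filter_upwards [(tendsto_bumpSeq_rOut (E := E)).eventually (eventually_lt_nhds hδ)] with k hk
    have hball : ∀ z ∈ tsupport ζ, Metric.closedBall z (bumpSeq E k).rOut ⊆ U := by
      intro z hz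
      exact ((Metric.closedBall_subset_closedBall hk.le).trans
        (Metric.closedBall_subset_cthickening hz δ)).trans hδU
    refine integral_renormIntegrand_smooth hΓ hg hζ hζc (contDiff_mollify hw.locallyIntegrable)
      (fun i => contDiff_mollify (hb i).locallyIntegrable) (fun z hz i => ?_) (fun z hz => ?_)
    · exact fderiv_mollify_eq_mollify (hwd i) hw.locallyIntegrable (hball z hz)
    · rw [fderiv_mollify hw.locallyIntegrable, heq _ (isTestFn_normed (hball z hz)),
        ← Finset.sum_neg_distrib]
      exact Finset.sum_congr rfl fun i _ => (fderiv_mollify (hb i).locallyIntegrable z (e i)).symm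
  have hbound : ∀ k z, ‖S k z‖ ≤ L * mollify μ (bumpSeq E k) ε z := by
    intro k z
    refine (abs_renormIntegrand_le hΓM hM hM' (hB z).1 (hB z).2.1 (hB z).2.2).trans ?_
    have b1 := mollify_mul_mollify_le (ρ := bumpSeq E k) hw hw hε hww z
    have b2 := fun i => mollify_mul_mollify_le (ρ := bumpSeq E k) (hb i) hw hε (hbw i) z
    have b3 := fun i => mollify_mul_mollify_le (ρ := bumpSeq E k) (hb i) (hd i) hε (hbd i) z
    rw [hL, mul_assoc (B * M)]
    refine mul_le_mul_of_nonneg_left ?_ (mul_nonneg hB0 hM0)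
    rw [add_mul, Finset.sum_mul]
    refine add_le_add b1 (Finset.sum_le_sum fun i _ => ?_)
    linarith [b2 i, b3 i]
  have haew := ae_tendsto_mollify hw.locallyIntegrable
  have haed : ∀ᵐ z ∂μ, ∀ i, Tendsto (fun k => mollify μ (bumpSeq E k) (d i) z) atTop
      (𝓝 (d i z)) := ae_all_iff.2 fun i => ae_tendsto_mollify (hd i).locallyIntegrable
  have haeb : ∀ᵐ z ∂μ, ∀ i, Tendsto (fun k => mollify μ (bumpSeq E k) (b i) z) atTop
      (𝓝 (b i z)) := ae_all_iff.2 fun i => ae_tendsto_mollify (hb i).locallyIntegrable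
  have hlim := tendsto_integral_of_tendsto_bound (μ := μ) (f := S)
    (f₀ := renormIntegrand Γ g ζ τ e w d b)
    (g := fun k z => L * mollify μ (bumpSeq E k) ε z) (g₀ := fun z => L * ε z)
    (fun k => aestronglyMeasurable_renormIntegrand hΓc hg hζ
      (integrable_mollify hw).aestronglyMeasurable
      (fun i => (integrable_mollify (hd i)).aestronglyMeasurable)
      (fun i => (integrable_mollify (hb i)).aestronglyMeasurable))
    (fun k => (integrable_mollify hε).const_mul L) (hε.const_mul L)
    (fun k => Eventually.of_forall (hbound k))
    (by
      filter_upwards [haew, haed, haeb] with z h1 h2 h3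
      exact tendsto_renormIntegrand hΓc hg h1 h2 h3)
    (by
      filter_upwards [ae_tendsto_mollify hε.locallyIntegrable] with z h
      exact h.const_mul L)
    (by
      simp only [integral_const_mul, integral_mollify hε]
      exact tendsto_const_nhds)
  refine ⟨hlim.1, tendsto_nhds_unique hlim.2 ?_⟩
  exact tendsto_const_nhds.congr' (hint.mono fun k hk => hk.symm)

end Renormalized

end

/-! ### Weak derivatives of translates and restrictions. -/

section
section Translate

variable {E F : Type*} [NormedAddCommGroup E] [NormedSpace ℝ E] [FiniteDimensional ℝ E]
  [MeasurableSpace E] [BorelSpace E] {μ : Measure E} [μ.IsAddHaarMeasure]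
  [NormedAddCommGroup F] [NormedSpace ℝ F] [CompleteSpace F]

theorem IsTestFn.integrable_smul {D : Set E} {θ : E → ℝ} (hθ : IsTestFn D θ) {g : E → F}
    (hg : Integrable g μ) : Integrable (fun z => θ z • g z) μ := by
  obtain ⟨M, hM⟩ := hθ.2.1.exists_bound_of_continuous hθ.1.continuous
  exact hg.bdd_smul M hθ.1.continuous.aestronglyMeasurable (Eventually.of_forall hM)

theorem IsTestFn.continuous_fderiv_apply {D : Set E} {θ : E → ℝ} (hθ : IsTestFn D θ) (v : E) :
    Continuous fun z => fderiv ℝ θ z v :=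
  (hθ.1.continuous_fderiv (by norm_num)).clm_apply continuous_const

theorem IsTestFn.integrable_fderiv_smul {D : Set E} {θ : E → ℝ} (hθ : IsTestFn D θ) {g : E → F}
    (hg : Integrable g μ) (v : E) : Integrable (fun z => fderiv ℝ θ z v • g z) μ := by
  obtain ⟨M, hM⟩ := (hθ.2.1.fderiv_apply ℝ v).exists_bound_of_continuous
    (hθ.continuous_fderiv_apply v)
  exact hg.bdd_smul M (hθ.continuous_fderiv_apply v).aestronglyMeasurable (Eventually.of_forall hM)

theorem IsTestFn.integral_fderiv_smul_translate_sub {D : Set E} {θ : E → ℝ} (hθ : IsTestFn D θ)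
    {g : E → F} (hg : Integrable g μ) (a v : E) :
    ∫ z, (fderiv ℝ θ z v) • (g (z + a) - g z) ∂μ
      = ∫ z, (fderiv ℝ (fun z => θ (z - a)) z v) • g z ∂μ - ∫ z, (fderiv ℝ θ z v) • g z ∂μ := by
  simp only [smul_sub]
  rw [integral_sub (hθ.integrable_fderiv_smul (hg.comp_add_right a) v)
    (hθ.integrable_fderiv_smul hg v)]
  congr 1
  rw [← integral_add_right_eq_self (μ := μ)
    (fun z => (fderiv ℝ (fun z => θ (z - a)) z v) • g z) a]
  simp [fderiv_comp_sub]

theorem IsTestFn.integral_smul_translate_sub {D : Set E} {θ : E → ℝ} (hθ : IsTestFn D θ)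
    {g : E → F} (hg : Integrable g μ) (a : E) :
    ∫ z, θ z • (g (z + a) - g z) ∂μ
      = ∫ z, θ (z - a) • g z ∂μ - ∫ z, θ z • g z ∂μ := by
  simp only [smul_sub]
  rw [integral_sub (hθ.integrable_smul (hg.comp_add_right a)) (hθ.integrable_smul hg)]
  congr 1
  rw [← integral_add_right_eq_self (μ := μ) (fun z => θ (z - a) • g z) a]
  simp

theorem HasWeakDirDeriv.translate_sub {U K : Set E} {v a : E} {g w : E → F}
    (h : HasWeakDirDeriv μ K v g w) (hg : Integrable g μ) (hw : Integrable w μ)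
    (hUK : U ⊆ K) (ha : ∀ z ∈ U, z + a ∈ K) :
    HasWeakDirDeriv μ U v (fun z => g (z + a) - g z) (fun z => w (z + a) - w z) := by
  intro θ hθ
  rw [hθ.integral_fderiv_smul_translate_sub hg, hθ.integral_smul_translate_sub hw,
    h _ (hθ.comp_sub ha), h _ (hθ.mono hUK)]
  abel

theorem IsTestFn.smul_indicator {K : Set E} {θ : E → ℝ} (hθ : IsTestFn K θ) (g : E → F) (z : E) :
    θ z • K.indicator g z = θ z • g z := by
  by_cases hz : z ∈ K
  · rw [indicator_of_mem hz]
  · rw [image_eq_zero_of_notMem_tsupport fun h => hz (hθ.2.2 h)]; simp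

theorem IsTestFn.fderiv_smul_indicator {K : Set E} {θ : E → ℝ} (hθ : IsTestFn K θ) (g : E → F)
    (v z : E) : fderiv ℝ θ z v • K.indicator g z = fderiv ℝ θ z v • g z := by
  by_cases hz : z ∈ K
  · rw [indicator_of_mem hz]
  · rw [fderiv_eq_zero_of_notMem_tsupport fun h => hz (hθ.2.2 h)]; simp

theorem HasWeakDirDeriv.indicator {D K : Set E} {v : E} {g w : E → F}
    (h : HasWeakDirDeriv μ D v g w) (hK : K ⊆ D) :
    HasWeakDirDeriv μ K v (K.indicator g) (K.indicator w) := by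
  intro θ hθ
  simp only [hθ.smul_indicator, hθ.fderiv_smul_indicator]
  exact h θ (hθ.mono hK)

end Translate

/-! ### Matrices and their rows -/

section Rows

variable {n N : ℕ}

/-- The `i`-th row of a matrix. -/
noncomputable def row (i : Fin n) : Mat n N →L[ℝ] EuclideanSpace ℝ (Fin N) :=
  LinearMap.toContinuousLinearMap
    { toFun := fun P => WithLp.toLp 2 fun k => P (i, k)
      map_add' := fun P Q => by ext k; simp
      map_smul' := fun c P => by ext k; simp }

/-- The matrix with given rows. -/
noncomputable def ofRows : (Fin n → EuclideanSpace ℝ (Fin N)) →L[ℝ] Mat n N :=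
  LinearMap.toContinuousLinearMap
    { toFun := fun R => WithLp.toLp 2 fun p => R p.1 p.2
      map_add' := fun P Q => by ext k; simp
      map_smul' := fun c P => by ext k; simp }

@[simp] theorem row_apply (i : Fin n) (P : Mat n N) (k : Fin N) : row i P k = P (i, k) := rfl

@[simp] theorem ofRows_apply (R : Fin n → EuclideanSpace ℝ (Fin N)) (p : Fin n × Fin N) :
    ofRows R p = R p.1 p.2 := rfl

@[simp] theorem row_ofRows (R : Fin n → EuclideanSpace ℝ (Fin N)) (i : Fin n) :
    row i (ofRows R) = R i := by ext k; simp

theorem ofRows_row (P : Mat n N) : ofRows (fun i => row i P) = P := by ext p; simp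

theorem inner_eq_sum_row (P Q : Mat n N) : inner ℝ P Q = ∑ i, inner ℝ (row i P) (row i Q) := by
  simp only [PiLp.inner_apply, row_apply, Fintype.sum_prod_type]

theorem sq_norm_eq_sum_row (P : Mat n N) : ‖P‖ ^ 2 = ∑ i, ‖row i P‖ ^ 2 := by
  rw [← real_inner_self_eq_norm_sq, inner_eq_sum_row]
  simp only [real_inner_self_eq_norm_sq]

theorem norm_row_le (i : Fin n) (P : Mat n N) : ‖row i P‖ ≤ ‖P‖ := by
  refine (abs_le_of_sq_le_sq' (a := ‖row i P‖) ?_ (norm_nonneg _)).2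
  rw [sq_norm_eq_sum_row P]
  exact Finset.single_le_sum (f := fun i => ‖row i P‖ ^ 2) (fun j _ => sq_nonneg _)
    (Finset.mem_univ i)

theorem norm_ofRows_le (R : Fin n → EuclideanSpace ℝ (Fin N)) : ‖ofRows R‖ ≤ ∑ i, ‖R i‖ := by
  refine (abs_le_of_sq_le_sq' (a := ‖ofRows R‖) ?_
    (Finset.sum_nonneg fun i _ => norm_nonneg _)).2
  rw [sq_norm_eq_sum_row]
  simp only [row_ofRows]
  exact Finset.sum_sq_le_sq_sum_of_nonneg fun i _ => norm_nonneg _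

theorem ext_row {P Q : Mat n N} (h : ∀ i, row i P = row i Q) : P = Q := by
  rw [← ofRows_row P, ← ofRows_row Q]; simp only [h]

end Rows

/-! ### Solutions with measurable representatives and their difference quotients. -/

section Setup

variable {n N : ℕ} {φ : ℝ → ℝ} {c₀ c₁ : ℝ}

/-- The unit vector in time direction. -/
def tdir (n : ℕ) : SpaceTime n := (1, 0)

/-- The unit vectors in space directions. -/
noncomputable def sdir {n : ℕ} (j : Fin n) : SpaceTime n := (0, EuclideanSpace.single j 1)

theorem measurable_fluxA : Measurable (fluxA φ : Mat n N → Mat n N) := by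
  unfold fluxA
  exact (((measurable_deriv φ).comp measurable_norm).div measurable_norm).smul measurable_id

theorem measurable_fieldV : Measurable (fieldV φ : Mat n N → Mat n N) := by
  unfold fieldV
  exact (((((measurable_deriv φ).comp measurable_norm).mul measurable_norm).sqrt).div
    measurable_norm).smul measurable_id

/-- A local weak solution with measurable representatives, with the weak formulation tested by
scalar functions. -/
structure IsMeasSolution (φ : ℝ → ℝ) (D : Set (SpaceTime n))
    (u : SpaceTime n → EuclideanSpace ℝ (Fin N)) (G : SpaceTime n → Mat n N) : Prop where
  isOpen : IsOpen D
  meas_u : StronglyMeasurable u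
  meas_G : StronglyMeasurable G
  int_u : LocallyIntegrableOn u D
  int_G : LocallyIntegrableOn G D
  int_G_sq : LocallyIntegrableOn (fun z => ‖G z‖ ^ 2) D
  int_A : LocallyIntegrableOn (fun z => fluxA φ (G z)) D
  int_V_sq : LocallyIntegrableOn (fun z => ‖fieldV φ (G z)‖ ^ 2) D
  weakGrad : ∀ i, HasWeakDirDeriv volume D (sdir i) u fun z => row i (G z)
  weakEq : ∀ θ, IsTestFn D θ → ∫ z, fderiv ℝ θ z (tdir n) • u z
    = ∑ i, ∫ z, fderiv ℝ θ z (sdir i) • row i (fluxA φ (G z))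

/-- The matrix with rows `⨍ X_j`, averaged over the segment from `z` to `z + h e_j`. -/
noncomputable def gradAvg (h : ℝ) (X : SpaceTime n → Mat n N) (z : SpaceTime n) : Mat n N :=
  ofRows fun j => row j (segAvg X (h • sdir j) z)

/-- The matrix of the difference quotients in all directions of the `i`-th row of `X`. -/
noncomputable def gradDiff (h : ℝ) (X : SpaceTime n → Mat n N) (i : Fin n) (z : SpaceTime n) :
    Mat n N :=
  ofRows fun j => row i (h⁻¹ • (X (z + h • sdir j) - X z))

/-- The difference quotients of `u`. -/
noncomputable def diffQuot (h : ℝ) (u : SpaceTime n → EuclideanSpace ℝ (Fin N))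
    (z : SpaceTime n) : Mat n N :=
  ofRows fun j => h⁻¹ • (u (z + h • sdir j) - u z)

end Setup

end

/-! ### The renormalized identity for difference quotients of a solution. -/

section
variable {n N : ℕ} {φ : ℝ → ℝ} {c₀ c₁ : ℝ} {D K U : Set (SpaceTime n)} {h₀ : ℝ}
  {u : SpaceTime n → EuclideanSpace ℝ (Fin N)} {G : SpaceTime n → Mat n N}

instance : (volume : Measure (SpaceTime n)).IsAddHaarMeasure :=
  Measure.prod.instIsAddHaarMeasure (volume : Measure ℝ) (volume : Measure (Space n))

/-- `U` is an open subset of the compact set `K ⊆ D`, at distance more than `h₀` from its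
complement in the space directions. -/
structure IsRegion (D K U : Set (SpaceTime n)) (h₀ : ℝ) : Prop where
  isCompact : IsCompact K
  subset : K ⊆ D
  isOpen : IsOpen U
  sub : U ⊆ K
  pos : 0 < h₀
  seg : ∀ z ∈ U, ∀ j, ∀ s : ℝ, |s| ≤ h₀ → z + s • sdir j ∈ K

theorem norm_sdir (j : Fin n) : ‖(sdir j : SpaceTime n)‖ = 1 := by
  simp [sdir, Prod.norm_def]

theorem exists_isRegion {S : Set (SpaceTime n)} (hS : IsCompact S) (hD : IsOpen D) (hSD : S ⊆ D) :
    ∃ K U h₀, IsRegion D K U h₀ ∧ S ⊆ U := by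
  obtain ⟨δ, hδ, hδD⟩ := hS.exists_cthickening_subset_open hD hSD
  refine ⟨Metric.cthickening δ S, Metric.thickening (δ / 2) S, δ / 2,
    ⟨hS.cthickening, hδD, Metric.isOpen_thickening, ?_, by positivity, ?_⟩,
    Metric.self_subset_thickening (by positivity) S⟩
  · exact (Metric.thickening_mono (by linarith) S).trans (Metric.thickening_subset_cthickening _ _)
  · intro z hz j s hs
    obtain ⟨y, hy, hzy⟩ := Metric.mem_thickening_iff.1 hz
    refine Metric.thickening_subset_cthickening _ _ (Metric.mem_thickening_iff.2 ⟨y, hy, ?_⟩)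
    calc dist (z + s • sdir j) y ≤ dist (z + s • sdir j) z + dist z y := dist_triangle _ _ _
      _ = |s| + dist z y := by
          rw [dist_eq_norm, add_sub_cancel_left, norm_smul, norm_sdir, mul_one, Real.norm_eq_abs]
      _ < δ := by linarith

namespace IsRegion

variable (hR : IsRegion D K U h₀)
include hR

theorem measK : MeasurableSet K := hR.isCompact.measurableSet

theorem seg' {z : SpaceTime n} (hz : z ∈ U) (j : Fin n) {h r : ℝ} (hh : |h| ≤ h₀)
    (hr : r ∈ Icc (0 : ℝ) 1) : z + r • (h • (sdir j : SpaceTime n)) ∈ K := by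
  rw [smul_smul]
  refine hR.seg z hz j _ ?_
  rw [abs_mul, abs_of_nonneg hr.1]
  nlinarith [hr.1, hr.2, abs_nonneg h]

theorem seg_one {z : SpaceTime n} (hz : z ∈ U) (j : Fin n) {h : ℝ} (hh : |h| ≤ h₀) :
    z + h • (sdir j : SpaceTime n) ∈ K := hR.seg z hz j h hh

end IsRegion

namespace IsMeasSolution

variable (hS : IsMeasSolution φ D u G)
include hS

theorem integrable_indicator {X : Type*} [NormedAddCommGroup X] {f : SpaceTime n → X}
    (hf : LocallyIntegrableOn f D) (hR : IsRegion D K U h₀) : Integrable (K.indicator f) :=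
  (integrable_indicator_iff hR.measK).2 (hf.integrableOn_compact_subset hR.subset hR.isCompact)

theorem meas_ind (hR : IsRegion D K U h₀) : StronglyMeasurable (K.indicator G) :=
  hS.meas_G.indicator hR.measK

theorem flux_ind : (fun z => fluxA φ (K.indicator G z)) = K.indicator fun z => fluxA φ (G z) := by
  ext1 z
  by_cases hz : z ∈ K <;> simp [hz]

theorem integrable_flux (hR : IsRegion D K U h₀) :
    Integrable fun z => fluxA φ (K.indicator G z) := by
  rw [hS.flux_ind]; exact hS.integrable_indicator hS.int_A hR

theorem integrable_V_sq (hR : IsRegion D K U h₀) :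
    Integrable fun z => ‖fieldV φ (K.indicator G z)‖ ^ 2 := by
  have : (fun z => ‖fieldV φ (K.indicator G z)‖ ^ 2)
      = K.indicator fun z => ‖fieldV φ (G z)‖ ^ 2 := by
    ext1 z
    by_cases hz : z ∈ K <;> simp [hz]
  rw [this]; exact hS.integrable_indicator hS.int_V_sq hR

theorem integrable_G_sq (hR : IsRegion D K U h₀) :
    Integrable fun z => ‖K.indicator G z‖ ^ 2 := by
  have : (fun z => ‖K.indicator G z‖ ^ 2) = K.indicator fun z => ‖G z‖ ^ 2 := by
    ext1 z
    by_cases hz : z ∈ K <;> simp [hz]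
  rw [this]; exact hS.integrable_indicator hS.int_G_sq hR

end IsMeasSolution

theorem lintegral_sq_lt_top {X E : Type*} [NormedAddCommGroup E] [MeasurableSpace X]
    {μ : Measure X} {f : X → E} (hf : Integrable (fun z => ‖f z‖ ^ 2) μ) :
    ∫⁻ z, ‖f z‖ₑ ^ 2 ∂μ < ⊤ := by
  have := hf.hasFiniteIntegral
  rw [hasFiniteIntegral_iff_enorm] at this
  refine lt_of_eq_of_lt (lintegral_congr fun z => ?_) this
  rw [enorm_pow, enorm_norm]

theorem integrable_sq_of_lintegral {X E : Type*} [NormedAddCommGroup E] [MeasurableSpace X]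
    {μ : Measure X} {f : X → E} (hm : AEStronglyMeasurable f μ) (hf : ∫⁻ z, ‖f z‖ₑ ^ 2 ∂μ < ⊤) :
    Integrable (fun z => ‖f z‖ ^ 2) μ := by
  refine ⟨hm.norm.pow 2, ?_⟩
  rw [hasFiniteIntegral_iff_enorm]
  refine lt_of_eq_of_lt (lintegral_congr fun z => ?_) hf
  rw [enorm_pow, enorm_norm]

theorem sum_sum_add_const (f g : Fin n → ℝ) :
    ∑ j, ∑ j', (f j + g j') = n * ∑ j, f j + n * ∑ j, g j := by
  simp only [Finset.sum_add_distrib, Finset.sum_const, Finset.card_univ, Fintype.card_fin,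
    nsmul_eq_mul, ← Finset.mul_sum]

theorem mul_add_mul_le_mul_sum {k a b L T S W T' S' W' : ℝ} (ha : k * a ≤ L) (hb : k * b ≤ L)
    (hL : 0 ≤ L) (hT : 0 ≤ T) (hS : 0 ≤ S) (hW : 0 ≤ W) (hT' : 0 ≤ T') (hS' : 0 ≤ S')
    (hW' : 0 ≤ W') : k * (a * T + b * S') ≤ L * (T + S + W) + L * (T' + S' + W') := by
  have e1 := mul_le_mul_of_nonneg_right ha hT
  have e2 := mul_le_mul_of_nonneg_right hb hS'
  have e3 : 0 ≤ L * (S + W + T' + W') := by positivity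
  linarith

theorem mul_add_mul_le_mul_sum' {k a L T S W T' S' W' : ℝ} (ha : k * a ≤ L)
    (hL : 0 ≤ L) (hT : 0 ≤ T) (hS : 0 ≤ S) (hW : 0 ≤ W) (hT' : 0 ≤ T') (hS' : 0 ≤ S')
    (hW' : 0 ≤ W') : k * (a * T + a * T') ≤ L * (T + S + W) + L * (T' + S' + W') := by
  have e1 := mul_le_mul_of_nonneg_right ha hT
  have e2 := mul_le_mul_of_nonneg_right ha hT'
  have e3 : 0 ≤ L * (S + W + S' + W') := by positivity
  linarith

theorem mul_le_mul_sum {L T S x T' S' y : ℝ} (hL : 1 ≤ L) (hT : 0 ≤ T) (hS : 0 ≤ S)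
    (hT' : 0 ≤ T') (hS' : 0 ≤ S') :
    x * y ≤ L * (T + S + x ^ 2) + L * (T' + S' + y ^ 2) := by
  have e0 : x * y ≤ x ^ 2 + y ^ 2 := by nlinarith [sq_nonneg (x - y), sq_nonneg (x + y)]
  have e1 := mul_le_mul_of_nonneg_right hL (add_nonneg (sq_nonneg x) (sq_nonneg y))
  have e3 : 0 ≤ L * (T + S + T' + S') := by positivity
  linarith

/-- The fundamental theorem for weak derivatives, row by row. It identifies the natural test field,
built from differences of `u`, with averages of `∇u`, for which `L²` bounds and limits as `h → 0`
are at hand. -/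
theorem ae_diffQuot_eq (hS : IsMeasSolution φ D u G) (hR : IsRegion D K U h₀) {h : ℝ}
    (hh0 : h ≠ 0) (hh : |h| ≤ h₀) :
    ∀ᵐ z, z ∈ U → diffQuot h u z = gradAvg h (K.indicator G) z := by
  have hGm := hS.meas_ind hR
  have hG2 := lintegral_sq_lt_top (hS.integrable_G_sq hR)
  have h1 : ∀ᵐ z, ∀ j : Fin n, z ∈ U → u (z + h • sdir j) - u z
      = segAvg (K.indicator fun z => h • row j (G z)) (h • sdir j) z := by
    refine ae_all_iff.2 fun j => ?_
    have hm : StronglyMeasurable fun z => h • row j (G z) :=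
      ((row j).continuous.comp_stronglyMeasurable hS.meas_G).const_smul h
    have hi : LocallyIntegrableOn (fun z => h • row j (G z)) D := by
      intro z hz
      obtain ⟨t, ht, hti⟩ := hS.int_G z hz
      exact ⟨t, ht, ((row j).integrable_comp hti).smul h⟩
    exact ((hS.weakGrad j).smul h).ae_sub_eq_segAvg hm hS.int_u hi hR.isCompact hR.subset hR.isOpen
      fun z hz r hr => hR.seg' hz j hh hr
  have h2 : ∀ᵐ z, ∀ j : Fin n,
      IntegrableOn (fun r : ℝ => K.indicator G (z + r • (h • sdir j))) (Ioc 0 1) :=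
    ae_all_iff.2 fun j => ae_integrable_segment hGm hG2 _
  filter_upwards [h1, h2] with z h1 h2 hz
  unfold diffQuot gradAvg
  congr 1
  ext1 j
  rw [h1 j hz, segAvg_eq, segAvg_eq, ← ContinuousLinearMap.integral_comp_comm _ (h2 j),
    ← integral_smul]
  refine integral_congr_ae (Eventually.of_forall fun r => ?_)
  simp only
  by_cases hr : z + r • h • sdir j ∈ K
  · rw [indicator_of_mem hr, indicator_of_mem hr, smul_smul, inv_mul_cancel₀ hh0, one_smul]
  · simp [indicator_of_notMem hr]

set_option maxHeartbeats 1000000 in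
-- The abstract identity is applied to the matrix `w` of the difference quotients of `u` in all
-- space directions. Treating them together makes `g(|w|²)` depend on an approximation of the full
-- gradient. The two-point hypotheses follow from Young's inequality for `A` and `∇u`; their
-- constants may depend on `h`, since the conclusion is an exact identity.
theorem integral_renormIntegrand_gradAvg (hS : IsMeasSolution φ D u G) (hφ : IsOrlicz φ c₀ c₁)
    (hc₀ : 0 < c₀) (hR : IsRegion D K U h₀) {h : ℝ} (hh0 : 0 < h) (hh : h ≤ h₀)
    {Γ g : ℝ → ℝ} (hΓ : ∀ x, HasDerivAt Γ (g x) x) (hΓ0 : Γ 0 = 0) (hg : ContDiff ℝ 1 g)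
    {M : ℝ} (hM : ∀ x, 0 ≤ x → |g x| ≤ M) (hM' : ∀ x, 0 ≤ x → |deriv g x * x| ≤ M)
    {ζ : SpaceTime n → ℝ} (hζ : ContDiff ℝ 1 ζ) (hζc : HasCompactSupport ζ)
    (hζU : tsupport ζ ⊆ U) :
    Integrable (renormIntegrand Γ g ζ (tdir n) sdir (gradAvg h (K.indicator G))
        (gradDiff h (K.indicator G)) (gradDiff h fun z => fluxA φ (K.indicator G z))) ∧
      ∫ z, renormIntegrand Γ g ζ (tdir n) sdir (gradAvg h (K.indicator G))
        (gradDiff h (K.indicator G)) (gradDiff h fun z => fluxA φ (K.indicator G z)) z = 0 := by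
  have hh' : |h| ≤ h₀ := by rwa [abs_of_pos hh0]
  have hUm : MeasurableSet U := hR.isOpen.measurableSet
  have hGm := hS.meas_ind hR
  have hG2 := lintegral_sq_lt_top (hS.integrable_G_sq hR)
  have hGi := hS.integrable_indicator hS.int_G hR
  have hui := hS.integrable_indicator hS.int_u hR
  have hAi := hS.integrable_flux hR
  have hEi := hS.integrable_V_sq hR
  set Gb := K.indicator G with hGb
  set ub := K.indicator u with hub
  set A : SpaceTime n → Mat n N := fun z => fluxA φ (Gb z) with hA
  set EE : SpaceTime n → ℝ := fun z => ‖fieldV φ (Gb z)‖ ^ 2 with hEE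
  have hEm : StronglyMeasurable EE :=
    (((measurable_fieldV.comp hGm.measurable).norm).pow_const 2).stronglyMeasurable
  have hE0 : ∀ z, 0 ≤ EE z := fun z => sq_nonneg _
  -- The density `EE = |V(∇u)|²` is integrable over the region, and this inequality holds for
  -- arbitrary pairs of points.
  have hYoung : ∀ z z', ‖A z‖ * ‖Gb z'‖ ≤ EE z + EE z' := fun z z' =>
    norm_fluxA_mul_le hφ hc₀ _ _
  -- the three fields on `U`
  set w := U.indicator (diffQuot h ub) with hw
  set d : Fin n → SpaceTime n → Mat n N := fun i => U.indicator (gradDiff h Gb i) with hd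
  set b : Fin n → SpaceTime n → Mat n N := fun i => U.indicator (gradDiff h A i) with hb
  have hgd : ∀ (X : SpaceTime n → Mat n N), Integrable X → ∀ i, Integrable (gradDiff h X i) := by
    intro X hX i
    refine ofRows.integrable_comp (Integrable.of_eval fun j => ?_)
    exact (row i).integrable_comp (((hX.comp_add_right _).sub hX).smul h⁻¹)
  have hqi : Integrable (diffQuot h ub) := by
    refine ofRows.integrable_comp (Integrable.of_eval fun j => ?_)
    exact ((hui.comp_add_right _).sub hui).smul h⁻¹
  have hwi : Integrable w := hqi.indicator hUm
  have hdi : ∀ i, Integrable (d i) := fun i => (hgd Gb hGi i).indicator hUm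
  have hbi : ∀ i, Integrable (b i) := fun i => (hgd A hAi i).indicator hUm
  have hwU : ∀ᵐ z, z ∈ U → w z = gradAvg h Gb z := by
    filter_upwards [ae_diffQuot_eq hS hR hh0.ne' hh'] with z hz hzU
    rw [hw, indicator_of_mem hzU, ← hz hzU]
    unfold diffQuot
    congr 1
    ext1 j
    rw [hub, indicator_of_mem (hR.sub hzU), indicator_of_mem (hR.seg_one hzU j hh')]
  -- weak equations
  have hwd : ∀ i, HasWeakDirDeriv volume U (sdir i) w (d i) := by
    intro i θ hθ
    rw [hw, hd]
    simp only [hθ.smul_indicator, hθ.fderiv_smul_indicator]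
    refine ext_row fun j => ?_
    rw [map_neg, ← ContinuousLinearMap.integral_comp_comm _ (hθ.integrable_fderiv_smul hqi _),
      ← ContinuousLinearMap.integral_comp_comm _ (hθ.integrable_smul (hgd Gb hGi i))]
    have h1 : HasWeakDirDeriv volume K (sdir i) ub fun z => row i (Gb z) := by
      have := (hS.weakGrad i).indicator hR.subset
      convert this using 1
      ext1 z
      by_cases hz : z ∈ K <;> simp [hGb, hz]
    have h2 := h1.translate_sub (a := h • sdir j) (U := U) hui ((row i).integrable_comp hGi)
      hR.sub (fun z hz => hR.seg_one hz j hh') θ hθ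
    simp only [map_smul, diffQuot, gradDiff, row_ofRows, map_sub]
    simp only [smul_comm _ h⁻¹, integral_smul]
    rw [h2, smul_neg]
  have heq : ∀ θ, IsTestFn U θ → ∫ z, (fderiv ℝ θ z (tdir n)) • w z
      = ∑ i, ∫ z, (fderiv ℝ θ z (sdir i)) • b i z := by
    intro θ hθ
    rw [hw, hb]
    simp only [hθ.fderiv_smul_indicator]
    refine ext_row fun j => ?_
    rw [map_sum, ← ContinuousLinearMap.integral_comp_comm _ (hθ.integrable_fderiv_smul hqi _)]
    simp only [fun i => ((row j).integral_comp_comm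
      (hθ.integrable_fderiv_smul (hgd A hAi i) (sdir i))).symm]
    simp only [map_smul, diffQuot, gradDiff, row_ofRows]
    simp only [smul_comm _ h⁻¹, integral_smul, map_sub]
    have hK : ∀ θ, IsTestFn K θ → ∫ z, fderiv ℝ θ z (tdir n) • ub z
        = ∑ i, ∫ z, fderiv ℝ θ z (sdir i) • row i (A z) := by
      intro θ hθ
      have e : ∀ i z, row i (A z) = K.indicator (fun z => row i (fluxA φ (G z))) z := by
        intro i z
        by_cases hz : z ∈ K <;> simp [hA, hGb, hz]
      simp only [e, hub, hθ.fderiv_smul_indicator]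
      exact hS.weakEq θ (hθ.mono hR.subset)
    rw [← Finset.smul_sum, hθ.integral_fderiv_smul_translate_sub hui,
      hK _ (hθ.comp_sub fun z hz => hR.seg_one hz j hh'), hK _ (hθ.mono hR.sub),
      ← Finset.sum_sub_distrib]
    congr 1
    refine Finset.sum_congr rfl fun i _ => ?_
    rw [hθ.integral_fderiv_smul_translate_sub ((row i).integrable_comp hAi)]
  -- bounds
  set T : SpaceTime n → ℝ := fun z => ∑ j : Fin n, (EE (z + h • sdir j) + EE z) with hT
  set Sg : SpaceTime n → ℝ := fun z => ∑ j : Fin n, segAvg EE (h • sdir j) z with hSg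
  have hT0 : ∀ z, 0 ≤ T z := fun z => Finset.sum_nonneg fun j _ => add_nonneg (hE0 _) (hE0 _)
  have hSg0 : ∀ z, 0 ≤ Sg z := fun z => Finset.sum_nonneg fun j _ =>
    intervalIntegral.integral_nonneg zero_le_one fun r _ => hE0 _
  have hh1 : 0 < h⁻¹ := inv_pos.2 hh0
  -- The three summands cover the products of two quotients with factor `h⁻²` (flux against
  -- gradient), those of a flux quotient with an average (factor `h⁻¹`), and `|w||w|`.
  set L : ℝ := 2 * n * h⁻¹ ^ 2 + 2 * n * h⁻¹ + 1 with hL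
  have hL0 : 0 ≤ L := by positivity
  have l0 : 0 ≤ n * h⁻¹ := by positivity
  have l0' : 0 ≤ 2 * n * h⁻¹ ^ 2 := by positivity
  have l1 : h⁻¹ * n ≤ L := by rw [hL]; linarith
  have l2 : h⁻¹ * (2 * n) ≤ L := by rw [hL]; linarith
  have l3 : 1 ≤ L := by rw [hL]; linarith
  have l4 : h⁻¹ ^ 2 * (2 * n) ≤ L := by rw [hL]; linarith
  clear_value L
  set ε : SpaceTime n → ℝ := fun z => L * (T z + Sg z + ‖w z‖ ^ 2) with hε
  have hw2 : Integrable fun z => ‖w z‖ ^ 2 := by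
    have hs : ∀ j : Fin n, Integrable fun z => ‖segAvg Gb (h • sdir j) z‖ ^ 2 := fun j =>
      integrable_sq_of_lintegral (stronglyMeasurable_segAvg hGm _).aestronglyMeasurable
        ((lintegral_sq_segAvg_le hGm _).trans_lt hG2)
    refine (integrable_finsetSum Finset.univ fun j _ => hs j).mono'
      (hwi.aestronglyMeasurable.norm.pow 2) ?_
    filter_upwards [hwU] with z hz
    rw [Real.norm_of_nonneg (sq_nonneg _)]
    by_cases hzU : z ∈ U
    · rw [hz hzU, gradAvg, sq_norm_eq_sum_row]
      simp only [row_ofRows]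
      exact Finset.sum_le_sum fun j _ => by gcongr; exact norm_row_le _ _
    · rw [hw, indicator_of_notMem hzU]
      simp only [norm_zero, ne_eq, OfNat.ofNat_ne_zero, not_false_eq_true, zero_pow]
      exact Finset.sum_nonneg fun j _ => sq_nonneg _
  have hεi : Integrable ε := by
    refine Integrable.const_mul ((Integrable.add ?_ ?_).add hw2) L
    · exact integrable_finsetSum _ fun j _ => (hEi.comp_add_right _).add hEi
    · exact integrable_finsetSum _ fun j _ => integrable_segAvg hEm hEi _
  have hrow : ∀ (X : SpaceTime n → Mat n N) i z,
      ‖U.indicator (gradDiff h X i) z‖ ≤ h⁻¹ * ∑ j : Fin n, (‖X (z + h • sdir j)‖ + ‖X z‖) := by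
    intro X i z
    rw [Finset.mul_sum]
    refine (norm_indicator_le_norm_self _ _).trans ((norm_ofRows_le _).trans ?_)
    refine Finset.sum_le_sum fun j _ => (norm_row_le _ _).trans ?_
    rw [norm_smul, Real.norm_of_nonneg hh1.le]
    gcongr
    exact norm_sub_le _ _
  have hsegE : ∀ᵐ z, ∀ j : Fin n, IntegrableOn (fun r : ℝ => EE (z + r • (h • sdir j)))
      (Ioc 0 1) := ae_all_iff.2 fun j => by
    have := (integrable_segment hEm hEi (h • sdir j)).prod_left_ae
    exact this
  have hsegG : ∀ᵐ z, ∀ j : Fin n, IntegrableOn (fun r : ℝ => Gb (z + r • (h • sdir j)))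
      (Ioc 0 1) := ae_all_iff.2 fun j => ae_integrable_segment hGm hG2 _
  -- `A` against averages of `G`
  have hAw : ∀ᵐ z', ∀ z, ‖A z‖ * ‖w z'‖ ≤ n * EE z + Sg z' := by
    filter_upwards [hwU, hsegE, hsegG] with z' h1 h2 h3 z
    by_cases hzU : z' ∈ U
    · rw [h1 hzU]
      calc ‖A z‖ * ‖gradAvg h Gb z'‖
          ≤ ‖A z‖ * ∑ j : Fin n, ‖segAvg Gb (h • sdir j) z'‖ := by
            gcongr
            exact (norm_ofRows_le _).trans (Finset.sum_le_sum fun j _ => norm_row_le _ _)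
        _ = ∑ j : Fin n, ‖A z‖ * ‖segAvg Gb (h • sdir j) z'‖ := Finset.mul_sum _ _ _
        _ ≤ ∑ j : Fin n, (EE z + segAvg EE (h • sdir j) z') := by
            refine Finset.sum_le_sum fun j _ => ?_
            rw [segAvg_eq, segAvg_eq]
            calc _ ≤ ‖A z‖ * ∫ r in Ioc (0 : ℝ) 1, ‖Gb (z' + r • h • sdir j)‖ := by
                  gcongr; exact norm_integral_le_integral_norm _
              _ = ∫ r in Ioc (0 : ℝ) 1, ‖A z‖ * ‖Gb (z' + r • h • sdir j)‖ :=
                  (integral_const_mul _ _).symm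
              _ ≤ ∫ r in Ioc (0 : ℝ) 1, (EE z + EE (z' + r • h • sdir j)) :=
                  integral_mono ((h3 j).norm.const_mul _) ((integrable_const _).add (h2 j))
                    fun r => hYoung _ _
              _ = _ := by rw [integral_add (integrable_const _) (h2 j)]; simp
        _ = _ := by rw [Finset.sum_add_distrib]; simp [hSg]
    · rw [hw, indicator_of_notMem hzU]
      have := hE0 z
      have := hSg0 z'
      simp only [norm_zero, mul_zero]
      positivity
  have hbw : ∀ i, ∀ᵐ z, ∀ᵐ z', ‖b i z‖ * ‖w z'‖ ≤ ε z + ε z' := by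
    intro i
    refine Eventually.of_forall fun z => ?_
    filter_upwards [hAw] with z' hz'
    have : ‖b i z‖ * ‖w z'‖ ≤ h⁻¹ * (n * T z + 2 * n * Sg z') := by
      calc ‖b i z‖ * ‖w z'‖
          ≤ (h⁻¹ * ∑ j : Fin n, (‖A (z + h • sdir j)‖ + ‖A z‖)) * ‖w z'‖ := by
            gcongr; exact hrow A i z
        _ = h⁻¹ * ∑ j : Fin n, (‖A (z + h • sdir j)‖ * ‖w z'‖ + ‖A z‖ * ‖w z'‖) := by
            rw [mul_assoc, Finset.sum_mul]; simp only [add_mul]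
        _ ≤ h⁻¹ * ∑ j : Fin n, ((n * EE (z + h • sdir j) + Sg z') + (n * EE z + Sg z')) := by
            gcongr <;> exact hz' _
        _ = _ := by
            have e : ∀ j : Fin n, (n * EE (z + h • sdir j) + Sg z') + (n * EE z + Sg z')
                = n * (EE (z + h • sdir j) + EE z) + 2 * Sg z' := fun j => by ring
            rw [Finset.sum_congr rfl fun j _ => e j, Finset.sum_add_distrib, ← Finset.mul_sum,
              Finset.sum_const, Finset.card_univ, Fintype.card_fin, nsmul_eq_mul]
            ring
    refine this.trans (mul_add_mul_le_mul_sum l1 l2 hL0 (hT0 z) (hSg0 z) (sq_nonneg _) (hT0 z')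
      (hSg0 z') (sq_nonneg _))
  have hbd : ∀ i, ∀ᵐ z, ∀ᵐ z', ‖b i z‖ * ‖d i z'‖ ≤ ε z + ε z' := by
    intro i
    refine Eventually.of_forall fun z => Eventually.of_forall fun z' => ?_
    have : ‖b i z‖ * ‖d i z'‖ ≤ h⁻¹ ^ 2 * (2 * n * T z + 2 * n * T z') := by
      calc ‖b i z‖ * ‖d i z'‖
          ≤ (h⁻¹ * ∑ j : Fin n, (‖A (z + h • sdir j)‖ + ‖A z‖)) *
              (h⁻¹ * ∑ j : Fin n, (‖Gb (z' + h • sdir j)‖ + ‖Gb z'‖)) := by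
            gcongr
            · exact hrow A i z
            · exact hrow Gb i z'
        _ = h⁻¹ ^ 2 * ∑ j : Fin n, ∑ j' : Fin n, (‖A (z + h • sdir j)‖ + ‖A z‖) *
              (‖Gb (z' + h • sdir j')‖ + ‖Gb z'‖) := by
            rw [← Finset.sum_mul_sum]; ring
        _ ≤ h⁻¹ ^ 2 * ∑ j : Fin n, ∑ j' : Fin n, (2 * (EE (z + h • sdir j) + EE z)
              + 2 * (EE (z' + h • sdir j') + EE z')) := by
            gcongr with j _ j' _
            have y1 := hYoung (z + h • sdir j) (z' + h • sdir j')
            have y2 := hYoung (z + h • sdir j) z'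
            have y3 := hYoung z (z' + h • sdir j')
            have y4 := hYoung z z'
            linarith
        _ = _ := by
            rw [sum_sum_add_const, ← Finset.mul_sum, ← Finset.mul_sum]
            ring
    refine this.trans (mul_add_mul_le_mul_sum' l4 hL0 (hT0 z) (hSg0 z) (sq_nonneg _) (hT0 z')
      (hSg0 z') (sq_nonneg _))
  have hww : ∀ᵐ z, ∀ᵐ z', ‖w z‖ * ‖w z'‖ ≤ ε z + ε z' := by
    refine Eventually.of_forall fun z => Eventually.of_forall fun z' => ?_
    exact mul_le_mul_sum l3 (hT0 z) (hSg0 z) (hT0 z') (hSg0 z')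
  obtain ⟨hI, hI0⟩ := integral_renormIntegrand (μ := volume) hR.isOpen (τ := tdir n) (e := sdir)
    hwi hdi hbi hεi hwd heq hww hbw hbd hΓ hΓ0 hg hM hM' hζ hζc hζU
  have hae : renormIntegrand Γ g ζ (tdir n) sdir w d b =ᵐ[volume]
      renormIntegrand Γ g ζ (tdir n) sdir (gradAvg h Gb) (gradDiff h Gb) (gradDiff h A) := by
    filter_upwards [hwU] with z hz
    by_cases hzU : z ∈ U
    · simp only [renormIntegrand, hz hzU, hd, hb, indicator_of_mem hzU]
    · have hzt : z ∉ tsupport ζ := fun h => hzU (hζU h)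
      simp [renormIntegrand, fderiv_eq_zero_of_notMem_tsupport hzt,
        image_eq_zero_of_notMem_tsupport hzt]
  exact ⟨hI.congr hae, (integral_congr_ae hae).symm.trans hI0⟩

end

/-! ### Young inequalities for the flux error, absorption, and weighted translates. -/

section
section Pointwise

variable {n N : ℕ}

/-- Both `A(P)` and `A(P')` are compared with `A(Q)`, where the estimate involving the factor `|Q|`
is available. In the application `Q` is the gradient at an intermediate point of the segment whose
endpoints carry `P` and `P'`. -/
theorem exists_mul_fluxA_sub_mul_le (c₀ c₁ : ℝ) (hc₀ : 0 < c₀) :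
    ∃ C : ℝ, 1 ≤ C ∧ ∀ φ, IsOrlicz φ c₀ c₁ → ∀ (n N : ℕ) (P P' Q : Mat n N),
      ‖fluxA φ P' - fluxA φ P‖ * ‖Q‖
        ≤ C * (‖fieldV φ Q - fieldV φ P‖ * (‖fieldV φ Q - fieldV φ P‖ + ‖fieldV φ Q‖)
          + ‖fieldV φ P' - fieldV φ Q‖ * (‖fieldV φ P' - fieldV φ Q‖ + ‖fieldV φ Q‖)) := by
  obtain ⟨C, hC, H⟩ := exists_fluxA_sub_mul_le c₀ c₁ hc₀
  refine ⟨C, hC, fun φ h n N P P' Q => ?_⟩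
  have h1 := (H φ h n N P Q).2
  have h2 := (H φ h n N P' Q).2
  rw [norm_sub_rev (fieldV φ P)] at h1
  have h3 : ‖fluxA φ P' - fluxA φ P‖ ≤ ‖fluxA φ P - fluxA φ Q‖ + ‖fluxA φ P' - fluxA φ Q‖ := by
    rw [norm_sub_rev (fluxA φ P)]
    calc _ = ‖(fluxA φ Q - fluxA φ P) + (fluxA φ P' - fluxA φ Q)‖ := by congr 1; abel
      _ ≤ _ := norm_add_le _ _
  nlinarith [mul_le_mul_of_nonneg_right h3 (norm_nonneg Q)]

theorem young_aux {x D p q ε : ℝ} (hx : 0 ≤ x) (hD : 0 ≤ D) (hε : 0 < ε) (hDp : D ≤ p + q) :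
    x * (D * (D + q)) ≤ 4 * (ε * (x ^ 2 * D ^ 2) + ε⁻¹ * (p ^ 2 / 2 + q ^ 2 / 2)) := by
  have h1 : x * (D * (D + q)) ≤ (x * D) * (p + 2 * q) := by
    rw [mul_assoc]
    exact mul_le_mul_of_nonneg_left (mul_le_mul_of_nonneg_left (by linarith) hD) hx
  refine h1.trans ?_
  have e : ε * ε⁻¹ = 1 := mul_inv_cancel₀ hε.ne'
  have h2 : 0 ≤ ε⁻¹ * (2 * ε * (x * D) - (p + 2 * q) / 2) ^ 2 := by positivity
  have h3 : ε⁻¹ * (2 * ε * (x * D) - (p + 2 * q) / 2) ^ 2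
      = 4 * (ε * ε⁻¹) * ε * (x * D) ^ 2 - 2 * (ε * ε⁻¹) * (x * D) * (p + 2 * q)
        + ε⁻¹ * (p + 2 * q) ^ 2 / 4 := by ring
  rw [h3, e] at h2
  have h4 : 0 ≤ ε⁻¹ * ((2 * p - q) ^ 2 + 11 * p ^ 2 + 11 * q ^ 2) := by positivity
  have h5 : 0 ≤ ε * (x * D) ^ 2 := by positivity
  linarith

/-- It is used with `x = η/h`. The term with `ε` then contains squared difference quotients of `V`,
to be absorbed, while the term with `ε⁻¹` has no factor `x` and stays bounded as `h → 0`. -/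
theorem exists_mul_fluxA_sub_mul_le_young (c₀ c₁ : ℝ) (hc₀ : 0 < c₀) :
    ∃ C : ℝ, 1 ≤ C ∧ ∀ φ, IsOrlicz φ c₀ c₁ → ∀ (n N : ℕ) (P P' Q : Mat n N) (x ε : ℝ),
      0 ≤ x → 0 < ε → x * (‖fluxA φ P' - fluxA φ P‖ * ‖Q‖)
        ≤ C * (ε * (x ^ 2 * (‖fieldV φ Q - fieldV φ P‖ ^ 2 + ‖fieldV φ P' - fieldV φ Q‖ ^ 2))
          + ε⁻¹ * (‖fieldV φ P‖ ^ 2 + ‖fieldV φ P'‖ ^ 2 + ‖fieldV φ Q‖ ^ 2)) := by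
  obtain ⟨C, hC, H⟩ := exists_mul_fluxA_sub_mul_le c₀ c₁ hc₀
  refine ⟨4 * C, by linarith, fun φ h n N P P' Q x ε hx hε => ?_⟩
  have h0 := H φ h n N P P' Q
  have d1 : ‖fieldV φ Q - fieldV φ P‖ ≤ ‖fieldV φ P‖ + ‖fieldV φ Q‖ := by
    rw [add_comm]; exact norm_sub_le _ _
  have d2 : ‖fieldV φ P' - fieldV φ Q‖ ≤ ‖fieldV φ P'‖ + ‖fieldV φ Q‖ := norm_sub_le _ _
  have y1 := young_aux hx (norm_nonneg _) hε d1
  have y2 := young_aux hx (norm_nonneg _) hε d2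
  have hC0 : 0 ≤ C := by linarith
  calc _ ≤ x * (C * _) := mul_le_mul_of_nonneg_left h0 hx
    _ = C * (x * (‖fieldV φ Q - fieldV φ P‖ * (‖fieldV φ Q - fieldV φ P‖ + ‖fieldV φ Q‖))
        + x * (‖fieldV φ P' - fieldV φ Q‖ * (‖fieldV φ P' - fieldV φ Q‖ + ‖fieldV φ Q‖))) := by
      ring
    _ ≤ C * (4 * (ε * (x ^ 2 * ‖fieldV φ Q - fieldV φ P‖ ^ 2)
          + ε⁻¹ * (‖fieldV φ P‖ ^ 2 / 2 + ‖fieldV φ Q‖ ^ 2 / 2))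
        + 4 * (ε * (x ^ 2 * ‖fieldV φ P' - fieldV φ Q‖ ^ 2)
          + ε⁻¹ * (‖fieldV φ P'‖ ^ 2 / 2 + ‖fieldV φ Q‖ ^ 2 / 2))) :=
      mul_le_mul_of_nonneg_left (add_le_add y1 y2) hC0
    _ ≤ _ := by
      have hε' : 0 ≤ ε⁻¹ := (inv_pos.2 hε).le
      have : 0 ≤ C * (ε⁻¹ * (‖fieldV φ P‖ ^ 2 + ‖fieldV φ P'‖ ^ 2)) := by positivity
      linarith

theorem sum_inner_gradDiff (h : ℝ) (X Y : SpaceTime n → Mat n N) (z : SpaceTime n) :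
    ∑ i, inner ℝ (gradDiff h X i z) (gradDiff h Y i z)
      = h⁻¹ ^ 2 * ∑ j, inner ℝ (X (z + h • sdir j) - X z) (Y (z + h • sdir j) - Y z) := by
  simp only [inner_eq_sum_row, gradDiff, row_ofRows, map_smul, real_inner_smul_left,
    real_inner_smul_right]
  rw [Finset.sum_comm, Finset.mul_sum]
  refine Finset.sum_congr rfl fun j _ => ?_
  rw [Finset.mul_sum]
  exact Finset.sum_congr rfl fun i _ => by ring

theorem abs_inner_gradDiff_ofRows_le {h : ℝ} (hh : 0 < h) (X : SpaceTime n → Mat n N)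
    (R : Fin n → Mat n N) (i : Fin n) (z : SpaceTime n) :
    |inner ℝ (gradDiff h X i z) (ofRows fun j => row j (R j))|
      ≤ ∑ j, h⁻¹ * (‖X (z + h • sdir j) - X z‖ * ‖R j‖) := by
  rw [inner_eq_sum_row]
  refine (Finset.abs_sum_le_sum_abs _ _).trans (Finset.sum_le_sum fun j _ => ?_)
  simp only [gradDiff, row_ofRows, map_smul, real_inner_smul_left]
  rw [abs_mul, abs_of_pos (inv_pos.2 hh)]
  gcongr
  exact (abs_real_inner_le_norm _ _).trans
    (mul_le_mul (norm_row_le _ _) (norm_row_le _ _) (norm_nonneg _) (norm_nonneg _))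

/-- The supremum of `F` over `(0, h]` is finite by the crude bound `B`, and the hypothesis bounds it
by half of itself plus `M h²`. A supremum is needed because the errors at step `h` involve all
smaller steps. -/
theorem le_two_mul_of_half_iterate {F : ℝ → ℝ} {B M h₀ : ℝ} (hF0 : ∀ h, 0 ≤ F h)
    (hB : ∀ h, F h ≤ B)
    (H : ∀ h, 0 < h → h ≤ h₀ → ∀ S, 0 ≤ S → (∀ h', 0 < h' → h' ≤ h → F h' ≤ S) →
      F h ≤ S / 2 + M * h ^ 2) (hM : 0 ≤ M) {h : ℝ} (hh : 0 < h) (hh0 : h ≤ h₀) :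
    F h ≤ 2 * M * h ^ 2 := by
  have hbdd : BddAbove (F '' Ioc 0 h) := ⟨B, by rintro _ ⟨x, _, rfl⟩; exact hB x⟩
  have hne : (F '' Ioc 0 h).Nonempty := ⟨_, h, ⟨hh, le_rfl⟩, rfl⟩
  set S := sSup (F '' Ioc 0 h) with hSdef
  have hle : ∀ x, 0 < x → x ≤ h → F x ≤ S := fun x hx hxh => le_csSup hbdd ⟨x, ⟨hx, hxh⟩, rfl⟩
  have hS0 : 0 ≤ S := (hF0 h).trans (hle h hh le_rfl)
  have hSle : S ≤ S / 2 + M * h ^ 2 := by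
    refine csSup_le hne ?_
    rintro _ ⟨x, hx, rfl⟩
    refine (H x hx.1 (hx.2.trans hh0) S hS0 fun y hy hyx => hle y hy (hyx.trans hx.2)).trans ?_
    have : x ^ 2 ≤ h ^ 2 := pow_le_pow_left₀ hx.1.le hx.2 2
    nlinarith
  have := hle h hh le_rfl
  linarith

end Pointwise

section Translates

variable {E F : Type*} [NormedAddCommGroup E] [NormedSpace ℝ E] [FiniteDimensional ℝ E]
  [MeasurableSpace E] [BorelSpace E] {μ : Measure E} [μ.IsAddHaarMeasure]
  [NormedAddCommGroup F] [NormedSpace ℝ F]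

theorem sq_norm_sub_le (a b : F) : ‖a - b‖ ^ 2 ≤ 2 * (‖a‖ ^ 2 + ‖b‖ ^ 2) := by
  have := norm_sub_le a b
  nlinarith [norm_nonneg (a - b), sq_nonneg (‖a‖ - ‖b‖)]

theorem integrable_sq_translate_sub {X : E → F} (hX : StronglyMeasurable X)
    (h2 : Integrable (fun z => ‖X z‖ ^ 2) μ) (v v' : E) :
    Integrable (fun z => ‖X (z + v) - X (z + v')‖ ^ 2) μ := by
  refine (((h2.comp_add_right v).add (h2.comp_add_right v')).const_mul 2).mono'
    (((hX.comp_measurable (measurable_add_const v)).sub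
      (hX.comp_measurable (measurable_add_const v'))).norm.pow 2).aestronglyMeasurable
    (Eventually.of_forall fun z => ?_)
  rw [Real.norm_of_nonneg (sq_nonneg _)]
  exact sq_norm_sub_le _ _

theorem integral_sq_translate_sub_le {X : E → F} (hX : StronglyMeasurable X)
    (h2 : Integrable (fun z => ‖X z‖ ^ 2) μ) (v v' : E) :
    ∫ z, ‖X (z + v) - X (z + v')‖ ^ 2 ∂μ ≤ 4 * ∫ z, ‖X z‖ ^ 2 ∂μ := by
  calc _ ≤ ∫ z, 2 * (‖X (z + v)‖ ^ 2 + ‖X (z + v')‖ ^ 2) ∂μ :=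
        integral_mono (integrable_sq_translate_sub hX h2 v v')
          (((h2.comp_add_right v).add (h2.comp_add_right v')).const_mul 2)
          fun z => sq_norm_sub_le _ _
    _ = _ := by
      rw [integral_const_mul, integral_add (h2.comp_add_right v) (h2.comp_add_right v'),
        integral_add_right_eq_self (μ := μ) (fun z => ‖X z‖ ^ 2) v,
        integral_add_right_eq_self (μ := μ) (fun z => ‖X z‖ ^ 2) v']
      ring

/-- Weighted difference quotients may be translated, up to the Lipschitz constant of the weight. -/
theorem integral_weight_translate_sub_le {X : E → F} (hX : StronglyMeasurable X)
    (h2 : Integrable (fun z => ‖X z‖ ^ 2) μ) {η : E → ℝ} (hη : Continuous η) {M L : ℝ}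
    (hM : ∀ z, ‖η z‖ ≤ M) (hL : ∀ z v, |η (z + v) - η z| ≤ L * ‖v‖) (v v' : E) :
    ∫ z, η z ^ 2 * ‖X (z + (v + v')) - X (z + v)‖ ^ 2 ∂μ
      ≤ 2 * ∫ z, η z ^ 2 * ‖X (z + v') - X z‖ ^ 2 ∂μ
        + 8 * (L * ‖v‖) ^ 2 * ∫ z, ‖X z‖ ^ 2 ∂μ := by
  have hi := integrable_sq_translate_sub hX h2 v' 0
  simp only [add_zero] at hi
  have hb : ∀ z, ‖η z ^ 2‖ ≤ M ^ 2 := fun z => by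
    rw [norm_pow]; exact pow_le_pow_left₀ (norm_nonneg _) (hM z) 2
  have hwi : Integrable (fun z => η z ^ 2 * ‖X (z + v') - X z‖ ^ 2) μ :=
    hi.bdd_mul (c := M ^ 2) (hη.pow 2).aestronglyMeasurable (Eventually.of_forall hb)
  calc ∫ z, η z ^ 2 * ‖X (z + (v + v')) - X (z + v)‖ ^ 2 ∂μ
      = ∫ z, η (z - v) ^ 2 * ‖X (z + v') - X z‖ ^ 2 ∂μ := by
        rw [← integral_add_right_eq_self (μ := μ)
          (fun z => η (z - v) ^ 2 * ‖X (z + v') - X z‖ ^ 2) v]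
        refine integral_congr_ae (Eventually.of_forall fun z => ?_)
        simp only [add_sub_cancel_right, add_assoc]
    _ ≤ ∫ z, (2 * (η z ^ 2 * ‖X (z + v') - X z‖ ^ 2)
          + 2 * (L * ‖v‖) ^ 2 * ‖X (z + v') - X z‖ ^ 2) ∂μ := by
        refine integral_mono ?_ ((hwi.const_mul 2).add (hi.const_mul _)) fun z => ?_
        · exact hi.bdd_mul (c := M ^ 2) ((hη.comp (by fun_prop)).pow 2).aestronglyMeasurable
            (Eventually.of_forall fun z => hb _)
        · have h1 := hL (z - v) v
          rw [sub_add_cancel] at h1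
          have h3 : (η z - η (z - v)) ^ 2 ≤ (L * ‖v‖) ^ 2 := sq_le_sq' (by
            have := neg_abs_le (η z - η (z - v)); linarith) (le_of_abs_le h1)
          have h4 : η (z - v) ^ 2 ≤ 2 * η z ^ 2 + 2 * (L * ‖v‖) ^ 2 := by
            nlinarith [sq_nonneg (2 * η z - η (z - v))]
          have := mul_le_mul_of_nonneg_right h4 (sq_nonneg ‖X (z + v') - X z‖)
          simp only
          linarith
    _ ≤ _ := by
        rw [integral_add (hwi.const_mul 2) (hi.const_mul _), integral_const_mul,
          integral_const_mul]
        have h5 := integral_sq_translate_sub_le hX h2 v' 0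
        simp only [add_zero] at h5
        have := mul_le_mul_of_nonneg_left h5 (by positivity : 0 ≤ 2 * (L * ‖v‖) ^ 2)
        linarith

/-- A compactly supported `C¹` function is bounded and Lipschitz. -/
theorem exists_bound_lipschitz {η : E → ℝ} (hη : ContDiff ℝ 1 η) (hc : HasCompactSupport η) :
    ∃ M, 0 ≤ M ∧ (∀ z, ‖η z‖ ≤ M) ∧ (∀ z, ‖fderiv ℝ η z‖ ≤ M) ∧
      ∀ z v, |η (z + v) - η z| ≤ M * ‖v‖ := by
  obtain ⟨M, hM⟩ := hc.exists_bound_of_continuous hη.continuous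
  obtain ⟨L, hL⟩ := (hc.fderiv ℝ).exists_bound_of_continuous
    (hη.continuous_fderiv (by norm_num))
  have hM0 : 0 ≤ M := (norm_nonneg _).trans (hM 0)
  refine ⟨max M L, le_max_of_le_left hM0, fun z => (hM z).trans (le_max_left _ _),
    fun z => (hL z).trans (le_max_right _ _), fun z v => ?_⟩
  have := Convex.norm_image_sub_le_of_norm_fderiv_le (𝕜 := ℝ) (f := η) (s := univ)
    (C := max M L) (x := z) (y := z + v)
    (fun x _ => hη.differentiable (by norm_num) x) (fun x _ => (hL x).trans (le_max_right _ _))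
    convex_univ (mem_univ _) (mem_univ _)
  simpa using this

end Translates

end

/-! ### Uniform bounds for the difference quotients of `V(∇u)`. -/

section
variable {n N : ℕ} {φ : ℝ → ℝ} {c₀ c₁ : ℝ} {D K U : Set (SpaceTime n)} {h₀ : ℝ}
  {u : SpaceTime n → EuclideanSpace ℝ (Fin N)} {G : SpaceTime n → Mat n N}

/-- Pointwise lower bound for the main part of the renormalized identity with `g = 1`. -/
theorem renormIntegrand_one_le {C h : ℝ} (hh : 0 < h) {η : SpaceTime n → ℝ}
    (hη : ContDiff ℝ 1 η) {M : ℝ} (hη0 : ∀ z, 0 ≤ η z) (hM : ∀ z, ‖η z‖ ≤ M)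
    (hL : ∀ z, ‖fderiv ℝ η z‖ ≤ M) {A V G : SpaceTime n → Mat n N} (hC : 0 < C)
    (hmono : ∀ z z', ‖V z - V z'‖ ^ 2 ≤ C * inner ℝ (A z - A z') (G z - G z'))
    (z : SpaceTime n) :
    h⁻¹ ^ 2 * C⁻¹ * (η z ^ 2 * ∑ j, ‖V (z + h • sdir j) - V z‖ ^ 2) ≤
      - renormIntegrand (fun x => x) (fun _ => 1) (fun z => η z ^ 2) (tdir n) sdir (gradAvg h G)
        (gradDiff h G) (gradDiff h A) z
      + M ^ 2 * ∑ j, ‖segAvg G (h • sdir j) z‖ ^ 2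
      + 2 * n * M * ∑ j, (η z * h⁻¹) *
          (‖A (z + h • sdir j) - A z‖ * ‖segAvg G (h • sdir j) z‖) := by
  have hM0 : 0 ≤ M := (norm_nonneg _).trans (hM z)
  have hd : ∀ v, fderiv ℝ (fun z => η z ^ 2) z v = 2 * η z * fderiv ℝ η z v := fun v => by
    have := ((hη.differentiable (by norm_num) z).hasFDerivAt.pow 2).fderiv
    rw [this]; simp
  have hv : ∀ v : SpaceTime n, ‖v‖ ≤ 1 → |fderiv ℝ η z v| ≤ M := fun v hv =>
    ((fderiv ℝ η z).le_opNorm v).trans (by nlinarith [hL z, norm_nonneg (fderiv ℝ η z), norm_nonneg v])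
  have htd : ‖tdir n‖ ≤ 1 := by simp [tdir, Prod.norm_def]
  have hηz : η z ≤ M := (le_abs_self _).trans (hM z)
  -- the three terms
  have t1 : 1 / 2 * ‖gradAvg h G z‖ ^ 2 * fderiv ℝ (fun z => η z ^ 2) z (tdir n)
      ≤ M ^ 2 * ∑ j, ‖segAvg G (h • sdir j) z‖ ^ 2 := by
    have e1 : ‖gradAvg h G z‖ ^ 2 ≤ ∑ j, ‖segAvg G (h • sdir j) z‖ ^ 2 := by
      rw [gradAvg, sq_norm_eq_sum_row]
      simp only [row_ofRows]
      exact Finset.sum_le_sum fun j _ => by gcongr; exact norm_row_le _ _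
    have e2 : η z * fderiv ℝ η z (tdir n) ≤ M * M :=
      (mul_le_mul_of_nonneg_left (le_of_abs_le (hv _ htd)) (hη0 z)).trans
        (mul_le_mul_of_nonneg_right hηz hM0)
    rw [hd]
    calc _ = ‖gradAvg h G z‖ ^ 2 * (η z * fderiv ℝ η z (tdir n)) := by ring
      _ ≤ ‖gradAvg h G z‖ ^ 2 * (M * M) := mul_le_mul_of_nonneg_left e2 (sq_nonneg _)
      _ ≤ (∑ j, ‖segAvg G (h • sdir j) z‖ ^ 2) * (M * M) := by gcongr
      _ = _ := by ring
  have t2 : h⁻¹ ^ 2 * C⁻¹ * ∑ j, ‖V (z + h • sdir j) - V z‖ ^ 2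
      ≤ ∑ i, inner ℝ (gradDiff h A i z) (gradDiff h G i z) := by
    rw [sum_inner_gradDiff, mul_assoc, Finset.mul_sum]
    gcongr with j
    rw [inv_mul_le_iff₀ hC]
    exact hmono _ _
  have t3 : ∀ i, -(2 * η z * fderiv ℝ η z (sdir i) *
        inner ℝ (gradDiff h A i z) (gradAvg h G z))
      ≤ 2 * M * ∑ j, (η z * h⁻¹) *
          (‖A (z + h • sdir j) - A z‖ * ‖segAvg G (h • sdir j) z‖) := by
    intro i
    have e1 := abs_inner_gradDiff_ofRows_le hh A (fun j => segAvg G (h • sdir j) z) i z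
    refine (neg_le_abs _).trans ?_
    rw [abs_mul, abs_mul, abs_of_nonneg (by linarith [hη0 z] : 0 ≤ 2 * η z)]
    calc _ ≤ 2 * η z * M * ∑ j, h⁻¹ *
          (‖A (z + h • sdir j) - A z‖ * ‖segAvg G (h • sdir j) z‖) := by
          gcongr
          · exact mul_nonneg (by linarith [hη0 z]) hM0
          · linarith [hη0 z]
          · exact hv _ (norm_sdir i).le
          · exact e1
      _ = _ := by
        rw [Finset.mul_sum, Finset.mul_sum]
        exact Finset.sum_congr rfl fun j _ => by ring
  have t4 := Finset.sum_le_sum fun i (_ : i ∈ (Finset.univ : Finset (Fin n))) => t3 i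
  rw [Finset.sum_const, Finset.card_univ, Fintype.card_fin, nsmul_eq_mul,
    Finset.sum_neg_distrib] at t4
  have e : renormIntegrand (fun x => x) (fun _ => 1) (fun z => η z ^ 2) (tdir n) sdir (gradAvg h G)
        (gradDiff h G) (gradDiff h A) z
      = 1 / 2 * ‖gradAvg h G z‖ ^ 2 * fderiv ℝ (fun z => η z ^ 2) z (tdir n)
        - (η z ^ 2 * ∑ i, inner ℝ (gradDiff h A i z) (gradDiff h G i z)
          + ∑ i, 2 * η z * fderiv ℝ η z (sdir i) *
            inner ℝ (gradDiff h A i z) (gradAvg h G z)) := by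
    rw [Finset.mul_sum, ← Finset.sum_add_distrib]
    simp only [renormIntegrand, inner_add_right, real_inner_smul_right, deriv_const', hd]
    congr 1
    exact Finset.sum_congr rfl fun i _ => by ring
  rw [e]
  have t5 := mul_le_mul_of_nonneg_left t2 (sq_nonneg (η z))
  linarith

theorem norm_segAvg_le {X F : Type*} [NormedAddCommGroup X] [NormedSpace ℝ X]
    [FiniteDimensional ℝ X] [MeasurableSpace X] [BorelSpace X]
    [NormedAddCommGroup F] [NormedSpace ℝ F] (f : X → F) (v z : X) :
    ‖segAvg f v z‖ ≤ ∫ r in Ioc (0 : ℝ) 1, ‖f (z + r • v)‖ := by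
  rw [segAvg_eq]; exact norm_integral_le_integral_norm _

/-- The function bounding the error terms of the renormalized identity. -/
noncomputable def segError (η : SpaceTime n → ℝ) (V : SpaceTime n → Mat n N) (ε h : ℝ)
    (v : SpaceTime n) (p : ℝ × SpaceTime n) : ℝ :=
  ε * ((η p.2 * h⁻¹) ^ 2 * (‖V (p.2 + p.1 • v) - V p.2‖ ^ 2
      + ‖V (p.2 + v) - V (p.2 + p.1 • v)‖ ^ 2))
    + ε⁻¹ * (‖V p.2‖ ^ 2 + ‖V (p.2 + v)‖ ^ 2 + ‖V (p.2 + p.1 • v)‖ ^ 2)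

theorem integrable_segError {η : SpaceTime n → ℝ} (hη : Continuous η) {M : ℝ}
    (hM : ∀ z, ‖η z‖ ≤ M) {V : SpaceTime n → Mat n N} (hV : StronglyMeasurable V)
    (h2 : Integrable fun z => ‖V z‖ ^ 2) (ε h : ℝ) (v : SpaceTime n) :
    Integrable (segError η V ε h v) ((volume.restrict (Ioc (0 : ℝ) 1)).prod volume) := by
  have hVm : StronglyMeasurable fun z => ‖V z‖ ^ 2 := (hV.norm.measurable.pow_const 2).stronglyMeasurable
  have i1 : Integrable (fun p : ℝ × SpaceTime n => ‖V (p.2 + p.1 • v)‖ ^ 2)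
      ((volume.restrict (Ioc (0 : ℝ) 1)).prod volume) := integrable_segment hVm h2 v
  have i2 : Integrable (fun p : ℝ × SpaceTime n => ‖V p.2‖ ^ 2)
      ((volume.restrict (Ioc (0 : ℝ) 1)).prod volume) := h2.comp_snd _
  have i3 : Integrable (fun p : ℝ × SpaceTime n => ‖V (p.2 + v)‖ ^ 2)
      ((volume.restrict (Ioc (0 : ℝ) 1)).prod volume) := (h2.comp_add_right v).comp_snd _
  have m1 : StronglyMeasurable fun p : ℝ × SpaceTime n => V (p.2 + p.1 • v) :=
    hV.comp_measurable (measurable_shear v)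
  have m2 : StronglyMeasurable fun p : ℝ × SpaceTime n => V p.2 := hV.comp_measurable measurable_snd
  have m3 : StronglyMeasurable fun p : ℝ × SpaceTime n => V (p.2 + v) :=
    hV.comp_measurable (by fun_prop)
  have j : Integrable (fun p : ℝ × SpaceTime n => ‖V (p.2 + p.1 • v) - V p.2‖ ^ 2
      + ‖V (p.2 + v) - V (p.2 + p.1 • v)‖ ^ 2)
      ((volume.restrict (Ioc (0 : ℝ) 1)).prod volume) := by
    refine ((((i1.add i2).const_mul 2).add ((i3.add i1).const_mul 2))).mono'
      (((m1.sub m2).norm.pow 2).add ((m3.sub m1).norm.pow 2)).aestronglyMeasurable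
      (Eventually.of_forall fun p => ?_)
    rw [Real.norm_of_nonneg (by positivity)]
    exact add_le_add (sq_norm_sub_le _ _) (sq_norm_sub_le _ _)
  refine ((j.bdd_mul (c := (M * |h⁻¹|) ^ 2) ?_ ?_).const_mul ε).add (((i2.add i3).add i1).const_mul ε⁻¹)
  · exact (((hη.comp continuous_snd).mul continuous_const).pow 2).aestronglyMeasurable
  · refine Eventually.of_forall fun p => ?_
    rw [norm_pow, norm_mul, Real.norm_eq_abs h⁻¹]
    gcongr
    exact hM _

theorem integral_combination {X : Type*} [MeasurableSpace X] {μ : Measure X}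
    {f₁ f₂ g₁ g₂ g₃ : X → ℝ} (hf₁ : Integrable f₁ μ) (hf₂ : Integrable f₂ μ)
    (hg₁ : Integrable g₁ μ) (hg₂ : Integrable g₂ μ) (hg₃ : Integrable g₃ μ) (k l : ℝ) :
    ∫ z, (k * f₁ z + k * f₂ z + l * (g₁ z + g₂ z + g₃ z)) ∂μ
      = k * ∫ z, f₁ z ∂μ + k * ∫ z, f₂ z ∂μ
        + l * (∫ z, g₁ z ∂μ + ∫ z, g₂ z ∂μ + ∫ z, g₃ z ∂μ) := by
  have i1 : Integrable (fun z => k * f₁ z + k * f₂ z) μ := (hf₁.const_mul k).add (hf₂.const_mul k)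
  have i2 : Integrable (fun z => g₁ z + g₂ z) μ := hg₁.add hg₂
  have i3 : Integrable (fun z => g₁ z + g₂ z + g₃ z) μ := i2.add hg₃
  rw [integral_add i1 (i3.const_mul l), integral_add (hf₁.const_mul k) (hf₂.const_mul k),
    integral_const_mul, integral_const_mul, integral_const_mul, integral_add i2 hg₃,
    integral_add hg₁ hg₂]

theorem integral_sum_combination {X : Type*} [MeasurableSpace X] {μ : Measure X}
    {I : X → ℝ} {s e : Fin n → X → ℝ} (hI : Integrable I μ) (hs : ∀ j, Integrable (s j) μ)
    (he : ∀ j, Integrable (e j) μ) (a b : ℝ) :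
    ∫ z, (- I z + a * ∑ j, s j z + b * ∑ j, e j z) ∂μ
      = - ∫ z, I z ∂μ + a * ∑ j, ∫ z, s j z ∂μ + b * ∑ j, ∫ z, e j z ∂μ := by
  have i1 : Integrable (fun z => ∑ j, s j z) μ := integrable_finsetSum _ fun j _ => hs j
  have i2 : Integrable (fun z => ∑ j, e j z) μ := integrable_finsetSum _ fun j _ => he j
  have i0 : Integrable (fun z => - I z) μ := hI.neg
  have i3 : Integrable (fun z => - I z + a * ∑ j, s j z) μ := i0.add (i1.const_mul a)
  rw [integral_add i3 (i2.const_mul b), integral_add i0 (i1.const_mul a), integral_const_mul,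
    integral_const_mul, integral_finsetSum _ fun j _ => hs j,
    integral_finsetSum _ fun j _ => he j, integral_neg]

/-- Arithmetic of the absorption, after multiplication by `h² C₁`: the factor of `S` becomes `3 κ
ε`, and `ε` is chosen to make it at most one half. -/
theorem le_of_scaled_le {F S B' B h C₁ C₂ M ε κ I : ℝ} {n : ℝ} (hh : 0 < h) (hC₁ : 0 < C₁)
    (hS : 0 ≤ S) (hκ0 : 0 ≤ κ) (hI : I = 0)
    (hκ : κ = 2 * n * M * n * C₂ * C₁) (hε : ε = (6 * (κ + 1))⁻¹)
    (H : h⁻¹ ^ 2 * C₁⁻¹ * F ≤ -I + M ^ 2 * (n * B') + 2 * n * M * C₂ *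
      (n * (ε * h⁻¹ ^ 2 * (3 * S) + (8 * ε * M ^ 2 + 3 * ε⁻¹) * B))) :
    F ≤ S / 2 + (C₁ * (M ^ 2 * (n * B')) + κ * ((8 * ε * M ^ 2 + 3 * ε⁻¹) * B)) * h ^ 2 := by
  have h1 := mul_le_mul_of_nonneg_left H (by positivity : 0 ≤ h ^ 2 * C₁)
  have e1 : h ^ 2 * C₁ * (h⁻¹ ^ 2 * C₁⁻¹ * F) = F := by field_simp
  have e2 : h ^ 2 * C₁ * (-I + M ^ 2 * (n * B') + 2 * n * M * C₂ *
      (n * (ε * h⁻¹ ^ 2 * (3 * S) + (8 * ε * M ^ 2 + 3 * ε⁻¹) * B)))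
      = (C₁ * (M ^ 2 * (n * B')) + κ * ((8 * ε * M ^ 2 + 3 * ε⁻¹) * B)) * h ^ 2
        + κ * ε * (3 * S) * (h ^ 2 * h⁻¹ ^ 2) := by rw [hI, hκ]; ring
  have e3 : h ^ 2 * h⁻¹ ^ 2 = 1 := by rw [← mul_pow, mul_inv_cancel₀ hh.ne', one_pow]
  have e4 : κ * ε ≤ 1 / 6 := by
    rw [hε, ← div_eq_mul_inv, div_le_iff₀ (by positivity)]; linarith
  rw [e1, e2, e3, mul_one] at h1
  nlinarith

/-- The point `z + r h eⱼ` splits the segment into pieces of lengths `r h` and `(1 - r) h`. The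
first contributes `S`. The second starts away from `z`; moving the weight there costs a factor 2 and
an error of order `h²` from the Lipschitz bound of `η`. This accounts for `3 S`. -/
theorem integral_segError_le {η : SpaceTime n → ℝ} (hη : Continuous η) {M : ℝ}
    (hM : ∀ z, ‖η z‖ ≤ M) (hL : ∀ z v, |η (z + v) - η z| ≤ M * ‖v‖)
    {V : SpaceTime n → Mat n N}
    (hV : StronglyMeasurable V) (h2 : Integrable fun z => ‖V z‖ ^ 2) {ε h : ℝ} (hε : 0 < ε)
    (hh : 0 < h) (j : Fin n) {S : ℝ}
    (hS : ∀ h', 0 ≤ h' → h' ≤ h →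
      ∫ z, η z ^ 2 * ‖V (z + h' • sdir j) - V z‖ ^ 2 ≤ S) :
    ∫ p, segError η V ε h (h • sdir j) p ∂((volume.restrict (Ioc (0 : ℝ) 1)).prod volume)
      ≤ ε * h⁻¹ ^ 2 * (3 * S) + (8 * ε * M ^ 2 + 3 * ε⁻¹) * ∫ z, ‖V z‖ ^ 2 := by
  set B := ∫ z, ‖V z‖ ^ 2 with hB
  have hB0 : 0 ≤ B := integral_nonneg fun z => sq_nonneg _
  have hi := integrable_segError hη hM hV h2 ε h (h • sdir j)
  rw [integral_prod _ hi]
  have key : ∀ r ∈ Ioc (0 : ℝ) 1, ∫ z, segError η V ε h (h • sdir j) (r, z)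
      ≤ ε * h⁻¹ ^ 2 * (3 * S) + (8 * ε * M ^ 2 + 3 * ε⁻¹) * B := by
    intro r hr
    have hwi : ∀ v v' : SpaceTime n,
        Integrable fun z => η z ^ 2 * ‖V (z + v) - V (z + v')‖ ^ 2 := fun v v' =>
      (integrable_sq_translate_sub hV h2 v v').bdd_mul (c := M ^ 2)
        (hη.pow 2).aestronglyMeasurable (Eventually.of_forall fun z => by
          rw [norm_pow]; exact pow_le_pow_left₀ (norm_nonneg _) (hM z) 2)
    have w1 := hwi (r • h • sdir j) 0
    simp only [add_zero] at w1
    have w2 := hwi (h • sdir j) (r • h • sdir j)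
    have e : ∀ z, segError η V ε h (h • sdir j) (r, z)
        = ε * h⁻¹ ^ 2 * (η z ^ 2 * ‖V (z + r • h • sdir j) - V z‖ ^ 2)
          + ε * h⁻¹ ^ 2 * (η z ^ 2 * ‖V (z + h • sdir j) - V (z + r • h • sdir j)‖ ^ 2)
          + ε⁻¹ * (‖V z‖ ^ 2 + ‖V (z + h • sdir j)‖ ^ 2 + ‖V (z + r • h • sdir j)‖ ^ 2) :=
      fun z => by simp only [segError]; ring
    simp only [e]
    rw [integral_combination w1 w2 h2 (h2.comp_add_right _) (h2.comp_add_right _),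
      integral_add_right_eq_self (μ := volume) (fun z => ‖V z‖ ^ 2) (h • sdir j),
      integral_add_right_eq_self (μ := volume) (fun z => ‖V z‖ ^ 2) (r • h • sdir j)]
    have a1 := hS (r * h) (mul_nonneg hr.1.le hh.le) (by nlinarith [hr.2])
    have a2 := hS ((1 - r) * h) (mul_nonneg (by linarith [hr.2]) hh.le) (by nlinarith [hr.1])
    have a3 := integral_weight_translate_sub_le (μ := volume) hV h2 hη hM hL (r • h • sdir j)
      (((1 - r) * h) • (sdir j : SpaceTime n))
    have e2 : r • h • (sdir j : SpaceTime n) + ((1 - r) * h) • sdir j = h • sdir j := by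
      rw [smul_smul, ← add_smul]; congr 1; ring
    rw [e2, norm_smul, norm_smul, norm_sdir, Real.norm_of_nonneg hr.1.le,
      Real.norm_of_nonneg hh.le] at a3
    rw [← smul_smul] at a1
    have hr2 : (M * (r * (h * 1))) ^ 2 ≤ M ^ 2 * h ^ 2 := by
      rw [mul_pow]
      have : (r * (h * 1)) ^ 2 ≤ h ^ 2 := by
        refine pow_le_pow_left₀ (by have := hr.1; positivity) ?_ 2
        nlinarith [hr.2]
      gcongr
    have a4 := mul_le_mul_of_nonneg_right hr2 hB0
    have a5 : ∫ z, η z ^ 2 * ‖V (z + h • sdir j) - V (z + r • h • sdir j)‖ ^ 2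
        ≤ 2 * S + 8 * (M ^ 2 * h ^ 2) * B := by linarith
    have k0 : 0 ≤ ε * h⁻¹ ^ 2 := by positivity
    have b1 := mul_le_mul_of_nonneg_left a1 k0
    have b2 := mul_le_mul_of_nonneg_left a5 k0
    have e3 : ε * h⁻¹ ^ 2 * (2 * S + 8 * (M ^ 2 * h ^ 2) * B)
        = ε * h⁻¹ ^ 2 * (2 * S) + 8 * ε * M ^ 2 * B := by field_simp
    rw [e3] at b2
    linarith
  calc _ ≤ ∫ r in Ioc (0 : ℝ) 1, (ε * h⁻¹ ^ 2 * (3 * S) + (8 * ε * M ^ 2 + 3 * ε⁻¹) * B) :=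
        setIntegral_mono_on hi.integral_prod_left (integrable_const _) measurableSet_Ioc key
    _ = _ := by simp

/-- Weighted `L²` bound for the difference quotients of `V(∇u)`. -/
theorem exists_integral_sq_diff_le (hS : IsMeasSolution φ D u G) (hφ : IsOrlicz φ c₀ c₁)
    (hc₀ : 0 < c₀) (hR : IsRegion D K U h₀) {η : SpaceTime n → ℝ} (hη : ContDiff ℝ 1 η)
    (hηc : HasCompactSupport η) (hηU : tsupport η ⊆ U) (hη0 : ∀ z, 0 ≤ η z) :
    ∃ M, ∀ h, 0 < h → h ≤ h₀ → ∀ j, ∫ z, η z ^ 2 *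
      ‖fieldV φ (K.indicator G (z + h • sdir j)) - fieldV φ (K.indicator G z)‖ ^ 2 ≤ M * h ^ 2 := by
  obtain ⟨M, hM0, hM, hM', hL⟩ := exists_bound_lipschitz hη hηc
  obtain ⟨C₁, hC₁, H₁⟩ := exists_sq_fieldV_sub_le_inner c₀ c₁ hc₀
  obtain ⟨C₂, hC₂, H₂⟩ := exists_mul_fluxA_sub_mul_le_young c₀ c₁ hc₀
  have hGm := hS.meas_ind hR
  have hGi := hS.integrable_G_sq hR
  have hG2 := lintegral_sq_lt_top hGi
  have hVi := hS.integrable_V_sq hR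
  set Gb := K.indicator G with hGb
  set V : SpaceTime n → Mat n N := fun z => fieldV φ (Gb z) with hV
  have hVm : StronglyMeasurable V := (measurable_fieldV.comp hGm.measurable).stronglyMeasurable
  set B := ∫ z, ‖V z‖ ^ 2 with hB
  set B' := ∫ z, ‖Gb z‖ ^ 2 with hB'
  have hB0 : 0 ≤ B := integral_nonneg fun z => sq_nonneg _
  have hB0' : 0 ≤ B' := integral_nonneg fun z => sq_nonneg _
  have hwi : ∀ v : SpaceTime n, Integrable fun z => η z ^ 2 * ‖V (z + v) - V z‖ ^ 2 := fun v => by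
    have := (integrable_sq_translate_sub hVm hVi v 0).bdd_mul (c := M ^ 2)
        (hη.continuous.pow 2).aestronglyMeasurable (Eventually.of_forall fun z => by
          rw [Pi.pow_apply, norm_pow]; exact pow_le_pow_left₀ (norm_nonneg _) (hM z) 2)
    simpa using this
  set Fj : Fin n → ℝ → ℝ := fun j h => ∫ z, η z ^ 2 * ‖V (z + h • sdir j) - V z‖ ^ 2 with hFj
  have hFj0 : ∀ j h, 0 ≤ Fj j h := fun j h => integral_nonneg fun z => by positivity
  have hFjB : ∀ j h, Fj j h ≤ M ^ 2 * (4 * B) := fun j h => by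
    have h5 := integral_sq_translate_sub_le (μ := volume) hVm hVi (h • sdir j) 0
    have h6 := integrable_sq_translate_sub (μ := volume) hVm hVi (h • sdir j) 0
    simp only [add_zero] at h5 h6
    calc Fj j h ≤ ∫ z, M ^ 2 * ‖V (z + h • sdir j) - V z‖ ^ 2 := by
          refine integral_mono (hwi _) (h6.const_mul _) fun z => ?_
          have : η z ^ 2 ≤ M ^ 2 := pow_le_pow_left₀ (hη0 z) ((le_abs_self _).trans (hM z)) 2
          simp only
          gcongr
      _ ≤ _ := by rw [integral_const_mul]; gcongr
  set F : ℝ → ℝ := fun h => ∑ j, Fj j h with hF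
  have hle : ∀ j h, Fj j h ≤ F h := fun j h =>
    Finset.single_le_sum (f := fun j => Fj j h) (fun i _ => hFj0 i h) (Finset.mem_univ j)
  -- `κ` is the total factor in front of the flux error after multiplication by `h² C₁`: `2 n M`
  -- from the gradient of `η²`, `C₂` from Young's inequality, `n` from the sum over directions, and
  -- `C₁` from monotonicity.
  set κ : ℝ := 2 * n * M * n * C₂ * C₁ with hκ
  have hκ0 : 0 ≤ κ := by positivity
  set ε : ℝ := (6 * (κ + 1))⁻¹ with hε
  have hε0 : 0 < ε := by positivity
  set M₁ : ℝ := C₁ * (M ^ 2 * (n * B')) + κ * ((8 * ε * M ^ 2 + 3 * ε⁻¹) * B) with hM₁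
  have hM₁0 : 0 ≤ M₁ := by positivity
  have main : ∀ h, 0 < h → h ≤ h₀ → ∀ S, 0 ≤ S → (∀ h', 0 < h' → h' ≤ h → F h' ≤ S) →
      F h ≤ S / 2 + M₁ * h ^ 2 := by
    intro h hh hhh S hS0 hS'
    have hS'' : ∀ j h', 0 ≤ h' → h' ≤ h → Fj j h' ≤ S := by
      intro j h' h1 h2
      rcases h1.eq_or_lt with rfl | h1
      · simpa [hFj] using hS0
      · exact (hle j h').trans (hS' h' h1 h2)
    -- The weight `g = 1` removes the term with `g'`, so no information on second derivatives is
    -- needed yet.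
    obtain ⟨hI, hI0⟩ := integral_renormIntegrand_gradAvg hS hφ hc₀ hR hh hhh
      (Γ := fun x => x) (g := fun _ => 1) hasDerivAt_id rfl contDiff_const (M := 1) (by simp)
      (by simp) (ζ := fun z => η z ^ 2) (hη.pow 2) (by
        simp only [sq]; exact hηc.mul_right) ((closure_mono fun z hz => by
          contrapose! hz; simp only [Function.mem_support, not_not] at hz ⊢
          simp [hz]).trans hηU)
    have hsegI : ∀ j : Fin n, Integrable fun z => ‖segAvg Gb (h • sdir j) z‖ ^ 2 := fun j =>
      integrable_sq_of_lintegral (stronglyMeasurable_segAvg hGm _).aestronglyMeasurable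
        ((lintegral_sq_segAvg_le hGm _).trans_lt hG2)
    have hsegB : ∀ j : Fin n, ∫ z, ‖segAvg Gb (h • sdir j) z‖ ^ 2 ≤ B' := fun j => by
      have h1 := lintegral_sq_segAvg_le (μ := volume) hGm (h • sdir j)
      have e : ∀ f : SpaceTime n → Mat n N, StronglyMeasurable f →
          ∫ z, ‖f z‖ ^ 2 = (∫⁻ z, ‖f z‖ₑ ^ 2).toReal := fun f hf => by
        rw [integral_eq_lintegral_of_nonneg_ae (Eventually.of_forall fun z => sq_nonneg _)
          (hf.norm.measurable.pow_const 2).aestronglyMeasurable]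
        congr 1
        refine lintegral_congr fun z => ?_
        rw [ENNReal.ofReal_pow (norm_nonneg _), ofReal_norm]
      rw [e _ (stronglyMeasurable_segAvg hGm _), hB', e _ hGm]
      exact ENNReal.toReal_mono hG2.ne h1
    have herr : ∀ j : Fin n, ∀ᵐ z, (η z * h⁻¹) *
          (‖fluxA φ (Gb (z + h • sdir j)) - fluxA φ (Gb z)‖ * ‖segAvg Gb (h • sdir j) z‖)
        ≤ C₂ * ∫ r in Ioc (0 : ℝ) 1, segError η V ε h (h • sdir j) (r, z) := by
      intro j
      filter_upwards [ae_integrable_segment hGm hG2 (h • sdir j),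
        (integrable_segError hη.continuous hM hVm hVi ε h (h • sdir j)).prod_left_ae] with z h1 h2
      have hx : 0 ≤ η z * h⁻¹ := mul_nonneg (hη0 z) (inv_pos.2 hh).le
      calc _ ≤ (η z * h⁻¹) * (‖fluxA φ (Gb (z + h • sdir j)) - fluxA φ (Gb z)‖ *
              ∫ r in Ioc (0 : ℝ) 1, ‖Gb (z + r • h • sdir j)‖) := by
            gcongr; exact norm_segAvg_le _ _ _
        _ = ∫ r in Ioc (0 : ℝ) 1, (η z * h⁻¹) *
              (‖fluxA φ (Gb (z + h • sdir j)) - fluxA φ (Gb z)‖ * ‖Gb (z + r • h • sdir j)‖) := by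
            rw [integral_const_mul, integral_const_mul]
        _ ≤ ∫ r in Ioc (0 : ℝ) 1, C₂ * segError η V ε h (h • sdir j) (r, z) := by
            refine integral_mono ((h1.norm.const_mul _).const_mul _) (h2.const_mul _) fun r => ?_
            exact H₂ φ hφ n N (Gb z) (Gb (z + h • sdir j)) (Gb (z + r • h • sdir j)) _ ε hx hε0
        _ = _ := integral_const_mul _ _
    have hEi : ∀ j : Fin n, Integrable fun z =>
        ∫ r in Ioc (0 : ℝ) 1, segError η V ε h (h • sdir j) (r, z) := fun j =>
      (integrable_segError hη.continuous hM hVm hVi ε h (h • sdir j)).integral_prod_right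
    have hEb : ∀ j : Fin n, ∫ z, ∫ r in Ioc (0 : ℝ) 1, segError η V ε h (h • sdir j) (r, z)
        ≤ ε * h⁻¹ ^ 2 * (3 * S) + (8 * ε * M ^ 2 + 3 * ε⁻¹) * B := fun j => by
      rw [← integral_prod_symm _ (integrable_segError hη.continuous hM hVm hVi ε h (h • sdir j))]
      exact integral_segError_le hη.continuous hM hL hVm hVi hε0 hh j (hS'' j)
    have hpt : ∀ᵐ z, h⁻¹ ^ 2 * C₁⁻¹ * (∑ j, η z ^ 2 * ‖V (z + h • sdir j) - V z‖ ^ 2) ≤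
        (- renormIntegrand (fun x => x) (fun _ => 1) (fun z => η z ^ 2) (tdir n) sdir
          (gradAvg h Gb) (gradDiff h Gb) (gradDiff h fun z => fluxA φ (Gb z)) z
        + M ^ 2 * ∑ j, ‖segAvg Gb (h • sdir j) z‖ ^ 2)
        + 2 * n * M * C₂ * ∑ j : Fin n,
          ∫ r in Ioc (0 : ℝ) 1, segError η V ε h (h • sdir j) (r, z) := by
      filter_upwards [ae_all_iff.2 herr] with z hz
      rw [← Finset.mul_sum]
      refine (renormIntegrand_one_le hh hη hη0 hM hM' (by linarith : 0 < C₁)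
        (fun z z' => H₁ φ hφ n N _ _) z).trans ?_
      refine add_le_add le_rfl ?_
      rw [mul_assoc (2 * n * M), Finset.mul_sum _ _ C₂]
      exact mul_le_mul_of_nonneg_left (Finset.sum_le_sum fun j _ => hz j) (by positivity)
    have i2 : Integrable (fun z => ∑ j, ‖segAvg Gb (h • sdir j) z‖ ^ 2) :=
      integrable_finsetSum _ fun j _ => hsegI j
    have i3 : Integrable (fun z => ∑ j : Fin n,
        ∫ r in Ioc (0 : ℝ) 1, segError η V ε h (h • sdir j) (r, z)) :=
      integrable_finsetSum _ fun j _ => hEi j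
    have hint := integral_mono_ae ((integrable_finsetSum _ fun j _ => hwi _).const_mul _)
      ((hI.neg.add (i2.const_mul (M ^ 2))).add (i3.const_mul (2 * n * M * C₂))) hpt
    rw [integral_const_mul, integral_finsetSum _ fun j _ => hwi _] at hint
    refine le_of_scaled_le hh (by linarith : 0 < C₁) hS0 hκ0 hI0 hκ hε (hint.trans ?_)
    refine (integral_sum_combination hI hsegI hEi (M ^ 2) (2 * n * M * C₂)).le.trans ?_
    refine add_le_add (add_le_add le_rfl ?_) ?_
    · refine mul_le_mul_of_nonneg_left ?_ (by positivity)
      exact (Finset.sum_le_sum fun j _ => hsegB j).trans (le_of_eq (by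
        rw [Finset.sum_const, Finset.card_univ, Fintype.card_fin, nsmul_eq_mul]))
    · refine mul_le_mul_of_nonneg_left ?_ (by positivity)
      exact (Finset.sum_le_sum fun j _ => hEb j).trans (le_of_eq (by
        rw [Finset.sum_const, Finset.card_univ, Fintype.card_fin, nsmul_eq_mul]))
  refine ⟨2 * M₁, fun h hh hhh j => ?_⟩
  exact (hle j h).trans (le_two_mul_of_half_iterate (B := ∑ j : Fin n, M ^ 2 * (4 * B))
    (fun h => Finset.sum_nonneg fun j _ => hFj0 j h)
    (fun h => Finset.sum_le_sum fun j _ => hFjB j h) main hM₁0 hh hhh)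

end

/-! ### Weak differentiability of `V(∇u)`. -/

section
section WeakLimit

variable {H : Type*} [NormedAddCommGroup H] [InnerProductSpace ℝ H] [CompleteSpace H]

/-- Bounded sequences in a Hilbert space converge weakly along every ultrafilter. -/
theorem exists_tendsto_inner_of_bounded {X : ℕ → H} {M : ℝ} (hX : ∀ k, ‖X k‖ ≤ M)
    (l : Ultrafilter ℕ) :
    ∃ y : H, ∀ f, Tendsto (fun k => inner ℝ (X k) f) l (𝓝 (inner ℝ y f)) := by
  have hc := WeakDual.isCompact_closedBall (𝕜 := ℝ) (E := H) 0 M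
  rw [isCompact_iff_ultrafilter_le_nhds] at hc
  set T : ℕ → WeakDual ℝ H := fun k => StrongDual.toWeakDual (InnerProductSpace.toDual ℝ H (X k))
    with hT
  obtain ⟨ψ, -, hψ⟩ := hc (l.map T) (by
    rw [Ultrafilter.coe_map, le_principal_iff, mem_map]
    refine univ_mem' fun k => ?_
    simp [hT, hX k])
  refine ⟨(InnerProductSpace.toDual ℝ H).symm (WeakDual.toStrongDual ψ), fun f => ?_⟩
  rw [InnerProductSpace.toDual_symm_apply]
  exact ((WeakDual.eval_continuous f).tendsto ψ).comp (tendsto_map'_iff.1 hψ)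

end WeakLimit

section WeakDeriv

variable {E F : Type*} [NormedAddCommGroup E] [NormedSpace ℝ E] [FiniteDimensional ℝ E]
  [MeasurableSpace E] [BorelSpace E] {μ : Measure E} [μ.IsAddHaarMeasure]
  [NormedAddCommGroup F] [InnerProductSpace ℝ F] [CompleteSpace F]

theorem HasWeakDirDeriv.congr_ae {D : Set E} {v : E} {g w w' : E → F}
    (h : HasWeakDirDeriv μ D v g w) (hw : ∀ᵐ z ∂μ, z ∈ D → w z = w' z) :
    HasWeakDirDeriv μ D v g w' := by
  intro θ hθ
  rw [h θ hθ]
  congr 1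
  refine integral_congr_ae ?_
  filter_upwards [hw] with z hz
  by_cases hzD : z ∈ D
  · simp only [hz hzD]
  · rw [image_eq_zero_of_notMem_tsupport fun h => hzD (hθ.2.2 h)]; simp

theorem HasWeakDirDeriv.congr_ae_left {D : Set E} {v : E} {g g' w : E → F}
    (h : HasWeakDirDeriv μ D v g w) (hw : ∀ᵐ z ∂μ, z ∈ D → g z = g' z) :
    HasWeakDirDeriv μ D v g' w := by
  intro θ hθ
  rw [← h θ hθ]
  refine integral_congr_ae ?_
  filter_upwards [hw] with z hz
  by_cases hzD : z ∈ D
  · simp only [hz hzD]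
  · rw [fderiv_eq_zero_of_notMem_tsupport fun h => hzD (hθ.2.2 h)]; simp

theorem HasWeakDirDeriv.mono {D D' : Set E} {v : E} {g w : E → F}
    (h : HasWeakDirDeriv μ D v g w) (hD : D' ⊆ D) : HasWeakDirDeriv μ D' v g w :=
  fun θ hθ => h θ (hθ.mono hD)

theorem HasWeakDirDeriv.ae_eq {U : Set E} (hU : IsOpen U) {v : E} {g w w' : E → F}
    (h : HasWeakDirDeriv μ U v g w) (h' : HasWeakDirDeriv μ U v g w')
    (hw : LocallyIntegrableOn w U μ) (hw' : LocallyIntegrableOn w' U μ) :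
    ∀ᵐ z ∂μ, z ∈ U → w z = w' z := by
  have key := hU.ae_eq_zero_of_integral_contDiff_smul_eq_zero (μ := μ) (hw.sub hw')
    (fun θ hθ hc hs => ?_)
  · filter_upwards [key] with z hz hzU
    exact sub_eq_zero.1 (hz hzU)
  · have hint : ∀ f : E → F, LocallyIntegrableOn f U μ → Integrable (fun z => θ z • f z) μ := by
      intro f hf
      have hI : Integrable ((tsupport θ).indicator f) μ :=
        (integrable_indicator_iff hc.measurableSet).2 (hf.integrableOn_compact_subset hs hc)
      have := IsTestFn.integrable_smul (D := univ) ⟨hθ, hc, subset_univ _⟩ hI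
      refine this.congr (Eventually.of_forall fun z => ?_)
      exact IsTestFn.smul_indicator (K := tsupport θ) ⟨hθ, hc, Subset.rfl⟩ f z
    have e : ∫ z, θ z • (w - w') z ∂μ = ∫ z, θ z • w z ∂μ - ∫ z, θ z • w' z ∂μ := by
      rw [← integral_sub (hint w hw) (hint w' hw')]
      simp only [Pi.sub_apply, smul_sub]
    rw [e, sub_eq_zero, ← neg_inj, ← h θ ⟨hθ, hc, hs⟩, h' θ ⟨hθ, hc, hs⟩]

/-- Bounded difference quotients in `L²` give a weak derivative in `L²`. -/
theorem exists_hasWeakDirDeriv_of_bounded {V : E → F} {v : E} (hV : StronglyMeasurable V)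
    (hVi : Integrable V μ) (hV2 : Integrable (fun z => ‖V z‖ ^ 2) μ) {η : E → ℝ}
    (hη : Continuous η) {Mη : ℝ} (hMη : ∀ z, ‖η z‖ ≤ Mη) {M h₀ : ℝ} (hh₀ : 0 < h₀)
    (hM : ∀ h, 0 < h → h ≤ h₀ → ∫ z, η z ^ 2 * ‖V (z + h • v) - V z‖ ^ 2 ∂μ ≤ M * h ^ 2) :
    ∃ w : E → F, StronglyMeasurable w ∧ ∫⁻ z, ‖w z‖ₑ ^ 2 ∂μ < ⊤ ∧
      HasWeakDirDeriv μ {z | η z = 1} v V w := by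
  set s : ℕ → ℝ := fun k => h₀ / (k + 1) with hs
  have hs0 : ∀ k, 0 < s k := fun k => by positivity
  have hsh : ∀ k, s k ≤ h₀ := fun k => div_le_self hh₀.le (by linarith [k.cast_nonneg (α := ℝ)])
  have hsl : Tendsto s atTop (𝓝 0) := by
    have := (tendsto_one_div_add_atTop_nhds_zero_nat (𝕜 := ℝ)).const_mul h₀
    simpa [hs, div_eq_mul_inv] using this
  set X : ℕ → E → F := fun k z => (η z * (s k)⁻¹) • (V (z + s k • v) - V z) with hX
  have hXm : ∀ k, StronglyMeasurable (X k) := fun k =>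
    ((hη.mul continuous_const).stronglyMeasurable).smul
      ((hV.comp_measurable (measurable_add_const _)).sub hV)
  have hXsq : ∀ k z, ‖X k z‖ ^ 2 = (s k)⁻¹ ^ 2 * (η z ^ 2 * ‖V (z + s k • v) - V z‖ ^ 2) := by
    intro k z
    simp only [hX, norm_smul, norm_mul, mul_pow, Real.norm_eq_abs, sq_abs]
    ring
  have hXi : ∀ k, Integrable (fun z => ‖X k z‖ ^ 2) μ := fun k => by
    simp only [hXsq]
    have := (integrable_sq_translate_sub hV hV2 (s k • v) 0).bdd_mul (c := Mη ^ 2)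
        (hη.pow 2).aestronglyMeasurable (Eventually.of_forall fun z => by
          rw [Pi.pow_apply, norm_pow]; exact pow_le_pow_left₀ (norm_nonneg _) (hMη z) 2)
    simp only [add_zero] at this
    exact this.const_mul ((s k)⁻¹ ^ 2)
  have hXL : ∀ k, MemLp (X k) 2 μ := fun k =>
    memLp_two_of_lintegral (hXm k).aestronglyMeasurable (lintegral_sq_lt_top (hXi k))
  have hXle : ∀ k, ‖(hXL k).toLp (X k)‖ ≤ √M := by
    intro k
    refine Real.le_sqrt_of_sq_le ?_
    rw [← real_inner_self_eq_norm_sq, L2.inner_def]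
    have e : ∫ z, inner ℝ ((hXL k).toLp (X k) z) ((hXL k).toLp (X k) z) ∂μ
        = (s k)⁻¹ ^ 2 * ∫ z, η z ^ 2 * ‖V (z + s k • v) - V z‖ ^ 2 ∂μ := by
      rw [← integral_const_mul]
      refine integral_congr_ae ?_
      filter_upwards [(hXL k).coeFn_toLp] with z hz
      rw [hz, real_inner_self_eq_norm_sq, hXsq]
    rw [e, inv_pow, inv_mul_le_iff₀ (by have := hs0 k; positivity), mul_comm]
    exact hM _ (hs0 k) (hsh k)
  -- A weak limit along a nonprincipal ultrafilter is enough: the discrete integration by parts has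
  -- a limit along the whole sequence, so the two limits can be identified.
  obtain ⟨y, hy⟩ := exists_tendsto_inner_of_bounded hXle (hyperfilter ℕ)
  have hyL := Lp.memLp y
  refine ⟨y, Lp.stronglyMeasurable y, ?_, fun θ hθ => ?_⟩
  · have := hyL.2
    rw [eLpNorm_lt_top_iff_lintegral_rpow_enorm_lt_top (by norm_num) (by norm_num)] at this
    simpa using this
  have hηθ : ∀ z, θ z * η z = θ z := fun z => by
    by_cases hz : z ∈ tsupport θ
    · have : η z = 1 := hθ.2.2 hz
      rw [this, mul_one]
    · rw [image_eq_zero_of_notMem_tsupport hz, zero_mul]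
  obtain ⟨Mθ, hMθ0, -, -, hLθ⟩ := exists_bound_lipschitz (hθ.1.of_le (by norm_num)) hθ.2.1
  -- the discrete integration by parts
  have hlim : Tendsto (fun k => ∫ z, (θ z * (s k)⁻¹) • (V (z + s k • v) - V z) ∂μ) atTop
      (𝓝 (∫ z, -((fderiv ℝ θ z v) • V z) ∂μ)) := by
    have e : ∀ k, ∫ z, (θ z * (s k)⁻¹) • (V (z + s k • v) - V z) ∂μ
        = ∫ z, ((s k)⁻¹ * (θ (z - s k • v) - θ z)) • V z ∂μ := by
      intro k
      have h1 := hθ.integral_smul_translate_sub hVi (s k • v)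
      have h2 : Integrable (fun z => θ (z - s k • v) • V z) μ :=
        IsTestFn.integrable_smul (D := univ) (hθ.comp_sub fun z _ => mem_univ _) hVi
      rw [← integral_sub h2 (hθ.integrable_smul hVi)] at h1
      simp only [mul_comm (θ _), mul_smul, integral_smul, sub_smul]
      rw [h1]
    simp only [e]
    refine tendsto_integral_of_dominated_convergence (fun z => (Mθ * ‖v‖) * ‖V z‖) ?_
      (hVi.norm.const_mul _) ?_ ?_
    · intro k
      exact ((continuous_const.mul ((hθ.1.continuous.comp (by fun_prop)).sub
        hθ.1.continuous)).stronglyMeasurable.smul hV).aestronglyMeasurable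
    · intro k
      refine Eventually.of_forall fun z => ?_
      rw [norm_smul, norm_mul, norm_inv, Real.norm_of_nonneg (hs0 k).le]
      refine mul_le_mul_of_nonneg_right ?_ (norm_nonneg _)
      rw [inv_mul_le_iff₀ (hs0 k)]
      have := hLθ (z - s k • v) (s k • v)
      rw [sub_add_cancel, norm_smul, Real.norm_of_nonneg (hs0 k).le] at this
      rw [Real.norm_eq_abs, abs_sub_comm]
      linarith
    · refine Eventually.of_forall fun z => ?_
      rw [← neg_smul]
      refine Tendsto.smul_const ?_ _
      have hd : HasDerivAt (fun t : ℝ => θ (z - t • v)) (-(fderiv ℝ θ z v)) 0 := by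
        have h1 : HasFDerivAt θ (fderiv ℝ θ z) (z - (0 : ℝ) • v) := by
          rw [zero_smul, sub_zero]
          exact (hθ.1.differentiable (by norm_num) z).hasFDerivAt
        have h2 : HasDerivAt (fun t : ℝ => z - t • v) (-v) 0 := by
          simpa using ((hasDerivAt_id (0 : ℝ)).smul_const v).const_sub z
        have h3 := h1.comp_hasDerivAt (0 : ℝ) h2
        rw [map_neg] at h3
        exact h3
      have h3 := hasDerivAt_iff_tendsto_slope_zero.1 hd
      have h4 : Tendsto s atTop (𝓝[≠] 0) :=
        tendsto_nhdsWithin_iff.2 ⟨hsl, Eventually.of_forall fun k => (hs0 k).ne'⟩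
      have h5 := h3.comp h4
      simpa [Function.comp_def] using h5
  have hgoal : ∫ z, θ z • y z ∂μ = ∫ z, -((fderiv ℝ θ z v) • V z) ∂μ := by
    refine ext_inner_left ℝ fun c => ?_
    have hθcI : MemLp (fun z => θ z • c) 2 μ :=
      ((hθ.1.continuous.smul continuous_const).memLp_of_hasCompactSupport
        (hθ.2.1.smul_right))
    have h1 := hy (hθcI.toLp _)
    have e1 : ∀ k, inner ℝ ((hXL k).toLp (X k)) (hθcI.toLp _)
        = inner ℝ c (∫ z, (θ z * (s k)⁻¹) • (V (z + s k • v) - V z) ∂μ) := by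
      intro k
      have hi : Integrable (fun z => (θ z * (s k)⁻¹) • (V (z + s k • v) - V z)) μ := by
        have := (hθ.integrable_smul ((hVi.comp_add_right (s k • v)).sub hVi)).smul (s k)⁻¹
        refine this.congr (Eventually.of_forall fun z => ?_)
        simp [smul_smul, mul_comm]
      rw [L2.inner_def, ← integral_inner hi]
      refine integral_congr_ae ?_
      filter_upwards [(hXL k).coeFn_toLp, hθcI.coeFn_toLp] with z h1 h2
      rw [h1, h2, real_inner_smul_right, real_inner_smul_right, real_inner_comm, hX]
      simp only [real_inner_smul_right]
      rw [← mul_assoc, ← mul_assoc, hηθ]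
    have e2 : inner ℝ y (hθcI.toLp _) = inner ℝ c (∫ z, θ z • y z ∂μ) := by
      have hi : Integrable (fun z => θ z • y z) μ := by
        have h2 : MemLp θ 2 μ := hθ.1.continuous.memLp_of_hasCompactSupport hθ.2.1
        exact memLp_one_iff_integrable.1 (hyL.smul h2)
      rw [L2.inner_def, ← integral_inner hi]
      refine integral_congr_ae ?_
      filter_upwards [hθcI.coeFn_toLp] with z h2
      rw [h2, real_inner_smul_right, real_inner_smul_right, real_inner_comm]
    simp only [e1, e2] at h1
    have h2 : Tendsto (fun k => inner ℝ c (∫ z, (θ z * (s k)⁻¹) • (V (z + s k • v) - V z) ∂μ))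
        (hyperfilter ℕ) (𝓝 (inner ℝ c (∫ z, -((fderiv ℝ θ z v) • V z) ∂μ))) :=
      (tendsto_const_nhds.inner hlim).mono_left (by
        rw [← Nat.cofinite_eq_atTop]; exact hyperfilter_le_cofinite)
    exact tendsto_nhds_unique h1 h2
  rw [hgoal, integral_neg, neg_neg]

theorem locallyIntegrableOn_of_lintegral_sq {w : E → F} (hm : StronglyMeasurable w)
    (h2 : ∫⁻ z, ‖w z‖ₑ ^ 2 ∂μ < ⊤) (D : Set E) : LocallyIntegrableOn w D μ := by
  have hL := memLp_two_of_lintegral hm.aestronglyMeasurable h2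
  exact (hL.locallyIntegrable (by norm_num)).locallyIntegrableOn D

theorem locallyIntegrableOn_of_ae_eq {X : Type*} [NormedAddCommGroup X] {f : E → X} {D : Set E}
    (hD : IsOpen D)
    (H : ∀ z ∈ D, ∃ (U : Set E) (g : E → X), U ∈ 𝓝 z ∧ LocallyIntegrableOn g D μ ∧
      ∀ᵐ y ∂μ, y ∈ U ∩ D → f y = g y) : LocallyIntegrableOn f D μ := by
  intro z hz
  obtain ⟨U, g, hU, hg, hae⟩ := H z hz
  obtain ⟨O, hOU, hO, hzO⟩ := mem_nhds_iff.1 hU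
  obtain ⟨s, hs1, hs2⟩ := hg z hz
  refine ⟨s ∩ (O ∩ D), inter_mem hs1 (inter_mem (mem_nhdsWithin_of_mem_nhds (hO.mem_nhds hzO))
    self_mem_nhdsWithin), (hs2.mono_set inter_subset_left).congr ?_⟩
  have h3 : ∀ᵐ y ∂μ.restrict (s ∩ (O ∩ D)), y ∈ O ∩ D :=
    ae_mono (Measure.restrict_mono inter_subset_right le_rfl)
      (ae_restrict_mem (hO.inter hD).measurableSet)
  filter_upwards [ae_restrict_of_ae hae, h3] with y hy1 hy2
  exact (hy1 ⟨hOU hy2.1, hy2.2⟩).symm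

/-- Local weak derivatives can be glued. -/
theorem exists_hasWeakDirDeriv_of_local {D : Set E} (hD : IsOpen D) {V : E → F} {v : E}
    (H : ∀ S, IsCompact S → S ⊆ D → ∃ U w, IsOpen U ∧ S ⊆ U ∧ StronglyMeasurable w ∧
      ∫⁻ z, ‖w z‖ₑ ^ 2 ∂μ < ⊤ ∧ HasWeakDirDeriv μ U v V w) :
    ∃ W : E → F, StronglyMeasurable W ∧ LocallyIntegrableOn W D μ ∧
      LocallyIntegrableOn (fun z => ‖W z‖ ^ 2) D μ ∧ HasWeakDirDeriv μ D v V W := by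
  choose! U w hUo hSU hwm hw2 hwd using H
  have hs : ∀ z ∈ D, ({z} : Set E) ⊆ D := fun z hz => singleton_subset_iff.2 hz
  obtain ⟨t, htD, htc, hcov⟩ := TopologicalSpace.countable_cover_nhdsWithin
    (f := fun z => U {z}) (s := D) fun z hz => mem_nhdsWithin_of_mem_nhds
      ((hUo _ isCompact_singleton (hs z hz)).mem_nhds
        (hSU _ isCompact_singleton (hs z hz) rfl))
  have hcov' : ∀ z ∈ D, ∃ i ∈ t, z ∈ U {i} := fun z hz => by simpa using hcov hz
  choose! ι hιt hιU using hcov'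
  set W₀ : E → F := fun z => w {ι z} z with hW₀
  -- Uniqueness of weak derivatives on overlaps; countability of the cover `t` makes the exceptional
  -- set null. The statement for every compact `S`, not only for points, allows `S` to be the
  -- support of a test function below.
  have huniq : ∀ S, IsCompact S → S ⊆ D → ∀ᵐ z ∂μ, z ∈ U S ∩ D → W₀ z = w S z := by
    intro S hS hSD
    have h1 : ∀ᵐ z ∂μ, ∀ i ∈ t, z ∈ U S ∩ U {i} → w {i} z = w S z := by
      rw [ae_ball_iff htc]
      intro i hi
      have hiD := hs i (htD hi)
      exact ((hwd _ isCompact_singleton hiD).mono inter_subset_right).ae_eq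
        ((hUo S hS hSD).inter (hUo _ isCompact_singleton hiD))
        ((hwd S hS hSD).mono inter_subset_left)
        (locallyIntegrableOn_of_lintegral_sq (hwm _ isCompact_singleton hiD)
          (hw2 _ isCompact_singleton hiD) _)
        (locallyIntegrableOn_of_lintegral_sq (hwm S hS hSD) (hw2 S hS hSD) _)
    filter_upwards [h1] with z hz hzU
    exact hz _ (hιt z hzU.2) ⟨hzU.1, hιU z hzU.2⟩
  have hWi : LocallyIntegrableOn W₀ D μ := by
    refine locallyIntegrableOn_of_ae_eq hD fun z hz => ?_
    have hz' := hs z hz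
    exact ⟨U {z}, w {z}, (hUo _ isCompact_singleton hz').mem_nhds
      (hSU _ isCompact_singleton hz' rfl), locallyIntegrableOn_of_lintegral_sq
      (hwm _ isCompact_singleton hz') (hw2 _ isCompact_singleton hz') D,
      huniq _ isCompact_singleton hz'⟩
  have hW2 : LocallyIntegrableOn (fun z => ‖W₀ z‖ ^ 2) D μ := by
    refine locallyIntegrableOn_of_ae_eq hD fun z hz => ?_
    have hz' := hs z hz
    refine ⟨U {z}, fun y => ‖w {z} y‖ ^ 2, (hUo _ isCompact_singleton hz').mem_nhds
      (hSU _ isCompact_singleton hz' rfl),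
      ((integrable_sq_of_lintegral (hwm _ isCompact_singleton hz').aestronglyMeasurable
      (hw2 _ isCompact_singleton hz')).locallyIntegrable).locallyIntegrableOn D, ?_⟩
    filter_upwards [huniq _ isCompact_singleton hz'] with y hy hyU
    rw [hy hyU]
  have hWd : HasWeakDirDeriv μ D v V W₀ := by
    intro θ hθ
    have h1 := huniq _ hθ.2.1 hθ.2.2
    have h2 := hwd _ hθ.2.1 hθ.2.2 θ ⟨hθ.1, hθ.2.1, hSU _ hθ.2.1 hθ.2.2⟩
    rw [h2]
    congr 1
    refine integral_congr_ae ?_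
    filter_upwards [h1] with z hz
    by_cases hzt : z ∈ tsupport θ
    · rw [hz ⟨hSU _ hθ.2.1 hθ.2.2 hzt, hθ.2.2 hzt⟩]
    · rw [image_eq_zero_of_notMem_tsupport hzt]; simp
  have hm := hWi.aestronglyMeasurable
  have hae : ∀ᵐ z ∂μ, z ∈ D → W₀ z = hm.mk W₀ z :=
    (ae_restrict_iff' hD.measurableSet).1 hm.ae_eq_mk
  refine ⟨hm.mk W₀, hm.stronglyMeasurable_mk, ?_, ?_, hWd.congr_ae hae⟩
  · refine locallyIntegrableOn_of_ae_eq hD fun z _ => ⟨univ, W₀, univ_mem, hWi, ?_⟩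
    filter_upwards [hae] with y hy hyD
    rw [hy hyD.2]
  · refine locallyIntegrableOn_of_ae_eq hD fun z _ => ⟨univ, _, univ_mem, hW2, ?_⟩
    filter_upwards [hae] with y hy hyD
    rw [hy hyD.2]

/-- Smooth cutoff functions between a compact set and an open neighbourhood. -/
theorem exists_cutoff {S U : Set E} (hS : IsCompact S) (hU : IsOpen U) (hSU : S ⊆ U) :
    ∃ (U' : Set E) (η : E → ℝ), IsOpen U' ∧ S ⊆ U' ∧ U' ⊆ U ∧ ContDiff ℝ ∞ η ∧
      HasCompactSupport η ∧ tsupport η ⊆ U ∧ (∀ z, 0 ≤ η z) ∧ (∀ z, η z ≤ 1) ∧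
      ∀ z ∈ U', η z = 1 := by
  obtain ⟨O, hO, hSO, hOU, hOc⟩ := exists_open_between_and_isCompact_closure hS hU hSU
  obtain ⟨U', hU', hSU', hUO, -⟩ := exists_open_between_and_isCompact_closure hS hO hSO
  obtain ⟨η, hη, hηr, hηs, hη1⟩ := exists_contMDiff_support_eq_eq_one_iff
    (modelWithCornersSelf ℝ E) (n := (⊤ : ℕ∞)) hO (isClosed_closure (s := U')) hUO
  have hts : tsupport η = closure O := by rw [tsupport, hηs]
  refine ⟨U', η, hU', hSU', (subset_closure.trans hUO).trans (subset_closure.trans hOU),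
    hη.contDiff, ?_, hts ▸ hOU, fun z => (hηr ⟨z, rfl⟩).1, fun z => (hηr ⟨z, rfl⟩).2,
    fun z hz => (hη1 z).1 (subset_closure hz)⟩
  rw [HasCompactSupport, hts]
  exact hOc

end WeakDeriv

section Fields

variable {n N : ℕ} {φ : ℝ → ℝ} {c₀ c₁ : ℝ} {D : Set (SpaceTime n)}
  {u : SpaceTime n → EuclideanSpace ℝ (Fin N)} {G : SpaceTime n → Mat n N}

/-- Near a compact set the weighted bound with a cutoff equal to 1 there gives a weak derivative in
`L²`; these local derivatives are glued. -/
theorem exists_hasWeakDirDeriv_fieldV (hS : IsMeasSolution φ D u G) (hφ : IsOrlicz φ c₀ c₁)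
    (hc₀ : 0 < c₀) :
    ∃ W : Fin n → SpaceTime n → Mat n N, (∀ j, StronglyMeasurable (W j)) ∧
      (∀ j, LocallyIntegrableOn (W j) D) ∧ (∀ j, LocallyIntegrableOn (fun z => ‖W j z‖ ^ 2) D) ∧
      ∀ j, HasWeakDirDeriv volume D (sdir j) (fun z => fieldV φ (G z)) (W j) := by
  suffices H : ∀ j : Fin n, ∃ W : SpaceTime n → Mat n N, StronglyMeasurable W ∧
      LocallyIntegrableOn W D ∧ LocallyIntegrableOn (fun z => ‖W z‖ ^ 2) D ∧
      HasWeakDirDeriv volume D (sdir j) (fun z => fieldV φ (G z)) W by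
    choose W h1 h2 h3 h4 using H
    exact ⟨W, h1, h2, h3, h4⟩
  intro j
  refine exists_hasWeakDirDeriv_of_local hS.isOpen fun S hSc hSD => ?_
  obtain ⟨K, U, h₀, hR, hSU⟩ := exists_isRegion hSc hS.isOpen hSD
  obtain ⟨U', η, hU'o, hSU', hU'U, hη, hηc, hηs, hηr, -, hη1⟩ := exists_cutoff hSc hR.isOpen hSU
  have hη1' : ContDiff ℝ 1 η := hη.of_le (by norm_num)
  obtain ⟨M, hM⟩ := exists_integral_sq_diff_le hS hφ hc₀ hR hη1' hηc hηs hηr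
  obtain ⟨Mη, -, hMη, -⟩ := exists_bound_lipschitz hη1' hηc
  have hVm : StronglyMeasurable fun z => fieldV φ (K.indicator G z) :=
    (measurable_fieldV.comp (hS.meas_ind hR).measurable).stronglyMeasurable
  have hV2 := hS.integrable_V_sq hR
  have hVi : Integrable fun z => fieldV φ (K.indicator G z) := by
    have h1 : Integrable (K.indicator fun _ : SpaceTime n => (1 : ℝ)) :=
      (integrable_indicator_iff hR.measK).2 (integrableOn_const hR.isCompact.measure_lt_top.ne)
    refine (h1.add hV2).mono' hVm.aestronglyMeasurable (Eventually.of_forall fun z => ?_)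
    by_cases hz : z ∈ K
    · simp only [Pi.add_apply, indicator_of_mem hz]
      nlinarith [sq_nonneg (‖fieldV φ (G z)‖ - 1), sq_nonneg ‖fieldV φ (G z)‖]
    · simp [indicator_of_notMem hz]
  obtain ⟨w, hwm, hw2, hwd⟩ := exists_hasWeakDirDeriv_of_bounded (μ := volume) hVm hVi hV2
    hη.continuous hMη hR.pos fun h h1 h2 => hM h h1 h2 j
  refine ⟨U', w, hU'o, hSU', hwm, hw2, (hwd.mono hη1).congr_ae_left
    (Eventually.of_forall fun z hz => ?_)⟩
  rw [indicator_of_mem (hR.sub (hU'U hz))]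

end Fields

end

/-! ### Derivatives of `A` and `V`, and the sign of the second-order term. -/

section
open PhiCaloric.IsOrlicz (profileV)


section Radial

variable {E : Type*} [NormedAddCommGroup E] [InnerProductSpace ℝ E]

/-- The linear map with eigenvalue `t` on the line through `P` and `s` on its complement. -/
noncomputable def radialMap (s t : ℝ) (P : E) : E →L[ℝ] E :=
  s • ContinuousLinearMap.id ℝ E + ((t - s) / ‖P‖ ^ 2) • (innerSL ℝ P).smulRight P

theorem radialMap_apply (s t : ℝ) (P Y : E) :
    radialMap s t P Y = s • Y + ((t - s) / ‖P‖ ^ 2 * inner ℝ P Y) • P := by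
  simp [radialMap, smul_smul]

theorem radialMap_radialMap {P : E} (hP : P ≠ 0) (s t s' t' : ℝ) (Y : E) :
    radialMap s t P (radialMap s' t' P Y) = radialMap (s * s') (t * t') P Y := by
  have hn : ‖P‖ ^ 2 ≠ 0 := by simp [hP]
  simp only [radialMap_apply, inner_add_right, real_inner_smul_right, smul_add, smul_smul,
    real_inner_self_eq_norm_sq]
  rw [add_assoc, ← add_smul]
  congr 2
  field_simp
  ring

theorem radialMap_one {P : E} (Y : E) : radialMap 1 1 P Y = Y := by simp [radialMap_apply]

theorem norm_radialMap_le {P : E} (s t : ℝ) (Y : E) :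
    ‖radialMap s t P Y‖ ≤ (2 * |s| + |t|) * ‖Y‖ := by
  rw [radialMap_apply]
  have h1 : ‖((t - s) / ‖P‖ ^ 2 * inner ℝ P Y) • P‖ ≤ (|t| + |s|) * ‖Y‖ := by
    rcases eq_or_ne P 0 with rfl | hP
    · simp; positivity
    have hp : 0 < ‖P‖ := norm_pos_iff.2 hP
    rw [norm_smul, norm_mul, norm_div, norm_pow, norm_norm]
    calc ‖t - s‖ / ‖P‖ ^ 2 * ‖inner ℝ P Y‖ * ‖P‖
        ≤ (|t| + |s|) / ‖P‖ ^ 2 * (‖P‖ * ‖Y‖) * ‖P‖ := by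
          gcongr
          · exact norm_sub_le t s
          · exact norm_inner_le_norm P Y
      _ = _ := by field_simp
  refine (norm_add_le _ _).trans ?_
  rw [norm_smul, Real.norm_eq_abs]
  linarith

theorem hasFDerivAt_norm_of_ne {P : E} (hP : P ≠ 0) :
    HasFDerivAt (fun P : E => ‖P‖) (‖P‖⁻¹ • innerSL ℝ P) P := by
  have h1 := (hasStrictFDerivAt_norm_sq P).hasFDerivAt.sqrt (by simp [hP])
  simp only [Real.sqrt_sq (norm_nonneg _)] at h1
  refine h1.congr_fderiv ?_
  ext Y
  have : ‖P‖ ≠ 0 := norm_ne_zero_iff.2 hP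
  simp
  field_simp

theorem hasFDerivAt_radial {m : ℝ → ℝ} {m' : ℝ} {P : E} (hm : HasDerivAt m m' ‖P‖) (hP : P ≠ 0) :
    HasFDerivAt (fun P : E => (m ‖P‖ / ‖P‖) • P) (radialMap (m ‖P‖ / ‖P‖) m' P) P := by
  have hp : ‖P‖ ≠ 0 := norm_ne_zero_iff.2 hP
  have h1 := ((hm.div (hasDerivAt_id _) hp).comp_hasFDerivAt P (hasFDerivAt_norm_of_ne hP)).smul
    (hasFDerivAt_id P)
  refine h1.congr_fderiv ?_
  ext1 Y
  simp [radialMap_apply, smul_smul]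
  congr 1
  field_simp

/-- Difference quotients along a sequence converge to the derivative. -/
theorem tendsto_diffQuot_of_hasFDerivAt {F : Type*} [NormedAddCommGroup F] [NormedSpace ℝ F]
    {f : E → F} {f' : E →L[ℝ] F} {P Y : E} (hf : HasFDerivAt f f' P) {Q : ℕ → E} {s : ℕ → ℝ}
    (hs0 : ∀ k, 0 < s k) (hs : Tendsto s atTop (𝓝 0))
    (hQ : Tendsto (fun k => (s k)⁻¹ • (Q k - P)) atTop (𝓝 Y)) :
    Tendsto (fun k => (s k)⁻¹ • (f (Q k) - f P)) atTop (𝓝 (f' Y)) := by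
  have h0 : Tendsto (fun k => Q k - P) atTop (𝓝 0) := by
    have := hs.smul hQ
    rw [zero_smul] at this
    refine this.congr fun k => ?_
    rw [smul_smul, mul_inv_cancel₀ (hs0 k).ne', one_smul]
  have h1 := (hasFDerivWithinAt_univ.2 hf).lim h0 (Eventually.of_forall fun _ => mem_univ _) hQ
  simpa only [add_sub_cancel] using h1

end Radial

section Fields

variable {n N : ℕ} {φ : ℝ → ℝ} {c₀ c₁ : ℝ}

/-- A three-point inequality, needed because the mixed term pairs increments in different
directions. If `Q'` is closer to `P` than `Q`, the two-point inequality suffices. Otherwise `|A(Q) -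
A(P)|` is at most a multiple of `φ'(s)/s · |Q - P|`, and this quantity is almost increasing in the
distance, so `Q` may be replaced by `Q'`. -/
theorem exists_fluxA_sub_mul_sub_le (c₀ c₁ : ℝ) (hc₀ : 0 < c₀) :
    ∃ C : ℝ, 1 ≤ C ∧ ∀ φ, IsOrlicz φ c₀ c₁ → ∀ (n N : ℕ) (P Q Q' : Mat n N),
      ‖fluxA φ Q - fluxA φ P‖ * ‖Q' - P‖
        ≤ C * (‖fieldV φ Q - fieldV φ P‖ ^ 2 + ‖fieldV φ Q' - fieldV φ P‖ ^ 2) := by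
  obtain ⟨C, hC, H⟩ := exists_norm_sub_le c₀ c₁ hc₀
  obtain ⟨C₁, hC₁, H₁⟩ := exists_sq_fieldV_sub_le_inner c₀ c₁ hc₀
  obtain ⟨C₂, hC₂, H₂⟩ := exists_fluxA_sub_mul_le c₀ c₁ hc₀
  -- If `t ≤ t'`, then `s ≤ 3 s' ≤ 4 s'` costs two doublings of `φ'`, and `t/s ≤ 3 t'/s'` gives the
  -- factor 3.
  set T : ℝ := 3 * (2 ^ c₁ * 2 ^ c₁) with hT
  have hT0 : 0 < T := by positivity
  refine ⟨C₂ + C * C₁ * T * C, by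
    have : 0 ≤ C * C₁ * T * C := by positivity
    linarith, fun φ h n N P Q Q' => ?_⟩
  set X := ‖fieldV φ Q - fieldV φ P‖ with hX
  set X' := ‖fieldV φ Q' - fieldV φ P‖ with hX'
  have hC0 : 0 ≤ C := by linarith
  have hK0 : 0 ≤ C * C₁ * T * C := by positivity
  rcases le_total ‖Q' - P‖ ‖Q - P‖ with hle | hle
  · have h1 := (H₂ φ h n N Q P).1
    have h2 := mul_le_mul_of_nonneg_left hle (norm_nonneg (fluxA φ Q - fluxA φ P))
    have h3 : 0 ≤ C₂ * X' ^ 2 + C * C₁ * T * C * (X ^ 2 + X' ^ 2) := by positivity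
    linarith
  rcases (norm_nonneg (Q' - P)).eq_or_lt with h0 | h0
  · rw [← h0, mul_zero]; positivity
  obtain ⟨-, h1⟩ := H φ h n N Q P
  obtain ⟨h2, -⟩ := H φ h n N Q' P
  set s := max ‖Q‖ ‖P‖ with hs
  set s' := max ‖Q'‖ ‖P‖ with hs'
  set t := ‖Q - P‖ with ht
  set t' := ‖Q' - P‖ with ht'
  set x := ‖fluxA φ Q - fluxA φ P‖ with hx
  have hx0 : 0 ≤ x := norm_nonneg _
  have ht0 : 0 ≤ t := norm_nonneg _
  have hp0 : 0 ≤ ‖P‖ := norm_nonneg _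
  have hs0 : 0 ≤ s := hp0.trans (le_max_right _ _)
  have b1 : s ≤ ‖P‖ + t := max_le (by rw [ht]; have := norm_sub_norm_le Q P; linarith)
    (by linarith)
  have b2 : ‖P‖ + t ≤ 3 * s := by
    have := norm_sub_le Q P
    have := le_max_left ‖Q‖ ‖P‖
    have := le_max_right ‖Q‖ ‖P‖
    linarith
  have b3 : s' ≤ ‖P‖ + t' := max_le (by rw [ht']; have := norm_sub_norm_le Q' P; linarith)
    (by linarith)
  have b4 : ‖P‖ + t' ≤ 3 * s' := by
    have := norm_sub_le Q' P
    have := le_max_left ‖Q'‖ ‖P‖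
    have := le_max_right ‖Q'‖ ‖P‖
    linarith
  have hs0' : 0 < s' := by linarith
  have ha0 : 0 ≤ deriv φ s / s := div_nonneg (h.deriv_nonneg hs0) hs0
  have ha0' : 0 ≤ deriv φ s' / s' := div_nonneg (h.deriv_nonneg hs0'.le) hs0'.le
  have hxle : x ≤ C * C₁ * (deriv φ s / s) * t := by
    have h3 : X ^ 2 ≤ C₁ * (x * t) := (H₁ φ h n N Q P).trans
      (mul_le_mul_of_nonneg_left (real_inner_le_norm _ _) (by linarith))
    rcases hx0.eq_or_lt with h0 | h0
    · rw [← h0]; positivity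
    · refine le_of_mul_le_mul_left ?_ h0
      have := mul_le_mul_of_nonneg_left h3 (mul_nonneg hC0 ha0)
      nlinarith
  have key : deriv φ s / s * t ≤ T * (deriv φ s' / s' * t') := by
    rcases hs0.eq_or_lt with h4 | h4
    · rw [← h4, div_zero, zero_mul]; positivity
    have e1 : deriv φ s ≤ 2 ^ c₁ * 2 ^ c₁ * deriv φ s' := by
      have e2 : deriv φ s ≤ 2 ^ c₁ * deriv φ (2 * s') :=
        h.deriv_le_of_le_two_mul hc₀ (by linarith) hs0 (by linarith)
      have e3 := h.deriv_two_mul_le hs0'.le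
      have := mul_le_mul_of_nonneg_left e3 (by positivity : (0 : ℝ) ≤ 2 ^ c₁)
      linarith
    have e4 : t / s ≤ 3 * (t' / s') := by
      rw [div_le_iff₀ h4, mul_comm, ← mul_assoc, ← mul_div_assoc, le_div_iff₀ hs0']
      nlinarith
    calc deriv φ s / s * t = deriv φ s * (t / s) := by ring
      _ ≤ (2 ^ c₁ * 2 ^ c₁ * deriv φ s') * (3 * (t' / s')) :=
        mul_le_mul e1 e4 (by positivity)
          (mul_nonneg (by positivity) (h.deriv_nonneg hs0'.le))
      _ = _ := by rw [hT]; ring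
  have e5 : x * t' ≤ C * C₁ * T * (deriv φ s' / s' * t' ^ 2) := by
    calc x * t' ≤ (C * C₁ * (deriv φ s / s) * t) * t' :=
          mul_le_mul_of_nonneg_right hxle h0.le
      _ = C * C₁ * (deriv φ s / s * t) * t' := by ring
      _ ≤ C * C₁ * (T * (deriv φ s' / s' * t')) * t' := by gcongr
      _ = _ := by ring
  have e6 := mul_le_mul_of_nonneg_left h2 (by positivity : 0 ≤ C * C₁ * T)
  have e7 : 0 ≤ C₂ * (X ^ 2 + X' ^ 2) + C * C₁ * T * C * X ^ 2 := by positivity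
  linarith

/-- Lipschitz functions supported in an annulus are Lipschitz functions of `V`. -/
theorem exists_norm_sub_le_mul_fieldV {F : Type*} [NormedAddCommGroup F] (h : IsOrlicz φ c₀ c₁)
    (hc₀ : 0 < c₀) {γ : Mat n N → F} {a b B L : ℝ} (ha : 0 < a) (hab : a < b)
    (hB : ∀ P, ‖γ P‖ ≤ B) (hL : ∀ P Q, ‖γ P - γ Q‖ ≤ L * ‖P - Q‖)
    (h0 : ∀ P, γ P ≠ 0 → a ≤ ‖P‖ ∧ ‖P‖ ≤ b) :
    ∃ C, 0 ≤ C ∧ ∀ P Q, ‖γ P - γ Q‖ ≤ C * ‖fieldV φ P - fieldV φ Q‖ := by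
  obtain ⟨C, hC, H⟩ := exists_norm_sub_le c₀ c₁ hc₀
  have hb : 0 < b := ha.trans hab
  have hB0 : 0 ≤ B := (norm_nonneg _).trans (hB 0)
  have hgap : 0 < profileV φ (2 * b) - profileV φ b :=
    sub_pos.2 (h.profileV_strictMono hc₀ hb.le (by linarith))
  have hda := h.deriv_pos hc₀ ha
  set C₁ := √(C * (2 * b) / deriv φ a) with hC₁
  set C₂ := B / (profileV φ (2 * b) - profileV φ b) with hC₂
  have hC₂0 : 0 ≤ C₂ := div_nonneg hB0 hgap.le
  have hC₁0 : 0 ≤ C₁ := Real.sqrt_nonneg _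
  have aux : ∀ P Q, γ P ≠ 0 → ‖γ P - γ Q‖ ≤ (|L| * C₁ + C₂) * ‖fieldV φ P - fieldV φ Q‖ := by
    intro P Q hP
    obtain ⟨hP1, hP2⟩ := h0 P hP
    rcases le_or_gt ‖Q‖ (2 * b) with hQ | hQ
    · have h1 := (H φ h n N P Q).1
      set s := max ‖P‖ ‖Q‖ with hs
      have hsa : a ≤ s := hP1.trans (le_max_left _ _)
      have hsb : s ≤ 2 * b := max_le (by linarith) hQ
      have h2 : deriv φ a / (2 * b) ≤ deriv φ s / s :=
        div_le_div₀ (h.deriv_nonneg (ha.le.trans hsa))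
          (h.monotoneOn_deriv hc₀ ha.le (ha.le.trans hsa) hsa) (ha.trans_le hsa) hsb
      have h3 : ‖P - Q‖ ^ 2 ≤ (C * (2 * b) / deriv φ a) * ‖fieldV φ P - fieldV φ Q‖ ^ 2 := by
        have h4 := (mul_le_mul_of_nonneg_right h2 (sq_nonneg ‖P - Q‖)).trans h1
        rw [div_mul_eq_mul_div, div_le_iff₀ (by positivity)] at h4
        rw [div_mul_eq_mul_div, le_div_iff₀ hda]
        linarith
      have h5 : ‖P - Q‖ ≤ C₁ * ‖fieldV φ P - fieldV φ Q‖ := by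
        refine (abs_le_of_sq_le_sq' (a := ‖P - Q‖) ?_ (by positivity)).2
        rw [mul_pow, hC₁, Real.sq_sqrt (by positivity)]
        exact h3
      have h6 : ‖γ P - γ Q‖ ≤ |L| * ‖P - Q‖ := (hL P Q).trans
        (mul_le_mul_of_nonneg_right (le_abs_self L) (norm_nonneg _))
      have h7 := mul_le_mul_of_nonneg_left h5 (abs_nonneg L)
      have h8 : 0 ≤ C₂ * ‖fieldV φ P - fieldV φ Q‖ := by positivity
      linarith
    · have hQ0 : γ Q = 0 := by
        by_contra hne
        have := (h0 Q hne).2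
        linarith
      have h1 : profileV φ (2 * b) - profileV φ b ≤ ‖fieldV φ P - fieldV φ Q‖ := by
        rw [norm_sub_rev]
        refine le_trans ?_ (norm_sub_norm_le _ _)
        rw [norm_fieldV, norm_fieldV]
        have e1 := h.profileV_mono hc₀ (by linarith : 0 ≤ 2 * b) hQ.le
        have e2 := h.profileV_mono hc₀ (norm_nonneg P) hP2
        linarith
      rw [hQ0, sub_zero]
      have h2 : B ≤ C₂ * ‖fieldV φ P - fieldV φ Q‖ := by
        rw [hC₂, div_mul_eq_mul_div, le_div_iff₀ hgap]
        exact mul_le_mul_of_nonneg_left h1 hB0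
      have h8 : 0 ≤ |L| * C₁ * ‖fieldV φ P - fieldV φ Q‖ := by positivity
      linarith [hB P]
  refine ⟨|L| * C₁ + C₂, by positivity, fun P Q => ?_⟩
  by_cases hP : γ P = 0
  · by_cases hQ : γ Q = 0
    · rw [hP, hQ, sub_zero, norm_zero]; positivity
    · rw [norm_sub_rev, norm_sub_rev (fieldV φ P)]; exact aux Q P hQ
  · exact aux P Q hP

theorem hasDerivAt_profileV (h : IsOrlicz φ c₀ c₁) (hc₀ : 0 < c₀) {r : ℝ} (hr : 0 < r) :
    HasDerivAt (profileV φ) ((deriv (deriv φ) r * r + deriv φ r) / (2 * profileV φ r)) r := by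
  have h1 := ((h.hasDerivAt_deriv hr).mul (hasDerivAt_id r)).sqrt
    (mul_pos (h.deriv_pos hc₀ hr) hr).ne'
  simpa [profileV] using h1

/-- The derivative of `V`. -/
theorem hasFDerivAt_fieldV (h : IsOrlicz φ c₀ c₁) (hc₀ : 0 < c₀) {P : Mat n N} (hP : P ≠ 0) :
    HasFDerivAt (fieldV φ) (radialMap (profileV φ ‖P‖ / ‖P‖)
      ((deriv (deriv φ) ‖P‖ * ‖P‖ + deriv φ ‖P‖) / (2 * profileV φ ‖P‖)) P) P :=
  hasFDerivAt_radial (hasDerivAt_profileV h hc₀ (norm_pos_iff.2 hP)) hP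

theorem hasFDerivAt_fluxA (h : IsOrlicz φ c₀ c₁) {P : Mat n N} (hP : P ≠ 0) :
    HasFDerivAt (fluxA φ) (radialMap (deriv φ ‖P‖ / ‖P‖) (deriv (deriv φ) ‖P‖) P) P :=
  hasFDerivAt_radial (h.hasDerivAt_deriv (norm_pos_iff.2 hP)) hP

/-- The inverse of the derivative of `V` at `P`, applied to `X`. -/
noncomputable def invDerivV (φ : ℝ → ℝ) (P X : Mat n N) : Mat n N :=
  radialMap (‖P‖ / profileV φ ‖P‖)
    ((2 * profileV φ ‖P‖) / (deriv (deriv φ) ‖P‖ * ‖P‖ + deriv φ ‖P‖)) P X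

theorem profileV_pos (h : IsOrlicz φ c₀ c₁) (hc₀ : 0 < c₀) {r : ℝ} (hr : 0 < r) :
    0 < profileV φ r := Real.sqrt_pos.2 (mul_pos (h.deriv_pos hc₀ hr) hr)

theorem deriv_deriv_nonneg (h : IsOrlicz φ c₀ c₁) (hc₀ : 0 < c₀) {r : ℝ} (hr : 0 < r) :
    0 ≤ deriv (deriv φ) r * r :=
  (mul_nonneg hc₀.le (h.deriv_nonneg hr.le)).trans (h.lower r hr)

/-- Convergence of `V(Q_k)` keeps `Q_k` bounded. If `|Q_k - P| ≥ ε`, the larger of the two norms is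
at least `ε/2`, so the weight in `exists_norm_sub_le` is bounded below and `V(Q_k)` stays away from
`V(P)`. No inverse of `V` is needed, and `P = 0` is included. -/
theorem tendsto_of_tendsto_fieldV (h : IsOrlicz φ c₀ c₁) (hc₀ : 0 < c₀) {P : Mat n N}
    {Q : ℕ → Mat n N} (hQ : Tendsto (fun k => fieldV φ (Q k)) atTop (𝓝 (fieldV φ P))) :
    Tendsto Q atTop (𝓝 P) := by
  obtain ⟨C, hC, H⟩ := exists_norm_sub_le c₀ c₁ hc₀
  rw [tendsto_iff_norm_sub_tendsto_zero, Metric.tendsto_atTop]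
  intro ε hε
  have hv : profileV φ ‖P‖ < profileV φ (‖P‖ + 1) :=
    h.profileV_strictMono hc₀ (norm_nonneg P) (by linarith)
  have h1 : ∀ᶠ k in atTop, ‖fieldV φ (Q k)‖ < profileV φ (‖P‖ + 1) := by
    refine hQ.norm.eventually_lt_const ?_
    rw [norm_fieldV]; exact hv
  have hb : 0 < ‖P‖ + 1 := by positivity
  have hd := h.deriv_pos hc₀ (half_pos hε)
  set κ := deriv φ (ε / 2) / (‖P‖ + 1) * ε ^ 2 with hκ
  have hκ0 : 0 < κ := by positivity
  have h2 : ∀ᶠ k in atTop, C * ‖fieldV φ (Q k) - fieldV φ P‖ ^ 2 < κ := by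
    have := ((tendsto_iff_norm_sub_tendsto_zero.1 hQ).pow 2).const_mul C
    simp only [ne_eq, OfNat.ofNat_ne_zero, not_false_eq_true, zero_pow, mul_zero] at this
    exact this.eventually_lt_const hκ0
  obtain ⟨k₀, hk₀⟩ := eventually_atTop.1 (h1.and h2)
  refine ⟨k₀, fun k hk => ?_⟩
  obtain ⟨h3, h4⟩ := hk₀ k hk
  rw [Real.dist_eq, sub_zero, abs_of_nonneg (norm_nonneg _)]
  by_contra! hge
  refine absurd h4 (not_lt.2 (le_trans ?_ (H φ h n N (Q k) P).1))
  have hQb : ‖Q k‖ ≤ ‖P‖ + 1 := by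
    by_contra! hlt
    rw [norm_fieldV] at h3
    exact absurd h3 (not_lt.2 (h.profileV_mono hc₀ hb.le hlt.le))
  have hs1 : ε / 2 ≤ max ‖Q k‖ ‖P‖ := by
    have := norm_sub_le (Q k) P
    have := le_max_left ‖Q k‖ ‖P‖
    have := le_max_right ‖Q k‖ ‖P‖
    linarith
  have hs2 : max ‖Q k‖ ‖P‖ ≤ ‖P‖ + 1 := max_le hQb (by linarith)
  have hs0 : 0 < max ‖Q k‖ ‖P‖ := (half_pos hε).trans_le hs1
  rw [hκ]
  gcongr
  · exact div_nonneg (h.deriv_nonneg hs0.le) hs0.le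
  · exact h.deriv_nonneg hs0.le
  · exact h.monotoneOn_deriv hc₀ (half_pos hε).le hs0.le hs1

/-- At `P ≠ 0` the derivative of `V` is invertible, with the reciprocal eigenvalues. Applying the
inverse to the first-order expansion of `V` shows first that `Q_k - P = O(s_k)` and then that its
error is `o(s_k)`. -/
theorem tendsto_diffQuot_of_fieldV (h : IsOrlicz φ c₀ c₁) (hc₀ : 0 < c₀) {P X : Mat n N}
    (hP : P ≠ 0) {Q : ℕ → Mat n N} {s : ℕ → ℝ} (hs0 : ∀ k, 0 < s k)
    (hQP : Tendsto Q atTop (𝓝 P))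
    (hQ : Tendsto (fun k => (s k)⁻¹ • (fieldV φ (Q k) - fieldV φ P)) atTop (𝓝 X)) :
    Tendsto (fun k => (s k)⁻¹ • (Q k - P)) atTop (𝓝 (invDerivV φ P X)) := by
  have hp : 0 < ‖P‖ := norm_pos_iff.2 hP
  have hv := profileV_pos h hc₀ hp
  have hα := h.deriv_pos hc₀ hp
  have hα' := deriv_deriv_nonneg h hc₀ hp
  have hL := hasFDerivAt_fieldV h hc₀ hP
  set L := radialMap (profileV φ ‖P‖ / ‖P‖)
      ((deriv (deriv φ) ‖P‖ * ‖P‖ + deriv φ ‖P‖) / (2 * profileV φ ‖P‖)) P with hLdef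
  set M := radialMap (‖P‖ / profileV φ ‖P‖)
    ((2 * profileV φ ‖P‖) / (deriv (deriv φ) ‖P‖ * ‖P‖ + deriv φ ‖P‖)) P with hMdef
  have hML : ∀ Y, M (L Y) = Y := fun Y => by
    rw [hMdef, hLdef, radialMap_radialMap hP]
    have e1 : ‖P‖ / profileV φ ‖P‖ * (profileV φ ‖P‖ / ‖P‖) = 1 := by
      rw [div_mul_div_comm, mul_comm, div_self (by positivity)]
    have e2 : 2 * profileV φ ‖P‖ / (deriv (deriv φ) ‖P‖ * ‖P‖ + deriv φ ‖P‖) *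
        ((deriv (deriv φ) ‖P‖ * ‖P‖ + deriv φ ‖P‖) / (2 * profileV φ ‖P‖)) = 1 := by
      rw [div_mul_div_comm, mul_comm, div_self (by positivity)]
    rw [e1, e2, radialMap_one]
  have o1 : (fun k => fieldV φ (Q k) - fieldV φ P - L (Q k - P)) =o[atTop] fun k => Q k - P :=
    hL.isLittleO.comp_tendsto hQP
  have o2 : (fun k => M (fieldV φ (Q k) - fieldV φ P - L (Q k - P))) =o[atTop]
      fun k => Q k - P := (M.isBigO_comp _ _).trans_isLittleO o1
  have e : ∀ k, M (fieldV φ (Q k) - fieldV φ P - L (Q k - P))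
      = M (fieldV φ (Q k) - fieldV φ P) - (Q k - P) := fun k => by rw [map_sub, hML]
  simp only [e] at o2
  have o3 : (fun k => fieldV φ (Q k) - fieldV φ P) =O[atTop] s := by
    have h1 := (Asymptotics.isBigO_refl s atTop).smul (hQ.isBigO_one ℝ)
    refine (Asymptotics.IsBigO.congr h1 (fun k => ?_) fun k => ?_)
    · rw [smul_smul, mul_inv_cancel₀ (hs0 k).ne', one_smul]
    · simp
  have o4 : (fun k => Q k - P) =O[atTop] s := by
    have h1 := o2.right_isBigO_add
    have h2 : ∀ k, M (fieldV φ (Q k) - fieldV φ P) - (Q k - P) + (Q k - P)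
        = M (fieldV φ (Q k) - fieldV φ P) := fun k => sub_add_cancel _ _
    simp only [h2] at h1
    exact h1.trans ((M.isBigO_comp _ _).trans o3)
  have o5 := o2.trans_isBigO o4
  have h3 : Tendsto (fun k => (s k)⁻¹ • (M (fieldV φ (Q k) - fieldV φ P) - (Q k - P))) atTop
      (𝓝 0) := by
    rw [tendsto_zero_iff_norm_tendsto_zero]
    have := o5.norm_norm.tendsto_div_nhds_zero
    refine this.congr fun k => ?_
    rw [norm_smul, norm_inv, div_eq_inv_mul]
  have h4 := ((M.continuous.tendsto X).comp hQ).sub h3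
  rw [sub_zero] at h4
  refine h4.congr fun k => ?_
  simp only [Function.comp_apply, map_smul]
  rw [← smul_sub, sub_sub_cancel]

theorem norm_invDerivV_le (h : IsOrlicz φ c₀ c₁) (hc₀ : 0 < c₀) {a b : ℝ} (ha : 0 < a)
    {P : Mat n N} (hP : a ≤ ‖P‖) (hPb : ‖P‖ ≤ b) (X : Mat n N) :
    ‖invDerivV φ P X‖ ≤ 4 * √(b / deriv φ a) * ‖X‖ := by
  have hp : 0 < ‖P‖ := ha.trans_le hP
  have hv := profileV_pos h hc₀ hp
  have hα := h.deriv_pos hc₀ hp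
  have hα' := deriv_deriv_nonneg h hc₀ hp
  have hsq := h.profileV_sq hp.le
  have hle : ‖P‖ / deriv φ ‖P‖ ≤ b / deriv φ a :=
    div_le_div₀ (hp.le.trans hPb) hPb (h.deriv_pos hc₀ ha) (h.monotoneOn_deriv hc₀ ha.le hp.le hP)
  have e1 : ‖P‖ / profileV φ ‖P‖ ≤ √(b / deriv φ a) := by
    refine Real.le_sqrt_of_sq_le (le_trans (le_of_eq ?_) hle)
    rw [div_pow, hsq]; field_simp
  have e2 : profileV φ ‖P‖ / deriv φ ‖P‖ ≤ √(b / deriv φ a) := by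
    refine Real.le_sqrt_of_sq_le (le_trans (le_of_eq ?_) hle)
    rw [div_pow, hsq]; field_simp
  have e3 : 2 * profileV φ ‖P‖ / (deriv (deriv φ) ‖P‖ * ‖P‖ + deriv φ ‖P‖)
      ≤ 2 * √(b / deriv φ a) := by
    refine le_trans ?_ (mul_le_mul_of_nonneg_left e2 zero_le_two)
    rw [← mul_div_assoc]
    exact div_le_div_of_nonneg_left (by positivity) hα (by linarith)
  refine (norm_radialMap_le _ _ X).trans (mul_le_mul_of_nonneg_right ?_ (norm_nonneg _))
  rw [abs_of_nonneg (by positivity), abs_of_nonneg (by positivity)]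
  linarith

/-- The sign of the second-order term in the renormalized identity: for symmetric second
derivatives it is nonnegative. -/
theorem sum_inner_fluxA_deriv_nonneg (h : IsOrlicz φ c₀ c₁) (hc₀ : 0 < c₀) {P : Mat n N}
    (hP : P ≠ 0) {D : Fin n → Mat n N} (hD : ∀ i j, row i (D j) = row j (D i)) :
    0 ≤ ∑ i, (∑ l, inner ℝ (row l P) (row i (D l))) * ∑ j, inner ℝ
      (row i (radialMap (deriv φ ‖P‖ / ‖P‖) (deriv (deriv φ) ‖P‖) P (D j))) (row j P) := by
  have hp : 0 < ‖P‖ := norm_pos_iff.2 hP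
  set a := deriv φ ‖P‖ / ‖P‖ with ha
  set b := deriv (deriv φ) ‖P‖ with hb
  have ha0 : 0 ≤ a := div_nonneg (h.deriv_nonneg hp.le) hp.le
  have hb0 : 0 ≤ b := by
    have := deriv_deriv_nonneg h hc₀ hp
    exact nonneg_of_mul_nonneg_left this hp
  -- By symmetry the contraction of `P` with the differentiated rows is `P · Dᵢ`. For `P = ∇u` and
  -- `Dᵢ = ∂ᵢ∇u` this is the `i`-th derivative of `½ |∇u|²`.
  set y : Fin n → ℝ := fun i => inner ℝ P (D i) with hy
  have e1 : ∀ i, ∑ l, inner ℝ (row l P) (row i (D l)) = y i := fun i => by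
    rw [hy]
    simp only [inner_eq_sum_row P]
    exact Finset.sum_congr rfl fun l _ => by rw [hD]
  have e2 : ∀ i, ∑ j, inner ℝ (row i (radialMap a b P (D j))) (row j P)
      = a * y i + (b - a) / ‖P‖ ^ 2 * ∑ j, y j * inner ℝ (row i P) (row j P) := fun i => by
    rw [← e1 i, Finset.mul_sum, Finset.mul_sum, ← Finset.sum_add_distrib]
    refine Finset.sum_congr rfl fun j _ => ?_
    simp only [radialMap_apply, map_add, map_smul, inner_add_left, real_inner_smul_left]
    rw [real_inner_comm (row j P) (row i (D j))]
    ring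
  simp only [e1, e2]
  set z : EuclideanSpace ℝ (Fin N) := ∑ j, y j • row j P with hz
  have e3 : ∑ i, y i * (a * y i + (b - a) / ‖P‖ ^ 2 * ∑ j, y j * inner ℝ (row i P) (row j P))
      = a * ∑ i, y i ^ 2 + (b - a) / ‖P‖ ^ 2 * ‖z‖ ^ 2 := by
    have e4 : ‖z‖ ^ 2 = ∑ i, y i * ∑ j, y j * inner ℝ (row i P) (row j P) := by
      rw [← real_inner_self_eq_norm_sq, hz, sum_inner]
      refine Finset.sum_congr rfl fun i _ => ?_
      rw [inner_sum, Finset.mul_sum]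
      exact Finset.sum_congr rfl fun j _ => by
        rw [real_inner_smul_left, real_inner_smul_right]
    rw [e4, Finset.mul_sum, Finset.mul_sum, ← Finset.sum_add_distrib]
    exact Finset.sum_congr rfl fun i _ => by ring
  rw [e3]
  have e5 : ‖z‖ ^ 2 ≤ (∑ i, y i ^ 2) * ‖P‖ ^ 2 := by
    have h1 : ‖z‖ ≤ ∑ i, |y i| * ‖row i P‖ := by
      refine (norm_sum_le _ _).trans (le_of_eq ?_)
      exact Finset.sum_congr rfl fun i _ => by rw [norm_smul, Real.norm_eq_abs]
    have h2 := Finset.sum_mul_sq_le_sq_mul_sq Finset.univ (fun i => |y i|) fun i => ‖row i P‖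
    simp only [sq_abs, ← sq_norm_eq_sum_row] at h2
    exact (pow_le_pow_left₀ (norm_nonneg _) h1 2).trans h2
  -- Since `|z|² ≤ |y|² |P|²` by Cauchy-Schwarz, the quadratic form is a combination of nonnegative
  -- quantities with coefficients `a/|P|²` and `b/|P|²`, irrespective of the sign of `b - a`.
  have e6 : a * ∑ i, y i ^ 2 + (b - a) / ‖P‖ ^ 2 * ‖z‖ ^ 2
      = (a / ‖P‖ ^ 2) * ((∑ i, y i ^ 2) * ‖P‖ ^ 2 - ‖z‖ ^ 2) + b / ‖P‖ ^ 2 * ‖z‖ ^ 2 := by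
    field_simp
    ring
  rw [e6]
  have := sub_nonneg.2 e5
  positivity

end Fields

end

/-! ### Increments along segments; step sequences with almost everywhere convergence. -/

section
section Segments

variable {E F : Type*} [NormedAddCommGroup E] [NormedSpace ℝ E] [FiniteDimensional ℝ E]
  [MeasurableSpace E] [BorelSpace E] {μ : Measure E} [μ.IsAddHaarMeasure]
  [NormedAddCommGroup F] [NormedSpace ℝ F] [CompleteSpace F]

theorem segAvg_indicator_smul (K : Set E) (c : ℝ) (w : E → F) (v z : E) :
    segAvg (K.indicator fun z => c • w z) v z = c • segAvg (K.indicator w) v z := by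
  rw [segAvg_eq, segAvg_eq, ← integral_smul]
  refine integral_congr_ae (Eventually.of_forall fun r => ?_)
  by_cases hr : z + r • v ∈ K
  · simp only [indicator_of_mem hr]
  · simp only [indicator_of_notMem hr, smul_zero]

theorem HasWeakDirDeriv.ae_diffQuot_eq {D K U : Set E} {v : E} {g w : E → F}
    (h : HasWeakDirDeriv μ D v g w) (hwm : StronglyMeasurable w)
    (hg : LocallyIntegrableOn g D μ) (hw : LocallyIntegrableOn w D μ)
    (hK : IsCompact K) (hKD : K ⊆ D) (hU : IsOpen U) {t : ℝ} (ht : t ≠ 0)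
    (hseg : ∀ z ∈ U, ∀ r ∈ Icc (0 : ℝ) 1, z + r • t • v ∈ K) :
    ∀ᵐ z ∂μ, z ∈ U → t⁻¹ • (g (z + t • v) - g z) = segAvg (K.indicator w) (t • v) z := by
  have hw' : LocallyIntegrableOn (fun z => t • w z) D μ := fun z hz => by
    obtain ⟨s, hs, hi⟩ := hw z hz
    exact ⟨s, hs, hi.smul t⟩
  filter_upwards [(h.smul t).ae_sub_eq_segAvg (hwm.const_smul t) hg hw' hK hKD hU hseg] with z hz hzU
  rw [hz hzU, segAvg_indicator_smul, smul_smul, inv_mul_cancel₀ ht, one_smul]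

/-- Increments along a segment are bounded by the average of the weak derivative. -/
theorem HasWeakDirDeriv.ae_ae_norm_sub_le {D K U : Set E} {v : E} {g w : E → F}
    (h : HasWeakDirDeriv μ D v g w) (hgm : StronglyMeasurable g) (hwm : StronglyMeasurable w)
    (hg : LocallyIntegrableOn g D μ) (hw : LocallyIntegrableOn w D μ)
    (hw2 : ∫⁻ z, ‖K.indicator w z‖ₑ ^ 2 ∂μ < ⊤)
    (hK : IsCompact K) (hKD : K ⊆ D) (hU : IsOpen U)
    (hseg : ∀ z ∈ U, ∀ r ∈ Icc (0 : ℝ) 1, z + r • v ∈ K) :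
    ∀ᵐ z ∂μ, z ∈ U → ∀ᵐ r ∂volume.restrict (Ioc (0 : ℝ) 1),
      ‖g (z + r • v) - g z‖ ≤ segAvg (fun z => ‖K.indicator w z‖) v z := by
  have hwK : StronglyMeasurable (K.indicator w) := hwm.indicator hK.measurableSet
  have h1 : ∀ r ∈ Ioc (0 : ℝ) 1, ∀ᵐ z ∂μ, z ∈ U →
      ‖g (z + r • v) - g z‖ ≤ segAvg (fun z => ‖K.indicator w z‖) v z := by
    intro r hr
    have hseg' : ∀ z ∈ U, ∀ σ ∈ Icc (0 : ℝ) 1, z + σ • r • v ∈ K := fun z hz σ hσ => by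
      rw [smul_smul]
      exact hseg z hz _ ⟨mul_nonneg hσ.1 hr.1.le, mul_le_one₀ hσ.2 hr.1.le hr.2⟩
    filter_upwards [h.ae_diffQuot_eq hwm hg hw hK hKD hU hr.1.ne' hseg',
      ae_integrable_segment hwK hw2 v] with z hz1 hz2 hzU
    have e1 : g (z + r • v) - g z = r • segAvg (K.indicator w) (r • v) z := by
      rw [← hz1 hzU, smul_smul, mul_inv_cancel₀ hr.1.ne', one_smul]
    rw [e1, norm_smul, Real.norm_of_nonneg hr.1.le]
    calc r * ‖segAvg (K.indicator w) (r • v) z‖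
        ≤ r * ∫ σ in (0 : ℝ)..1, ‖K.indicator w (z + σ • r • v)‖ := by
          refine mul_le_mul_of_nonneg_left ?_ hr.1.le
          rw [segAvg]
          exact intervalIntegral.norm_integral_le_integral_norm zero_le_one
      _ = ∫ τ in (0 : ℝ)..r, ‖K.indicator w (z + τ • v)‖ := by
          have := intervalIntegral.mul_integral_comp_mul_right (a := 0) (b := 1)
            (f := fun τ => ‖K.indicator w (z + τ • v)‖) r
          simp only [zero_mul, one_mul] at this
          rw [← this]
          simp only [smul_smul]
      _ ≤ ∫ τ in (0 : ℝ)..1, ‖K.indicator w (z + τ • v)‖ := by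
          refine intervalIntegral.integral_mono_interval le_rfl hr.1.le hr.2
            (Eventually.of_forall fun τ => norm_nonneg _) ?_
          rw [intervalIntegrable_iff_integrableOn_Ioc_of_le zero_le_one]
          exact hz2.norm
  -- The bound holds for each `r` outside a null set of points that depends on `r`. Joint
  -- measurability allows the two "almost every" to be exchanged.
  have hm : MeasurableSet {p : ℝ × E | p.2 ∈ U →
      ‖g (p.2 + p.1 • v) - g p.2‖ ≤ segAvg (fun z => ‖K.indicator w z‖) v p.2} := by
    have m1 : Measurable fun p : ℝ × E => ‖g (p.2 + p.1 • v) - g p.2‖ :=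
      ((hgm.comp_measurable (measurable_shear v)).sub
        (hgm.comp_measurable measurable_snd)).norm.measurable
    have m2 : Measurable fun p : ℝ × E => segAvg (fun z => ‖K.indicator w z‖) v p.2 :=
      (stronglyMeasurable_segAvg hwK.norm v).measurable.comp measurable_snd
    have : {p : ℝ × E | p.2 ∈ U →
      ‖g (p.2 + p.1 • v) - g p.2‖ ≤ segAvg (fun z => ‖K.indicator w z‖) v p.2}
      = (Prod.snd ⁻¹' U)ᶜ ∪ {p | ‖g (p.2 + p.1 • v) - g p.2‖
          ≤ segAvg (fun z => ‖K.indicator w z‖) v p.2} := by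
      ext p
      simp only [mem_ofPred_eq, mem_union, mem_compl_iff, mem_preimage]
      tauto
    rw [this]
    exact (measurable_snd hU.measurableSet).compl.union (measurableSet_le m1 m2)
  have h2 : ∀ᵐ r ∂volume.restrict (Ioc (0 : ℝ) 1), ∀ᵐ z ∂μ, z ∈ U →
      ‖g (z + r • v) - g z‖ ≤ segAvg (fun z => ‖K.indicator w z‖) v z :=
    (ae_restrict_iff' measurableSet_Ioc).2 (Eventually.of_forall h1)
  rw [Measure.ae_ae_comm hm] at h2
  filter_upwards [h2] with z hz hzU
  filter_upwards [hz] with r hr using hr hzU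

theorem ae_tendsto_zero_of_tsum_ne_top {X : Type*} [MeasurableSpace X] {μ : Measure X}
    {f : ℕ → X → ℝ≥0∞} (hf : ∀ k, Measurable (f k)) (h : ∑' k, ∫⁻ z, f k z ∂μ ≠ ⊤) :
    ∀ᵐ z ∂μ, Tendsto (fun k => f k z) atTop (𝓝 0) := by
  rw [← lintegral_tsum fun k => (hf k).aemeasurable] at h
  filter_upwards [ae_lt_top (Measurable.tsum hf) h] with z hz
  exact ENNReal.tendsto_atTop_zero_of_tsum_ne_top hz.ne

end Segments

section Limits

variable {n N : ℕ}

/-- A sequence of step sizes along which all averages over short segments converge, with a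
common error function. -/
structure IsLimitSeq (Gb : SpaceTime n → Mat n N) (Wb : Fin n → SpaceTime n → Mat n N)
    (s : ℕ → ℝ) (e : ℕ → SpaceTime n → ℝ) : Prop where
  pos : ∀ k, 0 < s k
  tendsto : Tendsto s atTop (𝓝 0)
  integrable : ∀ k, Integrable (e k)
  tendsto_integral : Tendsto (fun k => ∫ z, e k z) atTop (𝓝 0)
  ae_tendsto : ∀ᵐ z, Tendsto (fun k => e k z) atTop (𝓝 0)
  deriv_le : ∀ k j z, ‖segAvg (Wb j) (s k • sdir j) z - Wb j z‖ ^ 2 ≤ e k z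
  norm_le : ∀ k j z, ‖segAvg (fun z => ‖Wb j z‖) (s k • sdir j) z - ‖Wb j z‖‖ ^ 2 ≤ e k z
  grad_le : ∀ k j z, ‖segAvg Gb (s k • sdir j) z - Gb z‖ ^ 2 ≤ e k z
  grad_neg_le : ∀ k j z, ‖segAvg Gb ((-s k) • sdir j) z - Gb z‖ ^ 2 ≤ e k z

/-- All averages converge in `L²` as the step tends to 0. Steps whose errors have integral at most
`2^(-k)` make the integrals summable, so the errors tend to 0 almost everywhere as well as in `L¹`.
-/
theorem exists_isLimitSeq {Gb : SpaceTime n → Mat n N} {Wb : Fin n → SpaceTime n → Mat n N}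
    (hG : StronglyMeasurable Gb) (hW : ∀ j, StronglyMeasurable (Wb j))
    (hG2 : ∫⁻ z, ‖Gb z‖ₑ ^ 2 < ⊤) (hW2 : ∀ j, ∫⁻ z, ‖Wb j z‖ₑ ^ 2 < ⊤) {h₀ : ℝ} (hh₀ : 0 < h₀) :
    ∃ s e, IsLimitSeq Gb Wb s e ∧ ∀ k, s k ≤ h₀ := by
  -- the error function
  set a : Fin n → ℝ → SpaceTime n → ℝ := fun j t z =>
    ‖segAvg (Wb j) (t • sdir j) z - Wb j z‖ ^ 2
      + ‖segAvg (fun z => ‖Wb j z‖) (t • sdir j) z - ‖Wb j z‖‖ ^ 2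
      + ‖segAvg Gb (t • sdir j) z - Gb z‖ ^ 2 + ‖segAvg Gb ((-t) • sdir j) z - Gb z‖ ^ 2 with ha
  set err : ℝ → SpaceTime n → ℝ := fun t z => ∑ j, a j t z with herr
  have ha0 : ∀ j t z, 0 ≤ a j t z := fun j t z => by positivity
  have hle : ∀ j t z, a j t z ≤ err t z := fun j t z =>
    Finset.single_le_sum (f := fun j => a j t z) (fun i _ => ha0 i t z) (Finset.mem_univ j)
  have hN2 : ∀ j, ∫⁻ z, ‖‖Wb j z‖‖ₑ ^ 2 < ⊤ := fun j => by simpa using hW2 j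
  have hmeas : ∀ {F : Type} [NormedAddCommGroup F] [NormedSpace ℝ F] (X : SpaceTime n → F),
      StronglyMeasurable X → ∀ v, Measurable fun z => ‖segAvg X v z - X z‖ ^ 2 :=
    fun X hX v => ((stronglyMeasurable_segAvg hX v).sub hX).norm.measurable.pow_const 2
  have ham : ∀ j t, Measurable (a j t) := fun j t =>
    (((hmeas _ (hW j) _).add (hmeas _ (hW j).norm _)).add (hmeas _ hG _)).add (hmeas _ hG _)
  have hem : ∀ t, Measurable (err t) := fun t => Finset.measurable_sum _ fun j _ => ham j t
  have hlim1 : ∀ {F : Type} [NormedAddCommGroup F] [NormedSpace ℝ F] [CompleteSpace F]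
      (X : SpaceTime n → F), StronglyMeasurable X → ∫⁻ z, ‖X z‖ₑ ^ 2 < ⊤ → ∀ v : ℝ → SpaceTime n,
      Tendsto v (𝓝 0) (𝓝 0) →
      Tendsto (fun t => ∫⁻ z, ENNReal.ofReal (‖segAvg X (v t) z - X z‖ ^ 2)) (𝓝 0) (𝓝 0) := by
    intro F _ _ _ X hX hX2 v hv
    refine ((tendsto_lintegral_segAvg_sub (μ := volume) hX hX2).comp hv).congr fun t => ?_
    refine lintegral_congr fun z => ?_
    rw [ENNReal.ofReal_pow (norm_nonneg _), ofReal_norm]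
  have hv : ∀ j : Fin n, Tendsto (fun t : ℝ => t • (sdir j : SpaceTime n)) (𝓝 0) (𝓝 0) :=
    fun j => Continuous.tendsto' (by fun_prop) _ _ (by simp)
  have hv' : ∀ j : Fin n, Tendsto (fun t : ℝ => (-t) • (sdir j : SpaceTime n)) (𝓝 0) (𝓝 0) :=
    fun j => Continuous.tendsto' (by fun_prop) _ _ (by simp)
  have hlim : Tendsto (fun t => ∫⁻ z, ENNReal.ofReal (err t z)) (𝓝 0) (𝓝 0) := by
    have e1 : ∀ t, ∫⁻ z, ENNReal.ofReal (err t z) = ∑ j, ∫⁻ z, ENNReal.ofReal (a j t z) := by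
      intro t
      rw [← lintegral_finsetSum _ fun j _ => (ham j t).ennreal_ofReal]
      exact lintegral_congr fun z => ENNReal.ofReal_sum_of_nonneg fun j _ => ha0 j t z
    simp only [e1]
    have : (0 : ℝ≥0∞) = ∑ j : Fin n, 0 := by simp
    rw [this]
    refine tendsto_finsetSum _ fun j _ => ?_
    have e2 : ∀ t, ∫⁻ z, ENNReal.ofReal (a j t z)
        = (∫⁻ z, ENNReal.ofReal (‖segAvg (Wb j) (t • sdir j) z - Wb j z‖ ^ 2))
          + (∫⁻ z, ENNReal.ofReal (‖segAvg (fun z => ‖Wb j z‖) (t • sdir j) z - ‖Wb j z‖‖ ^ 2))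
          + (∫⁻ z, ENNReal.ofReal (‖segAvg Gb (t • sdir j) z - Gb z‖ ^ 2))
          + ∫⁻ z, ENNReal.ofReal (‖segAvg Gb ((-t) • sdir j) z - Gb z‖ ^ 2) := by
      intro t
      rw [← lintegral_add_right _ (hmeas _ (hW j).norm _).ennreal_ofReal,
        ← lintegral_add_right _ (hmeas _ hG _).ennreal_ofReal,
        ← lintegral_add_right _ (hmeas _ hG _).ennreal_ofReal]
      refine lintegral_congr fun z => ?_
      rw [ha, ENNReal.ofReal_add (by positivity) (by positivity),
        ENNReal.ofReal_add (by positivity) (by positivity),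
        ENNReal.ofReal_add (by positivity) (by positivity)]
    simp only [e2]
    have l1 := hlim1 _ (hW j) (hW2 j) _ (hv j)
    have l2 := hlim1 _ (hW j).norm (hN2 j) _ (hv j)
    have l3 := hlim1 _ hG hG2 _ (hv j)
    have l4 := hlim1 _ hG hG2 _ (hv' j)
    have l5 := ((l1.add l2).add l3).add l4
    rwa [add_zero, add_zero, add_zero] at l5
  -- choice of the sequence
  have hchoose : ∀ k : ℕ, ∃ t, 0 < t ∧ t ≤ h₀ ∧ t ≤ 1 / ((k : ℝ) + 1) ∧
      ∫⁻ z, ENNReal.ofReal (err t z) ≤ (1 / 2) ^ k := by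
    intro k
    have h1 : ∀ᶠ t in 𝓝 (0 : ℝ), ∫⁻ z, ENNReal.ofReal (err t z) ≤ (1 / 2) ^ k :=
      hlim.eventually_le_const (ENNReal.pow_pos (by norm_num) k)
    obtain ⟨δ, hδ, hball⟩ := Metric.eventually_nhds_iff.1 h1
    have hk : (0 : ℝ) < 1 / ((k : ℝ) + 1) := by positivity
    refine ⟨min (δ / 2) (min h₀ (1 / ((k : ℝ) + 1))), by positivity,
      (min_le_right _ _).trans (min_le_left _ _), (min_le_right _ _).trans (min_le_right _ _),
      hball ?_⟩
    rw [Real.dist_eq, sub_zero, abs_of_nonneg (by positivity)]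
    exact (min_le_left _ _).trans_lt (by linarith)
  choose s hs0 hsh hsk hse using hchoose
  have hfin : ∀ k, ∫⁻ z, ENNReal.ofReal (err (s k) z) < ⊤ := fun k =>
    (hse k).trans_lt (ENNReal.pow_lt_top (by norm_num))
  have he0 : ∀ k z, 0 ≤ err (s k) z := fun k z => Finset.sum_nonneg fun j _ => ha0 j _ z
  have hint : ∀ k, Integrable (err (s k)) := fun k => by
    refine ⟨(hem _).aestronglyMeasurable, ?_⟩
    rw [hasFiniteIntegral_iff_ofReal (Eventually.of_forall (he0 k))]
    exact hfin k
  refine ⟨s, fun k => err (s k), ⟨hs0, ?_, hint, ?_, ?_, fun k j z => ?_, fun k j z => ?_,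
    fun k j z => ?_, fun k j z => ?_⟩, hsh⟩
  · exact squeeze_zero (fun k => (hs0 k).le) hsk tendsto_one_div_add_atTop_nhds_zero_nat
  · have h1 : ∀ k, ∫ z, err (s k) z ≤ (1 / 2 : ℝ) ^ k := fun k => by
      rw [integral_eq_lintegral_of_nonneg_ae (Eventually.of_forall (he0 k))
        (hem _).aestronglyMeasurable]
      refine (ENNReal.toReal_mono (ENNReal.pow_lt_top (by norm_num)).ne (hse k)).trans (le_of_eq ?_)
      simp
    exact squeeze_zero (fun k => integral_nonneg (he0 k)) h1
      (tendsto_pow_atTop_nhds_zero_of_lt_one (by norm_num) (by norm_num))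
  · have h1 : ∑' k, ∫⁻ z, ENNReal.ofReal (err (s k) z) ≠ ⊤ := by
      refine ne_top_of_le_ne_top ?_ (ENNReal.tsum_le_tsum hse)
      rw [ENNReal.tsum_geometric]
      norm_num
    filter_upwards [ae_tendsto_zero_of_tsum_ne_top (fun k => (hem (s k)).ennreal_ofReal) h1]
      with z hz
    have := (ENNReal.tendsto_toReal ENNReal.zero_ne_top).comp hz
    simpa [Function.comp_def, ENNReal.toReal_ofReal (he0 _ z)] using this
  all_goals
    refine le_trans ?_ (hle j (s k) z)
    simp only [ha]
    have q1 := sq_nonneg ‖segAvg (Wb j) (s k • sdir j) z - Wb j z‖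
    have q2 := sq_nonneg ‖segAvg (fun z => ‖Wb j z‖) (s k • sdir j) z - ‖Wb j z‖‖
    have q3 := sq_nonneg ‖segAvg Gb (s k • sdir j) z - Gb z‖
    have q4 := sq_nonneg ‖segAvg Gb ((-s k) • sdir j) z - Gb z‖
    linarith

namespace IsLimitSeq

variable {Gb : SpaceTime n → Mat n N} {Wb : Fin n → SpaceTime n → Mat n N}
    {s : ℕ → ℝ} {e : ℕ → SpaceTime n → ℝ}

theorem tendsto_of_sq_le {F : Type*} [NormedAddCommGroup F] {x : ℕ → F} {y : F} {ε : ℕ → ℝ}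
    (h : ∀ k, ‖x k - y‖ ^ 2 ≤ ε k) (hε : Tendsto ε atTop (𝓝 0)) : Tendsto x atTop (𝓝 y) := by
  rw [tendsto_iff_norm_sub_tendsto_zero]
  have h1 : Tendsto (fun k => √(ε k)) atTop (𝓝 0) := by
    have := (Real.continuous_sqrt.tendsto 0).comp hε
    rwa [Real.sqrt_zero] at this
  exact squeeze_zero (fun k => norm_nonneg _) (fun k => Real.le_sqrt_of_sq_le (h k)) h1

/-- Dominated convergence with the error function of the sequence. -/
theorem tendsto_integral_of_le (h : IsLimitSeq Gb Wb s e) {F : Type*} [NormedAddCommGroup F]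
    [NormedSpace ℝ F] {f : ℕ → SpaceTime n → F} {f₀ : SpaceTime n → F} {g : SpaceTime n → ℝ}
    {C : ℝ} (hf : ∀ k, AEStronglyMeasurable (f k)) (hg : Integrable g)
    (hle : ∀ k, ∀ᵐ z, ‖f k z‖ ≤ C * (e k z + g z))
    (hlim : ∀ᵐ z, Tendsto (fun k => f k z) atTop (𝓝 (f₀ z))) :
    Integrable f₀ ∧ Tendsto (fun k => ∫ z, f k z) atTop (𝓝 (∫ z, f₀ z)) := by
  refine tendsto_integral_of_tendsto_bound (g := fun k z => C * (e k z + g z))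
    (g₀ := fun z => C * (0 + g z)) hf (fun k => ((h.integrable k).add hg).const_mul C)
    (by simpa using hg.const_mul C) hle hlim ?_ ?_
  · filter_upwards [h.ae_tendsto] with z hz
    exact (hz.add_const _).const_mul C
  · have e1 : ∀ k, ∫ z, C * (e k z + g z) = C * ((∫ z, e k z) + ∫ z, g z) := fun k => by
      rw [integral_const_mul, integral_add (h.integrable k) hg]
    have e2 : ∫ z, C * (0 + g z) = C * (0 + ∫ z, g z) := by
      simp only [zero_add]; rw [integral_const_mul]
    simp only [e1, e2]
    exact (h.tendsto_integral.add_const _).const_mul C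

end IsLimitSeq

end Limits

end

/-! ### Annular cutoffs in matrix space and limits of difference quotients. -/

section
open PhiCaloric.IsOrlicz (profileV)


section AnnulusCutoff

variable {n N : ℕ}

/-- A smooth function, positive exactly on the open annulus with radii `a` and `b`. -/
noncomputable def annulusCutoff (a b : ℝ) (P : Mat n N) : ℝ :=
  expNegInvGlue (‖P‖ ^ 2 - a ^ 2) * expNegInvGlue (b ^ 2 - ‖P‖ ^ 2)

theorem contDiff_annulusCutoff (a b : ℝ) : ContDiff ℝ 1 (annulusCutoff a b : Mat n N → ℝ) :=
  (expNegInvGlue.contDiff.comp ((contDiff_norm_sq ℝ).sub contDiff_const)).mul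
    (expNegInvGlue.contDiff.comp (contDiff_const.sub (contDiff_norm_sq ℝ)))

theorem annulusCutoff_pos {a b : ℝ} (ha : 0 < a) {P : Mat n N} (h1 : a < ‖P‖) (h2 : ‖P‖ < b) :
    0 < annulusCutoff a b P := by
  refine mul_pos (expNegInvGlue.pos_of_pos ?_) (expNegInvGlue.pos_of_pos ?_) <;> nlinarith

theorem annulus_of_ne_zero {a b : ℝ} (hb : 0 < b) {P : Mat n N}
    (h : annulusCutoff a b P ≠ 0) : a ≤ ‖P‖ ∧ ‖P‖ ≤ b := by
  unfold annulusCutoff at h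
  have hP := norm_nonneg P
  constructor
  · by_contra! hlt
    refine h (mul_eq_zero_of_left (expNegInvGlue.zero_of_nonpos ?_) _)
    nlinarith
  · by_contra! hlt
    refine h (mul_eq_zero_of_right _ (expNegInvGlue.zero_of_nonpos ?_))
    nlinarith

/-- `C¹` functions supported in an annulus. -/
structure IsAnnular {F : Type*} [NormedAddCommGroup F] [NormedSpace ℝ F] (γ : Mat n N → F)
    (a b : ℝ) : Prop where
  contDiff : ContDiff ℝ 1 γ
  pos : 0 < a
  lt : a < b
  supp : ∀ P, γ P ≠ 0 → a ≤ ‖P‖ ∧ ‖P‖ ≤ b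

theorem isAnnular_annulusCutoff {a b : ℝ} (ha : 0 < a) (hab : a < b) :
    IsAnnular (annulusCutoff a b : Mat n N → ℝ) a b :=
  ⟨contDiff_annulusCutoff a b, ha, hab, fun _ h => annulus_of_ne_zero (ha.trans hab) h⟩

theorem isAnnular_annulusCutoff_smul_row {a b : ℝ} (ha : 0 < a) (hab : a < b) (i : Fin n) :
    IsAnnular (fun P : Mat n N => annulusCutoff a b P • row i P) a b :=
  ⟨(contDiff_annulusCutoff a b).smul (row i).contDiff, ha, hab,
    fun _ h => annulus_of_ne_zero (ha.trans hab) (left_ne_zero_of_smul h)⟩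

namespace IsAnnular

variable {F : Type*} [NormedAddCommGroup F] [NormedSpace ℝ F] {γ : Mat n N → F} {a b : ℝ}
  {φ : ℝ → ℝ} {c₀ c₁ : ℝ}

/-- Away from 0 and infinity, increments of matrices are controlled by increments of `V`. Hence
`γ(∇u)` inherits difference quotients bounded in `L²` from `V(∇u)`, although `∇u` itself need not
have them. -/
theorem exists_bound (h : IsAnnular γ a b) (hφ : IsOrlicz φ c₀ c₁) (hc₀ : 0 < c₀) :
    ∃ C, 0 ≤ C ∧ (∀ P, ‖γ P‖ ≤ C) ∧
      ∀ P Q, ‖γ P - γ Q‖ ≤ C * ‖fieldV φ P - fieldV φ Q‖ := by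
  have hc : HasCompactSupport γ := by
    refine HasCompactSupport.intro (isCompact_closedBall (0 : Mat n N) b) fun P hP => ?_
    by_contra hne
    exact hP (mem_closedBall_zero_iff.2 (h.supp P hne).2)
  obtain ⟨B, hB⟩ := hc.exists_bound_of_continuous h.contDiff.continuous
  obtain ⟨L, hL⟩ := (hc.fderiv ℝ).exists_bound_of_continuous
    (h.contDiff.continuous_fderiv (by norm_num))
  obtain ⟨C, hC0, hC⟩ := exists_norm_sub_le_mul_fieldV (γ := γ) hφ hc₀ h.pos h.lt hB
    (fun P Q => Convex.norm_image_sub_le_of_norm_fderiv_le (𝕜 := ℝ) (s := univ)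
      (fun x _ => h.contDiff.differentiable (by norm_num) x) (fun x _ => hL x) convex_univ
      (mem_univ Q) (mem_univ P)) h.supp
  refine ⟨max B C, le_max_of_le_right hC0, fun P => (hB P).trans (le_max_left _ _),
    fun P Q => (hC P Q).trans ?_⟩
  gcongr
  exact le_max_right _ _

theorem eq_zero_of_norm_lt (h : IsAnnular γ a b) {P : Mat n N} (hP : ‖P‖ < a) : γ P = 0 := by
  by_contra hne
  exact absurd (h.supp P hne).1 (not_le.2 hP)

theorem fderiv_zero (h : IsAnnular γ a b) : fderiv ℝ γ 0 = 0 := by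
  have : γ =ᶠ[𝓝 0] fun _ => 0 := by
    filter_upwards [Metric.ball_mem_nhds (0 : Mat n N) h.pos] with P hP
    exact h.eq_zero_of_norm_lt (by simpa using hP)
  rw [this.fderiv_eq]; simp

end IsAnnular

end AnnulusCutoff

section Setup

variable {n N : ℕ}

theorem IsMeasSolution.locallyIntegrable_fieldV {φ : ℝ → ℝ} {D : Set (SpaceTime n)}
    {u : SpaceTime n → EuclideanSpace ℝ (Fin N)} {G : SpaceTime n → Mat n N}
    (h : IsMeasSolution φ D u G) : LocallyIntegrableOn (fun z => fieldV φ (G z)) D := by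
  have hm : StronglyMeasurable fun z => fieldV φ (G z) :=
    (measurable_fieldV.comp h.meas_G.measurable).stronglyMeasurable
  refine (((locallyIntegrable_const (1 : ℝ)).locallyIntegrableOn D).add
    h.int_V_sq).mono hm.aestronglyMeasurable (Eventually.of_forall fun z => ?_)
  rw [Pi.add_apply, Real.norm_of_nonneg (by positivity)]
  nlinarith [sq_nonneg (‖fieldV φ (G z)‖ - 1), sq_nonneg ‖fieldV φ (G z)‖]

/-- A solution, the weak derivatives `W` of `V(∇u)`, a region and a sequence of step sizes. -/
structure IsLimitSetup (φ : ℝ → ℝ) (c₀ c₁ : ℝ) (D : Set (SpaceTime n))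
    (u : SpaceTime n → EuclideanSpace ℝ (Fin N)) (G : SpaceTime n → Mat n N)
    (W : Fin n → SpaceTime n → Mat n N) (K U : Set (SpaceTime n)) (h₀ : ℝ) (s : ℕ → ℝ)
    (e : ℕ → SpaceTime n → ℝ) : Prop where
  orlicz : IsOrlicz φ c₀ c₁
  pos : 0 < c₀
  sol : IsMeasSolution φ D u G
  meas : ∀ j, StronglyMeasurable (W j)
  int : ∀ j, LocallyIntegrableOn (W j) D
  int_sq : ∀ j, LocallyIntegrableOn (fun z => ‖W j z‖ ^ 2) D
  weakDeriv : ∀ j, HasWeakDirDeriv volume D (sdir j) (fun z => fieldV φ (G z)) (W j)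
  region : IsRegion D K U h₀
  lim : IsLimitSeq (K.indicator G) (fun j => K.indicator (W j)) s e
  step_le : ∀ k, s k ≤ h₀

/-- The second derivatives `∂_j ∇u`, on the set where `∇u ≠ 0`. -/
noncomputable def hess (φ : ℝ → ℝ) (G : SpaceTime n → Mat n N)
    (W : Fin n → SpaceTime n → Mat n N) (j : Fin n) (z : SpaceTime n) : Mat n N :=
  invDerivV φ (G z) (W j z)

/-- A fixed integrable function which dominates, together with the error function. -/
noncomputable def baseFn (φ : ℝ → ℝ) (G : SpaceTime n → Mat n N)
    (W : Fin n → SpaceTime n → Mat n N) (K : Set (SpaceTime n)) (z : SpaceTime n) : ℝ :=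
  K.indicator (fun z => 1 + ∑ j, ‖W j z‖ ^ 2 + ‖G z‖ ^ 2 + ‖fieldV φ (G z)‖ ^ 2) z

namespace IsLimitSetup

variable {φ : ℝ → ℝ} {c₀ c₁ : ℝ} {D : Set (SpaceTime n)}
    {u : SpaceTime n → EuclideanSpace ℝ (Fin N)} {G : SpaceTime n → Mat n N}
    {W : Fin n → SpaceTime n → Mat n N} {K U : Set (SpaceTime n)} {h₀ : ℝ} {s : ℕ → ℝ}
    {e : ℕ → SpaceTime n → ℝ}

theorem shift (h : IsLimitSetup φ c₀ c₁ D u G W K U h₀ s e) (k₀ : ℕ) :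
    IsLimitSetup φ c₀ c₁ D u G W K U h₀ (fun k => s (k + k₀)) (fun k => e (k + k₀)) :=
  ⟨h.orlicz, h.pos, h.sol, h.meas, h.int, h.int_sq, h.weakDeriv, h.region,
    ⟨fun k => h.lim.pos _, h.lim.tendsto.comp (tendsto_add_atTop_nat k₀),
      fun k => h.lim.integrable _, h.lim.tendsto_integral.comp (tendsto_add_atTop_nat k₀), by
        filter_upwards [h.lim.ae_tendsto] with z hz using hz.comp (tendsto_add_atTop_nat k₀),
      fun k => h.lim.deriv_le _, fun k => h.lim.norm_le _, fun k => h.lim.grad_le _,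
      fun k => h.lim.grad_neg_le _⟩, fun k => h.step_le _⟩

variable (h : IsLimitSetup φ c₀ c₁ D u G W K U h₀ s e)
include h

theorem abs_step (k : ℕ) : |s k| ≤ h₀ := by rw [abs_of_pos (h.lim.pos k)]; exact h.step_le k

theorem err_nonneg [Nonempty (Fin n)] (k : ℕ) (z : SpaceTime n) : 0 ≤ e k z :=
  (sq_nonneg _).trans (h.lim.deriv_le k (Classical.arbitrary _) z)

theorem integrable_baseFn : Integrable (baseFn φ G W K) := by
  have h1 : LocallyIntegrableOn (fun z => 1 + ∑ j, ‖W j z‖ ^ 2 + ‖G z‖ ^ 2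
      + ‖fieldV φ (G z)‖ ^ 2) D := by
    refine ((LocallyIntegrableOn.add ?_ ?_).add h.sol.int_G_sq).add h.sol.int_V_sq
    · exact (locallyIntegrable_const 1).locallyIntegrableOn D
    · intro z hz
      choose t ht hti using fun j => h.int_sq j z hz
      refine ⟨⋂ j, t j, iInter_mem.2 ht, ?_⟩
      exact integrable_finsetSum _ fun j _ => (hti j).mono_set (iInter_subset _ j)
  exact h.sol.integrable_indicator h1 h.region

theorem baseFn_of_mem {z : SpaceTime n} (hz : z ∈ K) : baseFn φ G W K z
    = 1 + ∑ j, ‖W j z‖ ^ 2 + ‖G z‖ ^ 2 + ‖fieldV φ (G z)‖ ^ 2 := indicator_of_mem hz _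

theorem baseFn_nonneg (z : SpaceTime n) : 0 ≤ baseFn φ G W K z :=
  indicator_nonneg (fun z _ => by positivity) z

theorem ae_diffQuot_fieldV : ∀ᵐ z, z ∈ U → ∀ k j,
    (s k)⁻¹ • (fieldV φ (K.indicator G (z + s k • sdir j)) - fieldV φ (K.indicator G z))
      = segAvg (K.indicator (W j)) (s k • sdir j) z := by
  have h1 : ∀ᵐ z, ∀ k j, z ∈ U →
      (s k)⁻¹ • (fieldV φ (G (z + s k • sdir j)) - fieldV φ (G z))
        = segAvg (K.indicator (W j)) (s k • sdir j) z := by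
    refine ae_all_iff.2 fun k => ae_all_iff.2 fun j => ?_
    exact (h.weakDeriv j).ae_diffQuot_eq (h.meas j) h.sol.locallyIntegrable_fieldV (h.int j) h.region.isCompact
      h.region.subset h.region.isOpen (h.lim.pos k).ne'
      fun z hz r hr => h.region.seg' hz j (h.abs_step k) hr
  filter_upwards [h1] with z hz hzU k j
  rw [← hz k j hzU, indicator_of_mem (h.region.sub hzU),
    indicator_of_mem (h.region.seg_one hzU j (h.abs_step k))]

theorem ae_tendsto_segAvg : ∀ᵐ z, z ∈ U → ∀ j,
    Tendsto (fun k => segAvg (K.indicator (W j)) (s k • sdir j) z) atTop (𝓝 (W j z)) := by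
  filter_upwards [h.lim.ae_tendsto] with z hz hzU j
  have := IsLimitSeq.tendsto_of_sq_le (fun k => h.lim.deriv_le k j z) hz
  rwa [indicator_of_mem (h.region.sub hzU)] at this

/-- Along the sequence, increments of `∇u` tend to zero, and difference quotients converge where
`∇u ≠ 0`. -/
theorem ae_tendsto_grad : ∀ᵐ z, z ∈ U → ∀ j,
    Tendsto (fun k => K.indicator G (z + s k • sdir j)) atTop (𝓝 (G z)) ∧
    (G z ≠ 0 → Tendsto (fun k => (s k)⁻¹ • (K.indicator G (z + s k • sdir j) - G z)) atTop
      (𝓝 (hess φ G W j z))) := by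
  filter_upwards [h.ae_diffQuot_fieldV, h.ae_tendsto_segAvg] with z h1 h2 hzU j
  have h3 := h2 hzU j
  simp only [← h1 hzU, indicator_of_mem (h.region.sub hzU)] at h3
  have h4 : Tendsto (fun k => K.indicator G (z + s k • sdir j)) atTop (𝓝 (G z)) := by
    refine tendsto_of_tendsto_fieldV h.orlicz h.pos ?_
    have h5 := (h.lim.tendsto.smul h3).add_const (fieldV φ (G z))
    rw [zero_smul, zero_add] at h5
    refine h5.congr fun k => ?_
    rw [smul_smul, mul_inv_cancel₀ (h.lim.pos k).ne', one_smul, sub_add_cancel]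
  exact ⟨h4, fun hne => tendsto_diffQuot_of_fieldV h.orlicz h.pos hne h.lim.pos h4 h3⟩

theorem ae_tendsto_annular {F : Type*} [NormedAddCommGroup F] [NormedSpace ℝ F]
    {γ : Mat n N → F} {a b : ℝ} (hγ : IsAnnular γ a b) : ∀ᵐ z, z ∈ U → ∀ j,
    Tendsto (fun k => (s k)⁻¹ • (γ (K.indicator G (z + s k • sdir j)) - γ (G z))) atTop
      (𝓝 (fderiv ℝ γ (G z) (hess φ G W j z))) := by
  filter_upwards [h.ae_tendsto_grad] with z h1 hzU j
  obtain ⟨h2, h3⟩ := h1 hzU j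
  -- Near a zero of the gradient an annular function vanishes identically, so the quotients are
  -- eventually 0 and the value of `hess` there does not matter.
  by_cases hG : G z = 0
  · rw [hG, hγ.fderiv_zero, zero_apply]
    refine tendsto_const_nhds.congr' ?_
    rw [hG] at h2
    filter_upwards [h2.norm.eventually_lt_const (by simpa using hγ.pos)] with k hk
    rw [hγ.eq_zero_of_norm_lt hk, hγ.eq_zero_of_norm_lt (by simpa using hγ.pos), sub_zero,
      smul_zero]
  · exact tendsto_diffQuot_of_hasFDerivAt
      (hγ.contDiff.differentiable (by norm_num) _).hasFDerivAt h.lim.pos h.lim.tendsto (h3 hG)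

theorem sq_norm_segAvg_deriv_le (k : ℕ) (j : Fin n) (z : SpaceTime n) :
    ‖segAvg (K.indicator (W j)) (s k • sdir j) z‖ ^ 2 ≤ 2 * (e k z + baseFn φ G W K z) := by
  have h1 := h.lim.deriv_le k j z
  have h2 : ‖K.indicator (W j) z‖ ^ 2 ≤ baseFn φ G W K z := by
    by_cases hz : z ∈ K
    · rw [h.baseFn_of_mem hz, indicator_of_mem hz]
      have := Finset.single_le_sum (f := fun j => ‖W j z‖ ^ 2) (fun i _ => sq_nonneg _)
        (Finset.mem_univ j)
      have := sq_nonneg ‖G z‖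
      have := sq_nonneg ‖fieldV φ (G z)‖
      linarith
    · rw [indicator_of_notMem hz, norm_zero]
      simpa using h.baseFn_nonneg z
  have h3 := sq_norm_sub_le (segAvg (K.indicator (W j)) (s k • sdir j) z - K.indicator (W j) z)
    (-K.indicator (W j) z)
  rw [sub_neg_eq_add, sub_add_cancel, norm_neg] at h3
  linarith

theorem sq_norm_segAvg_grad_neg_le (k : ℕ) (j : Fin n) (z : SpaceTime n) :
    ‖segAvg (K.indicator G) ((-s k) • sdir j) z‖ ^ 2 ≤ 2 * (e k z + baseFn φ G W K z) := by
  have h1 := h.lim.grad_neg_le k j z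
  have h2 : ‖K.indicator G z‖ ^ 2 ≤ baseFn φ G W K z := by
    by_cases hz : z ∈ K
    · rw [h.baseFn_of_mem hz, indicator_of_mem hz]
      have : 0 ≤ 1 + ∑ j, ‖W j z‖ ^ 2 + ‖fieldV φ (G z)‖ ^ 2 := by positivity
      linarith
    · rw [indicator_of_notMem hz, norm_zero]
      simpa using h.baseFn_nonneg z
  have h3 := sq_norm_sub_le (segAvg (K.indicator G) ((-s k) • sdir j) z - K.indicator G z)
    (-K.indicator G z)
  rw [sub_neg_eq_add, sub_add_cancel, norm_neg] at h3
  linarith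

end IsLimitSetup

end Setup

end

/-! ### Symmetry of the second derivatives where the gradient is nonzero. -/

section
open PhiCaloric.IsOrlicz (profileV)


section Symmetry

variable {n N : ℕ}

/-- Discrete integration by parts, twice. -/
theorem integral_sub_smul_sub_comm {F : Type*} [NormedAddCommGroup F] [NormedSpace ℝ F]
    {ψ : SpaceTime n → ℝ} {v : SpaceTime n → F} (hψ : StronglyMeasurable ψ) {C : ℝ}
    (hC : ∀ z, ‖ψ z‖ ≤ C) (hv : Integrable v) (a b : SpaceTime n) :
    ∫ z, (ψ (z + a) - ψ z) • (v z - v (z - b)) = ∫ z, (ψ (z + b) - ψ z) • (v z - v (z - a)) := by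
  have hI : ∀ c d, Integrable fun z => ψ (z + c) • v (z - d) := fun c d => by
    have hv' := hv.comp_sub_right d
    refine (hv'.norm.const_mul C).mono' ?_ (Eventually.of_forall fun z => ?_)
    · exact (hψ.comp_measurable (measurable_id.add_const c)).aestronglyMeasurable.smul hv'.1
    · rw [norm_smul]; exact mul_le_mul_of_nonneg_right (hC _) (norm_nonneg _)
  have hI0 : ∀ c, Integrable fun z => ψ (z + c) • v z := fun c => by simpa using hI c 0
  have hI1 : ∀ d, Integrable fun z => ψ z • v (z - d) := fun d => by simpa using hI 0 d
  have hI2 : Integrable fun z => ψ z • v z := by simpa using hI 0 0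
  have hT : ∀ c d, ∫ z, ψ (z + c) • v (z - d) = ∫ z, ψ (z + c + d) • v z := fun c d => by
    rw [← integral_add_right_eq_self _ d]
    refine integral_congr_ae (Eventually.of_forall fun z => ?_)
    simp only [add_sub_cancel_right]
    rw [add_right_comm]
  have hT0 : ∀ d, ∫ z, ψ z • v (z - d) = ∫ z, ψ (z + d) • v z := fun d => by
    simpa using hT 0 d
  have key : ∀ c d, ∫ z, (ψ (z + c) - ψ z) • (v z - v (z - d))
      = (∫ z, ψ (z + c) • v z) - (∫ z, ψ z • v z)
        - ((∫ z, ψ (z + c + d) • v z) - ∫ z, ψ (z + d) • v z) := fun c d => by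
    have i1 : Integrable fun z => ψ (z + c) • v z - ψ z • v z := (hI0 c).sub hI2
    have i2 : Integrable fun z => ψ (z + c) • v (z - d) - ψ z • v (z - d) := (hI c d).sub (hI1 d)
    rw [← hT c d, ← hT0 d, ← integral_sub (hI0 c) hI2, ← integral_sub (hI c d) (hI1 d),
      ← integral_sub i1 i2]
    refine integral_congr_ae (Eventually.of_forall fun z => ?_)
    simp only [smul_sub, sub_smul]
  rw [key, key]
  simp only [add_right_comm _ b a]
  abel

namespace IsLimitSetup

variable {φ : ℝ → ℝ} {c₀ c₁ : ℝ} {D : Set (SpaceTime n)}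
    {u : SpaceTime n → EuclideanSpace ℝ (Fin N)} {G : SpaceTime n → Mat n N}
    {W : Fin n → SpaceTime n → Mat n N} {K U : Set (SpaceTime n)} {h₀ : ℝ} {s : ℕ → ℝ}
    {e : ℕ → SpaceTime n → ℝ}

variable (h : IsLimitSetup φ c₀ c₁ D u G W K U h₀ s e)
include h

theorem strongMeas_hess (j : Fin n) : StronglyMeasurable (hess φ G W j) := by
  have hG := h.sol.meas_G.measurable
  have hW := (h.meas j).measurable
  have h1 := (measurable_deriv φ).comp hG.norm
  have h2 := (measurable_deriv (deriv φ)).comp hG.norm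
  have hv : Measurable fun z => profileV φ ‖G z‖ :=
    Real.continuous_sqrt.measurable.comp (h1.mul hG.norm)
  have hA : Measurable fun z => ‖G z‖ / profileV φ ‖G z‖ := hG.norm.div hv
  have hB : Measurable fun z => (2 * profileV φ ‖G z‖)
      / (deriv (deriv φ) ‖G z‖ * ‖G z‖ + deriv φ ‖G z‖) :=
    (hv.const_mul 2).div ((h2.mul hG.norm).add h1)
  have : hess φ G W j = fun z => (‖G z‖ / profileV φ ‖G z‖) • W j z
      + (((2 * profileV φ ‖G z‖) / (deriv (deriv φ) ‖G z‖ * ‖G z‖ + deriv φ ‖G z‖)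
        - ‖G z‖ / profileV φ ‖G z‖) / ‖G z‖ ^ 2 * inner ℝ (G z) (W j z)) • G z := by
    ext1 z
    rw [hess, invDerivV, radialMap_apply]
  rw [this]
  exact ((hA.smul hW).add ((((hB.sub hA).div (hG.norm.pow_const 2)).mul
    (hG.inner hW)).smul hG)).stronglyMeasurable

variable {F : Type*} [NormedAddCommGroup F] [NormedSpace ℝ F] {γ : Mat n N → F} {a b : ℝ}
  {θ : SpaceTime n → ℝ}

/-- Difference quotients of `θ γ(∇u)`: convergence and domination. -/
theorem annular_quotient (hγ : IsAnnular γ a b) (hθ : IsTestFn U θ)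
    (hk : ∀ k j z, z + s k • sdir j ∈ tsupport θ → z ∈ U) (j : Fin n) :
    (∀ᵐ z, Tendsto (fun k => (s k)⁻¹ •
        (θ (z + s k • sdir j) • γ (K.indicator G (z + s k • sdir j))
          - θ z • γ (K.indicator G z))) atTop
      (𝓝 (fderiv ℝ θ z (sdir j) • γ (G z) + θ z • fderiv ℝ γ (G z) (hess φ G W j z)))) ∧
    ∃ C, ∀ᵐ z, ∀ k, ‖(s k)⁻¹ •
        (θ (z + s k • sdir j) • γ (K.indicator G (z + s k • sdir j))
          - θ z • γ (K.indicator G z))‖ ^ 2 ≤ C * (e k z + baseFn φ G W K z) ∧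
      ‖(s k)⁻¹ • (θ (z + s k • sdir j) • γ (K.indicator G (z + s k • sdir j))
          - θ z • γ (K.indicator G z))‖ ≤ C * (e k z + baseFn φ G W K z) := by
  have : Nonempty (Fin n) := ⟨j⟩
  have hθU : tsupport θ ⊆ U := hθ.2.2
  have hsplit : ∀ k z, (s k)⁻¹ •
        (θ (z + s k • sdir j) • γ (K.indicator G (z + s k • sdir j))
          - θ z • γ (K.indicator G z))
      = ((s k)⁻¹ • (θ (z + s k • sdir j) - θ z)) • γ (K.indicator G (z + s k • sdir j))
        + θ z • ((s k)⁻¹ • (γ (K.indicator G (z + s k • sdir j)) - γ (K.indicator G z))) :=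
    fun k z => by
      simp only [smul_sub, sub_smul, mul_sub, smul_eq_mul, smul_smul, mul_comm (θ _)]
      abel
  have hout : ∀ k z, z ∉ U → (s k)⁻¹ •
        (θ (z + s k • sdir j) • γ (K.indicator G (z + s k • sdir j))
          - θ z • γ (K.indicator G z)) = 0 := fun k z hz => by
    rw [image_eq_zero_of_notMem_tsupport fun hz' => hz (hk k j z hz'),
      image_eq_zero_of_notMem_tsupport fun hz' => hz (hθU hz')]
    simp
  constructor
  · filter_upwards [h.ae_tendsto_grad, h.ae_tendsto_annular hγ] with z h1 h2
    by_cases hz : z ∈ U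
    · simp only [hsplit]
      refine Tendsto.add (Tendsto.smul ?_ ?_) (Tendsto.const_smul ?_ _)
      · have h3 := (hθ.1.differentiable (by simp) z).hasFDerivAt
        refine h3.hasFDerivWithinAt.lim (s := univ) ?_ (Eventually.of_forall fun _ => mem_univ _)
          (tendsto_const_nhds.congr fun k => ?_)
        · simpa using h.lim.tendsto.smul_const (sdir j : SpaceTime n)
        · rw [smul_smul, inv_mul_cancel₀ (h.lim.pos k).ne', one_smul]
      · exact (hγ.contDiff.continuous.tendsto _).comp (h1 hz j).1
      · simpa only [indicator_of_mem (h.region.sub hz)] using h2 hz j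
    · simp only [fun k => hout k z hz]
      have hz' : z ∉ tsupport θ := fun h' => hz (hθU h')
      rw [fderiv_eq_zero_of_notMem_tsupport hz', image_eq_zero_of_notMem_tsupport hz']
      simp
  · obtain ⟨B, hB0, hB, hBV⟩ := hγ.exists_bound h.orlicz h.pos
    obtain ⟨M, hM0, hM, -, hML⟩ := exists_bound_lipschitz (hθ.1.of_le (by simp)) hθ.2.1
    -- Write `E` for the error plus the base function. On `U` one has `1 ≤ E` and the squared
    -- average of `W` is at most `2 E`, so `(1 + y)² ≤ 6 E`. The additional 1 turns the bound for
    -- the square into one for the norm itself.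
    refine ⟨6 * (M * B) ^ 2 + 1, ?_⟩
    filter_upwards [h.ae_diffQuot_fieldV] with z hV k
    have hE := h.err_nonneg k z
    have hb := h.baseFn_nonneg z
    by_cases hz : z ∈ U
    · have hs := h.lim.pos k
      have h1 : ‖(s k)⁻¹ • (θ (z + s k • sdir j) - θ z)‖ ≤ M := by
        rw [norm_smul, norm_inv, Real.norm_of_nonneg hs.le, inv_mul_le_iff₀ hs]
        refine (hML _ _).trans ?_
        rw [norm_smul, norm_sdir, Real.norm_of_nonneg hs.le]
        linarith
      have h2 : ‖(s k)⁻¹ • (γ (K.indicator G (z + s k • sdir j)) - γ (K.indicator G z))‖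
          ≤ B * ‖segAvg (K.indicator (W j)) (s k • sdir j) z‖ := by
        rw [← hV hz, norm_smul, norm_smul, norm_inv, Real.norm_of_nonneg hs.le,
          mul_left_comm]
        exact mul_le_mul_of_nonneg_left (hBV _ _) (inv_nonneg.2 hs.le)
      have h3 := h.sq_norm_segAvg_deriv_le k j z
      have h4 : 1 ≤ baseFn φ G W K z := by
        rw [h.baseFn_of_mem (h.region.sub hz)]
        have : 0 ≤ ∑ j, ‖W j z‖ ^ 2 + ‖G z‖ ^ 2 + ‖fieldV φ (G z)‖ ^ 2 := by positivity
        linarith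
      have h5 : ‖(s k)⁻¹ •
          (θ (z + s k • sdir j) • γ (K.indicator G (z + s k • sdir j))
            - θ z • γ (K.indicator G z))‖
          ≤ M * B * (1 + ‖segAvg (K.indicator (W j)) (s k • sdir j) z‖) := by
        rw [hsplit]
        refine (norm_add_le _ _).trans ?_
        rw [norm_smul, norm_smul (θ z)]
        have h6 := mul_le_mul h1 (hB (K.indicator G (z + s k • sdir j))) (norm_nonneg _) hM0
        have h7 := mul_le_mul (hM z) h2 (norm_nonneg _) hM0
        linarith
      have h6 : (1 + ‖segAvg (K.indicator (W j)) (s k • sdir j) z‖) ^ 2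
          ≤ 6 * (e k z + baseFn φ G W K z) := by
        nlinarith [sq_nonneg (‖segAvg (K.indicator (W j)) (s k • sdir j) z‖ - 1)]
      have h7 := pow_le_pow_left₀ (norm_nonneg _) h5 2
      rw [mul_pow] at h7
      have h8 := h7.trans (mul_le_mul_of_nonneg_left h6 (sq_nonneg _))
      generalize ‖(s k)⁻¹ • (θ (z + s k • sdir j) • γ (K.indicator G (z + s k • sdir j))
            - θ z • γ (K.indicator G z))‖ = q at *
      constructor
      · nlinarith
      · nlinarith [sq_nonneg (q - 1)]
    · rw [hout k z hz, norm_zero]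
      have := mul_nonneg (by positivity : 0 ≤ 6 * (M * B) ^ 2 + 1) (add_nonneg hE hb)
      exact ⟨by simpa using this, this⟩

theorem strongMeas_annular (hγ : IsAnnular γ a b) (hθ : IsTestFn U θ) :
    StronglyMeasurable fun z => θ z • γ (K.indicator G z) :=
  hθ.1.continuous.stronglyMeasurable.smul
    (hγ.contDiff.continuous.comp_stronglyMeasurable (h.sol.meas_ind h.region))

/-- Dropping finitely many steps keeps translates of the support of `θ` inside `U`, so the
difference quotients of functions supported there vanish outside `U`. -/
theorem exists_step_bound (hθ : IsTestFn U θ) :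
    ∃ k₀, ∀ k j z, z + s (k + k₀) • sdir j ∈ tsupport θ → z ∈ U := by
  obtain ⟨δ, hδ, hδU⟩ := hθ.2.1.isCompact.exists_thickening_subset_open h.region.isOpen hθ.2.2
  obtain ⟨k₀, hk₀⟩ := eventually_atTop.1 (h.lim.tendsto.eventually_lt_const hδ)
  refine ⟨k₀, fun k j z hz => hδU (Metric.mem_thickening_iff.2 ⟨_, hz, ?_⟩)⟩
  rw [dist_self_add_right, norm_smul, norm_sdir, mul_one, Real.norm_of_nonneg (h.lim.pos _).le]
  exact hk₀ _ (Nat.le_add_left _ _)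

/-- The chain rule for `γ(∇u)`, in weak form. -/
theorem integral_annular_eq_zero [CompleteSpace F] (hγ : IsAnnular γ a b) (hθ : IsTestFn U θ)
    (j : Fin n) :
    Integrable (fun z => fderiv ℝ θ z (sdir j) • γ (G z)
      + θ z • fderiv ℝ γ (G z) (hess φ G W j z)) ∧
    ∫ z, (fderiv ℝ θ z (sdir j) • γ (G z) + θ z • fderiv ℝ γ (G z) (hess φ G W j z)) = 0 := by
  obtain ⟨k₀, hk₀⟩ := h.exists_step_bound hθ
  have h' := h.shift k₀
  have : Nonempty (Fin n) := ⟨j⟩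
  obtain ⟨h1, C, hC⟩ := h'.annular_quotient hγ hθ hk₀ j
  have hm := h.strongMeas_annular hγ hθ
  obtain ⟨B, hB0, hB, -⟩ := hγ.exists_bound h.orlicz h.pos
  have hi : Integrable fun z => θ z • γ (K.indicator G z) := by
    refine ((hθ.1.continuous.integrable_of_hasCompactSupport hθ.2.1).norm.mul_const B).mono' 
      hm.aestronglyMeasurable (Eventually.of_forall fun z => ?_)
    rw [norm_smul]
    exact mul_le_mul_of_nonneg_left (hB _) (norm_nonneg _)
  have h2 := h'.lim.tendsto_integral_of_le (C := C) (g := baseFn φ G W K)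
    (fun k => ?_) h'.integrable_baseFn (fun k => ?_) h1
  · refine ⟨h2.1, tendsto_nhds_unique h2.2 (tendsto_const_nhds.congr fun k => ?_)⟩
    rw [integral_smul, integral_sub (hi.comp_add_right (s (k + k₀) • sdir j)) hi,
      integral_add_right_eq_self (fun z => θ z • γ (K.indicator G z)), sub_self, smul_zero]
  · exact (((hm.comp_measurable (measurable_id.add_const _)).sub hm).const_smul
      _).aestronglyMeasurable
  · filter_upwards [hC] with z hz using (hz k).2

/-- The integrals `∫ ∂_j (θ β(∇u)) ∂_i u` are symmetric in `i` and `j`. -/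
theorem integral_annular_smul_row_comm {β : Mat n N → ℝ} (hβ : IsAnnular β a b)
    (hθ : IsTestFn U θ) (i j : Fin n) :
    (Integrable fun z => (fderiv ℝ θ z (sdir j) • β (G z)
      + θ z • fderiv ℝ β (G z) (hess φ G W j z)) • row i (G z)) ∧
    ∫ z, (fderiv ℝ θ z (sdir j) • β (G z)
      + θ z • fderiv ℝ β (G z) (hess φ G W j z)) • row i (G z)
    = ∫ z, (fderiv ℝ θ z (sdir i) • β (G z)
      + θ z • fderiv ℝ β (G z) (hess φ G W i z)) • row j (G z) := by
  obtain ⟨k₀, hk₀⟩ := h.exists_step_bound hθ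
  have h' := h.shift k₀
  have : Nonempty (Fin n) := ⟨j⟩
  obtain ⟨B, hB0, hB, -⟩ := hβ.exists_bound h.orlicz h.pos
  obtain ⟨M, hM0, hM, -, -⟩ := exists_bound_lipschitz (hθ.1.of_le (by simp)) hθ.2.1
  have hm := h.strongMeas_annular hβ hθ
  have hGm := h.sol.meas_ind h.region
  have hu : Integrable (K.indicator u) := h.sol.integrable_indicator h.sol.int_u h.region
  have hum : StronglyMeasurable (K.indicator u) := h.sol.meas_u.indicator h.region.measK
  set ψ : SpaceTime n → ℝ := fun z => θ z • β (K.indicator G z) with hψ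
  -- Differences in direction `j` of `θ β(∇u)` are paired with backward differences in direction `i`
  -- of `u`. The first converge by the chain rule and the second to `∂ᵢu`, so the limit exists for
  -- both orders of the directions.
  have key : ∀ i j : Fin n,
      (Integrable fun z => (fderiv ℝ θ z (sdir j) • β (G z)
        + θ z • fderiv ℝ β (G z) (hess φ G W j z)) • row i (G z)) ∧
      Tendsto (fun k => ∫ z, (s (k + k₀))⁻¹ • (s (k + k₀))⁻¹ •
        ((ψ (z + s (k + k₀) • sdir j) - ψ z) •
          (K.indicator u z - K.indicator u (z - s (k + k₀) • sdir i)))) atTop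
        (𝓝 (∫ z, (fderiv ℝ θ z (sdir j) • β (G z)
          + θ z • fderiv ℝ β (G z) (hess φ G W j z)) • row i (G z))) := fun i j => by
    obtain ⟨h1, C, hC⟩ := h'.annular_quotient hβ hθ hk₀ j
    have hout : ∀ k z, z ∉ U → ψ (z + s (k + k₀) • sdir j) - ψ z = 0 := fun k z hz => by
      simp only [hψ]
      rw [image_eq_zero_of_notMem_tsupport fun hz' => hz (hk₀ k j z hz'),
        image_eq_zero_of_notMem_tsupport fun hz' => hz (hθ.2.2 hz')]
      simp
    have hdq : ∀ᵐ z, ∀ k, z ∈ U → (s (k + k₀))⁻¹ •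
        (K.indicator u z - K.indicator u (z - s (k + k₀) • sdir i))
        = row i (segAvg (K.indicator G) ((-s (k + k₀)) • sdir i) z) := by
      refine ae_all_iff.2 fun k => ?_
      have hk := h'.abs_step k
      filter_upwards [PhiCaloric.ae_diffQuot_eq h.sol h.region (h := -s (k + k₀))
        (neg_ne_zero.2 (h'.lim.pos k).ne') (by rwa [abs_neg])] with z hz hzU
      have h2 := congrArg (row i) (hz hzU)
      rw [diffQuot, gradAvg, row_ofRows, row_ofRows] at h2
      rw [← h2, indicator_of_mem (h.region.sub hzU), sub_eq_add_neg z, ← neg_smul,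
        indicator_of_mem (h.region.seg_one hzU i (by rwa [abs_neg])), inv_neg]
      module
    have hnice : ∀ᵐ z, ∀ k, (s (k + k₀))⁻¹ • (s (k + k₀))⁻¹ •
        ((ψ (z + s (k + k₀) • sdir j) - ψ z) •
          (K.indicator u z - K.indicator u (z - s (k + k₀) • sdir i)))
        = ((s (k + k₀))⁻¹ • (ψ (z + s (k + k₀) • sdir j) - ψ z)) •
          row i (segAvg (K.indicator G) ((-s (k + k₀)) • sdir i) z) := by
      filter_upwards [hdq] with z hz k
      by_cases hzU : z ∈ U
      · rw [← hz k hzU]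
        simp only [smul_smul, smul_eq_mul]
        congr 1
        ring
      · rw [hout k z hzU]
        simp
    refine h'.lim.tendsto_integral_of_le (C := |C| + 2) (g := baseFn φ G W K)
      (fun k => ?_) h'.integrable_baseFn (fun k => ?_) ?_
    · have m1 : StronglyMeasurable fun z => ψ (z + s (k + k₀) • sdir j) :=
        hm.comp_measurable (measurable_id.add_const _)
      have m2 : StronglyMeasurable fun z => K.indicator u (z - s (k + k₀) • sdir i) :=
        hum.comp_measurable (measurable_id.sub_const _)
      have m3 : StronglyMeasurable fun z => (ψ (z + s (k + k₀) • sdir j) - ψ z) •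
          (K.indicator u z - K.indicator u (z - s (k + k₀) • sdir i)) := (m1.sub hm).smul (hum.sub m2)
      exact ((m3.const_smul (s (k + k₀))⁻¹).const_smul (s (k + k₀))⁻¹).aestronglyMeasurable
    · filter_upwards [hC, hnice] with z hz hz'
      rw [hz' k, norm_smul]
      have h2 := (hz k).1
      have h3 := h'.sq_norm_segAvg_grad_neg_le k i z
      have h4 := norm_row_le i (segAvg (K.indicator G) ((-s (k + k₀)) • sdir i) z)
      have h5 := h'.err_nonneg k z
      have h6 := h'.baseFn_nonneg z
      have h7 : C * (e (k + k₀) z + baseFn φ G W K z)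
          ≤ |C| * (e (k + k₀) z + baseFn φ G W K z) :=
        mul_le_mul_of_nonneg_right (le_abs_self C) (add_nonneg h5 h6)
      have h8 := mul_le_mul_of_nonneg_left h4
        (norm_nonneg ((s (k + k₀))⁻¹ • (ψ (z + s (k + k₀) • sdir j) - ψ z)))
      refine h8.trans ?_
      have h9 := h2.trans h7
      rw [add_mul]
      nlinarith [two_mul_le_add_sq ‖(s (k + k₀))⁻¹ • (ψ (z + s (k + k₀) • sdir j) - ψ z)‖
        ‖segAvg (K.indicator G) ((-s (k + k₀)) • sdir i) z‖]
    · filter_upwards [h1, hnice, h'.lim.ae_tendsto] with z hz hz' hz''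
      simp only [hz']
      by_cases hzU : z ∈ U
      · have h2 := IsLimitSeq.tendsto_of_sq_le (fun k => h'.lim.grad_neg_le k i z) hz''
        rw [indicator_of_mem (h.region.sub hzU)] at h2
        exact hz.smul (((row i).continuous.tendsto _).comp h2)
      · have hz3 : z ∉ tsupport θ := fun h' => hzU (hθ.2.2 h')
        rw [fderiv_eq_zero_of_notMem_tsupport hz3, image_eq_zero_of_notMem_tsupport hz3]
        simp only [hout _ z hzU]
        simp
  -- Before the limit the two orders agree: moving both differences onto `θ β(∇u)` produces finite
  -- differences, which commute.
  refine ⟨(key i j).1, tendsto_nhds_unique (key i j).2 ((key j i).2.congr fun k => ?_)⟩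
  rw [integral_smul, integral_smul, integral_smul, integral_smul,
    integral_sub_smul_sub_comm (C := M * B) hm (fun z => ?_) hu]
  rw [norm_smul]
  exact mul_le_mul (hM z) (hB _) (norm_nonneg _) hM0

/-- Symmetry of second derivatives. -/
theorem ae_row_hess_comm : ∀ᵐ z, z ∈ U → G z ≠ 0 → ∀ i j,
    row i (hess φ G W j z) = row j (hess φ G W i z) := by
  have main : ∀ m : ℕ, ∀ i j, ∀ᵐ z, z ∈ U →
      annulusCutoff (1 / ((m : ℝ) + 1)) ((m : ℝ) + 2) (G z) •
        (row i (hess φ G W j z) - row j (hess φ G W i z)) = 0 := fun m i j => by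
    have hm1 : (0 : ℝ) < m + 1 := by positivity
    have ha : (0 : ℝ) < 1 / ((m : ℝ) + 1) := by positivity
    have hab : 1 / ((m : ℝ) + 1) < (m : ℝ) + 2 := by
      rw [div_lt_iff₀ hm1]; nlinarith [(Nat.cast_nonneg m : (0 : ℝ) ≤ m)]
    generalize 1 / ((m : ℝ) + 1) = a at ha hab ⊢
    generalize (m : ℝ) + 2 = b at ha hab ⊢
    have hβ := isAnnular_annulusCutoff (n := n) (N := N) ha hab
    obtain ⟨B, hB0, hB, -⟩ := hβ.exists_bound h.orlicz h.pos
    have hβm : StronglyMeasurable fun z => annulusCutoff a b (G z) :=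
      hβ.contDiff.continuous.comp_stronglyMeasurable h.sol.meas_G
    have hle : ∀ j z, ‖annulusCutoff a b (G z) • hess φ G W j z‖
        ≤ B * (4 * √(b / deriv φ a)) * ‖W j z‖ := fun j z => by
      rw [norm_smul, mul_assoc]
      by_cases hz : annulusCutoff a b (G z) = 0
      · rw [hz, norm_zero, zero_mul]; positivity
      · exact mul_le_mul (hB _) (norm_invDerivV_le h.orlicz h.pos ha
          (hβ.supp _ hz).1 (hβ.supp _ hz).2 _) (norm_nonneg _) hB0
    have hloc : ∀ i j, LocallyIntegrableOn
        (fun z => annulusCutoff a b (G z) • row i (hess φ G W j z)) U := fun i j => by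
      have h1 : LocallyIntegrableOn (fun z => B * (4 * √(b / deriv φ a)) * ‖W j z‖) U :=
        fun z hz => by
          obtain ⟨t, ht, hti⟩ := ((h.int j).mono_set (h.region.sub.trans h.region.subset)) z hz
          exact ⟨t, ht, hti.norm.const_mul _⟩
      refine h1.mono (hβm.smul ((row i).continuous.comp_stronglyMeasurable
        (h.strongMeas_hess j))).aestronglyMeasurable (Eventually.of_forall fun z => ?_)
      rw [Real.norm_of_nonneg (by positivity), ← map_smul]
      exact (norm_row_le _ _).trans (hle j z)
    have hloc' : LocallyIntegrableOn (fun z => annulusCutoff a b (G z) •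
        (row i (hess φ G W j z) - row j (hess φ G W i z))) U := by
      simp only [smul_sub]
      exact (hloc i j).sub (hloc j i)
    refine h.region.isOpen.ae_eq_zero_of_integral_contDiff_smul_eq_zero hloc' fun θ hθ1 hθ2 hθ3 => ?_
    have hθ : IsTestFn U θ := ⟨hθ1, hθ2, hθ3⟩
    -- Apply the chain rule to `P ↦ β(P) Pᵢ` and subtract the term in which the derivative falls on
    -- `β`. What remains is minus the integral of `∂_j(θ β(∇u)) ∂ᵢu`, already known to be symmetric.
    have hch : ∀ i j, (Integrable fun z => θ z • annulusCutoff a b (G z) •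
          row i (hess φ G W j z)) ∧
        ∫ z, θ z • annulusCutoff a b (G z) • row i (hess φ G W j z)
        = - ∫ z, (fderiv ℝ θ z (sdir j) • annulusCutoff a b (G z)
          + θ z • fderiv ℝ (annulusCutoff a b) (G z) (hess φ G W j z)) • row i (G z) :=
      fun i j => by
        obtain ⟨h1, h2⟩ := h.integral_annular_eq_zero
          (isAnnular_annulusCutoff_smul_row ha hab i) hθ j
        have h3 := (h.integral_annular_smul_row_comm hβ hθ i j).1
        have e1 : (fun z => θ z • annulusCutoff a b (G z) • row i (hess φ G W j z)) = fun z =>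
            (fderiv ℝ θ z (sdir j) • (fun P : Mat n N => annulusCutoff a b P • row i P) (G z)
            + θ z • fderiv ℝ (fun P : Mat n N => annulusCutoff a b P • row i P) (G z)
              (hess φ G W j z))
            - (fderiv ℝ θ z (sdir j) • annulusCutoff a b (G z)
              + θ z • fderiv ℝ (annulusCutoff a b) (G z) (hess φ G W j z)) • row i (G z) := by
          ext1 z
          have hd := (hβ.contDiff.differentiable (by norm_num) (G z)).hasFDerivAt.smul
            ((row i).hasFDerivAt (x := G z))
          rw [show fderiv ℝ (fun P : Mat n N => annulusCutoff a b P • row i P) (G z) = _ from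
            hd.fderiv]
          simp only [add_apply, smul_apply, ContinuousLinearMap.smulRight_apply, smul_add,
            add_smul, smul_smul, smul_eq_mul]
          abel
        constructor
        · rw [e1]; exact h1.sub h3
        · rw [e1, integral_sub h1 h3, h2, zero_sub]
    obtain ⟨i1, e1⟩ := hch i j
    obtain ⟨i2, e2⟩ := hch j i
    simp only [smul_sub]
    rw [integral_sub i1 i2, e1, e2, (h.integral_annular_smul_row_comm hβ hθ i j).2, sub_self]
  -- Countably many annuli exhaust the nonzero matrices, so one null set serves for all of them.
  have hall : ∀ᵐ z, ∀ (m : ℕ) (i j : Fin n), z ∈ U →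
      annulusCutoff (1 / ((m : ℝ) + 1)) ((m : ℝ) + 2) (G z) •
        (row i (hess φ G W j z) - row j (hess φ G W i z)) = 0 :=
    ae_all_iff.2 fun m => ae_all_iff.2 fun i => ae_all_iff.2 fun j => main m i j
  filter_upwards [hall] with z hz hzU hG i j
  have hp : 0 < ‖G z‖ := norm_pos_iff.2 hG
  obtain ⟨m, hm⟩ := exists_nat_gt (max (1 / ‖G z‖) ‖G z‖)
  have h1 := (le_max_left _ _).trans_lt hm
  have h2 := (le_max_right _ _).trans_lt hm
  have h3 : 0 < annulusCutoff (1 / ((m : ℝ) + 1)) ((m : ℝ) + 2) (G z) := by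
    refine annulusCutoff_pos (by positivity) ?_ (by linarith)
    rw [div_lt_iff₀ hp] at h1
    rw [div_lt_iff₀ (by positivity)]
    linarith
  exact sub_eq_zero.1 ((smul_eq_zero.1 (hz m i j hzU)).resolve_left h3.ne')

end IsLimitSetup

end Symmetry

end

/-! ### Passage to the limit in the renormalized identity. -/

section
open PhiCaloric.IsOrlicz (profileV)


section LimitTerms

variable {n N : ℕ}

/-- The mixed term of the renormalized identity. -/
noncomputable def mixedTerm (φ : ℝ → ℝ) (X : SpaceTime n → Mat n N) (t : ℝ) (z : SpaceTime n) : ℝ :=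
  ∑ i, inner ℝ (gradAvg t X z) (gradDiff t X i z)
    * inner ℝ (gradDiff t (fun z => fluxA φ (X z)) i z) (gradAvg t X z)

theorem norm_gradDiff_le (t : ℝ) (X : SpaceTime n → Mat n N) (i : Fin n) (z : SpaceTime n) :
    ‖gradDiff t X i z‖ ≤ ∑ j, ‖t⁻¹ • (X (z + t • sdir j) - X z)‖ :=
  (norm_ofRows_le _).trans (Finset.sum_le_sum fun _ _ => norm_row_le _ _)

theorem sq_norm_gradAvg_le (t : ℝ) (X : SpaceTime n → Mat n N) (z : SpaceTime n) :
    ‖gradAvg t X z‖ ^ 2 ≤ ∑ j, ‖segAvg X (t • sdir j) z‖ ^ 2 := by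
  rw [gradAvg, sq_norm_eq_sum_row]
  simp only [row_ofRows]
  exact Finset.sum_le_sum fun j _ => by gcongr; exact norm_row_le _ _

/-- Expanding both quotients pairs a flux increment in direction `j` with a gradient increment in
direction `l`; the three-point inequality bounds each pair by increments of `V`. The remaining
factor `|w|²` is what compensates `g'(|w|²)`. -/
theorem abs_mixedTerm_le {φ : ℝ → ℝ} {C : ℝ} (hC : ∀ P Q Q' : Mat n N,
      ‖fluxA φ Q - fluxA φ P‖ * ‖Q' - P‖
        ≤ C * (‖fieldV φ Q - fieldV φ P‖ ^ 2 + ‖fieldV φ Q' - fieldV φ P‖ ^ 2))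
    (X : SpaceTime n → Mat n N) {t : ℝ} (ht : 0 < t) (z : SpaceTime n) :
    |mixedTerm φ X t z| ≤ 2 * n ^ 2 * C * ‖gradAvg t X z‖ ^ 2
      * ∑ j, ‖t⁻¹ • (fieldV φ (X (z + t • sdir j)) - fieldV φ (X z))‖ ^ 2 := by
  set w := gradAvg t X z
  set S := ∑ j, ‖t⁻¹ • (fieldV φ (X (z + t • sdir j)) - fieldV φ (X z))‖ ^ 2 with hS
  have h1 : ∀ i, |inner ℝ w (gradDiff t X i z)
      * inner ℝ (gradDiff t (fun z => fluxA φ (X z)) i z) w| ≤ ‖w‖ ^ 2 * (2 * n * C * S) := by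
    intro i
    rw [abs_mul]
    have h2 : ‖gradDiff t (fun z => fluxA φ (X z)) i z‖ * ‖gradDiff t X i z‖
        ≤ 2 * n * C * S := by
      refine (mul_le_mul (norm_gradDiff_le _ _ _ _) (norm_gradDiff_le _ _ _ _) (norm_nonneg _)
        (Finset.sum_nonneg fun _ _ => norm_nonneg _)).trans ?_
      rw [Finset.sum_mul_sum]
      have h3 : ∀ j l, ‖t⁻¹ • (fluxA φ (X (z + t • sdir j)) - fluxA φ (X z))‖
          * ‖t⁻¹ • (X (z + t • sdir l) - X z)‖
          ≤ C * (‖t⁻¹ • (fieldV φ (X (z + t • sdir j)) - fieldV φ (X z))‖ ^ 2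
            + ‖t⁻¹ • (fieldV φ (X (z + t • sdir l)) - fieldV φ (X z))‖ ^ 2) := fun j l => by
        simp only [norm_smul, norm_inv, Real.norm_of_nonneg ht.le, mul_pow]
        have := mul_le_mul_of_nonneg_left (hC (X z) (X (z + t • sdir j)) (X (z + t • sdir l)))
          (sq_nonneg t⁻¹)
        linarith
      refine (Finset.sum_le_sum fun j _ => Finset.sum_le_sum fun l _ => h3 j l).trans_eq ?_
      simp only [← Finset.mul_sum, Finset.sum_add_distrib, Finset.sum_const, Finset.card_univ,
        Fintype.card_fin, nsmul_eq_mul, ← hS]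
      ring
    calc _ ≤ (‖w‖ * ‖gradDiff t X i z‖) * (‖gradDiff t (fun z => fluxA φ (X z)) i z‖ * ‖w‖) :=
          mul_le_mul (abs_real_inner_le_norm _ _) (abs_real_inner_le_norm _ _) (abs_nonneg _)
            (by positivity)
      _ = ‖w‖ ^ 2 * (‖gradDiff t (fun z => fluxA φ (X z)) i z‖ * ‖gradDiff t X i z‖) := by ring
      _ ≤ _ := mul_le_mul_of_nonneg_left h2 (sq_nonneg _)
  refine (Finset.abs_sum_le_sum_abs _ _).trans ((Finset.sum_le_sum fun i _ => h1 i).trans_eq ?_)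
  rw [Finset.sum_const, Finset.card_univ, Fintype.card_fin, nsmul_eq_mul]
  ring

/-- A lower bound for the negative of the renormalized integrand. -/
theorem le_neg_renormIntegrand {φ : ℝ → ℝ} {C t : ℝ} (ht : 0 < t) (hC : 0 < C)
    (hmono : ∀ P Q : Mat n N, ‖fieldV φ P - fieldV φ Q‖ ^ 2
      ≤ C * inner ℝ (fluxA φ P - fluxA φ Q) (P - Q)) {Γ g : ℝ → ℝ} {ζ : SpaceTime n → ℝ}
    (hg : ∀ x, 0 ≤ x → 0 ≤ g x) (X : SpaceTime n → Mat n N) {z : SpaceTime n} (hζ : 0 ≤ ζ z) :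
    C⁻¹ * (ζ z * g (‖gradAvg t X z‖ ^ 2)
        * ∑ j, ‖t⁻¹ • (fieldV φ (X (z + t • sdir j)) - fieldV φ (X z))‖ ^ 2)
      + min (2 * ζ z * deriv g (‖gradAvg t X z‖ ^ 2) * mixedTerm φ X t z) 0
      - (∑ i, |fderiv ℝ ζ z (sdir i)|) * g (‖gradAvg t X z‖ ^ 2)
        * (∑ j, t⁻¹ * (‖fluxA φ (X (z + t • sdir j)) - fluxA φ (X z)‖
          * ‖segAvg X (t • sdir j) z‖))
      - 1 / 2 * Γ (‖gradAvg t X z‖ ^ 2) * fderiv ℝ ζ z (tdir n)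
    ≤ - renormIntegrand Γ g ζ (tdir n) sdir (gradAvg t X) (gradDiff t X)
        (gradDiff t fun z => fluxA φ (X z)) z := by
  set A : SpaceTime n → Mat n N := fun z => fluxA φ (X z) with hA
  set w := gradAvg t X z with hw
  have hgw := hg (‖w‖ ^ 2) (sq_nonneg _)
  have e : - renormIntegrand Γ g ζ (tdir n) sdir (gradAvg t X) (gradDiff t X) (gradDiff t A) z
      = ζ z * g (‖w‖ ^ 2) * (∑ i, inner ℝ (gradDiff t A i z) (gradDiff t X i z))
        + 2 * ζ z * deriv g (‖w‖ ^ 2) * mixedTerm φ X t z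
        + g (‖w‖ ^ 2) * (∑ i, fderiv ℝ ζ z (sdir i) * inner ℝ (gradDiff t A i z) w)
        - 1 / 2 * Γ (‖w‖ ^ 2) * fderiv ℝ ζ z (tdir n) := by
    rw [renormIntegrand, mixedTerm, ← hw]
    simp only [inner_add_right, real_inner_smul_right, Finset.sum_add_distrib, Finset.mul_sum]
    have e1 : ∑ i, ζ z * g (‖w‖ ^ 2) * inner ℝ (gradDiff t A i z) (gradDiff t X i z)
      = ∑ i, ζ z * g (‖w‖ ^ 2) * inner ℝ (gradDiff t A i z) (gradDiff t X i z) := rfl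
    have e2 : ∑ i, ζ z * (2 * deriv g (‖w‖ ^ 2) * inner ℝ w (gradDiff t X i z))
          * inner ℝ (gradDiff t A i z) w
        = ∑ i, 2 * ζ z * deriv g (‖w‖ ^ 2)
          * (inner ℝ w (gradDiff t X i z) * inner ℝ (gradDiff t A i z) w) :=
      Finset.sum_congr rfl fun i _ => by ring
    have e3 : ∑ i, fderiv ℝ ζ z (sdir i) * g (‖w‖ ^ 2) * inner ℝ (gradDiff t A i z) w
        = ∑ i, g (‖w‖ ^ 2) * (fderiv ℝ ζ z (sdir i) * inner ℝ (gradDiff t A i z) w) :=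
      Finset.sum_congr rfl fun i _ => by ring
    rw [e2, e3]
    ring
  have t1 : C⁻¹ * ∑ j, ‖t⁻¹ • (fieldV φ (X (z + t • sdir j)) - fieldV φ (X z))‖ ^ 2
      ≤ ∑ i, inner ℝ (gradDiff t A i z) (gradDiff t X i z) := by
    rw [sum_inner_gradDiff, Finset.mul_sum, Finset.mul_sum]
    refine Finset.sum_le_sum fun j _ => ?_
    rw [norm_smul, mul_pow, norm_inv, Real.norm_of_nonneg ht.le, mul_left_comm]
    refine mul_le_mul_of_nonneg_left ?_ (sq_nonneg _)
    rw [inv_mul_le_iff₀ hC]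
    exact hmono _ _
  have t1' := mul_le_mul_of_nonneg_left t1 (mul_nonneg hζ hgw)
  -- Only the negative part of the mixed term is kept: the limit is nonnegative where the gradient
  -- does not vanish and zero elsewhere, so the negative part disappears and the positive part may
  -- be dropped.
  have t2 := min_le_left (2 * ζ z * deriv g (‖w‖ ^ 2) * mixedTerm φ X t z) 0
  have t3 : - ((∑ i, |fderiv ℝ ζ z (sdir i)|) * (∑ j, t⁻¹ * (‖A (z + t • sdir j) - A z‖
      * ‖segAvg X (t • sdir j) z‖))) ≤ ∑ i, fderiv ℝ ζ z (sdir i) * inner ℝ (gradDiff t A i z) w := by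
    rw [Finset.sum_mul, ← Finset.sum_neg_distrib]
    refine Finset.sum_le_sum fun i _ => ?_
    refine le_trans ?_ (neg_abs_le _)
    rw [abs_mul]
    exact neg_le_neg (mul_le_mul_of_nonneg_left (abs_inner_gradDiff_ofRows_le ht A _ i z)
      (abs_nonneg _))
  have t3' := mul_le_mul_of_nonneg_left t3 hgw
  rw [e]
  simp only [hA] at t3'
  nlinarith

theorem stronglyMeasurable_gradAvg {X : SpaceTime n → Mat n N} (hX : StronglyMeasurable X) (t : ℝ) :
    StronglyMeasurable (gradAvg t X) :=
  (ofRows.continuous.measurable.comp (measurable_pi_iff.2 fun j =>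
    (row j).continuous.measurable.comp (stronglyMeasurable_segAvg hX _).measurable)).stronglyMeasurable

theorem stronglyMeasurable_gradDiff {X : SpaceTime n → Mat n N} (hX : StronglyMeasurable X) (t : ℝ)
    (i : Fin n) : StronglyMeasurable (gradDiff t X i) :=
  (ofRows.continuous.measurable.comp (measurable_pi_iff.2 fun _ =>
    (row i).continuous.measurable.comp (((hX.measurable.comp (measurable_id.add_const _)).sub
      hX.measurable).const_smul t⁻¹))).stronglyMeasurable

theorem stronglyMeasurable_mixedTerm {φ : ℝ → ℝ} {X : SpaceTime n → Mat n N}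
    (hX : StronglyMeasurable X) (t : ℝ) : StronglyMeasurable (mixedTerm φ X t) :=
  Finset.stronglyMeasurable_fun_sum _ fun i _ =>
    ((stronglyMeasurable_gradAvg hX t).inner (stronglyMeasurable_gradDiff hX t i)).mul
      ((stronglyMeasurable_gradDiff (measurable_fluxA.comp hX.measurable).stronglyMeasurable t
        i).inner (stronglyMeasurable_gradAvg hX t))

end LimitTerms

namespace IsLimitSetup

variable {n N : ℕ} {φ : ℝ → ℝ} {c₀ c₁ : ℝ} {D : Set (SpaceTime n)}
    {u : SpaceTime n → EuclideanSpace ℝ (Fin N)} {G : SpaceTime n → Mat n N}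
    {W : Fin n → SpaceTime n → Mat n N} {K U : Set (SpaceTime n)} {h₀ : ℝ} {s : ℕ → ℝ}
    {e : ℕ → SpaceTime n → ℝ}

variable (h : IsLimitSetup φ c₀ c₁ D u G W K U h₀ s e)
include h

theorem sq_norm_segAvg_grad_le (k : ℕ) (j : Fin n) (z : SpaceTime n) :
    ‖segAvg (K.indicator G) (s k • sdir j) z‖ ^ 2 ≤ 2 * (e k z + baseFn φ G W K z) := by
  have h1 := h.lim.grad_le k j z
  have h2 : ‖K.indicator G z‖ ^ 2 ≤ baseFn φ G W K z := by
    by_cases hz : z ∈ K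
    · rw [h.baseFn_of_mem hz, indicator_of_mem hz]
      have : 0 ≤ 1 + ∑ j, ‖W j z‖ ^ 2 + ‖fieldV φ (G z)‖ ^ 2 := by positivity
      linarith
    · rw [indicator_of_notMem hz, norm_zero]
      simpa using h.baseFn_nonneg z
  have h3 := sq_norm_sub_le (segAvg (K.indicator G) (s k • sdir j) z - K.indicator G z)
    (-K.indicator G z)
  rw [sub_neg_eq_add, sub_add_cancel, norm_neg] at h3
  linarith

theorem sq_segAvg_norm_deriv_le (k : ℕ) (j : Fin n) (z : SpaceTime n) :
    segAvg (fun z => ‖K.indicator (W j) z‖) (s k • sdir j) z ^ 2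
      ≤ 2 * (e k z + baseFn φ G W K z) := by
  have h1 := h.lim.norm_le k j z
  have h2 : ‖K.indicator (W j) z‖ ^ 2 ≤ baseFn φ G W K z := by
    by_cases hz : z ∈ K
    · rw [h.baseFn_of_mem hz, indicator_of_mem hz]
      have := Finset.single_le_sum (f := fun j => ‖W j z‖ ^ 2) (fun i _ => sq_nonneg _)
        (Finset.mem_univ j)
      have := sq_nonneg ‖G z‖
      have := sq_nonneg ‖fieldV φ (G z)‖
      linarith
    · rw [indicator_of_notMem hz, norm_zero]
      simpa using h.baseFn_nonneg z
  rw [Real.norm_eq_abs, sq_abs] at h1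
  nlinarith [sq_nonneg (segAvg (fun z => ‖K.indicator (W j) z‖) (s k • sdir j) z
    - 2 * ‖K.indicator (W j) z‖)]

theorem sq_norm_gradAvg_le_base (k : ℕ) (z : SpaceTime n) :
    ‖gradAvg (s k) (K.indicator G) z‖ ^ 2 ≤ n * (2 * (e k z + baseFn φ G W K z)) := by
  refine (sq_norm_gradAvg_le _ _ _).trans ((Finset.sum_le_sum fun j _ =>
    h.sq_norm_segAvg_grad_le k j z).trans_eq ?_)
  rw [Finset.sum_const, Finset.card_univ, Fintype.card_fin, nsmul_eq_mul]

theorem ae_tendsto_gradAvg : ∀ᵐ z, z ∈ U →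
    Tendsto (fun k => gradAvg (s k) (K.indicator G) z) atTop (𝓝 (G z)) := by
  filter_upwards [h.lim.ae_tendsto] with z hz hzU
  rw [← ofRows_row (G z)]
  refine (ofRows.continuous.tendsto _).comp (tendsto_pi_nhds.2 fun j => ?_)
  have := IsLimitSeq.tendsto_of_sq_le (fun k => h.lim.grad_le k j z) hz
  rw [indicator_of_mem (h.region.sub hzU)] at this
  exact ((row j).continuous.tendsto _).comp this

theorem ae_tendsto_segAvg_norm : ∀ᵐ z, z ∈ U → ∀ j, Tendsto (fun k =>
    segAvg (fun z => ‖K.indicator (W j) z‖) (s k • sdir j) z) atTop (𝓝 ‖W j z‖) := by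
  filter_upwards [h.lim.ae_tendsto] with z hz hzU j
  have := IsLimitSeq.tendsto_of_sq_le (fun k => h.lim.norm_le k j z) hz
  rwa [indicator_of_mem (h.region.sub hzU)] at this

/-- On almost every segment each value of `V(∇u)` differs from the initial one by at most the step
times the average `m` of `|W j|`. Hence the flux error has a limit controlled by `|W j||V(∇u)|`,
with a remainder carrying an additional factor of the step. -/
theorem ae_flux_mul_segAvg_le {C : ℝ} (hC0 : 0 ≤ C) (hC : ∀ P P' Q : Mat n N,
      ‖fluxA φ P' - fluxA φ P‖ * ‖Q‖
        ≤ C * (‖fieldV φ Q - fieldV φ P‖ * (‖fieldV φ Q - fieldV φ P‖ + ‖fieldV φ Q‖)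
          + ‖fieldV φ P' - fieldV φ Q‖ * (‖fieldV φ P' - fieldV φ Q‖ + ‖fieldV φ Q‖))) :
    ∀ᵐ z, z ∈ U → ∀ k j, (s k)⁻¹ *
      (‖fluxA φ (K.indicator G (z + s k • sdir j)) - fluxA φ (K.indicator G z)‖
        * ‖segAvg (K.indicator G) (s k • sdir j) z‖)
      ≤ C * (segAvg (fun z => ‖K.indicator (W j) z‖) (s k • sdir j) z
        * (8 * s k * segAvg (fun z => ‖K.indicator (W j) z‖) (s k • sdir j) z
          + 3 * ‖fieldV φ (G z)‖)) := by
  have hVm : StronglyMeasurable fun z => fieldV φ (G z) :=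
    (measurable_fieldV.comp h.sol.meas_G.measurable).stronglyMeasurable
  have h1 : ∀ᵐ z, ∀ k j, z ∈ U → ∀ᵐ r ∂volume.restrict (Ioc (0 : ℝ) 1),
      ‖fieldV φ (G (z + r • s k • sdir j)) - fieldV φ (G z)‖
        ≤ s k * segAvg (fun z => ‖K.indicator (W j) z‖) (s k • sdir j) z := by
    refine ae_all_iff.2 fun k => ae_all_iff.2 fun j => ?_
    have hw2 : ∫⁻ z, ‖K.indicator (fun z => s k • W j z) z‖ₑ ^ 2 < ⊤ := by
      refine lintegral_sq_lt_top ?_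
      have h2 := (h.sol.integrable_indicator (h.int_sq j) h.region).const_mul (s k ^ 2)
      refine h2.congr (Eventually.of_forall fun z => ?_)
      by_cases hz : z ∈ K
      · simp only [indicator_of_mem hz, norm_smul, mul_pow, Real.norm_eq_abs, sq_abs]
      · simp [indicator_of_notMem hz]
    have hint : LocallyIntegrableOn (fun z => s k • W j z) D := fun z hz => by
      obtain ⟨t, ht, hti⟩ := h.int j z hz
      exact ⟨t, ht, hti.smul (s k)⟩
    filter_upwards [((h.weakDeriv j).smul (s k)).ae_ae_norm_sub_le hVm ((h.meas j).const_smul (s k))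
      h.sol.locallyIntegrable_fieldV hint hw2 h.region.isCompact h.region.subset h.region.isOpen
      fun z hz r hr => h.region.seg' hz j (h.abs_step k) hr] with z hz hzU
    have e1 : segAvg (fun z => ‖K.indicator (fun z => s k • W j z) z‖) (s k • sdir j) z
        = s k * segAvg (fun z => ‖K.indicator (W j) z‖) (s k • sdir j) z := by
      rw [segAvg, segAvg, ← intervalIntegral.integral_const_mul]
      congr 1
      ext1 r
      by_cases hz : z + r • s k • sdir j ∈ K
      · rw [indicator_of_mem hz, indicator_of_mem hz, norm_smul,
          Real.norm_of_nonneg (h.lim.pos k).le]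
      · simp [indicator_of_notMem hz]
    rw [e1] at hz
    exact hz hzU
  filter_upwards [h1, h.ae_diffQuot_fieldV] with z hz hV hzU k j
  have hs := h.lim.pos k
  set m := segAvg (fun z => ‖K.indicator (W j) z‖) (s k • sdir j) z with hm
  set P := K.indicator G z with hP
  set P' := K.indicator G (z + s k • sdir j) with hP'
  have hPG : P = G z := indicator_of_mem (h.region.sub hzU) _
  have hP'V : ‖fieldV φ P' - fieldV φ P‖ ≤ s k * m := by
    have h2 : ‖segAvg (K.indicator (W j)) (s k • sdir j) z‖ ≤ m := by
      rw [hm, segAvg_eq (fun z => ‖K.indicator (W j) z‖)]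
      exact norm_segAvg_le _ _ _
    rw [← hV hzU k j, norm_smul, norm_inv, Real.norm_of_nonneg hs.le, inv_mul_le_iff₀ hs] at h2
    exact h2
  have hm0 : 0 ≤ s k * m := (norm_nonneg _).trans hP'V
  have h3 : ‖fluxA φ P' - fluxA φ P‖ * ‖segAvg (K.indicator G) (s k • sdir j) z‖
      ≤ C * (s k * m * (8 * (s k * m) + 3 * ‖fieldV φ (G z)‖)) := by
    refine (mul_le_mul_of_nonneg_left (norm_segAvg_le _ _ _) (norm_nonneg _)).trans ?_
    rw [← integral_const_mul]
    have h4 := integral_mono_of_nonneg (μ := volume.restrict (Ioc (0 : ℝ) 1))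
      (f := fun r => ‖fluxA φ P' - fluxA φ P‖ * ‖K.indicator G (z + r • s k • sdir j)‖)
      (g := fun _ => C * (s k * m * (8 * (s k * m) + 3 * ‖fieldV φ (G z)‖)))
      (Eventually.of_forall fun r => by positivity) (integrable_const _) ?_
    · simpa using h4
    · filter_upwards [hz k j hzU, ae_restrict_mem measurableSet_Ioc] with r hr hr1
      refine (hC P P' _).trans (mul_le_mul_of_nonneg_left ?_ hC0)
      rw [indicator_of_mem (h.region.seg' hzU j (h.abs_step k) ⟨hr1.1.le, hr1.2⟩)]
      set Q := G (z + r • s k • sdir j)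
      rw [← hPG] at hr ⊢
      have d2 : ‖fieldV φ P' - fieldV φ Q‖ ≤ 2 * (s k * m) := by
        have := norm_sub_le_norm_sub_add_norm_sub (fieldV φ P') (fieldV φ P) (fieldV φ Q)
        rw [norm_sub_rev (fieldV φ P)] at this
        linarith
      have d3 : ‖fieldV φ Q‖ ≤ ‖fieldV φ P‖ + s k * m := by
        have := norm_le_norm_add_norm_sub' (fieldV φ Q) (fieldV φ P)
        linarith
      -- With `σ = s_k m`, the two distances are at most `σ` and `2σ`, and `|V(Q)| ≤ |V(P)| + σ`.
      -- Altogether `σ(2σ + |V|) + 2σ(3σ + |V|) = σ(8σ + 3|V|)`.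
      have a1 := mul_le_mul hr (add_le_add hr d3) (by positivity) hm0
      have a2 := mul_le_mul d2 (add_le_add d2 d3) (by positivity) (by linarith)
      nlinarith
  rw [inv_mul_le_iff₀ hs]
  refine h3.trans_eq ?_
  ring

/-- The negative part of the mixed term disappears in the limit. -/
theorem ae_tendsto_min_mixedTerm {g : ℝ → ℝ} (hg : ContDiff ℝ 1 g)
    (hg' : ∀ x, 0 ≤ x → 0 ≤ deriv g x) : ∀ᵐ z, z ∈ U → ∀ x, 0 ≤ x →
    Tendsto (fun k => min (2 * x * deriv g (‖gradAvg (s k) (K.indicator G) z‖ ^ 2)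
      * mixedTerm φ (K.indicator G) (s k) z) 0) atTop (𝓝 0) := by
  obtain ⟨C, hC1, hC⟩ := exists_fluxA_sub_mul_sub_le c₀ c₁ h.pos
  filter_upwards [h.ae_tendsto_gradAvg, h.ae_tendsto_grad, h.ae_row_hess_comm,
    h.ae_diffQuot_fieldV, h.ae_tendsto_segAvg] with z hw hG hsym hV hS hzU x hx
  have hdg : Tendsto (fun k => 2 * x * deriv g (‖gradAvg (s k) (K.indicator G) z‖ ^ 2)) atTop
      (𝓝 (2 * x * deriv g (‖G z‖ ^ 2))) :=
    (((hg.continuous_deriv le_rfl).tendsto _).comp ((hw hzU).norm.pow 2)).const_mul _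
  have hmix : Tendsto (fun k => min (mixedTerm φ (K.indicator G) (s k) z) 0) atTop (𝓝 0) := by
    -- At a zero of the gradient the factor `|w|²` tends to 0 while the quotients of `V` stay
    -- bounded. Elsewhere the mixed term converges to the quadratic form whose sign follows from
    -- symmetry.
    by_cases hz : G z = 0
    · have h1 : Tendsto (fun k => mixedTerm φ (K.indicator G) (s k) z) atTop (𝓝 0) := by
        refine squeeze_zero_norm (fun k => abs_mixedTerm_le (hC φ h.orlicz n N) _ (h.lim.pos k) z) ?_
        simp only [fun k j => hV hzU k j]
        have h2 := ((hw hzU).norm.pow 2).const_mul (2 * (n : ℝ) ^ 2 * C)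
        have h3 := tendsto_finsetSum Finset.univ fun j _ => (hS hzU j).norm.pow 2
        have h4 := h2.mul h3
        rwa [hz, norm_zero, zero_pow two_ne_zero, mul_zero, zero_mul] at h4
      simpa using h1.min (tendsto_const_nhds (x := (0 : ℝ)))
    · have h1 : Tendsto (fun k => mixedTerm φ (K.indicator G) (s k) z) atTop
          (𝓝 (∑ i, inner ℝ (G z) (ofRows fun j => row i (hess φ G W j z))
            * inner ℝ (ofRows fun j => row i (radialMap (deriv φ ‖G z‖ / ‖G z‖)
              (deriv (deriv φ) ‖G z‖) (G z) (hess φ G W j z))) (G z))) := by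
        refine tendsto_finsetSum _ fun i _ => ((hw hzU).inner ?_).mul (Tendsto.inner ?_ (hw hzU))
        · refine (ofRows.continuous.tendsto _).comp (tendsto_pi_nhds.2 fun j => ?_)
          rw [indicator_of_mem (h.region.sub hzU)]
          exact ((row i).continuous.tendsto _).comp ((hG hzU j).2 hz)
        · refine (ofRows.continuous.tendsto _).comp (tendsto_pi_nhds.2 fun j => ?_)
          simp only [indicator_of_mem (h.region.sub hzU)]
          exact ((row i).continuous.tendsto _).comp (tendsto_diffQuot_of_hasFDerivAt
            (hasFDerivAt_fluxA h.orlicz hz) h.lim.pos h.lim.tendsto ((hG hzU j).2 hz))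
      have h2 := sum_inner_fluxA_deriv_nonneg h.orlicz h.pos hz (D := fun j => hess φ G W j z)
        (hsym hzU hz)
      have h3 := h1.min (tendsto_const_nhds (x := (0 : ℝ)))
      rwa [min_eq_right] at h3
      simpa only [inner_eq_sum_row, row_ofRows] using h2
  have h5 := hdg.mul hmix
  rw [mul_zero] at h5
  refine h5.congr fun k => ?_
  have h6 : 0 ≤ 2 * x * deriv g (‖gradAvg (s k) (K.indicator G) z‖ ^ 2) :=
    mul_nonneg (by linarith) (hg' _ (sq_nonneg _))
  rw [mul_min_of_nonneg _ _ h6, mul_zero]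

/-- The renormalized energy inequality on a region. -/
theorem renormalized_inequality {C₁ C₂ : ℝ} (hC₁ : 0 < C₁) (hC₂ : 0 ≤ C₂)
    (hmono : ∀ P Q : Mat n N, ‖fieldV φ P - fieldV φ Q‖ ^ 2
      ≤ C₁ * inner ℝ (fluxA φ P - fluxA φ Q) (P - Q))
    (hflux : ∀ P P' Q : Mat n N, ‖fluxA φ P' - fluxA φ P‖ * ‖Q‖
        ≤ C₂ * (‖fieldV φ Q - fieldV φ P‖ * (‖fieldV φ Q - fieldV φ P‖ + ‖fieldV φ Q‖)
          + ‖fieldV φ P' - fieldV φ Q‖ * (‖fieldV φ P' - fieldV φ Q‖ + ‖fieldV φ Q‖)))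
    {Γ g : ℝ → ℝ} (hΓ : ∀ x, HasDerivAt Γ (g x) x) (hΓ0 : Γ 0 = 0) (hg : ContDiff ℝ 1 g)
    {M : ℝ} (hg0 : ∀ x, 0 ≤ x → 0 ≤ g x) (hg' : ∀ x, 0 ≤ x → 0 ≤ deriv g x)
    (hM : ∀ x, 0 ≤ x → g x ≤ M) (hM' : ∀ x, 0 ≤ x → deriv g x * x ≤ M)
    {ζ : SpaceTime n → ℝ} (hζ : ContDiff ℝ 1 ζ) (hζc : HasCompactSupport ζ)
    (hζU : tsupport ζ ⊆ U) (hζ0 : ∀ z, 0 ≤ ζ z) :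
    ∫ z, (C₁⁻¹ * (ζ z * g (‖G z‖ ^ 2) * ∑ j, ‖W j z‖ ^ 2)
      - (∑ i, |fderiv ℝ ζ z (sdir i)|) * g (‖G z‖ ^ 2)
        * (∑ j, C₂ * (‖W j z‖ * (3 * ‖fieldV φ (G z)‖)))
      - 1 / 2 * Γ (‖G z‖ ^ 2) * fderiv ℝ ζ z (tdir n)) ≤ 0 := by
  -- In dimension 0 there is no direction from which to infer that the error function is
  -- nonnegative; the gradient is then 0 and the integrand vanishes.
  rcases isEmpty_or_nonempty (Fin n) with hn | hn
  · have : ∀ z, G z = 0 := fun z => ext_row fun i => isEmptyElim i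
    simp [this, hΓ0]
  have hM0 : 0 ≤ M := (hg0 0 le_rfl).trans (hM 0 le_rfl)
  have hMa : ∀ x, 0 ≤ x → |g x| ≤ M := fun x hx => by
    rw [abs_of_nonneg (hg0 x hx)]; exact hM x hx
  have hMa' : ∀ x, 0 ≤ x → |deriv g x * x| ≤ M := fun x hx => by
    rw [abs_of_nonneg (mul_nonneg (hg' x hx) hx)]; exact hM' x hx
  obtain ⟨C₃, hC₃1, hC₃⟩ := exists_fluxA_sub_mul_sub_le c₀ c₁ h.pos
  obtain ⟨B, hB0, hB, hB', -⟩ := exists_bound_lipschitz hζ hζc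
  have hBv : ∀ z (v : SpaceTime n), ‖v‖ ≤ 1 → |fderiv ℝ ζ z v| ≤ B := fun z v hv =>
    ((fderiv ℝ ζ z).le_opNorm v).trans
      (by nlinarith [hB' z, norm_nonneg (fderiv ℝ ζ z), norm_nonneg v])
  have htd : ‖tdir n‖ ≤ 1 := by simp [tdir, Prod.norm_def]
  have hGm := h.sol.meas_ind h.region
  set w : ℕ → SpaceTime n → Mat n N := fun k => gradAvg (s k) (K.indicator G) with hw
  set m : ℕ → Fin n → SpaceTime n → ℝ := fun k j =>
    segAvg (fun z => ‖K.indicator (W j) z‖) (s k • sdir j) with hm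
  set S : ℕ → Fin n → SpaceTime n → Mat n N := fun k j =>
    segAvg (K.indicator (W j)) (s k • sdir j) with hS
  set ν : SpaceTime n → ℝ := fun z => ∑ i, |fderiv ℝ ζ z (sdir i)| with hν
  have hν0 : ∀ z, 0 ≤ ν z := fun z => Finset.sum_nonneg fun _ _ => abs_nonneg _
  have hνB : ∀ z, ν z ≤ n * B := fun z => by
    refine (Finset.sum_le_sum fun i _ => hBv z (sdir i) (norm_sdir i).le).trans_eq ?_
    rw [Finset.sum_const, Finset.card_univ, Fintype.card_fin, nsmul_eq_mul]
  set T1 : ℕ → SpaceTime n → ℝ := fun k z =>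
    C₁⁻¹ * (ζ z * g (‖w k z‖ ^ 2) * ∑ j, ‖S k j z‖ ^ 2) with hT1
  set T2 : ℕ → SpaceTime n → ℝ := fun k z =>
    min (2 * ζ z * deriv g (‖w k z‖ ^ 2) * mixedTerm φ (K.indicator G) (s k) z) 0 with hT2
  set T3 : ℕ → SpaceTime n → ℝ := fun k z => ν z * g (‖w k z‖ ^ 2)
    * ∑ j, C₂ * (m k j z * (8 * s k * m k j z + 3 * ‖fieldV φ (G z)‖)) with hT3
  set T4 : ℕ → SpaceTime n → ℝ := fun k z =>
    1 / 2 * Γ (‖w k z‖ ^ 2) * fderiv ℝ ζ z (tdir n) with hT4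
  have hΓc : Continuous Γ := continuous_iff_continuousAt.2 fun x => (hΓ x).continuousAt
  have hout : ∀ z, z ∉ U → ζ z = 0 ∧ fderiv ℝ ζ z = 0 := fun z hz =>
    ⟨image_eq_zero_of_notMem_tsupport fun h' => hz (hζU h'),
      fderiv_eq_zero_of_notMem_tsupport fun h' => hz (hζU h')⟩
  have hνout : ∀ z, z ∉ U → ν z = 0 := fun z hz => by simp [hν, (hout z hz).2]
  -- domination
  set Cd : ℝ := C₁⁻¹ * (B * M * (n * 2)) + 2 * B * (2 * n ^ 2 * C₃ * M * (n * 2))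
    + n * B * M * (n * (C₂ * (16 * h₀ + 9))) + M * n * B with hCd
  have hdom : ∀ k, ∀ᵐ z, ‖T1 k z + T2 k z - T3 k z - T4 k z‖ ≤ Cd * (e k z + baseFn φ G W K z) := by
    intro k
    filter_upwards [h.ae_diffQuot_fieldV] with z hV
    by_cases hz : z ∈ U
    · have hE := h.err_nonneg k z
      have hb := h.baseFn_nonneg z
      have hVb : ‖fieldV φ (G z)‖ ^ 2 ≤ e k z + baseFn φ G W K z := by
        rw [h.baseFn_of_mem (h.region.sub hz)]
        have : 0 ≤ 1 + ∑ j, ‖W j z‖ ^ 2 + ‖G z‖ ^ 2 := by positivity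
        linarith
      have hSb := Finset.sum_le_sum fun j (_ : j ∈ Finset.univ) => h.sq_norm_segAvg_deriv_le k j z
      have hwb := h.sq_norm_gradAvg_le_base k z
      have hmb := fun j => h.sq_segAvg_norm_deriv_le k j z
      rw [Finset.sum_const, Finset.card_univ, Fintype.card_fin, nsmul_eq_mul] at hSb
      have hg1 := hg0 (‖w k z‖ ^ 2) (sq_nonneg _)
      have hg2 := hM (‖w k z‖ ^ 2) (sq_nonneg _)
      have hg3 := hg' (‖w k z‖ ^ 2) (sq_nonneg _)
      have hg4 := hM' (‖w k z‖ ^ 2) (sq_nonneg _)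
      have hζB : ζ z ≤ B := (le_abs_self _).trans (hB z)
      have hs := h.lim.pos k
      have hs' := h.step_le k
      have hmix := abs_mixedTerm_le (hC₃ φ h.orlicz n N) (K.indicator G) hs z
      simp only [hV hz] at hmix
      have hm0 : ∀ j, 0 ≤ m k j z := fun j => by
        simp only [hm, segAvg_eq]; exact integral_nonneg fun _ => norm_nonneg _
      generalize e k z + baseFn φ G W K z = E at *
      have hE0 : 0 ≤ E := (sq_nonneg _).trans hVb
      have hS0 : 0 ≤ ∑ j, ‖S k j z‖ ^ 2 := Finset.sum_nonneg fun _ _ => sq_nonneg _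
      have b1 : |T1 k z| ≤ C₁⁻¹ * (B * M * (n * 2)) * E := by
        rw [hT1, abs_of_nonneg (by have := hζ0 z; positivity)]
        have := mul_le_mul (mul_le_mul hζB hg2 hg1 hB0) hSb hS0 (mul_nonneg hB0 hM0)
        have := mul_le_mul_of_nonneg_left this (inv_nonneg.2 hC₁.le)
        linarith
      have b2 : |T2 k z| ≤ 2 * B * (2 * n ^ 2 * C₃ * M * (n * 2)) * E := by
        have hmin : ∀ x : ℝ, |min x 0| ≤ |x| := fun x => by
          rcases le_total x 0 with hx | hx
          · rw [min_eq_left hx]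
          · rw [min_eq_right hx, abs_zero]; exact abs_nonneg x
        refine (hmin _).trans ?_
        rw [abs_mul, abs_of_nonneg (by have := hζ0 z; positivity)]
        have h1 := mul_le_mul_of_nonneg_left hmix
          (by have := hζ0 z; positivity : 0 ≤ 2 * ζ z * deriv g (‖w k z‖ ^ 2))
        refine h1.trans ?_
        -- The bound on `x g'(x)` enters here: without the factor `|w|²` from the mixed term, `g'`
        -- alone would not be controlled uniformly in the step.
        have h2 : ζ z * (deriv g (‖w k z‖ ^ 2) * ‖w k z‖ ^ 2) * (∑ j, ‖S k j z‖ ^ 2)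
            ≤ B * M * (n * (2 * E)) := mul_le_mul (mul_le_mul hζB hg4 (by positivity) hB0) hSb hS0
              (mul_nonneg hB0 hM0)
        have h3 := mul_le_mul_of_nonneg_left h2 (by positivity : 0 ≤ 4 * (n : ℝ) ^ 2 * C₃)
        simp only [hw] at h3 ⊢
        linarith
      have b3 : |T3 k z| ≤ n * B * M * (n * (C₂ * (16 * h₀ + 9))) * E := by
        have hj : ∀ j ∈ Finset.univ, C₂ * (m k j z * (8 * s k * m k j z + 3 * ‖fieldV φ (G z)‖))
            ≤ C₂ * ((16 * h₀ + 9) * E) := fun j _ => by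
          refine mul_le_mul_of_nonneg_left ?_ hC₂
          have h1 := hmb j
          have h2 := mul_le_mul hs' h1 (sq_nonneg _) h.region.pos.le
          simp only [hm] at *
          nlinarith [two_mul_le_add_sq (segAvg (fun z => ‖K.indicator (W j) z‖) (s k • sdir j) z)
            ‖fieldV φ (G z)‖]
        have h0 : 0 ≤ ∑ j, C₂ * (m k j z * (8 * s k * m k j z + 3 * ‖fieldV φ (G z)‖)) :=
          Finset.sum_nonneg fun j _ => by have := hm0 j; positivity
        rw [hT3, abs_of_nonneg (mul_nonneg (mul_nonneg (hν0 z) hg1) h0)]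
        have h1 := Finset.sum_le_sum hj
        rw [Finset.sum_const, Finset.card_univ, Fintype.card_fin, nsmul_eq_mul] at h1
        have h2 := mul_le_mul (mul_le_mul (hνB z) hg2 hg1 (by positivity)) h1 h0 (by positivity)
        linarith
      have b4 : |T4 k z| ≤ M * n * B * E := by
        rw [hT4, abs_mul, abs_mul, abs_of_pos (by norm_num : (0 : ℝ) < 1 / 2)]
        have h1 := (abs_le_mul_of_hasDerivAt hΓ hΓ0 hMa (sq_nonneg ‖w k z‖)).trans
          (mul_le_mul_of_nonneg_left hwb hM0)
        have h2 := mul_le_mul h1 (hBv z (tdir n) htd) (abs_nonneg _) (by positivity)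
        linarith
      rw [Real.norm_eq_abs, hCd]
      have a1 := abs_sub (T1 k z + T2 k z - T3 k z) (T4 k z)
      have a2 := abs_sub (T1 k z + T2 k z) (T3 k z)
      have a3 := abs_add_le (T1 k z) (T2 k z)
      linarith
    · rw [show T1 k z + T2 k z - T3 k z - T4 k z = 0 by
        simp [hT1, hT2, hT3, hT4, hνout z hz, (hout z hz).1, (hout z hz).2], norm_zero]
      have := h.region.pos
      exact mul_nonneg (by positivity) (add_nonneg (h.err_nonneg k z) (h.baseFn_nonneg z))
  have hmeas : ∀ k, AEStronglyMeasurable fun z => T1 k z + T2 k z - T3 k z - T4 k z := fun k => by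
    have hwm : StronglyMeasurable (w k) := stronglyMeasurable_gradAvg hGm _
    have hw2 : Measurable fun z => ‖w k z‖ ^ 2 := hwm.measurable.norm.pow_const 2
    have hSm : ∀ j, Measurable (S k j) := fun j =>
      (stronglyMeasurable_segAvg ((h.meas j).indicator h.region.measK) _).measurable
    have hmm : ∀ j, Measurable (m k j) := fun j =>
      (stronglyMeasurable_segAvg ((h.meas j).indicator h.region.measK).norm _).measurable
    have hVm : Measurable fun z => ‖fieldV φ (G z)‖ :=
      (measurable_fieldV.comp h.sol.meas_G.measurable).norm
    have hζm : Measurable ζ := hζ.continuous.measurable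
    have hζd : ∀ v, Measurable fun z => fderiv ℝ ζ z v := fun v =>
      ((hζ.continuous_fderiv (by norm_num)).clm_apply continuous_const).measurable
    have hgw : Measurable fun z => g (‖w k z‖ ^ 2) := hg.continuous.measurable.comp hw2
    have hgw' : Measurable fun z => deriv g (‖w k z‖ ^ 2) :=
      (hg.continuous_deriv le_rfl).measurable.comp hw2
    have hΓw : Measurable fun z => Γ (‖w k z‖ ^ 2) := hΓc.measurable.comp hw2
    have hνm : Measurable ν := Finset.measurable_fun_sum _ fun i _ => (hζd (sdir i)).abs
    have m1 : Measurable (T1 k) := ((hζm.mul hgw).mul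
      (Finset.measurable_fun_sum _ fun j _ => (hSm j).norm.pow_const 2)).const_mul _
    have m2 : Measurable (T2 k) := (((hζm.const_mul 2).mul hgw').mul
      (stronglyMeasurable_mixedTerm hGm _).measurable).min measurable_const
    have m3 : Measurable (T3 k) := (hνm.mul hgw).mul (Finset.measurable_fun_sum _ fun j _ =>
      ((hmm j).mul (((hmm j).const_mul _).add (hVm.const_mul 3))).const_mul C₂)
    have m4 : Measurable (T4 k) := (hΓw.const_mul _).mul (hζd (tdir n))
    exact (((m1.add m2).sub m3).sub m4).aestronglyMeasurable
  -- comparison with the renormalized identity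
  have hle : ∀ k, ∫ z, (T1 k z + T2 k z - T3 k z - T4 k z) ≤ 0 := fun k => by
    have hi : Integrable fun z => T1 k z + T2 k z - T3 k z - T4 k z :=
      (((h.lim.integrable k).add h.integrable_baseFn).const_mul Cd).mono' (hmeas k) (hdom k)
    obtain ⟨hri, hr0⟩ := integral_renormIntegrand_gradAvg h.sol h.orlicz h.pos h.region
      (h.lim.pos k) (h.step_le k) hΓ hΓ0 hg hMa hMa' hζ hζc hζU
    have h1 := integral_mono_ae hi hri.neg ?_
    · simpa only [Pi.neg_apply, integral_neg, hr0, neg_zero] using h1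
    · filter_upwards [h.ae_diffQuot_fieldV, h.ae_flux_mul_segAvg_le hC₂ hflux] with z hV hF
      rw [Pi.neg_apply]
      refine le_trans ?_ (le_neg_renormIntegrand (h.lim.pos k) hC₁ hmono hg0 _ (hζ0 z))
      by_cases hz : z ∈ U
      · simp only [hT1, hT2, hT3, hT4, hV hz, hS]
        have h2 := mul_le_mul_of_nonneg_left (Finset.sum_le_sum fun j (_ : j ∈ Finset.univ) =>
          hF hz k j) (mul_nonneg (hν0 z) (hg0 _ (sq_nonneg ‖w k z‖)))
        linarith
      · simp [hT1, hT2, hT3, hT4, hνout z hz, (hout z hz).1, (hout z hz).2]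
  have hlim : ∀ᵐ z, Tendsto (fun k => T1 k z + T2 k z - T3 k z - T4 k z) atTop
      (𝓝 (C₁⁻¹ * (ζ z * g (‖G z‖ ^ 2) * ∑ j, ‖W j z‖ ^ 2) + 0
      - ν z * g (‖G z‖ ^ 2) * (∑ j, C₂ * (‖W j z‖ * (8 * 0 * ‖W j z‖ + 3 * ‖fieldV φ (G z)‖)))
      - 1 / 2 * Γ (‖G z‖ ^ 2) * fderiv ℝ ζ z (tdir n))) := by
    filter_upwards [h.ae_tendsto_gradAvg, h.ae_tendsto_segAvg, h.ae_tendsto_segAvg_norm,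
      h.ae_tendsto_min_mixedTerm hg hg'] with z h1 h2 h3 h4
    by_cases hz : z ∈ U
    · have hw2 : Tendsto (fun k => ‖w k z‖ ^ 2) atTop (𝓝 (‖G z‖ ^ 2)) := (h1 hz).norm.pow 2
      have hgw := (hg.continuous.tendsto _).comp hw2
      have hΓw := (hΓc.tendsto _).comp hw2
      refine Tendsto.sub (Tendsto.sub (Tendsto.add ?_ (h4 hz _ (hζ0 z))) ?_) ?_
      · exact ((hgw.const_mul (ζ z)).mul (tendsto_finsetSum _ fun j _ =>
          (h2 hz j).norm.pow 2)).const_mul _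
      · exact (hgw.const_mul (ν z)).mul (tendsto_finsetSum _ fun j _ => ((h3 hz j).mul
          (((h.lim.tendsto.const_mul 8).mul (h3 hz j)).add_const _)).const_mul C₂)
      · exact (hΓw.const_mul _).mul_const _
    · simp [hT1, hT2, hT3, hT4, hνout z hz, (hout z hz).1, (hout z hz).2]
  have hfin := le_of_tendsto'
    (h.lim.tendsto_integral_of_le hmeas h.integrable_baseFn hdom hlim).2 hle
  simpa only [add_zero, mul_zero, zero_mul, zero_add] using hfin

end IsLimitSetup

end

/-! ### From smooth weights to bounded monotone weights. -/

section
section MonotoneWeights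

variable {X : Type*} [MeasurableSpace X] {μ : Measure X} {a b x : X → ℝ}

theorem intervalIntegrable_of_bounded {g : ℝ → ℝ} {M : ℝ} (hg : Measurable g)
    (hM : ∀ y, |g y| ≤ M) (s t : ℝ) : IntervalIntegrable g volume s t :=
  (intervalIntegrable_const (c := M)).mono_fun hg.aestronglyMeasurable
    (Eventually.of_forall fun y => by
      simp only [Real.norm_eq_abs]; exact (hM y).trans (le_abs_self M))

theorem abs_primitive_le {g : ℝ → ℝ} {M : ℝ} (hM : ∀ y, |g y| ≤ M) {t : ℝ} (ht : 0 ≤ t) :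
    |∫ y in (0 : ℝ)..t, g y| ≤ M * t := by
  have := intervalIntegral.norm_integral_le_of_norm_le_const (a := 0) (b := t) (f := g)
    fun y _ => hM y
  simpa [abs_of_nonneg ht] using this

/-- The integrand `a g(x) - b ∫₀ˣ g`. -/
noncomputable def weighted (a b x : X → ℝ) (g : ℝ → ℝ) (z : X) : ℝ :=
  a z * g (x z) - b z * ∫ y in (0 : ℝ)..x z, g y

theorem abs_weighted_le (hx : ∀ z, 0 ≤ x z) {g : ℝ → ℝ} {M : ℝ} (hM : ∀ y, |g y| ≤ M) (z : X) :
    |weighted a b x g z| ≤ M * |a z| + M * |b z * x z| := by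
  refine (abs_sub _ _).trans (add_le_add ?_ ?_)
  · rw [abs_mul, mul_comm]
    exact mul_le_mul_of_nonneg_right (hM _) (abs_nonneg _)
  · rw [abs_mul, abs_mul, abs_of_nonneg (hx z), mul_left_comm]
    exact mul_le_mul_of_nonneg_left (abs_primitive_le hM (hx z)) (abs_nonneg _)

theorem integrable_weighted (hx : ∀ z, 0 ≤ x z) (hxm : Measurable x) (ha : Integrable a μ)
    (hbm : AEStronglyMeasurable b μ) (hb : Integrable (fun z => b z * x z) μ) {g : ℝ → ℝ} {M : ℝ}
    (hg : Measurable g) (hM : ∀ y, |g y| ≤ M) : Integrable (weighted a b x g) μ := by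
  refine ((ha.abs.const_mul M).add (hb.abs.const_mul M)).mono' ?_
    (Eventually.of_forall fun z => abs_weighted_le hx hM z)
  have hc : Continuous fun t => ∫ y in (0 : ℝ)..t, g y :=
    intervalIntegral.continuous_primitive (intervalIntegrable_of_bounded hg hM) 0
  exact (ha.1.mul (hg.comp hxm).aestronglyMeasurable).sub
    (hbm.mul (hc.measurable.comp hxm).aestronglyMeasurable)

/-- Weights for which the weighted integral is nonpositive. -/
def IsGoodWeight (μ : Measure X) (a b x : X → ℝ) (g : ℝ → ℝ) : Prop :=
  Measurable g ∧ (∃ M, ∀ y, |g y| ≤ M) ∧ ∫ z, weighted a b x g z ∂μ ≤ 0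

theorem IsGoodWeight.sum (hx : ∀ z, 0 ≤ x z) (hxm : Measurable x) (ha : Integrable a μ)
    (hbm : AEStronglyMeasurable b μ) (hb : Integrable (fun z => b z * x z) μ) {c : ℝ} (hc : 0 ≤ c)
    {L : ℕ} {g : ℕ → ℝ → ℝ} (hg : ∀ i, IsGoodWeight μ a b x (g i)) :
    IsGoodWeight μ a b x fun y => c * ∑ i ∈ Finset.range L, g i y := by
  choose hm hM hI using hg
  choose M hM using hM
  refine ⟨(Finset.measurable_fun_sum _ fun i _ => hm i).const_mul c,
    ⟨c * ∑ i ∈ Finset.range L, M i, fun y => ?_⟩, ?_⟩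
  · rw [abs_mul, abs_of_nonneg hc]
    exact mul_le_mul_of_nonneg_left ((Finset.abs_sum_le_sum_abs _ _).trans
      (Finset.sum_le_sum fun i _ => hM i y)) hc
  · have e : weighted a b x (fun y => c * ∑ i ∈ Finset.range L, g i y)
        = fun z => c * ∑ i ∈ Finset.range L, weighted a b x (g i) z := by
      ext1 z
      simp only [weighted]
      rw [intervalIntegral.integral_const_mul, intervalIntegral.integral_finsetSum fun i _ =>
        intervalIntegrable_of_bounded (hm i) (hM i) _ _, Finset.sum_sub_distrib, ← Finset.mul_sum,
        ← Finset.mul_sum]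
      ring
    rw [e, integral_const_mul, integral_finsetSum _ fun i _ =>
      integrable_weighted hx hxm ha hbm hb (hm i) (hM i)]
    exact mul_nonpos_of_nonneg_of_nonpos hc (Finset.sum_nonpos fun i _ => hI i)

/-- Good weights are closed under bounded pointwise limits, since `M |a| + M |b x|` dominates.
Pointwise convergence everywhere is assumed, as the law of `x` may have atoms at the jumps of the
weight. -/
theorem IsGoodWeight.of_tendsto (hx : ∀ z, 0 ≤ x z) (hxm : Measurable x) (ha : Integrable a μ)
    (hbm : AEStronglyMeasurable b μ) (hb : Integrable (fun z => b z * x z) μ)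
    {g : ℕ → ℝ → ℝ} {g₀ : ℝ → ℝ} {M : ℝ} (hg : ∀ k, IsGoodWeight μ a b x (g k))
    (hM : ∀ k y, |g k y| ≤ M) (hlim : ∀ y, Tendsto (fun k => g k y) atTop (𝓝 (g₀ y))) :
    IsGoodWeight μ a b x g₀ := by
  have hM₀ : ∀ y, |g₀ y| ≤ M := fun y =>
    le_of_tendsto' (hlim y).abs fun k => hM k y
  have hm₀ : Measurable g₀ := measurable_of_tendsto_metrizable (fun k => (hg k).1)
    (tendsto_pi_nhds.2 hlim)
  refine ⟨hm₀, ⟨M, hM₀⟩, ?_⟩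
  refine le_of_tendsto' (tendsto_integral_of_dominated_convergence
    (fun z => M * |a z| + M * |b z * x z|)
    (fun k => (integrable_weighted hx hxm ha hbm hb (hg k).1 (hM k)).1)
    ((ha.abs.const_mul M).add (hb.abs.const_mul M))
    (fun k => Eventually.of_forall fun z => abs_weighted_le hx (hM k) z)
    (Eventually.of_forall fun z => ?_)) fun k => (hg k).2.2
  refine ((hlim _).const_mul _).sub (Tendsto.const_mul _ ?_)
  exact intervalIntegral.tendsto_integral_filter_of_dominated_convergence (fun _ => M)
    (Eventually.of_forall fun k => (hg k).1.aestronglyMeasurable)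
    (Eventually.of_forall fun k => Eventually.of_forall fun y _ => hM k y)
    intervalIntegrable_const (Eventually.of_forall fun y _ => hlim y)

/-- Smooth steps. -/
noncomputable def smoothStep (k : ℕ) (c σ y : ℝ) : ℝ := Real.smoothTransition (k * (y - c) + σ)

theorem contDiff_smoothStep (k : ℕ) (c σ : ℝ) : ContDiff ℝ 1 (smoothStep k c σ) :=
  Real.smoothTransition.contDiff.comp
    ((contDiff_const.mul (contDiff_id.sub contDiff_const)).add contDiff_const)

theorem monotone_smoothStep (k : ℕ) (c σ : ℝ) : Monotone (smoothStep k c σ) := fun y y' hy =>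
  Real.smoothTransition.monotone (by
    have : (0 : ℝ) ≤ k := Nat.cast_nonneg k
    nlinarith)

/-- Smooth steps are admissible in the renormalized inequality: beyond `c + (1 + |σ|)/k` the step is
constant, and on the remaining bounded interval the derivative is continuous. -/
theorem exists_deriv_smoothStep_mul_le (k : ℕ) (c σ : ℝ) :
    ∃ M, ∀ y, 0 ≤ y → deriv (smoothStep k c σ) y * y ≤ M := by
  rcases k.eq_zero_or_pos with hk | hk
  · refine ⟨0, fun y _ => ?_⟩
    have : smoothStep k c σ = fun _ => Real.smoothTransition σ := by
      ext1 y; simp [smoothStep, hk]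
    simp [this]
  · have hk' : (0 : ℝ) < k := Nat.cast_pos.2 hk
    set b := c + (1 + |σ|) / k with hb
    have hcont : ContinuousOn (fun y => deriv (smoothStep k c σ) y * y) (Icc 0 b) :=
      (((contDiff_smoothStep k c σ).continuous_deriv le_rfl).mul continuous_id).continuousOn
    obtain ⟨M, hM⟩ := isCompact_Icc.exists_bound_of_continuousOn hcont
    refine ⟨max M 0, fun y hy => ?_⟩
    rcases le_or_gt y b with hyb | hyb
    · exact ((le_abs_self _).trans (hM y ⟨hy, hyb⟩)).trans (le_max_left _ _)
    · have : smoothStep k c σ =ᶠ[𝓝 y] fun _ => 1 := by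
        filter_upwards [lt_mem_nhds hyb] with y' hy'
        refine Real.smoothTransition.one_of_one_le ?_
        have h1 : (1 + |σ|) / k < y' - c := by rw [hb] at hy'; linarith
        rw [div_lt_iff₀ hk'] at h1
        linarith [neg_abs_le σ]
      rw [this.deriv_eq, deriv_const, zero_mul]
      exact le_max_right _ _

theorem tendsto_smoothStep (c y : ℝ) {σ : ℝ} (hσ : σ = 0 ∨ σ = 1) :
    Tendsto (fun k : ℕ => smoothStep k c σ y) atTop
      (𝓝 (if c < y then 1 else if y < c then 0 else σ)) := by
  have hnat : Tendsto (fun k : ℕ => (k : ℝ)) atTop atTop := tendsto_natCast_atTop_atTop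
  rcases lt_trichotomy c y with h | h | h
  · rw [if_pos h]
    refine tendsto_const_nhds.congr' ?_
    have h1 := tendsto_atTop_add_const_right _ σ (hnat.atTop_mul_const (sub_pos.2 h))
    filter_upwards [h1.eventually_ge_atTop 1] with k hk
    exact (Real.smoothTransition.one_of_one_le hk).symm
  · subst h
    rw [if_neg (lt_irrefl _), if_neg (lt_irrefl _)]
    refine tendsto_const_nhds.congr fun k => ?_
    rcases hσ with rfl | rfl <;> simp [smoothStep]
  · rw [if_neg h.not_gt, if_pos h]
    refine tendsto_const_nhds.congr' ?_
    have h1 := tendsto_atBot_add_const_right _ σ (hnat.atTop_mul_const_of_neg (sub_neg.2 h))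
    filter_upwards [h1.eventually_le_atBot 0] with k hk
    exact (Real.smoothTransition.zero_of_nonpos hk).symm

/-- Passing from smooth to monotone weights. -/
theorem isGoodWeight_of_monotone (hx : ∀ z, 0 ≤ x z) (hxm : Measurable x) (ha : Integrable a μ)
    (hbm : AEStronglyMeasurable b μ) (hb : Integrable (fun z => b z * x z) μ)
    (H : ∀ g : ℝ → ℝ, ContDiff ℝ 1 g → Monotone g → ∀ M, (∀ y, 0 ≤ g y) → (∀ y, g y ≤ M) →
      (∀ y, 0 ≤ y → deriv g y * y ≤ M) → ∫ z, weighted a b x g z ∂μ ≤ 0)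
    {g : ℝ → ℝ} (hg : Monotone g) {M : ℝ} (hg0 : ∀ y, 0 ≤ g y) (hgM : ∀ y, g y ≤ M) :
    IsGoodWeight μ a b x g := by
  have hstep : ∀ k c σ, IsGoodWeight μ a b x (smoothStep k c σ) := fun k c σ => by
    obtain ⟨B, hB⟩ := exists_deriv_smoothStep_mul_le k c σ
    have h1 : ∀ y, smoothStep k c σ y ≤ 1 := fun y => Real.smoothTransition.le_one _
    have h0 : ∀ y, 0 ≤ smoothStep k c σ y := fun y => Real.smoothTransition.nonneg _
    exact ⟨(contDiff_smoothStep k c σ).continuous.measurable,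
      ⟨1, fun y => by rw [abs_of_nonneg (h0 y)]; exact h1 y⟩,
      H _ (contDiff_smoothStep k c σ) (monotone_smoothStep k c σ) (max 1 B) h0
        (fun y => (h1 y).trans (le_max_left _ _)) fun y hy => (hB y hy).trans (le_max_right _ _)⟩
  -- Indicators of upper sets are limits of smooth steps. A bounded monotone weight is then
  -- approximated uniformly by averages of indicators of its superlevel sets.
  have hind : ∀ S : Set ℝ, IsUpperSet S → IsGoodWeight μ a b x (S.indicator fun _ => 1) := by
    intro S hS
    rcases S.eq_empty_or_nonempty with rfl | hne
    · have := hstep 0 0 0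
      convert this using 1
      ext1 y; simp [smoothStep]
    by_cases huniv : S = univ
    · have := hstep 0 0 1
      convert this using 1
      ext1 y; simp [smoothStep, huniv]
    · obtain ⟨y₀, hy₀⟩ := (ne_univ_iff_exists_notMem S).1 huniv
      have hbdd : BddBelow S := ⟨y₀, fun y hy => le_of_not_gt fun h => hy₀ (hS h.le hy)⟩
      have h1 : ∀ y, sInf S < y → y ∈ S := fun y hy => by
        obtain ⟨y', hy', hlt⟩ := exists_lt_of_csInf_lt hne hy
        exact hS hlt.le hy'
      have h2 : ∀ y, y < sInf S → y ∉ S := fun y hy h => absurd (csInf_le hbdd h) (not_le.2 hy)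
      -- The offset of the steps is 1 or 0 according to whether the infimum belongs to `S`, so the
      -- limit is correct also at the jump.
      refine IsGoodWeight.of_tendsto hx hxm ha hbm hb (M := 1)
        (g := fun k => smoothStep k (sInf S) (S.indicator (fun _ => 1) (sInf S)))
        (fun k => hstep _ _ _) (fun k y => ?_) fun y => ?_
      · rw [smoothStep, abs_of_nonneg (Real.smoothTransition.nonneg _)]
        exact Real.smoothTransition.le_one _
      · convert tendsto_smoothStep (sInf S) y (σ := S.indicator (fun _ => 1) (sInf S)) ?_ using 2
        · rcases lt_trichotomy (sInf S) y with h | h | h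
          · rw [if_pos h, indicator_of_mem (h1 y h)]
          · rw [← h, if_neg (lt_irrefl _), if_neg (lt_irrefl _)]
          · rw [if_neg h.not_gt, if_pos h, indicator_of_notMem (h2 y h)]
        · by_cases h : sInf S ∈ S <;> simp [h]
  have hM0 : 0 ≤ M := (hg0 0).trans (hgM 0)
  -- approximation by step functions
  have hfloor : ∀ m : ℕ, ∀ y, ((m : ℝ) + 1)⁻¹ * ∑ i ∈ Finset.range (⌊(m + 1) * M⌋₊),
      {y | (i + 1 : ℝ) ≤ (m + 1) * g y}.indicator (fun _ => (1 : ℝ)) y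
      = ((m : ℝ) + 1)⁻¹ * ⌊(m + 1) * g y⌋₊ := fun m y => by
    have hm : (0 : ℝ) < m + 1 := by positivity
    have h0 : 0 ≤ (m + 1) * g y := mul_nonneg hm.le (hg0 y)
    have hle : ⌊(m + 1) * g y⌋₊ ≤ ⌊(m + 1) * M⌋₊ :=
      Nat.floor_le_floor (mul_le_mul_of_nonneg_left (hgM y) hm.le)
    congr 1
    have h1 : ∀ i : ℕ, {y | (i + 1 : ℝ) ≤ (m + 1) * g y}.indicator (fun _ => (1 : ℝ)) y
        = if i < ⌊(m + 1) * g y⌋₊ then 1 else 0 := fun i => by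
      rw [indicator_apply]
      congr 1
      rw [Set.mem_ofPred_eq, eq_iff_iff, ← Nat.succ_le_iff, Nat.le_floor_iff h0]
      push_cast
      rfl
    simp only [h1]
    rw [Finset.sum_ite, Finset.sum_const_zero, add_zero, Finset.sum_const, nsmul_eq_mul, mul_one]
    congr 1
    rw [show (Finset.range ⌊(m + 1) * M⌋₊).filter (fun i => i < ⌊(m + 1) * g y⌋₊)
      = Finset.range ⌊(m + 1) * g y⌋₊ by ext i; simp; omega, Finset.card_range]
  refine IsGoodWeight.of_tendsto hx hxm ha hbm hb (M := M)
    (g := fun (m : ℕ) y => ((m : ℝ) + 1)⁻¹ * ∑ i ∈ Finset.range (⌊(m + 1) * M⌋₊),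
      {y | (i + 1 : ℝ) ≤ (m + 1) * g y}.indicator (fun _ => (1 : ℝ)) y)
    (fun m => IsGoodWeight.sum hx hxm ha hbm hb (by positivity) fun i => hind _ ?_)
    (fun m y => ?_) fun y => ?_
  · intro y y' hyy' hy
    have hm : (0 : ℝ) ≤ m + 1 := by positivity
    exact le_trans hy (mul_le_mul_of_nonneg_left (hg hyy') hm)
  · have hm : (0 : ℝ) < m + 1 := by positivity
    rw [hfloor, abs_of_nonneg (by positivity), inv_mul_le_iff₀ hm]
    exact (Nat.floor_le (mul_nonneg hm.le (hg0 y))).trans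
      (mul_le_mul_of_nonneg_left (hgM y) hm.le)
  · simp only [hfloor]
    have h1 : Tendsto (fun m : ℕ => ((m : ℝ) + 1)⁻¹) atTop (𝓝 0) := by
      simpa using tendsto_one_div_add_atTop_nhds_zero_nat (𝕜 := ℝ)
    refine tendsto_of_tendsto_of_tendsto_of_le_of_le (g := fun m : ℕ => g y - ((m : ℝ) + 1)⁻¹)
      (h := fun _ => g y) (by simpa using tendsto_const_nhds.sub h1) tendsto_const_nhds
      (fun m => ?_) fun m => ?_
    · have hm : (0 : ℝ) < m + 1 := by positivity
      simp only
      rw [le_inv_mul_iff₀ hm, mul_sub, mul_inv_cancel₀ hm.ne']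
      exact (Nat.sub_one_lt_floor _).le
    · have hm : (0 : ℝ) < m + 1 := by positivity
      simp only
      rw [inv_mul_le_iff₀ hm]
      exact Nat.floor_le (mul_nonneg hm.le (hg0 y))

end MonotoneWeights

end

/-! ### The energy inequality for a weight pair. -/

section
section Weights

/-- The substitution `y = r²`. It translates weights of `|w|²` into weights of `|∇u|`: for `g(y) =
f(√y)` half of the primitive of `g` at `t²` is `H(t) - H(0)`. -/
theorem integral_comp_sqrt {f : ℝ → ℝ} {t : ℝ} (ht : 0 ≤ t) :
    ∫ y in (0 : ℝ)..t ^ 2, f (√y) = 2 * ∫ y in (0 : ℝ)..t, y * f y := by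
  have him : (fun y : ℝ => y ^ 2) '' Ioc 0 t = Ioc 0 (t ^ 2) := by
    ext y
    constructor
    · rintro ⟨x, ⟨hx0, hxt⟩, rfl⟩
      exact ⟨pow_pos hx0 2, pow_le_pow_left₀ hx0.le hxt 2⟩
    · rintro ⟨h0, h1⟩
      exact ⟨√y, ⟨Real.sqrt_pos.2 h0, Real.sqrt_le_left ht |>.2 h1⟩, Real.sq_sqrt h0.le⟩
  rw [intervalIntegral.integral_of_le (sq_nonneg t), intervalIntegral.integral_of_le ht, ← him,
    integral_image_eq_integral_abs_deriv_smul (f' := fun y => 2 * y) measurableSet_Ioc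
      (fun y _ => by simpa using (hasDerivAt_pow 2 y).hasDerivWithinAt) (fun x hx y hy hxy => by
        simpa using (pow_left_inj₀ hx.1.le hy.1.le two_ne_zero).1 hxy), ← integral_const_mul]
  refine setIntegral_congr_fun measurableSet_Ioc fun y hy => ?_
  simp only [smul_eq_mul]
  rw [Real.sqrt_sq hy.1.le, abs_of_pos (by linarith [hy.1])]
  ring

variable {f H : ℝ → ℝ}

namespace IsWeightPair

theorem monotone_sqrt (h : IsWeightPair f H) : Monotone fun y => f (√y) := fun _ _ hy =>
  h.mono (Real.sqrt_nonneg _) (Real.sqrt_nonneg _) (Real.sqrt_le_sqrt hy)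

theorem exists_le (h : IsWeightPair f H) : ∃ M, 0 ≤ M ∧ ∀ t, 0 ≤ t → f t ≤ M := by
  obtain ⟨M, hM⟩ := h.bdd
  have hM' : ∀ t, 0 ≤ t → f t ≤ M := fun t ht => hM ⟨t, ht, rfl⟩
  exact ⟨M, (h.nonneg 0 le_rfl).trans (hM' 0 le_rfl), hM'⟩

theorem primitive_sqrt (h : IsWeightPair f H) {t : ℝ} (ht : 0 ≤ t) :
    ∫ y in (0 : ℝ)..t ^ 2, f (√y) = 2 * (H t - H 0) := by
  rw [integral_comp_sqrt ht, h.primitive t ht]; ring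

theorem H_eq (h : IsWeightPair f H) {t : ℝ} (ht : 0 ≤ t) :
    H t = H 0 + 1 / 2 * ∫ y in (0 : ℝ)..t ^ 2, f (√y) := by
  rw [h.primitive_sqrt ht]; ring

theorem measurable_f_norm (h : IsWeightPair f H) {X E : Type*} [MeasurableSpace X]
    [NormedAddCommGroup E] {G : X → E} (hG : StronglyMeasurable G) :
    Measurable fun z => f ‖G z‖ := by
  have := h.monotone_sqrt.measurable.comp (hG.norm.measurable.pow_const 2)
  have e : (fun z => f ‖G z‖) = (fun y => f (√y)) ∘ fun z => ‖G z‖ ^ 2 := by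
    ext1 z
    simp [Real.sqrt_sq]
  rwa [e]

theorem measurable_H_norm (h : IsWeightPair f H) {X E : Type*} [MeasurableSpace X]
    [NormedAddCommGroup E] {G : X → E} (hG : StronglyMeasurable G) :
    Measurable fun z => H ‖G z‖ := by
  obtain ⟨M, hM0, hM⟩ := h.exists_le
  have hc : Continuous fun t => ∫ y in (0 : ℝ)..t, f (√y) :=
    intervalIntegral.continuous_primitive (intervalIntegrable_of_bounded (M := M)
      h.monotone_sqrt.measurable fun y => by
        rw [abs_of_nonneg (h.nonneg _ (Real.sqrt_nonneg _))]; exact hM _ (Real.sqrt_nonneg _)) 0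
  have := ((hc.measurable.comp (hG.norm.measurable.pow_const 2)).const_mul (1 / 2)).const_add (H 0)
  simpa only [Function.comp_apply, ← h.H_eq (norm_nonneg _)] using this

theorem H_le (h : IsWeightPair f H) : ∃ M, 0 ≤ M ∧ ∀ t, 0 ≤ t → H t ≤ M * (1 + t ^ 2) := by
  obtain ⟨M, hM0, hM⟩ := h.exists_le
  have hH0 := h.nonneg_H 0 le_rfl
  refine ⟨H 0 + M, by linarith, fun t ht => ?_⟩
  rw [h.H_eq ht]
  have h1 := abs_primitive_le (g := fun y => f (√y)) (M := M) (fun y => by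
    rw [abs_of_nonneg (h.nonneg _ (Real.sqrt_nonneg _))]; exact hM _ (Real.sqrt_nonneg _))
    (sq_nonneg t)
  have h2 := le_abs_self (∫ y in (0 : ℝ)..t ^ 2, f (√y))
  nlinarith [sq_nonneg t]

end IsWeightPair

end Weights

section Energy

variable {n N : ℕ} {D : Set (SpaceTime n)}

theorem integrable_smul_of_tsupport_subset {F : Type*} [NormedAddCommGroup F] [NormedSpace ℝ F]
    {ρ : SpaceTime n → ℝ} (hρ : Continuous ρ)
    {ζ : SpaceTime n → ℝ} (hζ : HasCompactSupport ζ) (hζD : tsupport ζ ⊆ D)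
    (hsupp : ∀ z, z ∉ tsupport ζ → ρ z = 0) {f : SpaceTime n → F}
    (hf : LocallyIntegrableOn f D) : Integrable fun z => ρ z • f z := by
  have h1 : IntegrableOn f (tsupport ζ) := hf.integrableOn_compact_subset hζD hζ.isCompact
  obtain ⟨M, hM⟩ := (HasCompactSupport.intro hζ.isCompact hsupp).exists_bound_of_continuous hρ
  have h2 : IntegrableOn (fun z => ρ z • f z) (tsupport ζ) :=
    Integrable.bdd_smul h1 M hρ.aestronglyMeasurable (Eventually.of_forall hM)
  refine (integrableOn_iff_integrable_of_support_subset fun z hz => ?_).1 h2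
  by_contra hne
  exact hz (by simp [hsupp z hne])

theorem integrable_mul_of_tsupport_subset {ρ : SpaceTime n → ℝ} (hρ : Continuous ρ)
    {ζ : SpaceTime n → ℝ} (hζ : HasCompactSupport ζ) (hζD : tsupport ζ ⊆ D)
    (hsupp : ∀ z, z ∉ tsupport ζ → ρ z = 0) {f : SpaceTime n → ℝ}
    (hf : LocallyIntegrableOn f D) : Integrable fun z => ρ z * f z :=
  integrable_smul_of_tsupport_subset hρ hζ hζD hsupp hf

theorem integral_fderiv_eq_zero {ζ : SpaceTime n → ℝ} (hζ : ContDiff ℝ 1 ζ)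
    (hζc : HasCompactSupport ζ) (v : SpaceTime n) : ∫ z, fderiv ℝ ζ z v = 0 := by
  have hc : Continuous fun z => fderiv ℝ ζ z v :=
    (hζ.continuous_fderiv (by norm_num)).clm_apply continuous_const
  have := integral_mul_fderiv_eq_neg_fderiv_mul_of_integrable (μ := (volume : Measure (SpaceTime n)))
    (f := fun _ => (1 : ℝ)) (g := ζ) (v := v) (by simp) 
    (by simpa using hc.integrable_of_hasCompactSupport (hζc.fderiv_apply ℝ v))
    (by simpa using hζ.continuous.integrable_of_hasCompactSupport hζc)
    (fun _ _ => differentiableAt_const _) (fun z _ => hζ.differentiable (by norm_num) z)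
  simpa using this

/-- The energy inequality for a weight pair, before the choice of the cutoff function. -/
theorem exists_energy_inequality (c₀ c₁ : ℝ) (hc₀ : 0 < c₀) :
    ∃ C₁ C₂ : ℝ, 0 < C₁ ∧ 0 < C₂ ∧ ∀ φ, IsOrlicz φ c₀ c₁ → ∀ (n N : ℕ) (D : Set (SpaceTime n))
      (u : SpaceTime n → EuclideanSpace ℝ (Fin N)) (G : SpaceTime n → Mat n N)
      (W : Fin n → SpaceTime n → Mat n N), IsMeasSolution φ D u G →
      (∀ j, StronglyMeasurable (W j)) → (∀ j, LocallyIntegrableOn (W j) D) →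
      (∀ j, LocallyIntegrableOn (fun z => ‖W j z‖ ^ 2) D) →
      (∀ j, HasWeakDirDeriv volume D (sdir j) (fun z => fieldV φ (G z)) (W j)) →
      ∀ f H, IsWeightPair f H → ∀ ζ : SpaceTime n → ℝ, ContDiff ℝ 1 ζ → HasCompactSupport ζ →
      tsupport ζ ⊆ D → (∀ z, 0 ≤ ζ z) →
      Integrable (fun z => C₁⁻¹ * (ζ z * f ‖G z‖ * ∑ j, ‖W j z‖ ^ 2)
        - C₂ * ((∑ i, |fderiv ℝ ζ z (sdir i)|) * f ‖G z‖ * ∑ j, ‖W j z‖ * ‖fieldV φ (G z)‖)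
        - H ‖G z‖ * fderiv ℝ ζ z (tdir n)) ∧
      ∫ z, (C₁⁻¹ * (ζ z * f ‖G z‖ * ∑ j, ‖W j z‖ ^ 2)
        - C₂ * ((∑ i, |fderiv ℝ ζ z (sdir i)|) * f ‖G z‖ * ∑ j, ‖W j z‖ * ‖fieldV φ (G z)‖)
        - H ‖G z‖ * fderiv ℝ ζ z (tdir n)) ≤ 0 := by
  obtain ⟨C₁, hC₁, hmono⟩ := exists_sq_fieldV_sub_le_inner c₀ c₁ hc₀
  obtain ⟨C₂, hC₂, hflux⟩ := exists_mul_fluxA_sub_mul_le c₀ c₁ hc₀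
  refine ⟨C₁, 3 * C₂, by linarith, by linarith, ?_⟩
  intro φ hφ n N D u G W hS hWm hWi hWi2 hWd f H hfH ζ hζ hζc hζD hζ0
  obtain ⟨K, U, h₀, hR, hζU⟩ := exists_isRegion hζc.isCompact hS.isOpen hζD
  have hW2 : ∀ j, Integrable fun z => ‖K.indicator (W j) z‖ ^ 2 := fun j => by
    refine (hS.integrable_indicator (hWi2 j) hR).congr (Eventually.of_forall fun z => ?_)
    by_cases hz : z ∈ K <;> simp [hz]
  obtain ⟨s, e, hlim, hs⟩ := exists_isLimitSeq (hS.meas_ind hR)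
    (fun j => (hWm j).indicator hR.measK) (lintegral_sq_lt_top (hS.integrable_G_sq hR))
    (fun j => lintegral_sq_lt_top (hW2 j)) hR.pos
  have hset : IsLimitSetup φ c₀ c₁ D u G W K U h₀ s e :=
    ⟨hφ, hc₀, hS, hWm, hWi, hWi2, hWd, hR, hlim, hs⟩
  obtain ⟨M, hM0, hM⟩ := hfH.exists_le
  have hζd : ∀ v, Continuous fun z => fderiv ℝ ζ z v := fun v =>
    (hζ.continuous_fderiv (by norm_num)).clm_apply continuous_const
  have hd0 : ∀ z, z ∉ tsupport ζ → fderiv ℝ ζ z = 0 := fun z hz =>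
    fderiv_eq_zero_of_notMem_tsupport hz
  set ν : SpaceTime n → ℝ := fun z => ∑ i, |fderiv ℝ ζ z (sdir i)| with hν
  have hνc : Continuous ν := continuous_finsetSum _ fun i _ => (hζd (sdir i)).abs
  set x : SpaceTime n → ℝ := fun z => ‖G z‖ ^ 2 with hx
  set a : SpaceTime n → ℝ := fun z => C₁⁻¹ * (ζ z * ∑ j, ‖W j z‖ ^ 2)
    - 3 * C₂ * (ν z * ∑ j, ‖W j z‖ * ‖fieldV φ (G z)‖) with ha
  set b : SpaceTime n → ℝ := fun z => 1 / 2 * fderiv ℝ ζ z (tdir n) with hb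
  have hx0 : ∀ z, 0 ≤ x z := fun z => sq_nonneg _
  have hxm : Measurable x := hS.meas_G.norm.measurable.pow_const 2
  have hVm : Measurable fun z => ‖fieldV φ (G z)‖ :=
    (measurable_fieldV.comp hS.meas_G.measurable).norm
  have hloc : ∀ F : Fin n → SpaceTime n → ℝ, (∀ j, LocallyIntegrableOn (F j) D) →
      LocallyIntegrableOn (fun z => ∑ j, F j z) D := fun F hF z hz => by
    choose t ht hti using fun j => hF j z hz
    refine ⟨⋂ j, t j, iInter_mem.2 ht, ?_⟩
    exact integrable_finsetSum _ fun j _ => (hti j).mono_set (iInter_subset _ j)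
  have hWV : ∀ j, LocallyIntegrableOn (fun z => ‖W j z‖ * ‖fieldV φ (G z)‖) D := fun j => by
    refine ((hWi2 j).add hS.int_V_sq).mono
      ((hWm j).norm.measurable.mul hVm).aestronglyMeasurable (Eventually.of_forall fun z => ?_)
    rw [Pi.add_apply, Real.norm_of_nonneg (by positivity), Real.norm_of_nonneg (by positivity)]
    nlinarith [two_mul_le_add_sq ‖W j z‖ ‖fieldV φ (G z)‖, sq_nonneg ‖W j z‖,
      sq_nonneg ‖fieldV φ (G z)‖]
  have hai : Integrable a := ((integrable_mul_of_tsupport_subset hζ.continuous hζc hζD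
      (fun z hz => image_eq_zero_of_notMem_tsupport hz) (hloc _ hWi2)).const_mul _).sub
    ((integrable_mul_of_tsupport_subset hνc hζc hζD (fun z hz => by simp [hν, hd0 z hz])
      (hloc _ hWV)).const_mul _)
  have hbm : AEStronglyMeasurable b := ((hζd (tdir n)).const_mul _).aestronglyMeasurable
  have hbi : Integrable fun z => b z * x z := by
    have := (integrable_mul_of_tsupport_subset (hζd (tdir n)) hζc hζD
      (fun z hz => by simp [hd0 z hz]) hS.int_G_sq).const_mul (1 / 2)
    refine this.congr (Eventually.of_forall fun z => ?_)
    simp only [hb, hx]; ring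
  have hgood := isGoodWeight_of_monotone (M := M) hx0 hxm hai hbm hbi ?_ hfH.monotone_sqrt
    (fun y => hfH.nonneg _ (Real.sqrt_nonneg _)) (fun y => hM _ (Real.sqrt_nonneg _))
  · have hint := integrable_weighted hx0 hxm hai hbm hbi (M := M) hgood.1 fun y => by
      rw [abs_of_nonneg (hfH.nonneg _ (Real.sqrt_nonneg _))]; exact hM _ (Real.sqrt_nonneg _)
    have hti : Integrable fun z => H 0 * fderiv ℝ ζ z (tdir n) :=
      ((hζd (tdir n)).integrable_of_hasCompactSupport (hζc.fderiv_apply ℝ _)).const_mul _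
    -- The renormalized inequality produces `H - H(0)`. The constant `H(0)` can be restored because
    -- the time derivative of a compactly supported function has integral 0.
    have heq : (fun z => C₁⁻¹ * (ζ z * f ‖G z‖ * ∑ j, ‖W j z‖ ^ 2)
        - 3 * C₂ * (ν z * f ‖G z‖ * ∑ j, ‖W j z‖ * ‖fieldV φ (G z)‖)
        - H ‖G z‖ * fderiv ℝ ζ z (tdir n))
        = fun z => weighted a b x (fun y => f (√y)) z - H 0 * fderiv ℝ ζ z (tdir n) := by
      ext1 z
      simp only [weighted, ha, hb, hx]
      rw [hfH.primitive_sqrt (norm_nonneg _), Real.sqrt_sq (norm_nonneg _)]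
      ring
    rw [heq]
    refine ⟨hint.sub hti, ?_⟩
    rw [integral_sub hint hti, integral_const_mul, integral_fderiv_eq_zero hζ hζc, mul_zero,
      sub_zero]
    exact hgood.2.2
  · intro g hg hgm B hg0 hgB hgB'
    have hΓ : ∀ y, HasDerivAt (fun t => ∫ r in (0 : ℝ)..t, g r) (g y) y := fun y =>
      intervalIntegral.integral_hasDerivAt_right (hg.continuous.intervalIntegrable _ _)
        hg.continuous.stronglyMeasurable.stronglyMeasurableAtFilter hg.continuous.continuousAt
    have h1 := hset.renormalized_inequality (by linarith : 0 < C₁) (by linarith : 0 ≤ C₂)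
      (hmono φ hφ n N) (hflux φ hφ n N) hΓ (by simp) hg (M := B) (fun y _ => hg0 y)
      (fun y _ => hgm.deriv_nonneg) (fun y _ => hgB y) hgB' hζ hζc hζU hζ0
    refine le_of_eq_of_le (integral_congr_ae (Eventually.of_forall fun z => ?_)) h1
    simp only [weighted, ha, hb, hx]
    rw [← Finset.mul_sum]
    have e1 : ∑ j, ‖W j z‖ * (3 * ‖fieldV φ (G z)‖) = 3 * ∑ j, ‖W j z‖ * ‖fieldV φ (G z)‖ := by
      rw [Finset.mul_sum]; exact Finset.sum_congr rfl fun j _ => by ring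
    rw [e1]
    ring

end Energy

end

/-! ### Cutoff functions in space-time and Young's inequality. -/

section
section TimeCutoff

/-- The cutoff function in time with derivative `-ρ`. -/
noncomputable def timeCutoff (ρ : ℝ → ℝ) (t₀ t : ℝ) : ℝ := ∫ τ in t..t₀, ρ τ

variable {ρ : ℝ → ℝ} {s ε t₀ : ℝ}

theorem hasDerivAt_timeCutoff (hρ : Continuous ρ) (t : ℝ) :
    HasDerivAt (timeCutoff ρ t₀) (-ρ t) t :=
  intervalIntegral.integral_hasDerivAt_left (hρ.intervalIntegrable _ _)
    hρ.stronglyMeasurable.stronglyMeasurableAtFilter hρ.continuousAt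

theorem contDiff_timeCutoff (hρ : Continuous ρ) : ContDiff ℝ 1 (timeCutoff ρ t₀) := by
  rw [contDiff_one_iff_deriv]
  refine ⟨fun t => (hasDerivAt_timeCutoff hρ t).differentiableAt, ?_⟩
  rw [show deriv (timeCutoff ρ t₀) = fun t => -ρ t from
    funext fun t => (hasDerivAt_timeCutoff hρ t).deriv]
  exact hρ.neg

theorem timeCutoff_nonneg (hρ0 : ∀ t, 0 ≤ ρ t) {t : ℝ} (ht : t ≤ t₀) : 0 ≤ timeCutoff ρ t₀ t :=
  intervalIntegral.integral_nonneg ht fun τ _ => hρ0 τ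

theorem timeCutoff_le_one (hρ0 : ∀ t, 0 ≤ ρ t) (hρi : Integrable ρ) (h1 : ∫ t, ρ t = 1) {t : ℝ}
    (ht : t ≤ t₀) : timeCutoff ρ t₀ t ≤ 1 := by
  rw [timeCutoff, intervalIntegral.integral_of_le ht, ← h1]
  exact setIntegral_le_integral hρi (Eventually.of_forall hρ0)

theorem timeCutoff_eq_zero (hsupp : ∀ t, ε ≤ |t - s| → ρ t = 0) {t : ℝ} (ht : s + ε ≤ t)
    (htt : t ≤ t₀) : timeCutoff ρ t₀ t = 0 := by
  rw [timeCutoff, intervalIntegral.integral_of_le htt]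
  refine setIntegral_eq_zero_of_forall_eq_zero fun τ hτ => hsupp τ ?_
  exact le_trans (by linarith [hτ.1]) (le_abs_self _)

theorem timeCutoff_eq_one (h1 : ∫ t, ρ t = 1) (hsupp : ∀ t, ε ≤ |t - s| → ρ t = 0)
    (hs : s + ε < t₀) {t : ℝ} (ht : t ≤ s - ε) (htt : t ≤ t₀) : timeCutoff ρ t₀ t = 1 := by
  rw [timeCutoff, intervalIntegral.integral_of_le htt, ← h1]
  refine setIntegral_eq_integral_of_forall_compl_eq_zero fun τ hτ => hsupp τ ?_
  rw [mem_Ioc, not_and_or, not_lt, not_le] at hτ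
  rcases hτ with h | h
  · exact le_trans (by linarith) (neg_le_abs _)
  · exact le_trans (by linarith) (le_abs_self _)

end TimeCutoff

section SpaceTimeCutoff

variable {n : ℕ} {t₀ α r s ε q : ℝ} {x₀ : Space n} {η : SpaceTime n → ℝ} {ρ : ℝ → ℝ}

theorem isOpen_paraCyl : IsOpen (paraCyl t₀ x₀ α r) := isOpen_Ioo.prod Metric.isOpen_ball

theorem paraCyl_subset_top : paraCyl t₀ x₀ α r ⊆ paraCylTop t₀ x₀ α r :=
  prod_mono Ioo_subset_Ioc_self le_rfl

open Classical in
/-- The cutoff function `η^q χ`. -/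
noncomputable def prodCutoff (t₀ : ℝ) (x₀ : Space n) (α r q : ℝ) (η : SpaceTime n → ℝ) (ρ : ℝ → ℝ)
    (z : SpaceTime n) : ℝ :=
  if z ∈ paraCyl t₀ x₀ α r then η z ^ q * timeCutoff ρ t₀ z.1 else 0

theorem prodCutoff_nonneg (hη : IsParCutoff t₀ x₀ α r η) (hρ0 : ∀ t, 0 ≤ ρ t) (z : SpaceTime n) :
    0 ≤ prodCutoff t₀ x₀ α r q η ρ z := by
  unfold prodCutoff
  split_ifs with hz
  · exact mul_nonneg (Real.rpow_nonneg (hη.nonneg z (paraCyl_subset_top hz)) _)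
      (timeCutoff_nonneg hρ0 hz.1.2.le)
  · exact le_rfl

theorem IsParCutoff.hasFDerivAt (hη : IsParCutoff t₀ x₀ α r η) {z : SpaceTime n}
    (hz : z ∈ paraCyl t₀ x₀ α r) : HasFDerivAt η (fderiv ℝ η z) z :=
  (((hη.smooth.mono paraCyl_subset_top).contDiffAt (isOpen_paraCyl.mem_nhds hz)).differentiableAt
    (by simp)).hasFDerivAt

theorem fderiv_prodCutoff (hη : IsParCutoff t₀ x₀ α r η) (hq : 1 ≤ q) (hρ : Continuous ρ)
    {z : SpaceTime n} (hz : z ∈ paraCyl t₀ x₀ α r) (v : SpaceTime n) :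
    fderiv ℝ (prodCutoff t₀ x₀ α r q η ρ) z v
      = q * η z ^ (q - 1) * fderiv ℝ η z v * timeCutoff ρ t₀ z.1 - η z ^ q * (ρ z.1 * v.1) := by
  have h1 := (hη.hasFDerivAt hz).rpow_const (p := q) (Or.inr hq)
  have h2 : HasFDerivAt (fun z : SpaceTime n => timeCutoff ρ t₀ z.1)
      ((-ρ z.1) • ContinuousLinearMap.fst ℝ ℝ (Space n)) z :=
    (hasDerivAt_timeCutoff hρ z.1).comp_hasFDerivAt z hasFDerivAt_fst
  have h3 : prodCutoff t₀ x₀ α r q η ρ =ᶠ[𝓝 z] fun z => η z ^ q * timeCutoff ρ t₀ z.1 := by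
    filter_upwards [isOpen_paraCyl.mem_nhds hz] with y hy
    exact if_pos hy
  rw [h3.fderiv_eq, show fderiv ℝ (fun z => η z ^ q * timeCutoff ρ t₀ z.1) z = _ from
    (h1.mul h2).fderiv]
  simp
  ring

/-- The function `η` need not vanish at the top of the cylinder. The time cutoff does so from `s + ε
< t₀` on, which makes the support of the product compact in the open cylinder. The power `η^q` is
`C¹` because `q ≥ 1`. -/
theorem prodCutoff_props (hη : IsParCutoff t₀ x₀ α r η) (hq : 1 ≤ q) (hρ : Continuous ρ)
    (hsupp : ∀ t, ε ≤ |t - s| → ρ t = 0) (hs : s + ε < t₀) :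
    ContDiff ℝ 1 (prodCutoff t₀ x₀ α r q η ρ) ∧ HasCompactSupport (prodCutoff t₀ x₀ α r q η ρ) ∧
      tsupport (prodCutoff t₀ x₀ α r q η ρ) ⊆ paraCyl t₀ x₀ α r := by
  obtain ⟨K, hK, hKQ, hK0⟩ := hη.support
  set K' : Set (SpaceTime n) := K ∩ Prod.fst ⁻¹' Iic (s + ε) with hK'
  have hK'c : IsCompact K' := hK.inter_right (isClosed_Iic.preimage continuous_fst)
  have hK'Q : K' ⊆ paraCyl t₀ x₀ α r := fun z hz =>
    ⟨⟨(hKQ hz.1).1.1, lt_of_le_of_lt hz.2 hs⟩, (hKQ hz.1).2⟩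
  have hzero : ∀ z, z ∉ K' → prodCutoff t₀ x₀ α r q η ρ z = 0 := fun z hz => by
    unfold prodCutoff
    split_ifs with hzQ
    · by_cases hzK : z ∈ K
      · have : s + ε ≤ z.1 := by
          by_contra! hlt
          exact hz ⟨hzK, hlt.le⟩
        rw [timeCutoff_eq_zero hsupp this hzQ.1.2.le, mul_zero]
      · rw [hK0 z (paraCyl_subset_top hzQ) hzK, Real.zero_rpow (by linarith), zero_mul]
    · rfl
  have hts : tsupport (prodCutoff t₀ x₀ α r q η ρ) ⊆ K' :=
    closure_minimal (fun z hz => by by_contra h; exact hz (hzero z h)) hK'c.isClosed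
  refine ⟨contDiff_iff_contDiffAt.2 fun z => ?_, HasCompactSupport.intro hK'c hzero,
    hts.trans hK'Q⟩
  by_cases hz : z ∈ K'
  · have hzQ := hK'Q hz
    have h1 : ContDiffAt ℝ 1 η z := ((hη.smooth.mono paraCyl_subset_top).contDiffAt
      (isOpen_paraCyl.mem_nhds hzQ)).of_le (by simp)
    have h2 : ContDiffAt ℝ 1 (fun z => η z ^ q * timeCutoff ρ t₀ z.1) z :=
      (h1.rpow_const_of_le (by exact_mod_cast hq)).mul
        ((contDiff_timeCutoff hρ).contDiffAt.comp z contDiffAt_fst)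
    refine h2.congr_of_eventuallyEq ?_
    filter_upwards [isOpen_paraCyl.mem_nhds hzQ] with y hy
    exact if_pos hy
  · have : prodCutoff t₀ x₀ α r q η ρ =ᶠ[𝓝 z] fun _ => 0 := by
      filter_upwards [hK'c.isClosed.isOpen_compl.mem_nhds hz] with y hy using hzero y hy
    exact contDiffAt_const.congr_of_eventuallyEq this

theorem sum_abs_spaceDeriv_le (η : SpaceTime n → ℝ) (z : SpaceTime n) :
    ∑ i, |fderiv ℝ η z (sdir i)| ≤ n * normSpaceGrad η z := by
  have h1 : ∀ i, |fderiv ℝ η z (sdir i)| ≤ normSpaceGrad η z := fun i => by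
    refine Real.abs_le_sqrt ?_
    exact Finset.single_le_sum (f := fun j => spaceDeriv j η z ^ 2) (fun i _ => sq_nonneg _)
      (Finset.mem_univ i)
  refine (Finset.sum_le_sum fun i _ => h1 i).trans_eq ?_
  rw [Finset.sum_const, Finset.card_univ, Fintype.card_fin, nsmul_eq_mul]

/-- Young's inequality for the gradient term. -/
theorem gradient_term_le {C₁ C₂ q η X g V : ℝ} {w : Fin n → ℝ} (hC₁ : 0 < C₁) (hC₂ : 0 ≤ C₂)
    (hq : 2 ≤ q) (hη : 0 ≤ η) (hη1 : η ≤ 1) (hX : X ≤ n * g) (hV : 0 ≤ V)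
    (hw : ∀ j, 0 ≤ w j) :
    C₂ * (q * η ^ (q - 1) * X * ∑ j, w j * V)
      ≤ (2 * C₁)⁻¹ * (η ^ q * ∑ j, w j ^ 2) + n * (C₁ * (C₂ * q * n) ^ 2 / 2) * (V ^ 2 * g ^ 2) := by
  -- Here `q ≥ 2` is essential: `2(q - 1) ≥ q` and `0 ≤ η ≤ 1`.
  have hηq : (η ^ (q - 1)) ^ 2 ≤ η ^ q := by
    rw [← Real.rpow_natCast, ← Real.rpow_mul hη]
    exact Real.rpow_le_rpow_of_exponent_ge_of_imp hη hη1 (by push_cast; linarith)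
      fun _ h => by push_cast at h; linarith
  have hE : 0 ≤ η ^ (q - 1) := Real.rpow_nonneg hη _
  have hj : ∀ j ∈ Finset.univ, C₂ * (q * η ^ (q - 1) * X) * (w j * V)
      ≤ (2 * C₁)⁻¹ * η ^ q * w j ^ 2 + C₁ * (C₂ * q * n) ^ 2 / 2 * (V ^ 2 * g ^ 2) := fun j _ => by
    have h1 : C₂ * (q * η ^ (q - 1) * X) * (w j * V)
        ≤ C₂ * (q * η ^ (q - 1) * (n * g)) * (w j * V) := by
      refine mul_le_mul_of_nonneg_right (mul_le_mul_of_nonneg_left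
        (mul_le_mul_of_nonneg_left hX (by positivity)) hC₂) (mul_nonneg (hw j) hV)
    have h2 : (2 * C₁)⁻¹ * ((η ^ (q - 1)) ^ 2 * w j ^ 2) ≤ (2 * C₁)⁻¹ * (η ^ q * w j ^ 2) := by
      gcongr
    have h3 : 0 ≤ (2 * C₁)⁻¹ * (η ^ (q - 1) * w j - C₁ * (C₂ * q * n) * (V * g)) ^ 2 := by positivity
    have h4 : (2 * C₁)⁻¹ * (η ^ (q - 1) * w j - C₁ * (C₂ * q * n) * (V * g)) ^ 2
        = (2 * C₁)⁻¹ * ((η ^ (q - 1)) ^ 2 * w j ^ 2) - C₂ * (q * η ^ (q - 1) * (n * g)) * (w j * V)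
          + C₁ * (C₂ * q * n) ^ 2 / 2 * (V ^ 2 * g ^ 2) := by
      field_simp
      ring
    linarith
  have h5 := Finset.sum_le_sum hj
  rw [← Finset.mul_sum, Finset.sum_add_distrib, ← Finset.mul_sum, Finset.sum_const,
    Finset.card_univ, Fintype.card_fin, nsmul_eq_mul] at h5
  linarith

/-- If `B` has infinite integral there is nothing to prove; otherwise it is integrable and the
Bochner inequality for `J + B` can be read in the extended reals. This allows an infinite right-hand
side in the theorem. -/
theorem lintegral_le_of_le_add {X : Type*} [MeasurableSpace X] {μ : Measure X} {A B J : X → ℝ}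
    (hJ : Integrable J μ) (hJ0 : ∫ z, J z ∂μ ≤ 0) (hB : AEMeasurable B μ)
    (hB0 : ∀ᵐ z ∂μ, 0 ≤ B z) (hA0 : ∀ᵐ z ∂μ, 0 ≤ A z) (hle : ∀ᵐ z ∂μ, A z ≤ J z + B z) :
    ∫⁻ z, ENNReal.ofReal (A z) ∂μ ≤ ∫⁻ z, ENNReal.ofReal (B z) ∂μ := by
  by_cases hfin : ∫⁻ z, ENNReal.ofReal (B z) ∂μ = ⊤
  · rw [hfin]; exact le_top
  have hBi : Integrable B μ := (lintegral_ofReal_ne_top_iff_integrable hB.aestronglyMeasurable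
    hB0).1 hfin
  have hJB : Integrable (fun z => J z + B z) μ := hJ.add hBi
  calc ∫⁻ z, ENNReal.ofReal (A z) ∂μ ≤ ∫⁻ z, ENNReal.ofReal (J z + B z) ∂μ :=
        lintegral_mono_ae (by filter_upwards [hle] with z hz using ENNReal.ofReal_le_ofReal hz)
    _ = ENNReal.ofReal (∫ z, (J z + B z) ∂μ) := (ofReal_integral_eq_lintegral_ofReal hJB
        (by filter_upwards [hA0, hle] with z h1 h2 using h1.trans h2)).symm
    _ ≤ ENNReal.ofReal (∫ z, B z ∂μ) := by
        refine ENNReal.ofReal_le_ofReal ?_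
        rw [integral_add hJ hBi]; linarith
    _ = _ := ofReal_integral_eq_lintegral_ofReal hBi hB0

end SpaceTimeCutoff

section EnergyCutoff

variable {n N : ℕ}

/-- The energy inequality with the cutoff function `η^q χ`. -/
theorem exists_energy_cutoff (c₀ c₁ : ℝ) (hc₀ : 0 < c₀) (n : ℕ) (q : ℝ) (hq : 2 ≤ q) :
    ∃ c C : ℝ, 0 < c ∧ 0 < C ∧ ∀ φ, IsOrlicz φ c₀ c₁ → ∀ (N : ℕ) (D : Set (SpaceTime n))
      (u : SpaceTime n → EuclideanSpace ℝ (Fin N)) (G : SpaceTime n → Mat n N)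
      (W : Fin n → SpaceTime n → Mat n N), IsMeasSolution φ D u G →
      (∀ j, StronglyMeasurable (W j)) → (∀ j, LocallyIntegrableOn (W j) D) →
      (∀ j, LocallyIntegrableOn (fun z => ‖W j z‖ ^ 2) D) →
      (∀ j, HasWeakDirDeriv volume D (sdir j) (fun z => fieldV φ (G z)) (W j)) →
      ∀ f H, IsWeightPair f H → ∀ (t₀ : ℝ) (x₀ : Space n) (α r : ℝ),
      paraCyl t₀ x₀ α r ⊆ D → ∀ η, IsParCutoff t₀ x₀ α r η →
      ∀ (ρ : ℝ → ℝ) (s ε : ℝ), Continuous ρ → (∀ t, 0 ≤ ρ t) → Integrable ρ → ∫ t, ρ t = 1 →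
      (∀ t, ε ≤ |t - s| → ρ t = 0) → s + ε < t₀ →
      ∫⁻ z in paraCyl t₀ x₀ α r, ENNReal.ofReal
          (c * ((∑ j, ‖W j z‖ ^ 2) * η z ^ q * f ‖G z‖ * timeCutoff ρ t₀ z.1)
            + H ‖G z‖ * η z ^ q * ρ z.1)
      ≤ ∫⁻ z in paraCyl t₀ x₀ α r, ENNReal.ofReal
          (C * (‖fieldV φ (G z)‖ ^ 2 * normSpaceGrad η z ^ 2 * f ‖G z‖
            + H ‖G z‖ * η z ^ (q - 1) * |timeDeriv η z|)) := by
  obtain ⟨C₁, C₂, hC₁, hC₂, hmain⟩ := exists_energy_inequality c₀ c₁ hc₀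
  set C₃ := n * (C₁ * (C₂ * q * n) ^ 2 / 2) with hC₃
  have hC₃0 : 0 ≤ C₃ := by positivity
  -- Young's inequality consumes half of the coercive term `C₁⁻¹`; `C₃` comes from the gradient of
  -- the cutoff and `q` from the time derivative of `η^q`.
  refine ⟨(2 * C₁)⁻¹, C₃ + q, by positivity, by positivity, ?_⟩
  intro φ hφ N D u G W hS hWm hWi hWi2 hWd f H hfH t₀ x₀ α r hQD η hη ρ s ε hρ hρ0 hρi hρ1 hsupp hs
  obtain ⟨hζ, hζc, hζQ⟩ := prodCutoff_props hη (by linarith : 1 ≤ q) hρ hsupp hs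
  obtain ⟨hJ, hJ0⟩ := hmain φ hφ n N D u G W hS hWm hWi hWi2 hWd f H hfH _ hζ hζc
    (hζQ.trans hQD) (prodCutoff_nonneg hη hρ0)
  set Q := paraCyl t₀ x₀ α r with hQ
  have hQm : MeasurableSet Q := isOpen_paraCyl.measurableSet
  rw [← setIntegral_eq_integral_of_forall_compl_eq_zero (s := Q) fun z hz => by
    have h1 : z ∉ tsupport (prodCutoff t₀ x₀ α r q η ρ) := fun h => hz (hζQ h)
    rw [image_eq_zero_of_notMem_tsupport h1, fderiv_eq_zero_of_notMem_tsupport h1]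
    simp] at hJ0
  have hf0 : ∀ z, 0 ≤ f ‖G z‖ := fun z => hfH.nonneg _ (norm_nonneg _)
  have hH0 : ∀ z, 0 ≤ H ‖G z‖ := fun z => hfH.nonneg_H _ (norm_nonneg _)
  have hηm : AEMeasurable η (volume.restrict Q) :=
    (hη.smooth.continuousOn.mono paraCyl_subset_top).aemeasurable hQm
  have hdm : ∀ v, Measurable fun z => fderiv ℝ η z v := fun v => measurable_fderiv_apply_const ℝ η v
  refine lintegral_le_of_le_add hJ.integrableOn hJ0 ?_ ?_ ?_ ?_
  · refine AEMeasurable.const_mul (AEMeasurable.add ?_ ?_) _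
    · exact ((((measurable_fieldV.comp hS.meas_G.measurable).norm.pow_const 2).mul
        ((Real.continuous_sqrt.measurable.comp (Finset.measurable_fun_sum _ fun j _ =>
          (hdm (sdir j)).pow_const 2)).pow_const 2)).mul
        (hfH.measurable_f_norm hS.meas_G)).aemeasurable
    · exact ((hfH.measurable_H_norm hS.meas_G).aemeasurable.mul (hηm.pow_const _)).mul
        (hdm (tdir n)).abs.aemeasurable
  · filter_upwards [ae_restrict_mem hQm] with z hz
    have := hη.nonneg z (paraCyl_subset_top hz)
    have := hf0 z
    have := hH0 z
    positivity
  · filter_upwards [ae_restrict_mem hQm] with z hz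
    have := hη.nonneg z (paraCyl_subset_top hz)
    have := hf0 z
    have := hH0 z
    have := hρ0 z.1
    have := timeCutoff_nonneg (t₀ := t₀) hρ0 hz.1.2.le
    positivity
  · filter_upwards [ae_restrict_mem hQm] with z hz
    have hη0 := hη.nonneg z (paraCyl_subset_top hz)
    have hη1 := hη.le_one z (paraCyl_subset_top hz)
    have hχ0 := timeCutoff_nonneg (t₀ := t₀) hρ0 hz.1.2.le
    have hχ1 := timeCutoff_le_one (t₀ := t₀) hρ0 hρi hρ1 hz.1.2.le
    have hE : 0 ≤ η z ^ (q - 1) := Real.rpow_nonneg hη0 _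
    have hEq : 0 ≤ η z ^ q := Real.rpow_nonneg hη0 _
    have hY := gradient_term_le (n := n) (C₁ := C₁) (C₂ := C₂) (w := fun j => ‖W j z‖)
      (V := ‖fieldV φ (G z)‖) hC₁ hC₂.le hq hη0 hη1 (sum_abs_spaceDeriv_le η z) (norm_nonneg _)
      (fun j => norm_nonneg _)
    have e1 : prodCutoff t₀ x₀ α r q η ρ z = η z ^ q * timeCutoff ρ t₀ z.1 := if_pos hz
    have e2 : ∑ i, |fderiv ℝ (prodCutoff t₀ x₀ α r q η ρ) z (sdir i)|
        = q * η z ^ (q - 1) * (∑ i, |fderiv ℝ η z (sdir i)|) * timeCutoff ρ t₀ z.1 := by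
      rw [Finset.mul_sum, Finset.sum_mul]
      refine Finset.sum_congr rfl fun i _ => ?_
      rw [fderiv_prodCutoff hη (by linarith) hρ hz]
      simp only [sdir, mul_zero, sub_zero]
      rw [abs_mul, abs_mul, abs_of_nonneg hχ0, abs_of_nonneg (by positivity)]
    have e3 : fderiv ℝ (prodCutoff t₀ x₀ α r q η ρ) z (tdir n)
        = q * η z ^ (q - 1) * fderiv ℝ η z (tdir n) * timeCutoff ρ t₀ z.1 - η z ^ q * ρ z.1 := by
      rw [fderiv_prodCutoff hη (by linarith) hρ hz]
      simp [tdir]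
    have e4 : timeDeriv η z = fderiv ℝ η z (tdir n) := rfl
    rw [e1, e2, e3, e4]
    have hf := hf0 z
    have hH := hH0 z
    have hV : 0 ≤ ‖fieldV φ (G z)‖ ^ 2 * normSpaceGrad η z ^ 2 := by positivity
    set χ := timeCutoff ρ t₀ z.1
    set S := ∑ j, ‖W j z‖ ^ 2
    set T := ∑ j, ‖W j z‖ * ‖fieldV φ (G z)‖
    set X := ∑ i, |fderiv ℝ η z (sdir i)|
    set V := ‖fieldV φ (G z)‖ ^ 2 * normSpaceGrad η z ^ 2
    set d := fderiv ℝ η z (tdir n)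
    set F := f ‖G z‖
    set h := H ‖G z‖
    rw [← hC₃] at hY
    have hY' := mul_le_mul_of_nonneg_left hY (mul_nonneg hχ0 hf)
    have h1 : χ * F * (C₃ * V) ≤ C₃ * (V * F) := by
      have := mul_le_mul_of_nonneg_right hχ1 (by positivity : 0 ≤ F * (C₃ * V))
      linarith
    have h2 : h * (q * η z ^ (q - 1) * d * χ) ≤ q * (h * η z ^ (q - 1) * |d|) := by
      have h3 : d * χ ≤ |d| := by
        refine (le_abs_self _).trans ?_
        rw [abs_mul, abs_of_nonneg hχ0]
        exact mul_le_of_le_one_right (abs_nonneg _) hχ1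
      have := mul_le_mul_of_nonneg_left h3 (by positivity : 0 ≤ q * (h * η z ^ (q - 1)))
      linarith
    have h4 : 0 ≤ C₃ * (h * η z ^ (q - 1) * |d|) := by positivity
    have h5 : 0 ≤ q * (V * F) := by positivity
    have h6 : C₁⁻¹ = 2 * (2 * C₁)⁻¹ := by field_simp
    rw [h6]
    linarith

end EnergyCutoff

end

/-! ### Estimates at almost every time and removal of the time cutoff. -/

section
section TimeBump

/-- Bump functions in time, centred at `s`. -/
noncomputable def timeBump (k : ℕ) (s t : ℝ) : ℝ := (bumpSeq ℝ k).normed volume (s - t)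

theorem continuous_timeBump (k : ℕ) (s : ℝ) : Continuous (timeBump k s) :=
  (bumpSeq ℝ k).continuous_normed.comp (continuous_const.sub continuous_id)

theorem timeBump_nonneg (k : ℕ) (s t : ℝ) : 0 ≤ timeBump k s t := (bumpSeq ℝ k).nonneg_normed _

theorem integrable_timeBump (k : ℕ) (s : ℝ) : Integrable (timeBump k s) :=
  (bumpSeq ℝ k).integrable_normed.comp_sub_left s

theorem integral_timeBump (k : ℕ) (s : ℝ) : ∫ t, timeBump k s t = 1 := by
  rw [← (bumpSeq ℝ k).integral_normed (μ := volume)]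
  exact integral_sub_left_eq_self (fun t => (bumpSeq ℝ k).normed volume t) volume s

theorem timeBump_eq_zero (k : ℕ) (s t : ℝ) (h : (bumpSeq ℝ k).rOut ≤ |t - s|) :
    timeBump k s t = 0 := by
  by_contra hne
  have h1 : s - t ∈ Function.support ((bumpSeq ℝ k).normed volume) := hne
  rw [ContDiffBump.support_normed_eq, mem_ball_zero_iff, Real.norm_eq_abs, abs_sub_comm] at h1
  exact absurd h1 (not_lt.2 h)

variable {n : ℕ}

/-- Bounds for averages in time imply bounds for almost every time. -/
theorem ae_lintegral_slice_le {a t₀ : ℝ} {B : Set (Space n)} {h : SpaceTime n → ℝ≥0∞} {E : ℝ≥0∞}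
    (hm : AEMeasurable h (volume.restrict (Ioo a t₀ ×ˢ B)))
    (hfin : ∫⁻ z in Ioo a t₀ ×ˢ B, h z ≠ ⊤)
    (hE : ∀ k s, s + (bumpSeq ℝ k).rOut < t₀ →
      ∫⁻ z in Ioo a t₀ ×ˢ B, ENNReal.ofReal (timeBump k s z.1) * h z ≤ E) :
    ∀ᵐ s ∂volume.restrict (Ioo a t₀), ∫⁻ x in B, h (s, x) ≤ E := by
  by_cases hE' : E = ⊤
  · simp [hE']
  have hpr : volume.restrict (Ioo a t₀ ×ˢ B)
      = (volume.restrict (Ioo a t₀)).prod (volume.restrict B) := by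
    rw [Measure.prod_restrict, Measure.volume_eq_prod]
  rw [hpr] at hm hfin
  simp only [hpr] at hE
  rw [lintegral_prod _ hm] at hfin
  have hFm := hm.lintegral_prod_right'
  have hFfin := ae_lt_top' hFm hfin
  have hFi := integrable_toReal_of_lintegral_ne_top hFm hfin
  set F : ℝ → ℝ := fun t => (∫⁻ x in B, h (t, x)).toReal with hF
  have hFi' : Integrable ((Ioo a t₀).indicator F) := (integrable_indicator_iff measurableSet_Ioo).2 hFi
  have hle : ∀ k s, s + (bumpSeq ℝ k).rOut < t₀ →
      mollify volume (bumpSeq ℝ k) ((Ioo a t₀).indicator F) s ≤ E.toReal := fun k s hks => by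
    rw [mollify_apply]
    have e1 : (fun t => (bumpSeq ℝ k).normed volume (s - t) • (Ioo a t₀).indicator F t)
        = (Ioo a t₀).indicator fun t => timeBump k s t * F t := by
      ext1 t
      by_cases ht : t ∈ Ioo a t₀ <;> simp [ht, timeBump]
    rw [e1, integral_indicator measurableSet_Ioo]
    refine ENNReal.ofReal_le_iff_le_toReal hE' |>.1 ?_
    have h0 : ∀ t, 0 ≤ timeBump k s t * F t := fun t =>
      mul_nonneg (timeBump_nonneg k s t) ENNReal.toReal_nonneg
    have hbm : Measurable fun z : SpaceTime n => ENNReal.ofReal (timeBump k s z.1) :=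
      ((continuous_timeBump k s).measurable.comp measurable_fst).ennreal_ofReal
    have hh := hE k s hks
    have hbh : AEMeasurable (fun z : SpaceTime n => ENNReal.ofReal (timeBump k s z.1) * h z)
        ((volume.restrict (Ioo a t₀)).prod (volume.restrict B)) := hbm.aemeasurable.mul hm
    rw [lintegral_prod _ hbh] at hh
    refine le_trans ?_ hh
    have hint : Integrable (fun t => timeBump k s t * F t) (volume.restrict (Ioo a t₀)) := by
      have hc : HasCompactSupport (timeBump k s) := by
        refine HasCompactSupport.intro (isCompact_closedBall s (bumpSeq ℝ k).rOut) fun t ht => ?_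
        refine timeBump_eq_zero k s t ?_
        rw [Metric.mem_closedBall, not_le, Real.dist_eq] at ht
        exact ht.le
      obtain ⟨M, hM⟩ := hc.exists_bound_of_continuous (continuous_timeBump k s)
      exact hFi.bdd_mul (continuous_timeBump k s).aestronglyMeasurable (Eventually.of_forall hM)
    rw [ofReal_integral_eq_lintegral_ofReal hint (Eventually.of_forall h0)]
    refine lintegral_mono fun t => ?_
    rw [ENNReal.ofReal_mul (timeBump_nonneg k s t)]
    refine (mul_le_mul_right ENNReal.ofReal_toReal_le _).trans ?_
    exact lintegral_const_mul_le _ _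
  -- The bound holds for averages in time around `s`; at Lebesgue points these converge to the value
  -- of the slice. For `s < t₀` the bump eventually ends before `t₀`.
  have hlim := ae_tendsto_mollify hFi'.locallyIntegrable
  filter_upwards [ae_restrict_of_ae hlim, hFfin, ae_restrict_mem measurableSet_Ioo] with s h1 h2 h3
  rw [indicator_of_mem h3] at h1
  have h4 : F s ≤ E.toReal := by
    refine le_of_tendsto h1 ?_
    have h5 : Tendsto (fun k => s + (bumpSeq ℝ k).rOut) atTop (𝓝 (s + 0)) :=
      tendsto_const_nhds.add tendsto_bumpSeq_rOut
    rw [add_zero] at h5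
    filter_upwards [h5.eventually_lt_const h3.2] with k hk using hle k s hk
  exact (ENNReal.toReal_le_toReal h2.ne hE').1 h4

/-- Fatou's lemma for the cutoff functions in time. -/
theorem lintegral_le_of_timeCutoff_le {a t₀ : ℝ} {B : Set (Space n)} {w : SpaceTime n → ℝ}
    {E : ℝ≥0∞} (hB : MeasurableSet B) (hm : AEMeasurable w (volume.restrict (Ioo a t₀ ×ˢ B)))
    (hE : ∀ k s, s + (bumpSeq ℝ k).rOut < t₀ →
      ∫⁻ z in Ioo a t₀ ×ˢ B, ENNReal.ofReal (w z * timeCutoff (timeBump k s) t₀ z.1) ≤ E) :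
    ∫⁻ z in Ioo a t₀ ×ˢ B, ENNReal.ofReal (w z) ≤ E := by
  have hr : ∀ k, 0 < (bumpSeq ℝ k).rOut := fun k => (bumpSeq ℝ k).rOut_pos
  -- Twice the radius leaves room below `t₀`, and the cutoff equals 1 up to `t₀` minus three radii,
  -- so it tends to 1 at every earlier time.
  set σ : ℕ → ℝ := fun k => t₀ - 2 * (bumpSeq ℝ k).rOut with hσ
  have hσ1 : ∀ k, σ k + (bumpSeq ℝ k).rOut < t₀ := fun k => by
    have := hr k
    simp only [hσ]; linarith
  have hlim : ∀ z ∈ Ioo a t₀ ×ˢ B, ENNReal.ofReal (w z) ≤ liminf (fun k =>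
      ENNReal.ofReal (w z * timeCutoff (timeBump k (σ k)) t₀ z.1)) atTop := fun z hz => by
    refine le_of_eq (Tendsto.liminf_eq (tendsto_const_nhds.congr' ?_)).symm
    have h1 : Tendsto (fun k => σ k - (bumpSeq ℝ k).rOut) atTop (𝓝 (t₀ - 2 * 0 - 0)) :=
      (tendsto_const_nhds.sub (tendsto_bumpSeq_rOut.const_mul 2)).sub tendsto_bumpSeq_rOut
    rw [mul_zero, sub_zero, sub_zero] at h1
    filter_upwards [h1.eventually_const_lt hz.1.2] with k hk
    rw [timeCutoff_eq_one (integral_timeBump k _) (timeBump_eq_zero k _) (hσ1 k) hk.le hz.1.2.le,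
      mul_one]
  calc _ ≤ ∫⁻ z in Ioo a t₀ ×ˢ B, liminf (fun k =>
        ENNReal.ofReal (w z * timeCutoff (timeBump k (σ k)) t₀ z.1)) atTop := by
        refine lintegral_mono_ae ?_
        filter_upwards [ae_restrict_mem (measurableSet_Ioo.prod hB)] with z hz using hlim z hz
    _ ≤ liminf (fun k => ∫⁻ z in Ioo a t₀ ×ˢ B,
        ENNReal.ofReal (w z * timeCutoff (timeBump k (σ k)) t₀ z.1)) atTop := by
        refine lintegral_liminf_le' fun k => (hm.mul ?_).ennreal_ofReal
        exact ((contDiff_timeCutoff (continuous_timeBump k _)).continuous.measurable.comp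
          measurable_fst).aemeasurable
    _ ≤ E := liminf_le_of_le (by isBoundedDefault) fun b hb => by
        obtain ⟨k, hk⟩ := hb.exists
        exact hk.trans (hE k _ (hσ1 k))

end TimeBump

section Estimate

/-- The energy estimate for solutions with measurable gradients. -/
theorem exists_energy_estimate (c₀ c₁ : ℝ) (hc₀ : 0 < c₀) (n : ℕ) (q : ℝ) (hq : 2 ≤ q) :
    ∃ c C : ℝ, 0 < c ∧ 0 < C ∧ ∀ φ, IsOrlicz φ c₀ c₁ → ∀ (N : ℕ) (D : Set (SpaceTime n))
      (u : SpaceTime n → EuclideanSpace ℝ (Fin N)) (G : SpaceTime n → Mat n N)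
      (W : Fin n → SpaceTime n → Mat n N), IsMeasSolution φ D u G →
      (∀ j, StronglyMeasurable (W j)) → (∀ j, LocallyIntegrableOn (W j) D) →
      (∀ j, LocallyIntegrableOn (fun z => ‖W j z‖ ^ 2) D) →
      (∀ j, HasWeakDirDeriv volume D (sdir j) (fun z => fieldV φ (G z)) (W j)) →
      ∀ f H, IsWeightPair f H → ∀ (t₀ : ℝ) (x₀ : Space n) (α R : ℝ), 0 < α → 0 < R →
      closure (paraCyl t₀ x₀ α R) ⊆ D → paraCyl t₀ x₀ α (2 * R) ⊆ D →
      ∀ η, IsParCutoff t₀ x₀ α (2 * R) η →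
      ∀ E : ℝ≥0∞, E = ENNReal.ofReal C * (∫⁻ z in paraCyl t₀ x₀ α (2 * R),
          ENNReal.ofReal (‖fieldV φ (G z)‖ ^ 2) *
            (⨆ y ∈ paraCyl t₀ x₀ α (2 * R), ENNReal.ofReal (normSpaceGrad η y)) ^ 2 *
            ENNReal.ofReal (f ‖G z‖))
        + ENNReal.ofReal C * (∫⁻ z in paraCyl t₀ x₀ α (2 * R),
          ENNReal.ofReal (H ‖G z‖ * η z ^ (q - 1) * |timeDeriv η z|)) →
      (∀ᵐ s ∂volume.restrict (Ioo (t₀ - α * R ^ 2) t₀),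
        ∫⁻ x in Metric.ball x₀ R, ENNReal.ofReal (H ‖G (s, x)‖ * η (s, x) ^ q) ≤ E) ∧
      ENNReal.ofReal c * ∫⁻ z in paraCyl t₀ x₀ α R,
        ENNReal.ofReal ((∑ j, ‖W j z‖ ^ 2) * η z ^ q * f ‖G z‖) ≤ E := by
  obtain ⟨c, C, hc, hC, hmain⟩ := exists_energy_cutoff c₀ c₁ hc₀ n q hq
  refine ⟨c, C, hc, hC, ?_⟩
  intro φ hφ N D u G W hS hWm hWi hWi2 hWd f H hfH t₀ x₀ α R hα hR hcl hQ2 η hη E hE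
  have hmono : paraCyl t₀ x₀ α R ⊆ paraCyl t₀ x₀ α (2 * R) := by
    refine prod_mono (Ioo_subset_Ioo_left ?_) (Metric.ball_subset_ball (by linarith))
    nlinarith [mul_pos hα (pow_pos hR 2)]
  have hQm : MeasurableSet (paraCyl t₀ x₀ α R) := isOpen_paraCyl.measurableSet
  have hQ2m : MeasurableSet (paraCyl t₀ x₀ α (2 * R)) := isOpen_paraCyl.measurableSet
  have hf0 : ∀ z, 0 ≤ f ‖G z‖ := fun z => hfH.nonneg _ (norm_nonneg _)
  have hH0 : ∀ z, 0 ≤ H ‖G z‖ := fun z => hfH.nonneg_H _ (norm_nonneg _)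
  have hηm2 : AEMeasurable η (volume.restrict (paraCyl t₀ x₀ α (2 * R))) :=
    (hη.smooth.continuousOn.mono paraCyl_subset_top).aemeasurable hQ2m
  have hηm : AEMeasurable η (volume.restrict (paraCyl t₀ x₀ α R)) :=
    hηm2.mono_measure (Measure.restrict_mono hmono le_rfl)
  have hdm : ∀ v, Measurable fun z => fderiv ℝ η z v := fun v => measurable_fderiv_apply_const ℝ η v
  -- the right-hand side
  have hRHS : ∫⁻ z in paraCyl t₀ x₀ α (2 * R), ENNReal.ofReal
      (C * (‖fieldV φ (G z)‖ ^ 2 * normSpaceGrad η z ^ 2 * f ‖G z‖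
        + H ‖G z‖ * η z ^ (q - 1) * |timeDeriv η z|)) ≤ E := by
    rw [hE, ← lintegral_const_mul' _ _ ENNReal.ofReal_ne_top,
      ← lintegral_const_mul' _ _ ENNReal.ofReal_ne_top, ← lintegral_add_right']
    · refine lintegral_mono_ae ?_
      filter_upwards [ae_restrict_mem hQ2m] with z hz
      have h1 : ENNReal.ofReal (normSpaceGrad η z)
          ≤ ⨆ y ∈ paraCyl t₀ x₀ α (2 * R), ENNReal.ofReal (normSpaceGrad η y) :=
        le_iSup₂ (f := fun y (_ : y ∈ paraCyl t₀ x₀ α (2 * R)) =>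
          ENNReal.ofReal (normSpaceGrad η y)) z hz
      have h2 := hη.nonneg z (paraCyl_subset_top hz)
      have h3 := hf0 z
      have h4 := hH0 z
      have h5 : 0 ≤ normSpaceGrad η z := Real.sqrt_nonneg _
      rw [ENNReal.ofReal_mul hC.le, ENNReal.ofReal_add (by positivity) (by positivity), mul_add,
        ENNReal.ofReal_mul (by positivity), ENNReal.ofReal_mul (by positivity),
        ENNReal.ofReal_pow h5]
      gcongr
    · exact (((hfH.measurable_H_norm hS.meas_G).aemeasurable.mul (hηm2.pow_const _)).mul
        (hdm (tdir n)).abs.aemeasurable).ennreal_ofReal.const_mul _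
  -- Both assertions follow from this inequality by dropping one of the two nonnegative terms on the
  -- left.
  have hcut : ∀ k s, s + (bumpSeq ℝ k).rOut < t₀ →
      ∫⁻ z in paraCyl t₀ x₀ α R, ENNReal.ofReal
          (c * ((∑ j, ‖W j z‖ ^ 2) * η z ^ q * f ‖G z‖ * timeCutoff (timeBump k s) t₀ z.1)
            + H ‖G z‖ * η z ^ q * timeBump k s z.1) ≤ E := fun k s hks =>
    ((lintegral_mono_set hmono).trans (hmain φ hφ N D u G W hS hWm hWi hWi2 hWd f H hfH t₀ x₀ α
      (2 * R) hQ2 η hη (timeBump k s) s _ (continuous_timeBump k s) (timeBump_nonneg k s)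
      (integrable_timeBump k s) (integral_timeBump k s) (timeBump_eq_zero k s) hks)).trans hRHS
  have hη0 : ∀ z ∈ paraCyl t₀ x₀ α R, 0 ≤ η z ^ q ∧ η z ^ q ≤ 1 := fun z hz =>
    ⟨Real.rpow_nonneg (hη.nonneg z (paraCyl_subset_top (hmono hz))) _,
      Real.rpow_le_one (hη.nonneg z (paraCyl_subset_top (hmono hz)))
        (hη.le_one z (paraCyl_subset_top (hmono hz))) (by linarith)⟩
  constructor
  · refine ae_lintegral_slice_le (h := fun z => ENNReal.ofReal (H ‖G z‖ * η z ^ q)) ?_ ?_ ?_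
    · exact ((hfH.measurable_H_norm hS.meas_G).aemeasurable.mul (hηm.pow_const _)).ennreal_ofReal
    -- The slice argument requires a finite integral. It is supplied by the quadratic growth of `H`,
    -- by `∇u ∈ L²_loc`, and by the compactness of the closed cylinder inside the domain.
    · obtain ⟨M, hM0, hM⟩ := hfH.H_le
      have hcomp : IsCompact (closure (paraCyl t₀ x₀ α R)) := by
        refine ((isCompact_Icc (a := t₀ - α * R ^ 2) (b := t₀)).prod
          (isCompact_closedBall x₀ R)).of_isClosed_subset isClosed_closure ?_
        exact closure_minimal (prod_mono Ioo_subset_Icc_self Metric.ball_subset_closedBall)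
          (isClosed_Icc.prod Metric.isClosed_closedBall)
      have hi : IntegrableOn (fun z => M * (1 + ‖G z‖ ^ 2)) (paraCyl t₀ x₀ α R) := by
        have h1 : LocallyIntegrableOn (fun z => 1 + ‖G z‖ ^ 2) D :=
          ((locallyIntegrable_const (1 : ℝ)).locallyIntegrableOn D).add hS.int_G_sq
        exact ((h1.integrableOn_compact_subset hcl hcomp).mono_set subset_closure).const_mul M
      refine (lt_of_le_of_lt (lintegral_mono_ae ?_) hi.lintegral_lt_top).ne
      filter_upwards [ae_restrict_mem hQm] with z hz
      refine ENNReal.ofReal_le_ofReal ?_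
      exact (mul_le_of_le_one_right (hH0 z) (hη0 z hz).2).trans (hM _ (norm_nonneg _))
    · intro k s hks
      refine le_trans (lintegral_mono_ae ?_) (hcut k s hks)
      filter_upwards [ae_restrict_mem hQm] with z hz
      rw [← ENNReal.ofReal_mul (timeBump_nonneg k s _)]
      refine ENNReal.ofReal_le_ofReal ?_
      have h1 := timeCutoff_nonneg (t₀ := t₀) (timeBump_nonneg k s) hz.1.2.le
      have h2 := (hη0 z hz).1
      have h3 := hf0 z
      have : 0 ≤ c * ((∑ j, ‖W j z‖ ^ 2) * η z ^ q * f ‖G z‖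
        * timeCutoff (timeBump k s) t₀ z.1) := by positivity
      linarith
  · rw [← lintegral_const_mul' _ _ ENNReal.ofReal_ne_top]
    simp only [← ENNReal.ofReal_mul hc.le]
    refine lintegral_le_of_timeCutoff_le Metric.isOpen_ball.measurableSet ?_ fun k s hks => ?_
    · exact (((Finset.measurable_fun_sum _ fun j _ =>
        ((hWm j).norm.measurable.pow_const 2)).aemeasurable.mul (hηm.pow_const _)).mul
        (hfH.measurable_f_norm hS.meas_G).aemeasurable).const_mul c
    · refine le_trans (lintegral_mono_ae ?_) (hcut k s hks)
      filter_upwards [ae_restrict_mem hQm] with z hz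
      refine ENNReal.ofReal_le_ofReal ?_
      have h1 := mul_nonneg (mul_nonneg (hH0 z) (hη0 z hz).1) (timeBump_nonneg k s z.1)
      linarith

end Estimate

end

/-! ### Measurable representatives of local weak solutions. -/

section
section Representative

variable {n N : ℕ}

theorem setIntegral_eq_integral_of_isTestFn {F : Type*} [NormedAddCommGroup F] [NormedSpace ℝ F]
    {D : Set (SpaceTime n)} {θ : SpaceTime n → ℝ} (hθ : IsTestFn D θ) {w : SpaceTime n → F}
    (hw : ∀ z, z ∉ tsupport θ → w z = 0) : ∫ z in D, w z = ∫ z, w z :=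
  setIntegral_eq_integral_of_forall_compl_eq_zero fun z hz => hw z fun h => hz (hθ.2.2 h)

theorem hasWeakSpaceDeriv_iff {F : Type*} [NormedAddCommGroup F] [NormedSpace ℝ F]
    {D : Set (SpaceTime n)} {j : Fin n} {g w : SpaceTime n → F} :
    HasWeakSpaceDeriv D j g w ↔ LocallyIntegrableOn g D ∧ LocallyIntegrableOn w D ∧
      HasWeakDirDeriv volume D (sdir j) g w := by
  refine and_congr_right fun _ => and_congr_right fun _ => forall₂_congr fun θ hθ => ?_
  rw [setIntegral_eq_integral_of_isTestFn (w := fun z => spaceDeriv j θ z • g z) hθ fun z hz => by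
      simp [spaceDeriv, fderiv_eq_zero_of_notMem_tsupport hz],
    setIntegral_eq_integral_of_isTestFn (w := fun z => θ z • w z) hθ fun z hz => by
      simp [image_eq_zero_of_notMem_tsupport hz]]
  rfl

theorem spaceGrad_smul_single {θ : SpaceTime n → ℝ} (hθ : ContDiff ℝ ∞ θ) (k : Fin N)
    (P : Mat n N) (z : SpaceTime n) :
    inner ℝ P (spaceGrad (fun z => θ z • EuclideanSpace.single k (1 : ℝ)) z)
      = ∑ i, fderiv ℝ θ z (sdir i) * P (i, k) := by
  have hd : ∀ v, fderiv ℝ (fun z => θ z • EuclideanSpace.single k (1 : ℝ)) z v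
      = fderiv ℝ θ z v • EuclideanSpace.single k (1 : ℝ) := fun v => by
    rw [fderiv_smul_const (hθ.differentiable (by simp) z)]; rfl
  rw [PiLp.inner_apply, Fintype.sum_prod_type]
  refine Finset.sum_congr rfl fun i _ => ?_
  rw [Finset.sum_eq_single k]
  · simp [spaceGrad, spaceDeriv, hd, sdir]
  · intro l _ hl
    simp [spaceGrad, spaceDeriv, hd, hl]
  · simp

theorem inner_timeDeriv_smul_single {θ : SpaceTime n → ℝ} (hθ : ContDiff ℝ ∞ θ) (k : Fin N)
    (x : EuclideanSpace ℝ (Fin N)) (z : SpaceTime n) :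
    inner ℝ x (timeDeriv (fun z => θ z • EuclideanSpace.single k (1 : ℝ)) z)
      = fderiv ℝ θ z (tdir n) * x k := by
  have hd : fderiv ℝ (fun z => θ z • EuclideanSpace.single k (1 : ℝ)) z (tdir n)
      = fderiv ℝ θ z (tdir n) • EuclideanSpace.single k (1 : ℝ) := by
    rw [fderiv_smul_const (hθ.differentiable (by simp) z)]; rfl
  change inner ℝ x (fderiv ℝ _ z (tdir n)) = _
  rw [hd, inner_smul_right, EuclideanSpace.inner_single_right]
  simp

variable {φ : ℝ → ℝ} {c₀ c₁ : ℝ} {D : Set (SpaceTime n)}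

/-- Almost everywhere equal functions have the same local integrability. -/
theorem locallyIntegrableOn_congr {F : Type*} [NormedAddCommGroup F] {g g' : SpaceTime n → F}
    (hg : LocallyIntegrableOn g D) (hD : MeasurableSet D) (h : ∀ᵐ z, z ∈ D → g z = g' z) :
    LocallyIntegrableOn g' D :=
  hg.congr ((ae_restrict_iff' hD).2 h)

/-- The weak formulation tested by vector fields implies the one tested by scalar functions. -/
theorem weakEq_scalar {u : SpaceTime n → EuclideanSpace ℝ (Fin N)} {A : SpaceTime n → Mat n N}
    (hu : LocallyIntegrableOn u D) (hA : LocallyIntegrableOn A D)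
    (h : ∀ ζ : SpaceTime n → EuclideanSpace ℝ (Fin N), IsTestFunction D ζ →
      ∫ z in D, inner ℝ (A z) (spaceGrad ζ z) = ∫ z in D, inner ℝ (u z) (timeDeriv ζ z))
    {θ : SpaceTime n → ℝ} (hθ : IsTestFn D θ) :
    ∫ z, fderiv ℝ θ z (tdir n) • u z = ∑ i, ∫ z, fderiv ℝ θ z (sdir i) • row i (A z) := by
  have h0 : ∀ v z, z ∉ tsupport θ → fderiv ℝ θ z v = 0 := fun v z hz => by
    simp [fderiv_eq_zero_of_notMem_tsupport hz]
  have hiu : Integrable fun z => fderiv ℝ θ z (tdir n) • u z :=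
    integrable_smul_of_tsupport_subset (hθ.continuous_fderiv_apply _) hθ.2.1 hθ.2.2 (h0 _) hu
  have hiA : ∀ i, Integrable fun z => fderiv ℝ θ z (sdir i) • row i (A z) := fun i => by
    have := (row i).integrable_comp (integrable_smul_of_tsupport_subset
      (hθ.continuous_fderiv_apply (sdir i)) hθ.2.1 hθ.2.2 (h0 _) hA)
    simpa only [map_smul] using this
  rw [← integral_finsetSum _ fun i _ => hiA i]
  ext k
  have hcomp : ∀ {X : SpaceTime n → EuclideanSpace ℝ (Fin N)}, Integrable X →
      (∫ z, X z) k = ∫ z, X z k := fun {X} hX =>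
    ((EuclideanSpace.proj (𝕜 := ℝ) k).integral_comp_comm hX).symm
  rw [hcomp hiu, hcomp (integrable_finsetSum _ fun i _ => hiA i)]
  have hζ : IsTestFunction D fun z => θ z • EuclideanSpace.single k (1 : ℝ) :=
    ⟨hθ.1.smul contDiff_const, hθ.2.1.smul_right,
      (closure_mono (Function.support_smul_subset_left _ _)).trans hθ.2.2⟩
  have hk := h _ hζ
  simp only [spaceGrad_smul_single hθ.1, inner_timeDeriv_smul_single hθ.1] at hk
  rw [setIntegral_eq_integral_of_isTestFn hθ fun z hz => by simp [h0 _ z hz],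
    setIntegral_eq_integral_of_isTestFn hθ fun z hz => by simp [h0 _ z hz]] at hk
  simp only [PiLp.smul_apply, smul_eq_mul, WithLp.ofLp_sum, Finset.sum_apply, row_apply]
  exact hk.symm

/-- Local weak solutions have measurable representatives. -/
theorem exists_isMeasSolution (hφ : IsOrlicz φ c₀ c₁) (hc₀ : 0 < c₀) {J : Set ℝ}
    {Ω : Set (Space n)} (hJ : IsOpen J) (hΩ : IsOpen Ω)
    {u : SpaceTime n → EuclideanSpace ℝ (Fin N)} {G : SpaceTime n → Mat n N}
    (hS : IsLocalWeakSolution φ J Ω u G)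
    (hG2 : LocallyIntegrableOn (fun z => ‖G z‖ ^ 2) (J ×ˢ Ω)) :
    ∃ u' G', IsMeasSolution φ (J ×ˢ Ω) u' G' ∧ ∀ᵐ z, z ∈ J ×ˢ Ω → G z = G' z := by
  set D : Set (SpaceTime n) := J ×ˢ Ω with hDdef
  have hDo : IsOpen D := hJ.prod hΩ
  have hD := hDo.measurableSet
  obtain ⟨hu, hG, hgrad⟩ := hS.weakGrad
  have hum := hu.aestronglyMeasurable
  have hGm := hG.aestronglyMeasurable
  set u' := hum.mk u
  set G' := hGm.mk G
  have hue : ∀ᵐ z, z ∈ D → u z = u' z := (ae_restrict_iff' hD).1 hum.ae_eq_mk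
  have hGe : ∀ᵐ z, z ∈ D → G z = G' z := (ae_restrict_iff' hD).1 hGm.ae_eq_mk
  have hcG : ∀ {F : Type} [NormedAddCommGroup F] (p : Mat n N → F),
      ∀ᵐ z, z ∈ D → p (G z) = p (G' z) := fun p => by
    filter_upwards [hGe] with z hz hzD using by rw [hz hzD]
  have hG'm : StronglyMeasurable G' := hGm.stronglyMeasurable_mk
  have hu' : LocallyIntegrableOn u' D := locallyIntegrableOn_congr hu hD hue
  have hE : LocallyIntegrableOn (fun z => φ ‖G' z‖) D :=
    locallyIntegrableOn_congr hS.energy hD (hcG fun P => φ ‖P‖)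
  -- The energy density controls `|V|²` because `φ'(t) t` is at most a multiple of `φ(t)`.
  have hV : LocallyIntegrableOn (fun z => ‖fieldV φ (G' z)‖ ^ 2) D := by
    refine LocallyIntegrableOn.mono (hE.smul (2 * 2 ^ c₁ : ℝ))
      ((measurable_fieldV.comp hG'm.measurable).norm.pow_const 2).aestronglyMeasurable
      (Eventually.of_forall fun z => ?_)
    rw [Pi.smul_apply, smul_eq_mul, Real.norm_of_nonneg (by positivity)]
    refine le_trans ?_ (le_abs_self _)
    rw [sq_norm_fieldV hφ]
    exact hφ.deriv_mul_le (norm_nonneg _)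
  -- Young's inequality with second argument 1 gives `φ'(t) ≤ φ'(t) t + φ'(1)`, so the flux is
  -- locally integrable as well.
  have hA : LocallyIntegrableOn (fun z => fluxA φ (G' z)) D := by
    refine LocallyIntegrableOn.mono
      (((locallyIntegrable_const (deriv φ 1)).locallyIntegrableOn D).add hV)
      (measurable_fluxA.comp hG'm.measurable).aestronglyMeasurable
      (Eventually.of_forall fun z => ?_)
    refine le_trans ?_ (le_abs_self _)
    rw [Pi.add_apply, norm_fluxA hφ, sq_norm_fieldV hφ]
    have := hφ.deriv_mul_le_add hc₀ (norm_nonneg (G' z)) zero_le_one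
    linarith
  refine ⟨u', G', ⟨hDo, hum.stronglyMeasurable_mk, hG'm, hu', locallyIntegrableOn_congr hG hD hGe,
    locallyIntegrableOn_congr hG2 hD (hcG fun P => ‖P‖ ^ 2), hA, hV, fun i => ?_, fun θ hθ => ?_⟩,
    hGe⟩
  · exact ((hasWeakSpaceDeriv_iff.1 (hgrad i)).2.2.congr_ae (w' := fun z => row i (G' z))
      (hcG fun P => row i P)).congr_ae_left hue
  · refine weakEq_scalar hu' hA (fun ζ hζ => ?_) hθ
    refine (Eq.trans ?_ (hS.weakEq ζ hζ)).trans ?_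
    · refine setIntegral_congr_ae hD ?_
      filter_upwards [hGe] with z hz hzD
      rw [hz hzD]
    · refine setIntegral_congr_ae hD ?_
      filter_upwards [hue] with z hz hzD
      rw [hz hzD]

end Representative

end

/-! ### From integrals to mean values. -/

section
section Averages

variable {n : ℕ} {t₀ : ℝ} {x₀ : Space n} {α R : ℝ}

theorem volume_paraCyl : volume (paraCyl t₀ x₀ α R)
    = ENNReal.ofReal (α * R ^ 2) * volume (Metric.ball x₀ R) := by
  rw [paraCyl, Measure.volume_eq_prod, Measure.prod_prod, Real.volume_Ioo, sub_sub_cancel]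

/-- Since `|Q_R| = α R² |B_R|`, the prefactor `R²/|Q_R|` is `1/(α |B_R|)`, which is also the one of
the slice term. Both terms on the left are therefore scaled alike. -/
theorem mul_setLAverage_paraCyl (hα : 0 < α) (hR : 0 < R) (F : SpaceTime n → ℝ≥0∞) :
    ENNReal.ofReal (R ^ 2) * ⨍⁻ z in paraCyl t₀ x₀ α R, F z ∂volume
      = ENNReal.ofReal (1 / α) / volume (Metric.ball x₀ R) *
        ∫⁻ z in paraCyl t₀ x₀ α R, F z := by
  have h1 : ENNReal.ofReal (1 / α) = ENNReal.ofReal (R ^ 2) / ENNReal.ofReal (α * R ^ 2) := by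
    rw [← ENNReal.ofReal_div_of_pos (by positivity)]
    congr 1
    field_simp
  have h2 : ENNReal.ofReal (α * R ^ 2) ≠ 0 := (ENNReal.ofReal_pos.2 (by positivity)).ne'
  rw [setLAverage_eq, volume_paraCyl, h1]
  simp only [div_eq_mul_inv]
  rw [ENNReal.mul_inv (Or.inl h2) (Or.inl ENNReal.ofReal_ne_top)]
  ring

/-- Passing to the doubled cylinder costs `2^n` from the volume of the ball and 4 from `(2R)²`. -/
theorem mul_lintegral_paraCyl_two_mul (hα : 0 < α) (hR : 0 < R) (F : SpaceTime n → ℝ≥0∞) :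
    ENNReal.ofReal (1 / α) / volume (Metric.ball x₀ R) * ∫⁻ z in paraCyl t₀ x₀ α (2 * R), F z
      = ENNReal.ofReal (2 ^ n * 4) *
        (ENNReal.ofReal (R ^ 2) * ⨍⁻ z in paraCyl t₀ x₀ α (2 * R), F z ∂volume) := by
  have h := mul_setLAverage_paraCyl (t₀ := t₀) (x₀ := x₀) hα (R := 2 * R) (by positivity) F
  have hb : volume (Metric.ball x₀ (2 * R))
      = ENNReal.ofReal (2 ^ n) * volume (Metric.ball x₀ R) := by
    rw [Measure.addHaar_ball_mul_of_pos _ _ two_pos, Measure.addHaar_ball_center _ x₀ R,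
      finrank_euclideanSpace_fin]
  have h2 : ENNReal.ofReal ((2 : ℝ) ^ n) ≠ 0 := (ENNReal.ofReal_pos.2 (by positivity)).ne'
  have h4 : ENNReal.ofReal ((2 * R) ^ 2) = ENNReal.ofReal 4 * ENNReal.ofReal (R ^ 2) := by
    rw [← ENNReal.ofReal_mul (by norm_num)]
    congr 1
    ring
  rw [h4, hb, mul_assoc] at h
  rw [ENNReal.ofReal_mul (by positivity), mul_assoc, h]
  generalize ENNReal.ofReal (1 / α) = a, ∫⁻ z in paraCyl t₀ x₀ α (2 * R), F z = I
  simp only [div_eq_mul_inv]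
  rw [ENNReal.mul_inv (Or.inl h2) (Or.inl ENNReal.ofReal_ne_top)]
  calc a * (volume (Metric.ball x₀ R))⁻¹ * I
      = (ENNReal.ofReal (2 ^ n) * (ENNReal.ofReal (2 ^ n))⁻¹) *
          (a * (volume (Metric.ball x₀ R))⁻¹ * I) := by
        rw [ENNReal.mul_inv_cancel h2 ENNReal.ofReal_ne_top, one_mul]
    _ = _ := by ring

/-- Estimates for integrals imply estimates for mean values. -/
theorem essSup_add_laverage_le {c C : ℝ} (hc : 0 < c) (hC : 0 < C) (hα : 0 < α) (hR : 0 < R)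
    {h : SpaceTime n → ℝ≥0∞} {F F₁ F₂ : SpaceTime n → ℝ≥0∞} {E : ℝ≥0∞}
    (hE : E = ENNReal.ofReal C * (∫⁻ z in paraCyl t₀ x₀ α (2 * R), F₁ z)
      + ENNReal.ofReal C * ∫⁻ z in paraCyl t₀ x₀ α (2 * R), F₂ z)
    (hs : ∀ᵐ s ∂volume.restrict (Ioo (t₀ - α * R ^ 2) t₀),
      ∫⁻ x in Metric.ball x₀ R, h (s, x) ≤ E)
    (hF : ENNReal.ofReal c * ∫⁻ z in paraCyl t₀ x₀ α R, F z ≤ E) :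
    essSup (fun s => ENNReal.ofReal (1 / α) * ⨍⁻ x in Metric.ball x₀ R, h (s, x) ∂volume)
        (volume.restrict (Ioo (t₀ - α * R ^ 2) t₀)) +
      ENNReal.ofReal (R ^ 2) * ⨍⁻ z in paraCyl t₀ x₀ α R, F z ∂volume ≤
    ENNReal.ofReal ((1 + c⁻¹) * (C * (2 ^ n * 4))) *
      (ENNReal.ofReal (R ^ 2) * ⨍⁻ z in paraCyl t₀ x₀ α (2 * R), F₁ z ∂volume +
        ENNReal.ofReal (R ^ 2) * ⨍⁻ z in paraCyl t₀ x₀ α (2 * R), F₂ z ∂volume) := by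
  set κ := ENNReal.ofReal (1 / α) / volume (Metric.ball x₀ R) with hκ
  have h1 : essSup (fun s => ENNReal.ofReal (1 / α) *
      ⨍⁻ x in Metric.ball x₀ R, h (s, x) ∂volume)
        (volume.restrict (Ioo (t₀ - α * R ^ 2) t₀)) ≤ κ * E := by
    refine essSup_le_of_ae_le _ ?_
    filter_upwards [hs] with s hs
    rw [setLAverage_eq, hκ, ← mul_div_assoc, ← ENNReal.mul_div_right_comm]
    gcongr
  have hF' : ∫⁻ z in paraCyl t₀ x₀ α R, F z ≤ ENNReal.ofReal c⁻¹ * E := by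
    rw [ENNReal.ofReal_inv_of_pos hc, mul_comm, ← div_eq_mul_inv,
      ENNReal.le_div_iff_mul_le (Or.inl (ENNReal.ofReal_pos.2 hc).ne')
        (Or.inl ENNReal.ofReal_ne_top), mul_comm]
    exact hF
  rw [mul_setLAverage_paraCyl hα hR]
  calc _ ≤ κ * E + κ * (ENNReal.ofReal c⁻¹ * E) := by gcongr
    _ = ENNReal.ofReal (1 + c⁻¹) * (κ * E) := by
        rw [ENNReal.ofReal_add zero_le_one (by positivity), ENNReal.ofReal_one]; ring
    _ = _ := by
        have e1 := mul_lintegral_paraCyl_two_mul (t₀ := t₀) (x₀ := x₀) hα hR F₁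
        have e2 := mul_lintegral_paraCyl_two_mul (t₀ := t₀) (x₀ := x₀) hα hR F₂
        rw [← hκ] at e1 e2
        have e3 : κ * E = ENNReal.ofReal C * (κ * (∫⁻ z in paraCyl t₀ x₀ α (2 * R), F₁ z)
            + κ * ∫⁻ z in paraCyl t₀ x₀ α (2 * R), F₂ z) := by rw [hE]; ring
        rw [e3, e1, e2, ENNReal.ofReal_mul (p := 1 + c⁻¹) (by positivity), ENNReal.ofReal_mul hC.le]
        ring

end Averages

end

end PhiCaloric

theorem theorem3p6 (n : ℕ) (c₀ c₁ : ℝ) (hc₀ : 0 < c₀) :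
    -- an admissible exponent exists, depending only on the characteristics
    (∃ q C : ℝ, 1 < q ∧ ∀ φ : ℝ → ℝ, IsOrlicz φ c₀ c₁ → IsCutoffExponent φ q C) ∧
    -- the energy estimate, for every admissible exponent
    ∀ q C : ℝ, 1 < q → ∃ c : ℝ, 0 < c ∧
      ∀ φ : ℝ → ℝ, IsOrlicz φ c₀ c₁ → IsCutoffExponent φ q C →
      ∀ (N : ℕ) (J : Set ℝ) (Ω : Set (Space n))
        (u : SpaceTime n → EuclideanSpace ℝ (Fin N)) (G : SpaceTime n → Mat n N),
        IsOpen J → J.OrdConnected → IsOpen Ω → IsConnected Ω →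
        IsLocalWeakSolution φ J Ω u G →
        LocallyIntegrableOn (fun z => ‖G z‖ ^ 2) (J ×ˢ Ω) →
        -- `W j` is the weak derivative `∂_j V(∇u)`, and it belongs to `L²_loc`
        ∃ W : Fin n → SpaceTime n → Mat n N,
          (∀ j, HasWeakSpaceDeriv (J ×ˢ Ω) j (fun z => fieldV φ (G z)) (W j)) ∧
          (∀ j, LocallyIntegrableOn (fun z => ‖W j z‖ ^ 2) (J ×ˢ Ω)) ∧
          ∀ (f H : ℝ → ℝ), IsWeightPair f H →
          ∀ (t₀ : ℝ) (x₀ : Space n) (α R : ℝ), 0 < α → 0 < R →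
            closure (paraCyl t₀ x₀ α R) ⊆ J ×ˢ Ω →
            paraCyl t₀ x₀ α (2 * R) ⊆ J ×ˢ Ω →
          ∀ η : SpaceTime n → ℝ, IsParCutoff t₀ x₀ α (2 * R) η →
            essSup (fun s => ENNReal.ofReal (1 / α) *
                ⨍⁻ x in Metric.ball x₀ R, ENNReal.ofReal (H ‖G (s, x)‖ * η (s, x) ^ q) ∂volume)
              (volume.restrict (Ioo (t₀ - α * R ^ 2) t₀)) +
            ENNReal.ofReal (R ^ 2) *
              ⨍⁻ z in paraCyl t₀ x₀ α R,
                ENNReal.ofReal ((∑ j, ‖W j z‖ ^ 2) * η z ^ q * f ‖G z‖) ∂volume ≤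
            ENNReal.ofReal c *
              (ENNReal.ofReal (R ^ 2) *
                  ⨍⁻ z in paraCyl t₀ x₀ α (2 * R),
                    ENNReal.ofReal (‖fieldV φ (G z)‖ ^ 2) *
                      (⨆ y ∈ paraCyl t₀ x₀ α (2 * R),
                        ENNReal.ofReal (normSpaceGrad η y)) ^ 2 *
                      ENNReal.ofReal (f ‖G z‖) ∂volume +
                ENNReal.ofReal (R ^ 2) *
                  ⨍⁻ z in paraCyl t₀ x₀ α (2 * R),
                    ENNReal.ofReal (H ‖G z‖ * η z ^ (q - 1) * |timeDeriv η z|) ∂volume) := by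
  refine ⟨exists_isCutoffExponent c₀ c₁ hc₀, fun q C hq1 => ?_⟩
  -- For `q < 2` no admissible `φ` satisfies (1), so any constant will do.
  by_cases hq2 : 2 ≤ q
  swap
  · exact ⟨1, one_pos, fun φ hφ hq => absurd (hq.two_le hφ hc₀ hq1) hq2⟩
  obtain ⟨c, C', hc, hC', hmain⟩ := exists_energy_estimate c₀ c₁ hc₀ n q hq2
  refine ⟨(1 + c⁻¹) * (C' * (2 ^ n * 4)), by positivity, ?_⟩
  intro φ hφ _ N J Ω u G hJ _ hΩ _ hu hG2
  have hDm : MeasurableSet (J ×ˢ Ω) := (hJ.prod hΩ).measurableSet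
  obtain ⟨u', G', hS, hGG⟩ := exists_isMeasSolution hφ hc₀ hJ hΩ hu hG2
  obtain ⟨W, hWm, hWi, hWi2, hWd⟩ := exists_hasWeakDirDeriv_fieldV hS hφ hc₀
  have hVG : ∀ᵐ z, z ∈ J ×ˢ Ω → fieldV φ (G' z) = fieldV φ (G z) := by
    filter_upwards [hGG] with z hz hzD using by rw [hz hzD]
  refine ⟨W, fun j => hasWeakSpaceDeriv_iff.2 ⟨locallyIntegrableOn_congr
    hS.locallyIntegrable_fieldV hDm hVG, hWi j, (hWd j).congr_ae_left hVG⟩, hWi2, ?_⟩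
  intro f H hfH t₀ x₀ α R hα hR hcl hQ2 η hη
  have hQ : paraCyl t₀ x₀ α R ⊆ J ×ˢ Ω := subset_closure.trans hcl
  have hcongr : ∀ {r : ℝ}, paraCyl t₀ x₀ α r ⊆ J ×ˢ Ω →
      ∀ p : PhiCaloric.SpaceTime n → Mat n N → ENNReal,
      ∫⁻ z in paraCyl t₀ x₀ α r, p z (G' z) = ∫⁻ z in paraCyl t₀ x₀ α r, p z (G z) :=
    fun hr p => by
      refine setLIntegral_congr_fun_ae isOpen_paraCyl.measurableSet ?_
      filter_upwards [hGG] with z hz hzQ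
      rw [hz (hr hzQ)]
  obtain ⟨h1, h2⟩ := hmain φ hφ N _ u' G' W hS hWm hWi hWi2 hWd f H hfH t₀ x₀ α R hα hR hcl hQ2
    η hη _ rfl
  rw [hcongr hQ2 fun z P => ENNReal.ofReal (‖fieldV φ P‖ ^ 2) *
      (⨆ y ∈ paraCyl t₀ x₀ α (2 * R), ENNReal.ofReal (normSpaceGrad η y)) ^ 2 *
      ENNReal.ofReal (f ‖P‖),
    hcongr hQ2 fun z P => ENNReal.ofReal (H ‖P‖ * η z ^ (q - 1) * |timeDeriv η z|)] at h1 h2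
  rw [hcongr hQ fun z P => ENNReal.ofReal ((∑ j, ‖W j z‖ ^ 2) * η z ^ q * f ‖P‖)] at h2
  refine essSup_add_laverage_le (h := fun z => ENNReal.ofReal (H ‖G z‖ * η z ^ q)) hc hC' hα hR
    rfl ?_ h2
  rw [Measure.volume_eq_prod] at hGG
  -- The supremum is over slices: by Fubini the gradient and its measurable representative agree
  -- almost everywhere on almost every time slice.
  have hsl := Measure.ae_ae_of_ae_prod hGG
  filter_upwards [h1, ae_restrict_of_ae hsl, ae_restrict_mem measurableSet_Ioo] with s h3 h4 hs
  refine le_trans (le_of_eq ?_) h3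
  refine setLIntegral_congr_fun_ae Metric.isOpen_ball.measurableSet ?_
  filter_upwards [h4] with x hx hxB
  rw [hx (hQ ⟨hs, hxB⟩)]
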